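/- Let $(M,g)$ be a smooth oriented Riemannian four-manifold. Its negative twistor space $\pi:\mathcal Z\to M$ is the six-manifold of pairs $(p,\sigma)$, where $\sigma$ is a complex structure on $T_pM$ compatible with $g$ and with the opposite orientation of $M$. The Levi-Civita connection splits $T\mathcal Z=\mathcal H\oplus\mathcal V$ into horizontal and vertical parts; the elements of $\mathcal V_\sigma$ are the $g$-skew-symmetric endomorphisms of $T_pM$ anticommuting with $\sigma$. For $t>0$ let $h_t=\pi^*g+t\,g^v$, where $g^v(P,Q)=-\tfrac14\operatorname{Trace}(PQ)$ on $\mathcal V$ and $g^v=0$ on $\mathcal H$. For $n=1,2$ let $\mathcal J_n$ be the almost complex structure on $\mathcal Z$ which at $\sigma$ is the horizontal lift of $\sigma$ on $\mathcal H_\sigma$ and is $P\mapsto(-1)^{n+1}\sigma P$ on $\mathcal V_\sigma$. The Ricci tensor $\rho_t$ of $(\mathcal Z,h_t)$ is called $\mathcal J_n$-Hermitian if $\rho_t(\mathcal J_nE,\mathcal J_nF)=\rho_t(E,F)$ for all tangent vectors $E,F$ at the same point of $\mathcal Z$. The manifold $(M,g)$ is called Einstein if its traceless Ricci tensor vanishes,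 and self-dual if the restriction $\mathcal W_-$ of its Weyl conformal tensor to the $(-1)$-eigenbundle $\Lambda^2_-TM$ of the Hodge star operator vanishes. Fix $t>0$, and consider the conditions (i) $(M,g)$ is Einstein and self-dual; (ii) $(M,g)$ is self-dual with constant scalar curvature $s=12/t$ and, at each point of $M$, at least three eigenvalues of its Ricci operator coincide. **Theorem.** (a) Suppose that $M$ is connected and $(M,g)$ is real-analytic, and let $n\in\{1,2\}$. If the Ricci tensor of $(\mathcal Z,h_t)$ is $\mathcal J_n$-Hermitian, then (i) or (ii) holds. (b) Conversely, if $(M,g)$ (smooth, not necessarily real-analytic) satisfies (i) or (ii), then the Ricci tensor of $(\mathcal Z,h_t)$ is $\mathcal J_n$-Hermitian for $n=1$ and for $n=2$. (c) In particular, if $M$ is compact and non-empty, and $(M,g)$ is Einstein and self-dual with constant negative scalar curvature $s$, then for $t=-12/s$ the manifold $\mathcal Z$ is compact, $(\mathcal Z,h_t,\mathcal J_2)$ is almost Kähler (the Kähler form $h_t(\mathcal J_2\,\cdot,\cdot)$ is closed) and not Kähler, and its Ricci tensor is $\mathcal J_2$-Hermitian. -/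

import Mathlib

open Bundle Manifold Matrix
open scoped ContDiff

noncomputable section

namespace Twistor

/-! ### Riemannian geometry in local coordinates

A metric on an open subset of `ℝⁿ` is given by its matrix of coefficients `G`. All indices are
written as explicit arguments, and sums over repeated indices as explicit sums. -/

/-- The coordinate space `ℝⁿ`. -/
abbrev R (n : ℕ) : Type := EuclideanSpace ℝ (Fin n)

/-- The `i`-th standard basis vector of `ℝⁿ`. -/
def stdVec {n : ℕ} (i : Fin n) : R n := EuclideanSpace.single i 1

/-- The partial derivative `∂f/∂xⁱ` at `x`. -/
def pd {n : ℕ} (f : R n → ℝ) (i : Fin n) (x : R n) : ℝ := fderiv ℝ f x (stdVec i)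

/-- The Christoffel symbol `Γᵏᵢⱼ` of the Levi-Civita connection, so `∇_{∂ᵢ} ∂ⱼ = Γᵏᵢⱼ ∂ₖ`. -/
def christoffel {n : ℕ} (G : R n → Matrix (Fin n) (Fin n) ℝ) (k i j : Fin n) (x : R n) : ℝ :=
  (1 / 2 : ℝ) * ∑ l, (G x)⁻¹ k l *
    (pd (fun y => G y j l) i x + pd (fun y => G y i l) j x - pd (fun y => G y i j) l x)

/-- The curvature components `Rˡₖᵢⱼ`, with
`(∇_{∂ᵢ} ∇_{∂ⱼ} - ∇_{∂ⱼ} ∇_{∂ᵢ}) ∂ₖ = Rˡₖᵢⱼ ∂ₗ`. -/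
def riemann {n : ℕ} (G : R n → Matrix (Fin n) (Fin n) ℝ) (l k i j : Fin n) (x : R n) : ℝ :=
  pd (christoffel G l j k) i x - pd (christoffel G l i k) j x
    + ∑ m, (christoffel G l i m x * christoffel G m j k x
      - christoffel G l j m x * christoffel G m i k x)

/-- The Ricci tensor `ρⱼₖ = Rⁱₖᵢⱼ` (positive on round spheres). -/
def ricci {n : ℕ} (G : R n → Matrix (Fin n) (Fin n) ℝ) (x : R n) : Matrix (Fin n) (Fin n) ℝ :=
  Matrix.of fun j k => ∑ i, riemann G i k i j x

/-- The matrix of the Ricci operator `A`, defined by `g(A X, Y) = ρ(X, Y)`. -/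
def ricciOperator {n : ℕ} (G : R n → Matrix (Fin n) (Fin n) ℝ) (x : R n) :
    Matrix (Fin n) (Fin n) ℝ :=
  (G x)⁻¹ * ricci G x

/-- The scalar curvature. -/
def scalar {n : ℕ} (G : R n → Matrix (Fin n) (Fin n) ℝ) (x : R n) : ℝ :=
  (ricciOperator G x).trace

/-- The Weyl conformal tensor `W_{abij}` of a metric in dimension four, with the index convention
`R_{abij} = g(R(∂ᵢ, ∂ⱼ) ∂_b, ∂_a)` (so `R_{abij} = g_{ai} g_{bj} - g_{aj} g_{bi}` for the round
sphere of radius one). -/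
def weyl (G : R 4 → Matrix (Fin 4) (Fin 4) ℝ) (a b i j : Fin 4) (x : R 4) : ℝ :=
  (∑ m, G x a m * riemann G m b i j x)
    - (1 / 2 : ℝ) * (G x a i * ricci G x b j - G x a j * ricci G x b i
      + G x b j * ricci G x a i - G x b i * ricci G x a j)
    + scalar G x / 6 * (G x a i * G x b j - G x a j * G x b i)

/-- The Levi-Civita permutation symbol in four indices. -/
def epsilon (i j k l : Fin 4) : ℝ :=
  Matrix.det (Matrix.of fun r s : Fin 4 => if ![i, j, k, l] r = s then (1 : ℝ) else 0)

/-- The Hodge star of a two-vector `a = ½ aⁱʲ ∂ᵢ ∧ ∂ⱼ` (`a` a skew-symmetric matrix), for the inner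
product with matrix `G` and the standard orientation of `ℝ⁴`. -/
def hodgeStar (G : Matrix (Fin 4) (Fin 4) ℝ) (a : Matrix (Fin 4) (Fin 4) ℝ) :
    Matrix (Fin 4) (Fin 4) ℝ :=
  Matrix.of fun i j => (1 / 2 : ℝ) * (Real.sqrt G.det)⁻¹ *
    ∑ k, ∑ l, epsilon i j k l * (G * a * G) k l

/-- `𝒲₋ = 0` at `x`: the Weyl tensor annihilates every two-vector `a` with `∗a = -a`. -/
def WeylMinusZeroAt (G : R 4 → Matrix (Fin 4) (Fin 4) ℝ) (x : R 4) : Prop :=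
  ∀ a : Matrix (Fin 4) (Fin 4) ℝ, aᵀ = -a → hodgeStar (G x) a = -a →
    ∀ k l, ∑ i, ∑ j, weyl G k l i j x * a i j = 0

/-! ### The base manifold -/

/-- The charts of the given atlas are pairwise orientation compatible: an orientation of a
four-manifold is given by an atlas of positively oriented charts. -/
def IsOrientedAtlas (M : Type*) [TopologicalSpace M] [ChartedSpace (R 4) M] : Prop :=
  ∀ c ∈ atlas (R 4) M, ∀ c' ∈ atlas (R 4) M, ∀ x ∈ (c.symm.trans c').source,
    0 < (fderiv ℝ (c.symm.trans c') x).det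

section Base

variable {M : Type*} [TopologicalSpace M] [ChartedSpace (R 4) M]

section

variable [IsManifold (𝓡 4) ∞ M]

/-- Smooth Riemannian metrics on a smooth four-manifold. -/
abbrev Metric (M : Type*) [TopologicalSpace M] [ChartedSpace (R 4) M]
    [IsManifold (𝓡 4) ∞ M] :=
  ContMDiffRiemannianMetric (𝓡 4) ∞ (R 4) (fun p : M => TangentSpace (𝓡 4) p)

end

/-- The coordinate vector field `∂ⱼ` of the chart `c`, at the point with coordinates `x`. -/
def coordVec (c : OpenPartialHomeomorph M (R 4)) (x : R 4) (j : Fin 4) :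
    TangentSpace (𝓡 4) (c.symm x) :=
  mfderiv (𝓡 4) (𝓡 4) c.symm x (stdVec j)

variable [IsManifold (𝓡 4) ∞ M]

/-- The coefficients `gᵢⱼ` of the metric in the chart `c`. -/
def coeff (g : Metric M) (c : OpenPartialHomeomorph M (R 4)) (x : R 4) :
    Matrix (Fin 4) (Fin 4) ℝ :=
  Matrix.of fun i j => g.inner (c.symm x) (coordVec c x i) (coordVec c x j)

/-- `(M, g)` is a real-analytic Riemannian manifold: the atlas and the metric are analytic. -/
def IsRealAnalytic (g : Metric M) : Prop :=
  IsManifold (𝓡 4) ω M ∧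
    ContMDiff (𝓡 4) ((𝓡 4).prod 𝓘(ℝ, R 4 →L[ℝ] R 4 →L[ℝ] ℝ)) ω
      (fun p : M => TotalSpace.mk' (R 4 →L[ℝ] R 4 →L[ℝ] ℝ)
        (E := fun p : M => TangentSpace (𝓡 4) p →L[ℝ] TangentSpace (𝓡 4) p →L[ℝ] ℝ) p (g.inner p))

/-- `(M, g)` is Einstein: the traceless Ricci tensor vanishes. -/
def IsEinstein (g : Metric M) : Prop :=
  ∀ c ∈ atlas (R 4) M, ∀ x ∈ c.target,
    ricci (coeff g c) x = (scalar (coeff g c) x / 4) • coeff g c x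

/-- `(M, g)` is self-dual: `𝒲₋ = 0`. -/
def IsSelfDual (g : Metric M) : Prop :=
  ∀ c ∈ atlas (R 4) M, ∀ x ∈ c.target, WeylMinusZeroAt (coeff g c) x

/-- The scalar curvature of `(M, g)` is the constant `s`. -/
def HasConstantScalar (g : Metric M) (s : ℝ) : Prop :=
  ∀ c ∈ atlas (R 4) M, ∀ x ∈ c.target, scalar (coeff g c) x = s

/-- At every point of `M` at least three eigenvalues of the Ricci operator coincide. -/
def HasTripleRicciEigenvalue (g : Metric M) : Prop :=
  ∀ c ∈ atlas (R 4) M, ∀ x ∈ c.target, ∃ μ : ℝ,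
    3 ≤ Module.finrank ℝ
      (Module.End.eigenspace (Matrix.toLin' (ricciOperator (coeff g c) x)) μ)

/-! ### The negative twistor space -/

/-- The total space of the bundle of endomorphisms of the tangent spaces of `M`. -/
abbrev EndBundle (M : Type*) [TopologicalSpace M] [ChartedSpace (R 4) M]
    [IsManifold (𝓡 4) ∞ M] :=
  TotalSpace (R 4 →L[ℝ] R 4)
    (fun p : M => TangentSpace (𝓡 4) p →L[ℝ] TangentSpace (𝓡 4) p)

/-- The negative twistor space `𝒵`: pairs of a point `p` and a complex structure `J` on `T_p M` that
is compatible with the metric and with the opposite orientation. The tangent space `T_p M` is `ℝ⁴`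
through the preferred chart at `p`, which is positively oriented. The bases of `T_p M` of the form
`(v, J v, w, J w)` all define the orientation of `J`; four such vectors have determinant zero if they
are not a basis.

The unit sphere bundle of `Λ²₋ TM` is identified with `𝒵` through `σ ↦ K_σ`, where
`g(K_σ X, Y) = 2 g(σ, X ∧ Y)`. -/
def twistorSpace (g : Metric M) : Set (EndBundle M) :=
  {z | (∀ v, z.2 (z.2 v) = -v) ∧
    (∀ v w, g.inner z.1 (z.2 v) (z.2 w) = g.inner z.1 v w) ∧
    ∀ v w : R 4, (EuclideanSpace.basisFun (Fin 4) ℝ).toBasis.det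
      ![v, (z.2 v : R 4), w, (z.2 w : R 4)] ≤ 0}

/-- The coordinates of the base point of `z` in the chart `c`. -/
def baseCoord (c : OpenPartialHomeomorph M (R 4)) (z : EndBundle M) : R 4 := c z.1

/-- The matrix of the endomorphism `z.2` in the coordinate basis `∂₁, …, ∂₄` of the chart `c`. -/
def endCoord (c : OpenPartialHomeomorph M (R 4)) (z : EndBundle M) :
    Matrix (Fin 4) (Fin 4) ℝ :=
  Matrix.of fun i j =>
    (show R 4 from mfderiv (𝓡 4) (𝓡 4) c z.1
      (z.2 (show R 4 from mfderiv (𝓡 4) (𝓡 4) c.symm (c z.1) (stdVec j)))) i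

/-- `φ : V → 𝒵` is a smooth local parametrization of the six-manifold `𝒵` on the open set `V ⊆ ℝ⁶`,
over the domain of the chart `c` of `M`: it is smooth in the bundle coordinates
`(baseCoord c, endCoord c)`, and its differential is injective. The tangent vectors of `𝒵` at `φ u`
are the vectors `dφ_u(ξ)`, `ξ ∈ ℝ⁶`. -/
structure IsLocalParam (g : Metric M) (c : OpenPartialHomeomorph M (R 4)) (V : Set (R 6))
    (φ : R 6 → EndBundle M) : Prop where
  isOpen : IsOpen V
  mem : ∀ u ∈ V, φ u ∈ twistorSpace g
  mem_source : ∀ u ∈ V, (φ u).1 ∈ c.source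
  smooth_base : ∀ i, ContDiffOn ℝ ∞ (fun u => baseCoord c (φ u) i) V
  smooth_end : ∀ i j, ContDiffOn ℝ ∞ (fun u => endCoord c (φ u) i j) V
  immersion : ∀ u ∈ V, ∀ ξ : Fin 6 → ℝ,
    (∀ i, ∑ k, ξ k * pd (fun w => baseCoord c (φ w) i) k u = 0) →
    (∀ i j, ∑ k, ξ k * pd (fun w => endCoord c (φ w) i j) k u = 0) → ξ = 0

/-- Tangent vectors of the endomorphism bundle in the bundle coordinates of a chart: `X` is the base
component (the image under `π_*`) and `A` is the derivative of the matrix of the endomorphism. -/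
abbrev TVec : Type := (Fin 4 → ℝ) × Matrix (Fin 4) (Fin 4) ℝ

/-- The matrix `Γ(X)` with entries `Γᵏᵢⱼ Xⁱ` (row `k`, column `j`), so `∇_X Y = X(Y) + Γ(X) Y`. -/
def connMatrix (G : R 4 → Matrix (Fin 4) (Fin 4) ℝ) (x : R 4) (X : Fin 4 → ℝ) :
    Matrix (Fin 4) (Fin 4) ℝ :=
  Matrix.of fun k j => ∑ i, christoffel G k i j x * X i

/-- The vertical part, with respect to the Levi-Civita connection, of the tangent vector `E` at the
point with coordinates `(x, S)`: for `E` the velocity of a curve of endomorphisms, this is the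
covariant derivative of the endomorphism along the curve. -/
def vertical (G : R 4 → Matrix (Fin 4) (Fin 4) ℝ) (x : R 4) (S : Matrix (Fin 4) (Fin 4) ℝ)
    (E : TVec) : Matrix (Fin 4) (Fin 4) ℝ :=
  E.2 + (connMatrix G x E.1 * S - S * connMatrix G x E.1)

/-- The metric `h_t = π^* g + t g^v`. The metric `g` of `Λ² TM` with
`g(v₁ ∧ v₂, v₃ ∧ v₄) = ½ det g(vᵢ, vⱼ)` satisfies `g(a, b) = -¼ Trace (K_a K_b)`. -/
def hMetric (t : ℝ) (G : R 4 → Matrix (Fin 4) (Fin 4) ℝ) (x : R 4)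
    (S : Matrix (Fin 4) (Fin 4) ℝ) (E F : TVec) : ℝ :=
  (∑ i, ∑ j, G x i j * E.1 i * F.1 j)
    + t * (-(1 / 4 : ℝ) * (vertical G x S E * vertical G x S F).trace)

/-- The almost complex structures `𝒥₁`, `𝒥₂` at the point with coordinates `(x, S)`. The horizontal
component is mapped by the horizontal lift of `S = K_σ`; a vertical vector `P` is mapped to
`(-1)ⁿ⁺¹ S P`. Since `K_σ K_V = -K_{σ × V}` for `V ∈ Λ²₋` orthogonal to `σ`, the latter is the map
`V ↦ -(-1)ⁿ⁺¹ (σ × V)`: for `n = 1` the standard complex structure of the fibre, for `n = 2` its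
conjugate. -/
def acs (n : ℕ) (G : R 4 → Matrix (Fin 4) (Fin 4) ℝ) (x : R 4)
    (S : Matrix (Fin 4) (Fin 4) ℝ) (E : TVec) : TVec :=
  (S *ᵥ E.1,
    (-1 : ℝ) ^ (n + 1) • (S * vertical G x S E)
      - (connMatrix G x (S *ᵥ E.1) * S - S * connMatrix G x (S *ᵥ E.1)))

/-- The tangent vector `dφ_u(ξ)` in the bundle coordinates of the chart `c`. -/
def push (c : OpenPartialHomeomorph M (R 4)) (φ : R 6 → EndBundle M) (u : R 6)
    (ξ : Fin 6 → ℝ) : TVec :=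
  (fun i => ∑ k, ξ k * pd (fun w => baseCoord c (φ w) i) k u,
    Matrix.of fun i j => ∑ k, ξ k * pd (fun w => endCoord c (φ w) i j) k u)

/-- The coefficients of the metric `h_t` in the local coordinates of `𝒵` given by `φ`. -/
def hCoeff (g : Metric M) (t : ℝ) (c : OpenPartialHomeomorph M (R 4)) (φ : R 6 → EndBundle M)
    (u : R 6) : Matrix (Fin 6) (Fin 6) ℝ :=
  Matrix.of fun k l => hMetric t (coeff g c) (baseCoord c (φ u)) (endCoord c (φ u))
    (push c φ u (Pi.single k 1)) (push c φ u (Pi.single l 1))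

/-- `𝒥` is the matrix of the almost complex structure `𝒥_n` in the local coordinates of `𝒵` given by
`φ` on `V`, that is, `dφ (𝒥 ξ) = 𝒥_n (dφ ξ)`. -/
def IsAcsMatrix (g : Metric M) (n : ℕ) (c : OpenPartialHomeomorph M (R 4)) (V : Set (R 6))
    (φ : R 6 → EndBundle M) (J : R 6 → Matrix (Fin 6) (Fin 6) ℝ) : Prop :=
  ∀ u ∈ V, ∀ ξ : Fin 6 → ℝ,
    push c φ u (J u *ᵥ ξ) =
      acs n (coeff g c) (baseCoord c (φ u)) (endCoord c (φ u)) (push c φ u ξ)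

/-- The Ricci tensor `ρ_t` of `(𝒵, h_t)` is `𝒥_n`-Hermitian: `ρ_t(𝒥_n E, 𝒥_n F) = ρ_t(E, F)` for all
tangent vectors `E`, `F` of `𝒵`. -/
def RicciIsHermitian (g : Metric M) (t : ℝ) (n : ℕ) : Prop :=
  ∀ c ∈ atlas (R 4) M, ∀ V φ J, IsLocalParam g c V φ → IsAcsMatrix g n c V φ J →
    ∀ u ∈ V, ∀ ξ η : Fin 6 → ℝ,
      (J u *ᵥ ξ) ⬝ᵥ (ricci (hCoeff g t c φ) u *ᵥ (J u *ᵥ η)) =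
        ξ ⬝ᵥ (ricci (hCoeff g t c φ) u *ᵥ η)

/-- The components `Ω_{kl} = h_t(𝒥_n ∂ₖ, ∂ₗ)` of the Kähler form, in local coordinates of `𝒵`. -/
def kahlerForm (g : Metric M) (t : ℝ) (n : ℕ) (c : OpenPartialHomeomorph M (R 4))
    (φ : R 6 → EndBundle M) (u : R 6) : Matrix (Fin 6) (Fin 6) ℝ :=
  Matrix.of fun k l => hMetric t (coeff g c) (baseCoord c (φ u)) (endCoord c (φ u))
    (acs n (coeff g c) (baseCoord c (φ u)) (endCoord c (φ u)) (push c φ u (Pi.single k 1)))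
    (push c φ u (Pi.single l 1))

/-- `(𝒵, h_t, 𝒥_n)` is almost Kähler: its Kähler form is closed. -/
def IsAlmostKahler (g : Metric M) (t : ℝ) (n : ℕ) : Prop :=
  ∀ c ∈ atlas (R 4) M, ∀ V φ, IsLocalParam g c V φ → ∀ u ∈ V, ∀ i j k,
    pd (fun w => kahlerForm g t n c φ w j k) i u
      + pd (fun w => kahlerForm g t n c φ w k i) j u
      + pd (fun w => kahlerForm g t n c φ w i j) k u = 0

/-- The components `Nᵏᵢⱼ` of the Nijenhuis tensor
`N(X, Y) = [JX, JY] - J[JX, Y] - J[X, JY] - [X, Y]` of an almost complex structure with matrix `J`. -/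
def nijenhuis {n : ℕ} (J : R n → Matrix (Fin n) (Fin n) ℝ) (k i j : Fin n) (u : R n) : ℝ :=
  ∑ l, (J u l i * pd (fun w => J w k j) l u - J u l j * pd (fun w => J w k i) l u
    - J u k l * (pd (fun w => J w l j) i u - pd (fun w => J w l i) j u))

/-- The almost complex structure `𝒥_n` of `𝒵` is integrable: its Nijenhuis tensor vanishes. -/
def IsIntegrable (g : Metric M) (n : ℕ) : Prop :=
  ∀ c ∈ atlas (R 4) M, ∀ V φ J, IsLocalParam g c V φ → IsAcsMatrix g n c V φ J →
    ∀ u ∈ V, ∀ k i j, nijenhuis J k i j u = 0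

/-- `(𝒵, h_t, 𝒥_n)` is Kähler: the Kähler form is closed and `𝒥_n` is integrable. -/
def IsKahler (g : Metric M) (t : ℝ) (n : ℕ) : Prop :=
  IsAlmostKahler g t n ∧ IsIntegrable g n

end Base

end Twistor

end

noncomputable section

namespace Twistor


/-! ### Calculus of matrix-valued functions -/

section Calculus

variable {m n : ℕ} {α β γ δ ι : Type*} {V : Set (R m)} {u : R m}

/-! The proof is Cartan's moving frame calculus on the six-manifold. Near a point of 𝒵 take an
orthonormal frame `E` of `TM` along the projection with `S E = E I₀`, where `S` is the tautological
complex structure and `I₀ = sdBasis 0` is left multiplication by the quaternion i. Such a frame is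
negatively oriented, so `Λ²₋` of `M` becomes the space of left quaternion multiplications; this is
the factor called self-dual in `so`, `sdPart` and `blockA`. The dual coframe `θ`, together with `τ =
2√t` times the components 1 and 2 of the self-dual connection form, is an orthonormal coframe of
`h_t` (`hLoc_eq`) in which `𝒥_n` has the constant matrix `twJ n`. Its Levi-Civita form is `twForm`.
With `F_b = sdCurv K b`, the Ricci tensor (`twistor_ricci`) has horizontal block `ρ + (τ²/2)(F₁² +
F₂²)`, mixed block `-(τ/2) div F_a` and vertical block `(4/τ²) δ - (τ²/4) tr(F_b F_a)`.

Let `A = blockA` and `B = blockB` be the parts `Λ²₋ → Λ²₋` and `Λ²₋ → Λ²₊` of the curvature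
operator. Then `A` is scalar iff `𝒲₋ = 0` (`weylMinusZeroAt_iff`), `B = 0` iff the metric is
Einstein (`einstein_iff_blockB`), `BᵀB` is scalar iff three Ricci eigenvalues coincide
(`tripleEigenvalue_iff`), and `s = 8 tr A`. Invariance of the horizontal and vertical Ricci blocks
is `RicciCondition`.

Part (a). Over a fixed point of `M` the condition holds at every `σ` in the fibre, that is, after
every rotation of `Λ²₋`. The vertical block then gives that `A² + BᵀB` is scalar
(`ricciCondition_sq`), the horizontal block that `A = 1/(2t)` if `B ≠ 0` (`ricciCondition_blockA`).
Hence on the open set where `A` is not scalar, `B` vanishes and `A²` is scalar, so `A` has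
eigenvalues `a, a, -a`. The second Bianchi identity makes such an `A` parallel; it therefore
commutes with the curvature of `Λ²₋`, which spans all of `so(3)`, a contradiction
(`MovingFrame.blockA_isScalar`). So `M` is self-dual. The scalar curvature is `12/t` where `B ≠ 0`
and locally constant on open sets with `B = 0` by Schur's lemma, so it is constant. If it is not
`12/t`, then `B = 0` everywhere, which is (i); if it is, then `BᵀB` is scalar because `A` and `A² +
BᵀB` are, which is (ii).

Part (b). Both conditions give `RicciCondition` by inspection. The mixed block is a divergence: the
derivative of `F` is purely self-dual under (i), since `B = 0`, and purely anti-self-dual under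
(ii), since `A` is constant. For forms of one duality type the Bianchi identity is the vanishing of
the divergence (`div_of_cyclic_sd`, `div_of_cyclic_asd`).

Part (c). Here `F_b = α I_b` with `α τ² = -2`, exactly the value for which the covariant derivative
of `𝒥₂` alternates to zero. The Nijenhuis tensor contracted with a vertical form is `4τα I₁` on
horizontal vectors, which is not zero. Compactness follows from local triviality with compact fibre.
-/

lemma differentiableAt_of_smooth {f : R m → ℝ} (hV : IsOpen V) (hf : ContDiffOn ℝ ∞ f V)
    (hu : u ∈ V) : DifferentiableAt ℝ f u :=
  (hf.contDiffAt (hV.mem_nhds hu)).differentiableAt (by simp)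

lemma pd_congr {f g : R m → ℝ} (hV : IsOpen V) (h : ∀ w ∈ V, f w = g w) (hu : u ∈ V) (k : Fin m) :
    pd f k u = pd g k u := by
  unfold pd
  rw [Filter.EventuallyEq.fderiv_eq (Filter.eventually_of_mem (hV.mem_nhds hu) h)]

lemma pd_const (c : ℝ) (k : Fin m) (u : R m) : pd (fun _ => c) k u = 0 := by
  simp [pd]

lemma pd_neg (f : R m → ℝ) (k : Fin m) (u : R m) : pd (fun w => - f w) k u = - pd f k u := by
  simp [pd, fderiv_fun_neg]

lemma pd_add {f g : R m → ℝ} (hf : DifferentiableAt ℝ f u) (hg : DifferentiableAt ℝ g u)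
    (k : Fin m) : pd (fun w => f w + g w) k u = pd f k u + pd g k u := by
  simp [pd, fderiv_fun_add hf hg]

lemma pd_sub {f g : R m → ℝ} (hf : DifferentiableAt ℝ f u) (hg : DifferentiableAt ℝ g u)
    (k : Fin m) : pd (fun w => f w - g w) k u = pd f k u - pd g k u := by
  simp [pd, fderiv_fun_sub hf hg]

lemma pd_mul {f g : R m → ℝ} (hf : DifferentiableAt ℝ f u) (hg : DifferentiableAt ℝ g u)
    (k : Fin m) : pd (fun w => f w * g w) k u = pd f k u * g u + f u * pd g k u := by
  simp [pd, fderiv_fun_mul hf hg]; ring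

lemma pd_sum (s : Finset ι) {f : ι → R m → ℝ} (hf : ∀ i ∈ s, DifferentiableAt ℝ (f i) u)
    (k : Fin m) : pd (fun w => ∑ i ∈ s, f i w) k u = ∑ i ∈ s, pd (f i) k u := by
  simp [pd, fderiv_fun_sum hf]

lemma pd_const_mul (c : ℝ) {f : R m → ℝ} (hf : DifferentiableAt ℝ f u) (k : Fin m) :
    pd (fun w => c * f w) k u = c * pd f k u := by
  rw [pd_mul (differentiableAt_const c) hf, pd_const]; ring

lemma contDiffOn_pd {f : R m → ℝ} (hV : IsOpen V) (hf : ContDiffOn ℝ ∞ f V) (k : Fin m) :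
    ContDiffOn ℝ ∞ (pd f k) V := by
  have h := hf.fderiv_of_isOpen hV (m := ∞) (by simp)
  exact h.clm_apply contDiffOn_const

lemma pd_comm {f : R m → ℝ} (hV : IsOpen V) (hf : ContDiffOn ℝ ∞ f V) (hu : u ∈ V)
    (k l : Fin m) : pd (pd f l) k u = pd (pd f k) l u := by
  have hs : IsSymmSndFDerivAt ℝ f u :=
    (hf.contDiffAt (hV.mem_nhds hu)).isSymmSndFDerivAt (by
      simp only [minSmoothness_of_isRCLikeNormedField]; exact ENat.LEInfty.out)
  have hd : DifferentiableAt ℝ (fderiv ℝ f) u :=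
    ((hf.fderiv_of_isOpen hV (m := ∞) (by simp)).contDiffAt (hV.mem_nhds hu)).differentiableAt
      (by simp)
  have key : ∀ a b : Fin m, pd (pd f a) b u = fderiv ℝ (fderiv ℝ f) u (stdVec b) (stdVec a) := by
    intro a b
    unfold pd
    rw [fderiv_clm_apply hd (differentiableAt_const _)]
    simp
  rw [key, key, hs.eq]

lemma sum_stdVec (v : R m) : v = ∑ i, v i • stdVec i := by
  have := (EuclideanSpace.basisFun (Fin m) ℝ).sum_repr v
  conv_lhs => rw [← this]
  simp [stdVec]

lemma fderiv_apply_eq_sum (f : R m → ℝ) (u v : R m) : fderiv ℝ f u v = ∑ i, v i * pd f i u := by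
  conv_lhs => rw [sum_stdVec v]
  simp [pd]

lemma fderiv_coord {x : R m → R n} (hx : DifferentiableAt ℝ x u) (v : R m) (i : Fin n) :
    fderiv ℝ x u v i = fderiv ℝ (fun w => x w i) u v := by
  have h := ((EuclideanSpace.proj (𝕜 := ℝ) i : EuclideanSpace ℝ (Fin n) →L[ℝ] ℝ).hasFDerivAt.comp u
    hx.hasFDerivAt).fderiv
  have h2 : (EuclideanSpace.proj (𝕜 := ℝ) i : EuclideanSpace ℝ (Fin n) →L[ℝ] ℝ) ∘ x
      = fun w => x w i := rfl
  rw [h2] at h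
  rw [h]; rfl

lemma pd_comp {x : R m → R n} {f : R n → ℝ} (hf : DifferentiableAt ℝ f (x u))
    (hx : DifferentiableAt ℝ x u) (k : Fin m) :
    pd (fun w => f (x w)) k u = ∑ i, pd f i (x u) * pd (fun w => x w i) k u := by
  have h : fderiv ℝ (fun w => f (x w)) u = (fderiv ℝ f (x u)).comp (fderiv ℝ x u) :=
    fderiv_comp u hf hx
  unfold pd at *
  rw [h, ContinuousLinearMap.comp_apply, fderiv_apply_eq_sum]
  refine Finset.sum_congr rfl fun i _ => ?_
  rw [fderiv_coord hx]
  unfold pd; ring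

lemma pd_coord (i k : Fin m) (u : R m) : pd (fun w : R m => w i) k u = if i = k then 1 else 0 := by
  have h : fderiv ℝ (fun w : R m => w i) u = (EuclideanSpace.proj i : R m →L[ℝ] ℝ) :=
    (EuclideanSpace.proj (𝕜 := ℝ) i : EuclideanSpace ℝ (Fin m) →L[ℝ] ℝ).hasFDerivAt.fderiv
  simp [pd, h, stdVec]

/-- The entrywise partial derivative of a matrix-valued function. -/
def mpd (A : R m → Matrix α β ℝ) (k : Fin m) (u : R m) : Matrix α β ℝ :=
  Matrix.of fun i j => pd (fun w => A w i j) k u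

/-- A matrix-valued function with smooth entries. -/
def MSmooth (V : Set (R m)) (A : R m → Matrix α β ℝ) : Prop :=
  ∀ i j, ContDiffOn ℝ ∞ (fun w => A w i j) V

lemma mpd_apply (A : R m → Matrix α β ℝ) (k : Fin m) (u : R m) (i : α) (j : β) :
    mpd A k u i j = pd (fun w => A w i j) k u := rfl

lemma MSmooth.mono {A : R m → Matrix α β ℝ} {W : Set (R m)} (h : MSmooth V A) (hW : W ⊆ V) :
    MSmooth W A := fun i j => (h i j).mono hW

lemma MSmooth.congr {A B : R m → Matrix α β ℝ} (h : MSmooth V A) (hB : ∀ w ∈ V, B w = A w) :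
    MSmooth V B := fun i j => (h i j).congr fun w hw => by rw [hB w hw]

lemma MSmooth.const (A : Matrix α β ℝ) : MSmooth V (fun _ => A) := fun _ _ => contDiffOn_const

lemma MSmooth.add {A B : R m → Matrix α β ℝ} (hA : MSmooth V A) (hB : MSmooth V B) :
    MSmooth V (fun w => A w + B w) := fun i j => (hA i j).add (hB i j)

lemma MSmooth.sub {A B : R m → Matrix α β ℝ} (hA : MSmooth V A) (hB : MSmooth V B) :
    MSmooth V (fun w => A w - B w) := fun i j => (hA i j).sub (hB i j)

lemma MSmooth.neg {A : R m → Matrix α β ℝ} (hA : MSmooth V A) :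
    MSmooth V (fun w => - A w) := fun i j => (hA i j).neg

lemma MSmooth.sum {s : Finset ι} {A : ι → R m → Matrix α β ℝ} (hA : ∀ i, MSmooth V (A i)) :
    MSmooth V (fun w => ∑ i ∈ s, A i w) := fun i j => by
  simp only [Matrix.sum_apply]
  exact ContDiffOn.sum fun a _ => hA a i j

lemma MSmooth.smul {f : R m → ℝ} {A : R m → Matrix α β ℝ} (hf : ContDiffOn ℝ ∞ f V)
    (hA : MSmooth V A) : MSmooth V (fun w => f w • A w) := fun i j => hf.mul (hA i j)

lemma MSmooth.transpose {A : R m → Matrix α β ℝ} (hA : MSmooth V A) :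
    MSmooth V (fun w => (A w)ᵀ) := fun i j => hA j i

lemma MSmooth.mul [Fintype β] {A : R m → Matrix α β ℝ} {B : R m → Matrix β γ ℝ}
    (hA : MSmooth V A) (hB : MSmooth V B) : MSmooth V (fun w => A w * B w) := fun i j => by
  simp only [Matrix.mul_apply]
  exact ContDiffOn.sum fun a _ => (hA i a).mul (hB a j)

lemma MSmooth.fromBlocks {A : R m → Matrix α γ ℝ} {B : R m → Matrix α δ ℝ}
    {C : R m → Matrix β γ ℝ} {D : R m → Matrix β δ ℝ}
    (hA : MSmooth V A) (hB : MSmooth V B) (hC : MSmooth V C) (hD : MSmooth V D) :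
    MSmooth V (fun w => Matrix.fromBlocks (A w) (B w) (C w) (D w)) := by
  rintro (i | i) (j | j)
  exacts [hA i j, hB i j, hC i j, hD i j]

lemma contDiffOn_det [Fintype α] [DecidableEq α] {A : R m → Matrix α α ℝ} (hA : MSmooth V A) :
    ContDiffOn ℝ ∞ (fun w => (A w).det) V := by
  simp only [Matrix.det_apply']
  refine ContDiffOn.sum fun σ _ => contDiffOn_const.mul ?_
  exact contDiffOn_prod fun i _ => hA _ _

/-- Cramer's rule: an entry of the inverse is the determinant of the matrix with one row replaced by
a constant vector, divided by the determinant. -/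
lemma MSmooth.inv [Fintype α] [DecidableEq α] {A : R m → Matrix α α ℝ} (hA : MSmooth V A)
    (hdet : ∀ w ∈ V, (A w).det ≠ 0) : MSmooth V (fun w => (A w)⁻¹) := by
  intro i j
  have : ∀ w, (A w)⁻¹ i j = (A w).det⁻¹ * (A w).adjugate i j := fun w => by
    rw [Matrix.inv_def, Ring.inverse_eq_inv']; rfl
  simp only [this]
  refine ((contDiffOn_det hA).inv hdet).mul ?_
  simp only [Matrix.adjugate_apply]
  refine contDiffOn_det fun a b => ?_
  by_cases h : a = j
  · subst h; simpa using contDiffOn_const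
  · simpa [Matrix.updateRow_apply, h] using hA a b

lemma MSmooth.differentiableAt {A : R m → Matrix α β ℝ} (hA : MSmooth V A) (hV : IsOpen V)
    (hu : u ∈ V) (i : α) (j : β) : DifferentiableAt ℝ (fun w => A w i j) u :=
  differentiableAt_of_smooth hV (hA i j) hu

lemma MSmooth.mpd {A : R m → Matrix α β ℝ} (hA : MSmooth V A) (hV : IsOpen V) (k : Fin m) :
    MSmooth V (mpd A k) := fun i j => contDiffOn_pd hV (hA i j) k

lemma mpd_congr {A B : R m → Matrix α β ℝ} (hV : IsOpen V) (h : ∀ w ∈ V, A w = B w) (hu : u ∈ V)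
    (k : Fin m) : mpd A k u = mpd B k u := by
  ext i j
  exact pd_congr hV (fun w hw => by rw [h w hw]) hu k

lemma mpd_const (A : Matrix α β ℝ) (k : Fin m) (u : R m) : mpd (fun _ => A) k u = 0 := by
  ext i j; simp [mpd_apply, pd_const]

lemma mpd_neg (A : R m → Matrix α β ℝ) (k : Fin m) (u : R m) :
    mpd (fun w => - A w) k u = - mpd A k u := by
  ext i j; simp [mpd_apply, pd_neg]

lemma mpd_transpose (A : R m → Matrix α β ℝ) (k : Fin m) (u : R m) :
    mpd (fun w => (A w)ᵀ) k u = (mpd A k u)ᵀ := rfl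

lemma mpd_add {A B : R m → Matrix α β ℝ} (hV : IsOpen V) (hu : u ∈ V) (hA : MSmooth V A)
    (hB : MSmooth V B) (k : Fin m) : mpd (fun w => A w + B w) k u = mpd A k u + mpd B k u := by
  ext i j
  exact pd_add (hA.differentiableAt hV hu i j) (hB.differentiableAt hV hu i j) k

lemma mpd_sub {A B : R m → Matrix α β ℝ} (hV : IsOpen V) (hu : u ∈ V) (hA : MSmooth V A)
    (hB : MSmooth V B) (k : Fin m) : mpd (fun w => A w - B w) k u = mpd A k u - mpd B k u := by
  ext i j
  exact pd_sub (hA.differentiableAt hV hu i j) (hB.differentiableAt hV hu i j) k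

lemma mpd_sum {s : Finset ι} {A : ι → R m → Matrix α β ℝ} (hV : IsOpen V) (hu : u ∈ V)
    (hA : ∀ i, MSmooth V (A i)) (k : Fin m) :
    mpd (fun w => ∑ i ∈ s, A i w) k u = ∑ i ∈ s, mpd (A i) k u := by
  ext i j
  simp only [mpd_apply, Matrix.sum_apply]
  exact pd_sum s (fun a _ => (hA a).differentiableAt hV hu i j) k

lemma mpd_smul {f : R m → ℝ} {A : R m → Matrix α β ℝ} (hV : IsOpen V) (hu : u ∈ V)
    (hf : ContDiffOn ℝ ∞ f V) (hA : MSmooth V A) (k : Fin m) :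
    mpd (fun w => f w • A w) k u = pd f k u • A u + f u • mpd A k u := by
  ext i j
  exact pd_mul (differentiableAt_of_smooth hV hf hu) (hA.differentiableAt hV hu i j) k

lemma mpd_mul [Fintype β] {A : R m → Matrix α β ℝ} {B : R m → Matrix β γ ℝ} (hV : IsOpen V)
    (hu : u ∈ V) (hA : MSmooth V A) (hB : MSmooth V B) (k : Fin m) :
    mpd (fun w => A w * B w) k u = mpd A k u * B u + A u * mpd B k u := by
  ext i j
  simp only [mpd_apply, Matrix.mul_apply, Matrix.add_apply]
  have hs : ∀ a ∈ Finset.univ, DifferentiableAt ℝ (fun w => A w i a * B w a j) u := fun a _ =>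
    (hA.differentiableAt hV hu i a).mul (hB.differentiableAt hV hu a j)
  rw [pd_sum _ hs, ← Finset.sum_add_distrib]
  exact Finset.sum_congr rfl fun a _ =>
    pd_mul (hA.differentiableAt hV hu i a) (hB.differentiableAt hV hu a j) k

lemma mpd_comm {A : R m → Matrix α β ℝ} (hV : IsOpen V) (hu : u ∈ V) (hA : MSmooth V A)
    (k l : Fin m) : mpd (mpd A l) k u = mpd (mpd A k) l u := by
  ext i j
  exact pd_comm hV (hA i j) hu k l

lemma mpd_fromBlocks (A : R m → Matrix α γ ℝ) (B : R m → Matrix α δ ℝ)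
    (C : R m → Matrix β γ ℝ) (D : R m → Matrix β δ ℝ) (k : Fin m) (u : R m) :
    mpd (fun w => Matrix.fromBlocks (A w) (B w) (C w) (D w)) k u =
      Matrix.fromBlocks (mpd A k u) (mpd B k u) (mpd C k u) (mpd D k u) := by
  ext (i | i) (j | j) <;> rfl

/-- The curvature of a matrix-valued connection form. -/
def curv [Fintype α] (ϖ : Fin m → R m → Matrix α α ℝ) (k l : Fin m) (u : R m) : Matrix α α ℝ :=
  mpd (ϖ l) k u - mpd (ϖ k) l u + (ϖ k u * ϖ l u - ϖ l u * ϖ k u)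

lemma MSmooth.curv [Fintype α] {ϖ : Fin m → R m → Matrix α α ℝ} (hV : IsOpen V)
    (hϖ : ∀ k, MSmooth V (ϖ k)) (k l : Fin m) : MSmooth V (curv ϖ k l) :=
  (((hϖ l).mpd hV k).sub ((hϖ k).mpd hV l)).add
    (((hϖ k).mul (hϖ l)).sub ((hϖ l).mul (hϖ k)))

lemma curv_swap [Fintype α] (ϖ : Fin m → R m → Matrix α α ℝ) (k l : Fin m) (u : R m) :
    curv ϖ k l u = - curv ϖ l k u := by
  unfold curv; abel

/-- A matrix-valued function that intertwines two connections intertwines their curvatures. -/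
theorem curv_intertwine [Fintype α] [Fintype β] {E : R m → Matrix α β ℝ}
    {ϖ : Fin m → R m → Matrix β β ℝ} {Γ : Fin m → R m → Matrix α α ℝ} (hV : IsOpen V)
    (hE : MSmooth V E) (hϖ : ∀ k, MSmooth V (ϖ k)) (hΓ : ∀ k, MSmooth V (Γ k))
    (h : ∀ w ∈ V, ∀ k, E w * ϖ k w = mpd E k w + Γ k w * E w) (hu : u ∈ V) (k l : Fin m) :
    E u * curv ϖ k l u = curv Γ k l u * E u := by
  -- The relation `E ϖ_b = ∂_b E + Γ_b E` is differentiated in the direction `a`. Antisymmetrising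
  -- in `a` and `b` removes the second derivatives of `E`.
  have key : ∀ a b : Fin m, mpd E a u * ϖ b u + E u * mpd (ϖ b) a u =
      mpd (mpd E b) a u + (mpd (Γ b) a u * E u + Γ b u * mpd E a u) := by
    intro a b
    rw [← mpd_mul hV hu hE (hϖ b), ← mpd_mul hV hu (hΓ b) hE,
      ← mpd_add hV hu (hE.mpd hV b) ((hΓ b).mul hE)]
    exact mpd_congr hV (fun w hw => h w hw b) hu a
  have hk := key k l
  have hl := key l k
  have e : ∀ a, mpd E a u = E u * ϖ a u - Γ a u * E u := fun a => by rw [h u hu a]; abel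
  rw [mpd_comm hV hu hE] at hk
  rw [e, Matrix.mul_sub, Matrix.sub_mul] at hk hl
  have e3 := congrArg₂ (fun p q => p - q) hk hl
  simp only [curv, Matrix.mul_add, Matrix.add_mul, Matrix.mul_sub, Matrix.sub_mul,
    ← Matrix.mul_assoc] at e3 ⊢
  rw [← sub_eq_zero] at e3 ⊢
  rw [← e3]; abel

/-- The second Bianchi identity for a matrix-valued connection form. -/
theorem curv_bianchi [Fintype α] {ϖ : Fin m → R m → Matrix α α ℝ} (hV : IsOpen V)
    (hϖ : ∀ k, MSmooth V (ϖ k)) (hu : u ∈ V) (j k l : Fin m) :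
    (mpd (curv ϖ k l) j u + (ϖ j u * curv ϖ k l u - curv ϖ k l u * ϖ j u))
      + (mpd (curv ϖ l j) k u + (ϖ k u * curv ϖ l j u - curv ϖ l j u * ϖ k u))
      + (mpd (curv ϖ j k) l u + (ϖ l u * curv ϖ j k u - curv ϖ j k u * ϖ l u)) = 0 := by
  have key : ∀ a b c : Fin m, mpd (curv ϖ a b) c u =
      mpd (mpd (ϖ b) a) c u - mpd (mpd (ϖ a) b) c u
        + ((mpd (ϖ a) c u * ϖ b u + ϖ a u * mpd (ϖ b) c u)
          - (mpd (ϖ b) c u * ϖ a u + ϖ b u * mpd (ϖ a) c u)) := by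
    intro a b c
    unfold curv
    rw [mpd_add hV hu (((hϖ b).mpd hV a).sub ((hϖ a).mpd hV b))
      (((hϖ a).mul (hϖ b)).sub ((hϖ b).mul (hϖ a))),
      mpd_sub hV hu ((hϖ b).mpd hV a) ((hϖ a).mpd hV b),
      mpd_sub hV hu ((hϖ a).mul (hϖ b)) ((hϖ b).mul (hϖ a)),
      mpd_mul hV hu (hϖ a) (hϖ b), mpd_mul hV hu (hϖ b) (hϖ a)]
  rw [key, key, key, mpd_comm hV hu (hϖ l) j k, mpd_comm hV hu (hϖ k) j l,
    mpd_comm hV hu (hϖ j) k l]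
  simp only [curv, Matrix.mul_add, Matrix.add_mul, Matrix.mul_sub, Matrix.sub_mul,
    ← Matrix.mul_assoc]
  abel

end Calculus


/-! ### The Levi-Civita connection in moving frames -/

section LeviCivita

variable {m n : ℕ} {α ι : Type*} {V : Set (R m)} {u : R m}

/-- The matrix of Christoffel symbols `Γᵏᵢⱼ` (row `k`, column `j`). -/
def chr (G : R n → Matrix (Fin n) (Fin n) ℝ) (i : Fin n) (x : R n) : Matrix (Fin n) (Fin n) ℝ :=
  Matrix.of fun k j => christoffel G k i j x

/-- Passes from index notation to matrix-valued forms: with `Γᵢ` as a matrix, the Riemann tensor is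
`dΓ + Γ ∧ Γ`, and all later curvature arguments are gauge transformations of such forms. -/
lemma riemann_eq_curv (G : R n → Matrix (Fin n) (Fin n) ℝ) (l k i j : Fin n) (x : R n) :
    riemann G l k i j x = curv (chr G) i j x l k := by
  simp only [riemann, curv, Matrix.add_apply, Matrix.sub_apply, Matrix.mul_apply,
    Finset.sum_sub_distrib]
  rfl

/-- The Christoffel symbols of the first kind, up to a factor of two. -/
def chrLow (G : R n → Matrix (Fin n) (Fin n) ℝ) (i : Fin n) (x : R n) :
    Matrix (Fin n) (Fin n) ℝ :=
  Matrix.of fun l j =>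
    pd (fun y => G y j l) i x + pd (fun y => G y i l) j x - pd (fun y => G y i j) l x

lemma chr_eq (G : R n → Matrix (Fin n) (Fin n) ℝ) (i : Fin n) (x : R n) :
    chr G i x = (1 / 2 : ℝ) • ((G x)⁻¹ * chrLow G i x) := by
  ext k j
  simp [chr, chrLow, christoffel, Matrix.mul_apply]

variable {G : R n → Matrix (Fin n) (Fin n) ℝ} {W : Set (R n)} {x : R n}

lemma MSmooth.chr (hW : IsOpen W) (hG : MSmooth W G) (hdet : ∀ y ∈ W, (G y).det ≠ 0)
    (i : Fin n) : MSmooth W (chr G i) := by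
  have h : MSmooth W (chrLow G i) := fun l j =>
    ((contDiffOn_pd hW (hG j l) i).add (contDiffOn_pd hW (hG i l) j)).sub
      (contDiffOn_pd hW (hG i j) l)
  refine (MSmooth.smul (f := fun _ => (1 / 2 : ℝ)) contDiffOn_const
    ((hG.inv hdet).mul h)).congr fun w _ => chr_eq G i w

lemma pd_symm (hW : IsOpen W) (hs : ∀ y ∈ W, (G y)ᵀ = G y) (hx : x ∈ W) (i j l : Fin n) :
    pd (fun y => G y i j) l x = pd (fun y => G y j i) l x :=
  pd_congr hW (fun y hy => by conv_lhs => rw [← hs y hy, Matrix.transpose_apply]) hx l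

lemma chr_symm (hW : IsOpen W) (hs : ∀ y ∈ W, (G y)ᵀ = G y) (hx : x ∈ W) (i j k : Fin n) :
    chr G i x k j = chr G j x k i := by
  simp only [chr_eq, Matrix.smul_apply, Matrix.mul_apply]
  congr 1
  refine Finset.sum_congr rfl fun l _ => ?_
  simp only [chrLow, Matrix.of_apply]
  rw [pd_symm hW hs hx i j l]; ring

lemma mul_chr (hdet : (G x).det ≠ 0) (i : Fin n) :
    G x * chr G i x = (1 / 2 : ℝ) • chrLow G i x := by
  rw [chr_eq, Matrix.mul_smul, ← Matrix.mul_assoc, Matrix.mul_nonsing_inv _ (isUnit_iff_ne_zero.2 hdet),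
    Matrix.one_mul]

/-- Lowering the index of `Γᵢ` gives half of `chrLow`, whose last two terms are antisymmetric in row
and column. Adding the transpose leaves the first term. -/
lemma chr_compat (hW : IsOpen W) (hs : ∀ y ∈ W, (G y)ᵀ = G y) (hx : x ∈ W)
    (hdet : (G x).det ≠ 0) (i : Fin n) :
    mpd G i x = (chr G i x)ᵀ * G x + G x * chr G i x := by
  have h2 : (chr G i x)ᵀ * G x = (G x * chr G i x)ᵀ := by
    rw [Matrix.transpose_mul, hs x hx]
  rw [h2, mul_chr hdet]
  ext a b
  simp only [mpd_apply, chrLow, Matrix.add_apply, Matrix.transpose_apply, Matrix.smul_apply,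
    Matrix.of_apply, smul_eq_mul]
  rw [pd_symm hW hs hx b a i, pd_symm hW hs hx i a b, pd_symm hW hs hx i b a]
  rw [pd_symm hW hs hx a i b, pd_symm hW hs hx b i a]; ring

/-- The Levi-Civita connection is the only torsion-free metric connection. -/
theorem chr_unique (hs : ∀ y ∈ W, (G y)ᵀ = G y) (hx : x ∈ W)
    (hdet : (G x).det ≠ 0) {Γ : Fin n → Matrix (Fin n) (Fin n) ℝ}
    (hsymm : ∀ i j k, Γ i k j = Γ j k i) (hc : ∀ i, mpd G i x = (Γ i)ᵀ * G x + G x * Γ i)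
    (i : Fin n) : chr G i x = Γ i := by
  -- Koszul's argument: compatibility writes each first derivative of `G` as two lowered symbols,
  -- and symmetry of `Γ` lets four of the six terms in the alternating sum cancel.
  have hlow : ∀ i, chrLow G i x = (2 : ℝ) • (G x * Γ i) := by
    intro i
    have e : ∀ a b c, pd (fun y => G y a b) c x = (G x * Γ c) b a + (G x * Γ c) a b := by
      intro a b c
      have := congrFun (congrFun (hc c) a) b
      have h3 : (Γ c)ᵀ * G x = (G x * Γ c)ᵀ := by rw [Matrix.transpose_mul, hs x hx]
      rw [h3] at this
      exact this
    have sy : ∀ a b c, (G x * Γ a) c b = (G x * Γ b) c a := by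
      intro a b c
      simp only [Matrix.mul_apply]
      exact Finset.sum_congr rfl fun k _ => by rw [hsymm]
    ext l j
    simp only [chrLow, Matrix.of_apply, e, Matrix.smul_apply, smul_eq_mul]
    rw [sy j i l, sy l i j, sy l j i]; ring
  rw [chr_eq, hlow, Matrix.mul_smul, ← Matrix.mul_assoc,
    Matrix.nonsing_inv_mul _ (isUnit_iff_ne_zero.2 hdet), Matrix.one_mul, smul_smul]
  norm_num

/-- The Ricci tensor from the components of the curvature form in a coframe. -/
theorem ricci_of_curv [Fintype ι] [DecidableEq ι] {h : R m → Matrix (Fin m) (Fin m) ℝ}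
    {Θ : Matrix ι (Fin m) ℝ} {X : Matrix (Fin m) ι ℝ} (hXΘ : X * Θ = 1) (hΘX : Θ * X = 1)
    (K : ι → ι → Matrix ι ι ℝ)
    (hK : ∀ k l, Θ * curv (chr h) k l u = (∑ C, ∑ D, (Θ C k * Θ D l) • K C D) * Θ) :
    ricci h u = Θᵀ * (Matrix.of fun D B => ∑ A, K A D A B) * Θ := by
  have hR : ∀ k l, curv (chr h) k l u = ∑ C, ∑ D, (Θ C k * Θ D l) • (X * K C D * Θ) := by
    intro k l
    rw [← Matrix.one_mul (curv _ _ _ _), ← hXΘ, Matrix.mul_assoc, hK, ← Matrix.mul_assoc]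
    simp [Matrix.mul_sum, Matrix.sum_mul]
  -- Contraction over the coordinate index `i` pairs `Θ` with its inverse `X`, so the coordinate
  -- trace becomes a trace over the coframe index.
  have hd : ∀ A C, ∑ i, Θ C i * X i A = if C = A then 1 else 0 := by
    intro A C
    have := congrFun (congrFun hΘX C) A
    rwa [Matrix.mul_apply, Matrix.one_apply] at this
  ext j k
  simp only [ricci, Matrix.of_apply, riemann_eq_curv, hR, Matrix.sum_apply, Matrix.smul_apply,
    smul_eq_mul, Matrix.mul_apply, Matrix.transpose_apply]
  calc ∑ i, ∑ C, ∑ D, Θ C i * Θ D j * ∑ B, (∑ A, X i A * K C D A B) * Θ B k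
      = ∑ i, ∑ C, ∑ D, ∑ B, ∑ A, (Θ C i * X i A) * (Θ D j * K C D A B * Θ B k) := by
        refine Finset.sum_congr rfl fun i _ => Finset.sum_congr rfl fun C _ =>
          Finset.sum_congr rfl fun D _ => ?_
        rw [Finset.mul_sum]
        refine Finset.sum_congr rfl fun B _ => ?_
        rw [Finset.sum_mul, Finset.mul_sum]
        exact Finset.sum_congr rfl fun A _ => by ring
    _ = ∑ C, ∑ D, ∑ B, ∑ A, (∑ i, Θ C i * X i A) * (Θ D j * K C D A B * Θ B k) := by
        rw [Finset.sum_comm]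
        refine Finset.sum_congr rfl fun C _ => ?_
        rw [Finset.sum_comm]
        refine Finset.sum_congr rfl fun D _ => ?_
        rw [Finset.sum_comm]
        refine Finset.sum_congr rfl fun B _ => ?_
        rw [Finset.sum_comm]
        exact Finset.sum_congr rfl fun A _ => by rw [Finset.sum_mul]
    _ = ∑ C, ∑ D, ∑ B, Θ D j * K C D C B * Θ B k := by
        simp only [hd, ite_mul, one_mul, zero_mul, Finset.sum_ite_eq, Finset.mem_univ, if_true]
    _ = _ := by
        have h1 : ∀ C, ∑ D, ∑ B, Θ D j * K C D C B * Θ B k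
            = ∑ B, ∑ D, Θ D j * K C D C B * Θ B k := fun C => Finset.sum_comm
        simp only [h1]
        rw [Finset.sum_comm]
        refine Finset.sum_congr rfl fun B _ => ?_
        rw [Finset.sum_comm, Finset.sum_mul]
        refine Finset.sum_congr rfl fun D _ => ?_
        rw [Finset.mul_sum, Finset.sum_mul]

section Coframe

variable [Fintype ι] [DecidableEq ι] {Θ : R m → Matrix ι (Fin m) ℝ} {X : R m → Matrix (Fin m) ι ℝ}
  {ϖ : Fin m → R m → Matrix ι ι ℝ} {h : R m → Matrix (Fin m) (Fin m) ℝ}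

/-- Cartan's lemma: a skew torsion-free connection form in an orthonormal coframe is the Levi-Civita
connection. -/
theorem chr_of_coframe (hV : IsOpen V) (hΘ : MSmooth V Θ)
    (hXΘ : ∀ w ∈ V, X w * Θ w = 1) (hΘX : ∀ w ∈ V, Θ w * X w = 1)
    (hskew : ∀ w ∈ V, ∀ k, (ϖ k w)ᵀ = - ϖ k w)
    (htor : ∀ w ∈ V, ∀ k l i,
      (mpd Θ k w + ϖ k w * Θ w) i l = (mpd Θ l w + ϖ l w * Θ w) i k)
    (hh : ∀ w ∈ V, h w = (Θ w)ᵀ * Θ w) (hu : u ∈ V) (k : Fin m) :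
    chr h k u = X u * (mpd Θ k u + ϖ k u * Θ u) := by
  have hs : ∀ w ∈ V, (h w)ᵀ = h w := fun w hw => by
    rw [hh w hw, Matrix.transpose_mul, Matrix.transpose_transpose]
  have hdet : (h u).det ≠ 0 := by
    have : (X u * (X u)ᵀ) * h u = 1 := by
      rw [hh u hu, Matrix.mul_assoc, ← Matrix.mul_assoc _ (Θ u)ᵀ, ← Matrix.transpose_mul,
        hΘX u hu, Matrix.transpose_one, Matrix.one_mul, hXΘ u hu]
    exact Matrix.det_ne_zero_of_left_inverse this
  -- The candidate is `ϖ` transformed to the coordinate frame. The torsion hypothesis is its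
  -- symmetry, and skewness of `ϖ` removes it from the derivative of `ΘᵀΘ`, which leaves metric
  -- compatibility.
  refine chr_unique (Γ := fun k => X u * (mpd Θ k u + ϖ k u * Θ u)) hs hu hdet ?_ ?_ k
  · intro i j k
    simp only [Matrix.mul_apply]
    exact Finset.sum_congr rfl fun a _ => by rw [htor u hu i j a]
  · intro i
    have e : mpd h i u = (mpd Θ i u)ᵀ * Θ u + (Θ u)ᵀ * mpd Θ i u := by
      rw [mpd_congr hV hh hu i, mpd_mul hV hu hΘ.transpose hΘ, mpd_transpose]
    have e2 : h u * (X u * (mpd Θ i u + ϖ i u * Θ u)) = (Θ u)ᵀ * (mpd Θ i u + ϖ i u * Θ u) := by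
      rw [hh u hu, Matrix.mul_assoc, ← Matrix.mul_assoc (Θ u), hΘX u hu, Matrix.one_mul]
    have e3 := congrArg Matrix.transpose e2
    rw [Matrix.transpose_mul, hs u hu] at e3
    rw [e, e2, e3]
    simp only [Matrix.transpose_mul, Matrix.transpose_add, Matrix.transpose_transpose,
      hskew u hu, Matrix.mul_add, Matrix.mul_neg, Matrix.neg_mul, Matrix.mul_assoc]
    abel

/-- Cartan's lemma says `Θ Γ_k = ∂_k Θ + ϖ_k Θ`, so `Θ` is a gauge transformation between the two
connection forms, and `curv_intertwine` applies. Curvature of the metric can thus be computed from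
`ϖ` alone. -/
theorem curv_of_coframe (hV : IsOpen V) (hΘ : MSmooth V Θ)
    (hϖ : ∀ k, MSmooth V (ϖ k))
    (hXΘ : ∀ w ∈ V, X w * Θ w = 1) (hΘX : ∀ w ∈ V, Θ w * X w = 1)
    (hskew : ∀ w ∈ V, ∀ k, (ϖ k w)ᵀ = - ϖ k w)
    (htor : ∀ w ∈ V, ∀ k l i,
      (mpd Θ k w + ϖ k w * Θ w) i l = (mpd Θ l w + ϖ l w * Θ w) i k)
    (hh : ∀ w ∈ V, h w = (Θ w)ᵀ * Θ w) (hu : u ∈ V) (k l : Fin m) :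
    Θ u * curv (chr h) k l u = curv ϖ k l u * Θ u := by
  have hsm : MSmooth V h := (hΘ.transpose.mul hΘ).congr hh
  have hdet : ∀ w ∈ V, (h w).det ≠ 0 := fun u hu => by
    have : (X u * (X u)ᵀ) * h u = 1 := by
      rw [hh u hu, Matrix.mul_assoc, ← Matrix.mul_assoc _ (Θ u)ᵀ, ← Matrix.transpose_mul,
        hΘX u hu, Matrix.transpose_one, Matrix.one_mul, hXΘ u hu]
    exact Matrix.det_ne_zero_of_left_inverse this
  refine curv_intertwine hV hΘ (fun k => hsm.chr hV hdet k) hϖ (fun w hw k => ?_) hu k l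
  rw [chr_of_coframe hV hΘ hXΘ hΘX hskew htor hh hw k, ← Matrix.mul_assoc, hΘX w hw,
    Matrix.one_mul]

end Coframe

/-! ### Pull-backs -/

/-- The Jacobian matrix of a map. -/
def jac (x : R m → R n) (u : R m) : Matrix (Fin n) (Fin m) ℝ :=
  Matrix.of fun i k => pd (fun w => x w i) k u

/-- The pull-back of a matrix-valued one-form. -/
def pullForm (x : R m → R n) (Γ : Fin n → R n → Matrix α α ℝ) (k : Fin m) (u : R m) :
    Matrix α α ℝ :=
  ∑ i, jac x u i k • Γ i (x u)

lemma MSmooth.jac {x : R m → R n} (hV : IsOpen V) (hx : ContDiffOn ℝ ∞ x V) :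
    MSmooth V (jac x) := fun i k => contDiffOn_pd hV (contDiffOn_euclidean.1 hx i) k

lemma MSmooth.comp {β : Type*} {x : R m → R n} {A : R n → Matrix α β ℝ} (hA : MSmooth W A)
    (hx : ContDiffOn ℝ ∞ x V) (hxV : ∀ w ∈ V, x w ∈ W) : MSmooth V (fun w => A (x w)) :=
  fun i j => (hA i j).comp hx hxV

lemma MSmooth.pullForm {x : R m → R n} {Γ : Fin n → R n → Matrix α α ℝ} (hV : IsOpen V)
    (hx : ContDiffOn ℝ ∞ x V) (hxV : ∀ w ∈ V, x w ∈ W) (hΓ : ∀ i, MSmooth W (Γ i)) (k : Fin m) :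
    MSmooth V (pullForm x Γ k) :=
  MSmooth.sum fun i => MSmooth.smul (MSmooth.jac hV hx i k) ((hΓ i).comp hx hxV)

lemma mpd_comp {β : Type*} {x : R m → R n} {A : R n → Matrix α β ℝ} (hV : IsOpen V)
    (hW : IsOpen W) (hA : MSmooth W A) (hx : ContDiffOn ℝ ∞ x V) (hxV : ∀ w ∈ V, x w ∈ W)
    (hu : u ∈ V) (k : Fin m) :
    mpd (fun w => A (x w)) k u = ∑ i, jac x u i k • mpd A i (x u) := by
  ext a b
  simp only [mpd_apply, Matrix.sum_apply, Matrix.smul_apply, smul_eq_mul]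
  rw [pd_comp (hA.differentiableAt hW (hxV u hu) a b)
    ((hx.contDiffAt (hV.mem_nhds hu)).differentiableAt (by simp))]
  exact Finset.sum_congr rfl fun i _ => mul_comm _ _

lemma mpd_jac_comm {x : R m → R n} (hV : IsOpen V) (hx : ContDiffOn ℝ ∞ x V) (hu : u ∈ V)
    (k l : Fin m) (i : Fin n) : mpd (jac x) k u i l = mpd (jac x) l u i k :=
  pd_comm hV (contDiffOn_euclidean.1 hx i) hu k l

/-- Naturality of curvature: the second derivatives of `x` are symmetric in `k`, `l` and drop out of
the exterior derivative. -/
lemma curv_pullForm [Fintype α] {x : R m → R n} {Γ : Fin n → R n → Matrix α α ℝ} (hV : IsOpen V)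
    (hW : IsOpen W) (hx : ContDiffOn ℝ ∞ x V) (hxV : ∀ w ∈ V, x w ∈ W)
    (hΓ : ∀ i, MSmooth W (Γ i)) (hu : u ∈ V) (k l : Fin m) :
    curv (pullForm x Γ) k l u = ∑ i, ∑ j, (jac x u i k * jac x u j l) • curv Γ i j (x u) := by
  have e : ∀ k l, mpd (pullForm x Γ l) k u = ∑ i, (mpd (jac x) k u i l • Γ i (x u)
      + ∑ j, (jac x u i l * jac x u j k) • mpd (Γ i) j (x u)) := by
    intro k l
    unfold pullForm
    rw [mpd_sum hV hu fun i => MSmooth.smul (MSmooth.jac hV hx i l) ((hΓ i).comp hx hxV)]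
    refine Finset.sum_congr rfl fun i _ => ?_
    rw [mpd_smul hV hu (MSmooth.jac hV hx i l) ((hΓ i).comp hx hxV),
      mpd_comp hV hW (hΓ i) hx hxV hu, Finset.smul_sum]
    simp only [smul_smul]; rfl
  have e2 : ∀ k l, pullForm x Γ k u * pullForm x Γ l u
      = ∑ i, ∑ j, (jac x u i k * jac x u j l) • (Γ i (x u) * Γ j (x u)) := by
    intro k l
    simp only [pullForm, Matrix.sum_mul, Matrix.mul_sum, smul_mul_assoc, mul_smul_comm,
      Finset.smul_sum, smul_smul]
    rw [Finset.sum_comm]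
    simp only [mul_comm (jac x u _ l)]
  have e3 : ∀ k l, ∑ i, ∑ j, (jac x u i l * jac x u j k) • mpd (Γ i) j (x u)
      = ∑ i, ∑ j, (jac x u i k * jac x u j l) • mpd (Γ j) i (x u) := by
    intro k l
    rw [Finset.sum_comm]
    simp only [mul_comm]
  have e4 : ∑ i, ∑ j, (jac x u i l * jac x u j k) • (Γ i (x u) * Γ j (x u))
      = ∑ i, ∑ j, (jac x u i k * jac x u j l) • (Γ j (x u) * Γ i (x u)) := by
    rw [Finset.sum_comm]
    simp only [mul_comm (jac x u _ l)]
  unfold curv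
  rw [e, e, e2, e2, Finset.sum_add_distrib, Finset.sum_add_distrib, e3 k l, e4]
  simp only [mpd_jac_comm hV hx hu k l, smul_add, smul_sub, Finset.sum_add_distrib,
    Finset.sum_sub_distrib]
  abel

end LeviCivita


/-! ### Orthonormal moving frames along a map -/

section MovingFrame

variable {m n : ℕ} {V : Set (R m)} {u : R m} {W : Set (R n)} {x : R m → R n}
  {G : R n → Matrix (Fin n) (Fin n) ℝ} {E : R m → Matrix (Fin n) (Fin n) ℝ}

lemma sum_smul_lin {ι κ N : Type*} [Fintype ι] [Fintype κ] [AddCommGroup N] [Module ℝ N]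
    (e : ι → κ → ℝ) (s : κ → ℝ) (M : ι → N) :
    ∑ i, (∑ a, e i a * s a) • M i = ∑ a, s a • ∑ i, e i a • M i := by
  simp only [Finset.sum_smul, Finset.smul_sum, smul_smul]
  rw [Finset.sum_comm]
  simp only [mul_comm]

lemma sum_smul_bilin {ι κ N : Type*} [Fintype ι] [Fintype κ] [AddCommGroup N] [Module ℝ N]
    (e : ι → κ → ℝ) (s t : κ → ℝ) (M : ι → ι → N) :
    ∑ i, ∑ j, ((∑ a, e i a * s a) * ∑ b, e j b * t b) • M i j =
      ∑ a, ∑ b, (s a * t b) • ∑ i, ∑ j, (e i a * e j b) • M i j := by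
  simp only [← smul_smul, ← Finset.smul_sum, sum_smul_lin]
  refine Finset.sum_congr rfl fun a _ => ?_
  congr 1
  simp only [Finset.smul_sum, smul_smul]
  rw [Finset.sum_comm]
  refine Finset.sum_congr rfl fun b _ => Finset.sum_congr rfl fun i _ =>
    Finset.sum_congr rfl fun j _ => ?_
  congr 1; ring

/-- An orthonormal moving frame along a map into a Riemannian manifold: the pulled-back coframe `θ`,
the pulled-back Levi-Civita connection form `ϖ`, and the components `K` of the curvature. -/
structure MovingFrame (V : Set (R m)) (θ : R m → Matrix (Fin n) (Fin m) ℝ)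
    (ϖ : Fin m → R m → Matrix (Fin n) (Fin n) ℝ)
    (K : Fin n → Fin n → R m → Matrix (Fin n) (Fin n) ℝ) : Prop where
  isOpen : IsOpen V
  smooth_coframe : MSmooth V θ
  smooth_form : ∀ k, MSmooth V (ϖ k)
  smooth_curv : ∀ i j, MSmooth V (K i j)
  skew : ∀ w ∈ V, ∀ k, (ϖ k w)ᵀ = - ϖ k w
  torsion : ∀ w ∈ V, ∀ k l i, (mpd θ k w + ϖ k w * θ w) i l = (mpd θ l w + ϖ l w * θ w) i k
  curv : ∀ w ∈ V, ∀ k l, curv ϖ k l w = ∑ i, ∑ j, (θ w i k * θ w j l) • K i j w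

/-- The coframe dual to `E`. -/
def frameCoframe (G : R n → Matrix (Fin n) (Fin n) ℝ) (x : R m → R n)
    (E : R m → Matrix (Fin n) (Fin n) ℝ) (u : R m) : Matrix (Fin n) (Fin m) ℝ :=
  (E u)ᵀ * G (x u) * jac x u

/-- The Levi-Civita connection form in the frame `E`. -/
def frameForm (G : R n → Matrix (Fin n) (Fin n) ℝ) (x : R m → R n)
    (E : R m → Matrix (Fin n) (Fin n) ℝ) (k : Fin m) (u : R m) : Matrix (Fin n) (Fin n) ℝ :=
  (E u)ᵀ * G (x u) * (mpd E k u + pullForm x (chr G) k u * E u)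

/-- The components of the curvature at `y` in the frame `e`. -/
def frameCurv (G : R n → Matrix (Fin n) (Fin n) ℝ) (y : R n) (e : Matrix (Fin n) (Fin n) ℝ)
    (a b : Fin n) : Matrix (Fin n) (Fin n) ℝ :=
  ∑ i, ∑ j, (e i a * e j b) • (eᵀ * G y * curv (chr G) i j y * e)

/-- A metric on an open set of `ℝⁿ`. -/
structure IsMetricOn (W : Set (R n)) (G : R n → Matrix (Fin n) (Fin n) ℝ) : Prop where
  isOpen : IsOpen W
  smooth : MSmooth W G
  posDef : ∀ y ∈ W, (G y).PosDef

lemma IsMetricOn.symm (hG : IsMetricOn W G) : ∀ y ∈ W, (G y)ᵀ = G y := fun y hy => by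
  simpa using (hG.posDef y hy).isHermitian.eq

lemma IsMetricOn.det_ne (hG : IsMetricOn W G) : ∀ y ∈ W, (G y).det ≠ 0 := fun y hy =>
  (hG.posDef y hy).det_pos.ne'

lemma IsMetricOn.smooth_chr (hG : IsMetricOn W G) (i : Fin n) : MSmooth W (chr G i) :=
  hG.smooth.chr hG.isOpen hG.det_ne i

/-- The matrix `E` is a gauge transformation from the pulled-back Christoffel form to `frameForm`,
which gives the curvature. Skewness is the derivative of the orthonormality relation. Vanishing
torsion comes from differentiating `jac x = E θ` and using the symmetry of second derivatives and of
the Christoffel symbols. The domain may have any dimension, since the frame is used on the twistor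
space as well as on the base. -/
theorem movingFrame_of_frame (hG : IsMetricOn W G) (hV : IsOpen V) (hx : ContDiffOn ℝ ∞ x V)
    (hxV : ∀ w ∈ V, x w ∈ W) (hE : MSmooth V E) (hon : ∀ w ∈ V, (E w)ᵀ * G (x w) * E w = 1) :
    MovingFrame V (frameCoframe G x E) (frameForm G x E)
      (fun a b w => frameCurv G (x w) (E w) a b) := by
  have hGx : MSmooth V (fun w => G (x w)) := hG.smooth.comp hx hxV
  have hP : MSmooth V (fun w => (E w)ᵀ * G (x w)) := hE.transpose.mul hGx
  have hon' : ∀ w ∈ V, E w * ((E w)ᵀ * G (x w)) = 1 := fun w hw =>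
    mul_eq_one_comm.1 (hon w hw)
  have hJ : MSmooth V (jac x) := MSmooth.jac hV hx
  have hpull : ∀ k, MSmooth V (pullForm x (chr G) k) := fun k =>
    MSmooth.pullForm hV hx hxV hG.smooth_chr k
  have hθ : MSmooth V (frameCoframe G x E) := hP.mul hJ
  have hϖ : ∀ k, MSmooth V (frameForm G x E k) := fun k =>
    hP.mul ((hE.mpd hV k).add ((hpull k).mul hE))
  have hEθ : ∀ w ∈ V, E w * frameCoframe G x E w = jac x w := fun w hw => by
    rw [frameCoframe, ← Matrix.mul_assoc, hon' w hw, Matrix.one_mul]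
  have hEϖ : ∀ w ∈ V, ∀ k, E w * frameForm G x E k w = mpd E k w + pullForm x (chr G) k w * E w :=
    fun w hw k => by
      rw [frameForm, ← Matrix.mul_assoc, hon' w hw, Matrix.one_mul]
  refine ⟨hV, hθ, hϖ, fun a b => ?_, ?_, ?_, ?_⟩
  · refine MSmooth.sum fun i => MSmooth.sum fun j =>
      MSmooth.smul ((hE i a).mul (hE j b)) ((hP.mul ?_).mul hE)
    exact (MSmooth.curv hG.isOpen hG.smooth_chr i j).comp hx hxV
  · intro w hw k
    have h0 : mpd (fun w => (E w)ᵀ * G (x w) * E w) k w = 0 := by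
      rw [mpd_congr hV hon hw, mpd_const]
    rw [mpd_mul hV hw hP hE, mpd_mul hV hw hE.transpose hGx, mpd_transpose,
      mpd_comp hV hG.isOpen hG.smooth hx hxV hw] at h0
    have h1 : ∑ i, jac x w i k • mpd G i (x w)
        = (pullForm x (chr G) k w)ᵀ * G (x w) + G (x w) * pullForm x (chr G) k w := by
      simp only [pullForm, Matrix.transpose_sum, Matrix.transpose_smul, Matrix.sum_mul,
        Matrix.mul_sum, smul_mul_assoc, mul_smul_comm, ← Finset.sum_add_distrib, ← smul_add]
      exact Finset.sum_congr rfl fun i _ => by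
        rw [chr_compat hG.isOpen hG.symm (hxV w hw) (hG.det_ne _ (hxV w hw))]
    rw [h1] at h0
    rw [← sub_eq_zero, sub_neg_eq_add, ← h0]
    simp only [frameForm, Matrix.transpose_mul, Matrix.transpose_add, Matrix.transpose_transpose,
      hG.symm _ (hxV w hw), Matrix.mul_add, Matrix.add_mul, Matrix.mul_assoc]
    abel
  · intro w hw k l i
    have e : ∀ k, mpd (frameCoframe G x E) k w + frameForm G x E k w * frameCoframe G x E w
        = (E w)ᵀ * G (x w) * (mpd (jac x) k w + pullForm x (chr G) k w * jac x w) := by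
      intro k
      have h2 : mpd (jac x) k w = mpd E k w * frameCoframe G x E w
          + E w * mpd (frameCoframe G x E) k w := by
        rw [← mpd_mul hV hw hE hθ]
        exact mpd_congr hV (fun w hw => (hEθ w hw).symm) hw k
      have h3 : mpd (jac x) k w + pullForm x (chr G) k w * jac x w =
          E w * (mpd (frameCoframe G x E) k w
            + frameForm G x E k w * frameCoframe G x E w) := by
        rw [h2, Matrix.mul_add, ← Matrix.mul_assoc (E w) (frameForm _ _ _ _ _), hEϖ w hw,
          Matrix.add_mul, Matrix.mul_assoc _ (E w), hEθ w hw]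
        abel
      rw [h3, ← Matrix.mul_assoc, hon w hw, Matrix.one_mul]
    rw [e, e]
    simp only [Matrix.mul_apply (M := (E w)ᵀ * G (x w))]
    refine Finset.sum_congr rfl fun a _ => ?_
    congr 1
    simp only [Matrix.add_apply, Matrix.mul_apply, pullForm, Matrix.sum_apply, Matrix.smul_apply,
      smul_eq_mul, Finset.sum_mul]
    rw [mpd_jac_comm hV hx hw k l, Finset.sum_comm]
    congr 1
    refine Finset.sum_congr rfl fun b _ => Finset.sum_congr rfl fun c _ => ?_
    rw [chr_symm hG.isOpen hG.symm (hxV w hw) c b a]; ring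
  · intro w hw k l
    have h2 := curv_intertwine hV hE hϖ hpull hEϖ hw k l
    have h3 : Twistor.curv (frameForm G x E) k l w
        = (E w)ᵀ * G (x w) * (Twistor.curv (pullForm x (chr G)) k l w * E w) := by
      rw [← h2, ← Matrix.mul_assoc, hon w hw, Matrix.one_mul]
    have hj : ∀ i k, jac x w i k = ∑ a, E w i a * frameCoframe G x E w a k := fun i k => by
      conv_lhs => rw [← hEθ w hw, Matrix.mul_apply]
    rw [h3, curv_pullForm hV hG.isOpen hx hxV hG.smooth_chr hw]
    rw [Finset.sum_mul, Finset.mul_sum]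
    simp only [hj, Matrix.sum_mul, Matrix.mul_sum, smul_mul_assoc, mul_smul_comm, frameCurv,
      ← Matrix.mul_assoc]
    exact sum_smul_bilin _ _ _ _

end MovingFrame


/-! ### Skew-symmetric endomorphisms of a four-dimensional space -/

section SkewFour

/-- The skew-symmetric matrix with self-dual part `p` and anti-self-dual part `q`: `p` acts by left and
`q` by right multiplication with an imaginary quaternion. -/
def so (p q : Fin 3 → ℝ) : Matrix (Fin 4) (Fin 4) ℝ :=
  !![0, -(p 0 + q 0), -(p 1 + q 1), -(p 2 + q 2);
    p 0 + q 0, 0, -p 2 + q 2, p 1 - q 1;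
    p 1 + q 1, p 2 - q 2, 0, -p 0 + q 0;
    p 2 + q 2, -p 1 + q 1, p 0 - q 0, 0]

/-- The self-dual basis matrices: left multiplication by `i`, `j`, `k`. -/
def sdBasis (b : Fin 3) : Matrix (Fin 4) (Fin 4) ℝ := so (Pi.single b 1) 0

/-- The self-dual components of a matrix. -/
def sdPart (M : Matrix (Fin 4) (Fin 4) ℝ) : Fin 3 → ℝ :=
  ![(M 1 0 - M 0 1 + M 3 2 - M 2 3) / 4, (M 2 0 - M 0 2 + M 1 3 - M 3 1) / 4,
    (M 3 0 - M 0 3 + M 2 1 - M 1 2) / 4]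

/-- The anti-self-dual components of a matrix. -/
def asdPart (M : Matrix (Fin 4) (Fin 4) ℝ) : Fin 3 → ℝ :=
  ![(M 1 0 - M 0 1 - M 3 2 + M 2 3) / 4, (M 2 0 - M 0 2 - M 1 3 + M 3 1) / 4,
    (M 3 0 - M 0 3 - M 2 1 + M 1 2) / 4]

lemma skew_apply {α : Type*} {M : Matrix α α ℝ} (h : Mᵀ = -M) (i j : α) :
    M i j = - M j i := by
  have := congrFun (congrFun h j) i
  simpa using this

lemma skew_diag {α : Type*} {M : Matrix α α ℝ} (h : Mᵀ = -M) (i : α) :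
    M i i = 0 := by
  linarith [skew_apply h i i]

lemma eq_so {M : Matrix (Fin 4) (Fin 4) ℝ} (h : Mᵀ = -M) : M = so (sdPart M) (asdPart M) := by
  have h10 := skew_apply h 0 1
  have h20 := skew_apply h 0 2
  have h30 := skew_apply h 0 3
  have h21 := skew_apply h 1 2
  have h31 := skew_apply h 1 3
  have h32 := skew_apply h 2 3
  ext i j
  fin_cases i <;> fin_cases j <;>
    simp [so, sdPart, asdPart, skew_diag h] <;> linarith

lemma so_transpose (p q : Fin 3 → ℝ) : (so p q)ᵀ = - so p q := by
  ext i j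
  fin_cases i <;> fin_cases j <;> simp [so] <;> ring

lemma sdPart_so (p q : Fin 3 → ℝ) : sdPart (so p q) = p := by
  ext b
  fin_cases b <;> simp [so, sdPart] <;> ring

lemma asdPart_so (p q : Fin 3 → ℝ) : asdPart (so p q) = q := by
  ext b
  fin_cases b <;> simp [so, asdPart] <;> ring

lemma so_smul (c : ℝ) (p q : Fin 3 → ℝ) : so (c • p) (c • q) = c • so p q := by
  ext i j
  fin_cases i <;> fin_cases j <;> simp [so] <;> ring

lemma so_eq_sum (p : Fin 3 → ℝ) : so p 0 = ∑ b, p b • sdBasis b := by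
  ext i j
  fin_cases i <;> fin_cases j <;> simp [so, sdBasis, Fin.sum_univ_three]

lemma so_left_mul_self (p : Fin 3 → ℝ) : so p 0 * so p 0 = -(p 0 ^ 2 + p 1 ^ 2 + p 2 ^ 2) • (1 : Matrix (Fin 4) (Fin 4) ℝ) := by
  ext i j
  fin_cases i <;> fin_cases j <;> simp [so, Matrix.mul_apply, Fin.sum_univ_four] <;> ring

set_option maxHeartbeats 1000000 in
/-- The commutator of skew-symmetric matrices in terms of cross products. -/
lemma so_bracket (p q p' q' : Fin 3 → ℝ) :
    so p q * so p' q' - so p' q' * so p q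
      = so (fun b => 2 * (p (b + 1) * p' (b + 2) - p (b + 2) * p' (b + 1)))
        (fun b => -2 * (q (b + 1) * q' (b + 2) - q (b + 2) * q' (b + 1))) := by
  ext i j
  fin_cases i <;> fin_cases j <;>
    simp [so] <;> ring

lemma sdPart_add (M N : Matrix (Fin 4) (Fin 4) ℝ) : sdPart (M + N) = sdPart M + sdPart N := by
  ext b
  fin_cases b <;> simp [sdPart] <;> ring

lemma sdPart_sub (M N : Matrix (Fin 4) (Fin 4) ℝ) : sdPart (M - N) = sdPart M - sdPart N := by
  ext b
  fin_cases b <;> simp [sdPart] <;> ring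

lemma sdPart_smul (c : ℝ) (M : Matrix (Fin 4) (Fin 4) ℝ) : sdPart (c • M) = c • sdPart M := by
  ext b
  fin_cases b <;> simp [sdPart] <;> ring

lemma sdPart_sum {ι : Type*} (s : Finset ι) (M : ι → Matrix (Fin 4) (Fin 4) ℝ) :
    sdPart (∑ i ∈ s, M i) = ∑ i ∈ s, sdPart (M i) := by
  classical
  induction s using Finset.induction_on with
  | empty => ext b; fin_cases b <;> simp [sdPart]
  | insert a s ha ih => rw [Finset.sum_insert ha, Finset.sum_insert ha, sdPart_add, ih]

/-- Left and right quaternion multiplications commute, so self-dual parts bracket among themselves,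
by twice the cross product; `b + 1` and `b + 2` are taken modulo three. -/
lemma sdPart_bracket {M N : Matrix (Fin 4) (Fin 4) ℝ} (hM : Mᵀ = -M) (hN : Nᵀ = -N) (b : Fin 3) :
    sdPart (M * N - N * M) b
      = 2 * (sdPart M (b + 1) * sdPart N (b + 2) - sdPart M (b + 2) * sdPart N (b + 1)) := by
  conv_lhs => rw [eq_so hM, eq_so hN, so_bracket, sdPart_so]

end SkewFour

/-! ### The connection of the bundle of self-dual two-vectors -/

section SelfDualConnection

variable {m : ℕ} {V : Set (R m)} {u : R m} {θ : R m → Matrix (Fin 4) (Fin m) ℝ}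
  {ϖ : Fin m → R m → Matrix (Fin 4) (Fin 4) ℝ} {K : Fin 4 → Fin 4 → R m → Matrix (Fin 4) (Fin 4) ℝ}

/-- The self-dual part of the connection form. -/
def sdForm (ϖ : Fin m → R m → Matrix (Fin 4) (Fin 4) ℝ) (u : R m) : Matrix (Fin 3) (Fin m) ℝ :=
  Matrix.of fun b k => sdPart (ϖ k u) b

/-- The components of the `b`-th self-dual part of the curvature. -/
def sdCurv (K : Fin 4 → Fin 4 → R m → Matrix (Fin 4) (Fin 4) ℝ) (b : Fin 3) (u : R m) :
    Matrix (Fin 4) (Fin 4) ℝ :=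
  Matrix.of fun i j => sdPart (K i j u) b

/-- The covariant derivative of the self-dual part of the curvature. -/
def covCurv (ϖ : Fin m → R m → Matrix (Fin 4) (Fin 4) ℝ)
    (K : Fin 4 → Fin 4 → R m → Matrix (Fin 4) (Fin 4) ℝ) (b : Fin 3) (k : Fin m) (u : R m) :
    Matrix (Fin 4) (Fin 4) ℝ :=
  mpd (sdCurv K b) k u + (ϖ k u * sdCurv K b u - sdCurv K b u * ϖ k u)
    + (2 : ℝ) • (sdForm ϖ u (b + 1) k • sdCurv K (b + 2) u
      - sdForm ϖ u (b + 2) k • sdCurv K (b + 1) u)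

lemma MSmooth.sdPart {A : R m → Matrix (Fin 4) (Fin 4) ℝ} (hA : MSmooth V A) (b : Fin 3) :
    ContDiffOn ℝ ∞ (fun w => sdPart (A w) b) V := by
  fin_cases b
  · exact ((((hA 1 0).sub (hA 0 1)).add (hA 3 2)).sub (hA 2 3)).div_const 4
  · exact ((((hA 2 0).sub (hA 0 2)).add (hA 1 3)).sub (hA 3 1)).div_const 4
  · exact ((((hA 3 0).sub (hA 0 3)).add (hA 2 1)).sub (hA 1 2)).div_const 4

lemma pd_comb {f₁ f₂ f₃ f₄ : R m → ℝ} (h1 : DifferentiableAt ℝ f₁ u) (h2 : DifferentiableAt ℝ f₂ u)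
    (h3 : DifferentiableAt ℝ f₃ u) (h4 : DifferentiableAt ℝ f₄ u) (k : Fin m) :
    pd (fun w => (f₁ w - f₂ w + f₃ w - f₄ w) / 4) k u
      = (pd f₁ k u - pd f₂ k u + pd f₃ k u - pd f₄ k u) / 4 := by
  have e : (fun w => (f₁ w - f₂ w + f₃ w - f₄ w) / 4)
      = fun w => (1 / 4 : ℝ) * (f₁ w - f₂ w + f₃ w - f₄ w) := by ext w; ring
  rw [e, pd_const_mul _ (((h1.fun_sub h2).fun_add h3).fun_sub h4), pd_sub ((h1.fun_sub h2).fun_add h3) h4,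
    pd_add (h1.fun_sub h2) h3, pd_sub h1 h2]
  ring

lemma pd_sdPart {A : R m → Matrix (Fin 4) (Fin 4) ℝ} (hV : IsOpen V) (hu : u ∈ V)
    (hA : MSmooth V A) (b : Fin 3) (k : Fin m) :
    pd (fun w => sdPart (A w) b) k u = sdPart (mpd A k u) b := by
  have hd := hA.differentiableAt hV hu
  fin_cases b
  · exact pd_comb (hd 1 0) (hd 0 1) (hd 3 2) (hd 2 3) k
  · exact pd_comb (hd 2 0) (hd 0 2) (hd 1 3) (hd 3 1) k
  · exact pd_comb (hd 3 0) (hd 0 3) (hd 2 1) (hd 1 2) k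

namespace MovingFrame

variable (hF : MovingFrame V θ ϖ K)
include hF

lemma smooth_sdForm : MSmooth V (sdForm ϖ) := fun b k => (hF.smooth_form k).sdPart b

lemma smooth_sdCurv (b : Fin 3) : MSmooth V (sdCurv K b) := fun i j => (hF.smooth_curv i j).sdPart b

lemma curv_skew (hu : u ∈ V) (k l : Fin m) : (Twistor.curv ϖ k l u)ᵀ = - Twistor.curv ϖ k l u := by
  have e : ∀ a b, (mpd (ϖ a) b u)ᵀ = - mpd (ϖ a) b u := fun a b => by
    rw [← mpd_transpose, ← mpd_neg]
    exact mpd_congr hF.isOpen (fun w hw => hF.skew w hw a) hu b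
  simp only [Twistor.curv, Matrix.transpose_add, Matrix.transpose_sub, Matrix.transpose_mul, e,
    hF.skew u hu, Matrix.neg_mul, Matrix.mul_neg, neg_neg]
  abel

lemma sdPart_curv (hu : u ∈ V) (k l : Fin m) (b : Fin 3) :
    sdPart (Twistor.curv ϖ k l u) b = ((θ u)ᵀ * sdCurv K b u * θ u) k l := by
  rw [hF.curv u hu, sdPart_sum]
  simp only [sdPart_sum, sdPart_smul, Finset.sum_apply, Pi.smul_apply, smul_eq_mul,
    Matrix.mul_apply, Matrix.transpose_apply, sdCurv, Matrix.of_apply, Finset.sum_mul]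
  rw [Finset.sum_comm]
  exact Finset.sum_congr rfl fun i _ => Finset.sum_congr rfl fun j _ => by ring

/-- The structure equation of the self-dual connection form. -/
lemma sdForm_structure (hu : u ∈ V) (k l : Fin m) (b : Fin 3) :
    mpd (sdForm ϖ) k u b l - mpd (sdForm ϖ) l u b k
      + 2 * (sdForm ϖ u (b + 1) k * sdForm ϖ u (b + 2) l
        - sdForm ϖ u (b + 2) k * sdForm ϖ u (b + 1) l)
      = ((θ u)ᵀ * sdCurv K b u * θ u) k l := by
  rw [← hF.sdPart_curv hu, Twistor.curv, sdPart_add, sdPart_sub, Pi.add_apply, Pi.sub_apply,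
    sdPart_bracket (hF.skew u hu k) (hF.skew u hu l),
    ← pd_sdPart hF.isOpen hu (hF.smooth_form l), ← pd_sdPart hF.isOpen hu (hF.smooth_form k)]
  rfl

lemma sdCurv_skew_pull (hu : u ∈ V) (b : Fin 3) (k l : Fin m) :
    ((θ u)ᵀ * sdCurv K b u * θ u) k l = - ((θ u)ᵀ * sdCurv K b u * θ u) l k := by
  rw [← hF.sdPart_curv hu, ← hF.sdPart_curv hu, curv_swap,
    show (- Twistor.curv ϖ l k u) = (-1 : ℝ) • Twistor.curv ϖ l k u by simp, sdPart_smul]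
  simp

/-- The second Bianchi identity. -/
theorem bianchi (hskew : ∀ b, (sdCurv K b u)ᵀ = - sdCurv K b u) (hu : u ∈ V) (b : Fin 3)
    (j k l : Fin m) :
    ((θ u)ᵀ * covCurv ϖ K b j u * θ u) k l + ((θ u)ᵀ * covCurv ϖ K b k u * θ u) l j
      + ((θ u)ᵀ * covCurv ϖ K b l u * θ u) j k = 0 := by
  have hV := hF.isOpen
  -- Differentiating `θᵀ F θ` also differentiates `θ`. The extra terms contain `∂_j θ + ϖ_j θ`,
  -- which is symmetric in its coordinate indices as the torsion vanishes, so they cancel in the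
  -- cyclic sum.
  have key : ∀ j k l, sdPart (mpd (Twistor.curv ϖ k l) j u
      + (ϖ j u * Twistor.curv ϖ k l u - Twistor.curv ϖ k l u * ϖ j u)) b
      = ((θ u)ᵀ * covCurv ϖ K b j u * θ u) k l
        + (((mpd θ j u + ϖ j u * θ u)ᵀ * (sdCurv K b u * θ u)) k l
          - ((mpd θ j u + ϖ j u * θ u)ᵀ * (sdCurv K b u * θ u)) l k) := by
    intro j k l
    have h1 : sdPart (mpd (Twistor.curv ϖ k l) j u) b
        = mpd (fun w => (θ w)ᵀ * sdCurv K b w * θ w) j u k l := by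
      rw [← pd_sdPart hV hu (MSmooth.curv hV hF.smooth_form k l), mpd_apply]
      exact pd_congr hV (fun w hw => hF.sdPart_curv hw k l b) hu j
    have h2 : ((mpd θ j u + ϖ j u * θ u)ᵀ * (sdCurv K b u * θ u)) l k
        = - ((θ u)ᵀ * sdCurv K b u * (mpd θ j u + ϖ j u * θ u)) k l := by
      have := congrFun (congrFun (Matrix.transpose_mul ((mpd θ j u + ϖ j u * θ u)ᵀ)
        (sdCurv K b u * θ u)) k) l
      rw [Matrix.transpose_apply] at this
      rw [this, Matrix.transpose_mul, hskew, Matrix.transpose_transpose, Matrix.mul_neg,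
        Matrix.neg_mul, Matrix.neg_apply]
    rw [h2, sdPart_add, Pi.add_apply, h1,
      sdPart_bracket (hF.skew u hu j) (hF.curv_skew hu k l), hF.sdPart_curv hu, hF.sdPart_curv hu,
      mpd_mul hV hu (hF.smooth_coframe.transpose.mul (hF.smooth_sdCurv b)) hF.smooth_coframe,
      mpd_mul hV hu hF.smooth_coframe.transpose (hF.smooth_sdCurv b), mpd_transpose]
    have e : ∀ c k, sdPart (ϖ k u) c = sdForm ϖ u c k := fun _ _ => rfl
    simp only [e, covCurv, Matrix.transpose_add, Matrix.transpose_mul, hF.skew u hu, Matrix.mul_add,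
      Matrix.add_mul, Matrix.mul_sub, Matrix.sub_mul, Matrix.mul_smul, Matrix.smul_mul,
      Matrix.add_apply, Matrix.sub_apply, Matrix.smul_apply, smul_eq_mul, Matrix.mul_neg,
      Matrix.neg_mul, Matrix.neg_apply, Matrix.mul_assoc]
    ring
  have h := congrFun (congrArg sdPart (curv_bianchi hV hF.smooth_form hu j k l)) b
  rw [sdPart_add, sdPart_add, Pi.add_apply, Pi.add_apply, key, key, key] at h
  have hs : ∀ (j k l : Fin m), ((mpd θ j u + ϖ j u * θ u)ᵀ * (sdCurv K b u * θ u)) k l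
      = ((mpd θ k u + ϖ k u * θ u)ᵀ * (sdCurv K b u * θ u)) j l := by
    intro j k l
    simp only [Matrix.mul_apply (M := (mpd θ _ u + ϖ _ u * θ u)ᵀ), Matrix.transpose_apply]
    exact Finset.sum_congr rfl fun i _ => by rw [hF.torsion u hu j k i]
  have h0 : sdPart 0 b = 0 := by fin_cases b <;> simp [sdPart]
  rw [h0, hs j l k, hs k j l, hs l k j] at h
  linarith

end MovingFrame

/-- The covariant derivative along frame vectors given by the columns of `X`. -/
def covDir (ϖ : Fin m → R m → Matrix (Fin 4) (Fin 4) ℝ)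
    (K : Fin 4 → Fin 4 → R m → Matrix (Fin 4) (Fin 4) ℝ) (X : Matrix (Fin m) (Fin 4) ℝ) (b : Fin 3)
    (p : Fin 4) (u : R m) : Matrix (Fin 4) (Fin 4) ℝ :=
  ∑ j, X j p • covCurv ϖ K b j u

/-- Multilinear extension of a cyclic identity from coordinate vectors to arbitrary ones. Columns of
a right inverse of `t` turn it into frame components; a vector in the kernel of `t` isolates a
single term. -/
lemma pull_contract {M : Fin m → Matrix (Fin 4) (Fin 4) ℝ} {t : Matrix (Fin 4) (Fin m) ℝ}
    (h : ∀ j k l, (tᵀ * M j * t) k l + (tᵀ * M k * t) l j + (tᵀ * M l * t) j k = 0)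
    (a b c : Fin m → ℝ) :
    (t *ᵥ b) ⬝ᵥ ((∑ j, a j • M j) *ᵥ (t *ᵥ c)) + (t *ᵥ c) ⬝ᵥ ((∑ j, b j • M j) *ᵥ (t *ᵥ a))
      + (t *ᵥ a) ⬝ᵥ ((∑ j, c j • M j) *ᵥ (t *ᵥ b)) = 0 := by
  have e : ∀ a b c : Fin m → ℝ, (t *ᵥ b) ⬝ᵥ ((∑ j, a j • M j) *ᵥ (t *ᵥ c))
      = ∑ j, ∑ k, ∑ l, a j * b k * c l * (tᵀ * M j * t) k l := by
    intro a b c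
    rw [← Matrix.vecMul_transpose, ← Matrix.dotProduct_mulVec, Matrix.mulVec_mulVec,
      Matrix.mulVec_mulVec, Matrix.mul_sum, Matrix.sum_mul]
    simp only [Matrix.mul_smul, Matrix.smul_mul, dotProduct, Matrix.mulVec, Matrix.sum_apply,
      Matrix.smul_apply, smul_eq_mul, Finset.mul_sum, Finset.sum_mul]
    rw [Finset.sum_congr rfl fun k _ => Finset.sum_comm, Finset.sum_comm]
    exact Finset.sum_congr rfl fun j _ => Finset.sum_congr rfl fun k _ =>
      Finset.sum_congr rfl fun l _ => by ring
  rw [e, e, e]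
  have e2 : ∑ j, ∑ k, ∑ l, b j * c k * a l * (tᵀ * M j * t) k l
      = ∑ j, ∑ k, ∑ l, a j * b k * c l * (tᵀ * M k * t) l j := by
    rw [Finset.sum_congr rfl fun j _ => Finset.sum_comm, Finset.sum_comm]
    exact Finset.sum_congr rfl fun j _ => Finset.sum_congr rfl fun k _ =>
      Finset.sum_congr rfl fun l _ => by ring
  have e3 : ∑ j, ∑ k, ∑ l, c j * a k * b l * (tᵀ * M j * t) k l
      = ∑ j, ∑ k, ∑ l, a j * b k * c l * (tᵀ * M l * t) j k := by
    rw [Finset.sum_comm, Finset.sum_congr rfl fun j _ => Finset.sum_comm]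
    exact Finset.sum_congr rfl fun j _ => Finset.sum_congr rfl fun k _ =>
      Finset.sum_congr rfl fun l _ => by ring
  rw [e2, e3, ← Finset.sum_add_distrib, ← Finset.sum_add_distrib]
  refine Finset.sum_eq_zero fun j _ => ?_
  rw [← Finset.sum_add_distrib, ← Finset.sum_add_distrib]
  refine Finset.sum_eq_zero fun k _ => ?_
  rw [← Finset.sum_add_distrib, ← Finset.sum_add_distrib]
  refine Finset.sum_eq_zero fun l _ => ?_
  linear_combination (a j * b k * c l) * h j k l

lemma mulVec_single_col {X : Matrix (Fin m) (Fin 4) ℝ} {t : Matrix (Fin 4) (Fin m) ℝ}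
    (h : t * X = 1) (p : Fin 4) : t *ᵥ (fun j => X j p) = Pi.single p 1 := by
  ext i
  have := congrFun (congrFun h i) p
  rw [Matrix.mul_apply, Matrix.one_apply] at this
  rw [Matrix.mulVec, dotProduct, this, Pi.single_apply]

namespace MovingFrame

variable (hF : MovingFrame V θ ϖ K)
include hF

lemma covDir_bianchi (hskew : ∀ b, (sdCurv K b u)ᵀ = - sdCurv K b u) (hu : u ∈ V)
    {X : Matrix (Fin m) (Fin 4) ℝ} (hX : θ u * X = 1) (b : Fin 3) (p q r : Fin 4) :
    covDir ϖ K X b p u q r + covDir ϖ K X b q u r p + covDir ϖ K X b r u p q = 0 := by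
  have h := pull_contract (hF.bianchi hskew hu b) (fun j => X j p) (fun j => X j q)
    (fun j => X j r)
  simp only [mulVec_single_col hX] at h
  simpa [covDir] using h

/-- The curvature is horizontal, so it is covariantly constant in vertical directions. -/
lemma covCurv_eq (hskew : ∀ b, (sdCurv K b u)ᵀ = - sdCurv K b u) (hu : u ∈ V)
    {X : Matrix (Fin m) (Fin 4) ℝ} (hX : θ u * X = 1) (b : Fin 3) (k : Fin m) :
    covCurv ϖ K b k u = ∑ p, θ u p k • covDir ϖ K X b p u := by
  -- The vector `a` is the part of the `k`-th coordinate vector in the kernel of `θ`. In the Bianchi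
  -- identity for `a` and two frame vectors, the two other terms contain `θ a = 0`.
  set a : Fin m → ℝ := fun j => (Pi.single k 1 : Fin m → ℝ) j - ∑ p, X j p * θ u p k with ha
  have h0 : θ u *ᵥ a = 0 := by
    have e : a = Pi.single k 1 - X *ᵥ (fun p => θ u p k) := by
      ext j; simp [ha, Matrix.mulVec, dotProduct]
    rw [e, Matrix.mulVec_sub, Matrix.mulVec_mulVec, hX, Matrix.one_mulVec]
    ext i; simp
  have h1 : ∑ j, a j • covCurv ϖ K b j u = 0 := by
    ext p q
    have h := pull_contract (hF.bianchi hskew hu b) a (fun j => X j p) (fun j => X j q)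
    simp only [mulVec_single_col hX, h0] at h
    simpa using h
  simp only [ha, sub_smul, Finset.sum_sub_distrib, Finset.sum_smul] at h1
  rw [sub_eq_zero] at h1
  have h2 : ∑ j, (Pi.single k 1 : Fin m → ℝ) j • covCurv ϖ K b j u = covCurv ϖ K b k u := by
    simp [Pi.single_apply]
  rw [← h2, h1, Finset.sum_comm]
  refine Finset.sum_congr rfl fun p _ => ?_
  rw [covDir, Finset.smul_sum]
  exact Finset.sum_congr rfl fun j _ => by rw [smul_smul, mul_comm]

end MovingFrame

end SelfDualConnection


/-! ### The Levi-Civita connection and the Ricci tensor of the twistor space -/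

section TwistorCurvature

variable {m : ℕ} {V : Set (R m)} {u : R m} {θ : R m → Matrix (Fin 4) (Fin m) ℝ}
  {ϖ : Fin m → R m → Matrix (Fin 4) (Fin 4) ℝ} {K : Fin 4 → Fin 4 → R m → Matrix (Fin 4) (Fin 4) ℝ}

/-- Block form of `dω + ω ∧ ω`, which splits the curvature of the twistor space into horizontal,
mixed and vertical parts that are treated separately. -/
lemma curv_fromBlocks {α β : Type*} [Fintype α] [Fintype β]
    (A : Fin m → R m → Matrix α α ℝ) (B : Fin m → R m → Matrix α β ℝ)
    (C : Fin m → R m → Matrix β α ℝ) (D : Fin m → R m → Matrix β β ℝ) (k l : Fin m) (u : R m) :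
    curv (fun k w => Matrix.fromBlocks (A k w) (B k w) (C k w) (D k w)) k l u =
      Matrix.fromBlocks (curv A k l u + (B k u * C l u - B l u * C k u))
        (mpd (B l) k u - mpd (B k) l u
          + (A k u * B l u + B k u * D l u - (A l u * B k u + B l u * D k u)))
        (mpd (C l) k u - mpd (C k) l u
          + (C k u * A l u + D k u * C l u - (C l u * A k u + D l u * C k u)))
        (curv D k l u + (C k u * B l u - C l u * B k u)) := by
  simp only [curv, mpd_fromBlocks, Matrix.fromBlocks_multiply, sub_eq_add_neg,
    Matrix.fromBlocks_neg, Matrix.fromBlocks_add]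
  congr 1 <;> abel

/-- The vertical part of the coframe of the twistor space. -/
def vertCoframe (τ : ℝ) (ϖ : Fin m → R m → Matrix (Fin 4) (Fin 4) ℝ) (w : R m) :
    Matrix (Fin 2) (Fin m) ℝ :=
  Matrix.of fun a k => τ * sdForm ϖ w a.succ k

/-- The coframe of the twistor space. -/
def twCoframe (τ : ℝ) (θ : R m → Matrix (Fin 4) (Fin m) ℝ)
    (ϖ : Fin m → R m → Matrix (Fin 4) (Fin 4) ℝ) (w : R m) : Matrix (Fin 4 ⊕ Fin 2) (Fin m) ℝ :=
  Matrix.fromRows (θ w) (vertCoframe τ ϖ w)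

/-- The vertical connection form. -/
def vertForm (ϖ : Fin m → R m → Matrix (Fin 4) (Fin 4) ℝ) (k : Fin m) (w : R m) :
    Matrix (Fin 2) (Fin 2) ℝ :=
  sdForm ϖ w 0 k • !![0, -2; 2, 0]

/-- The mixed block of the connection form. -/
def mixForm (τ : ℝ) (θ : R m → Matrix (Fin 4) (Fin m) ℝ)
    (K : Fin 4 → Fin 4 → R m → Matrix (Fin 4) (Fin 4) ℝ) (k : Fin m) (w : R m) :
    Matrix (Fin 4) (Fin 2) ℝ :=
  Matrix.of fun i a => -(τ / 2) * (sdCurv K a.succ w * θ w) i k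

/-- The horizontal block of the connection form. -/
def horForm (τ : ℝ) (ϖ : Fin m → R m → Matrix (Fin 4) (Fin 4) ℝ)
    (K : Fin 4 → Fin 4 → R m → Matrix (Fin 4) (Fin 4) ℝ) (k : Fin m) (w : R m) :
    Matrix (Fin 4) (Fin 4) ℝ :=
  ϖ k w + (-(τ / 2)) • (vertCoframe τ ϖ w 0 k • sdCurv K 1 w + vertCoframe τ ϖ w 1 k • sdCurv K 2 w)

/-- The Levi-Civita connection form of the twistor space. -/
def twForm (τ : ℝ) (θ : R m → Matrix (Fin 4) (Fin m) ℝ)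
    (ϖ : Fin m → R m → Matrix (Fin 4) (Fin 4) ℝ)
    (K : Fin 4 → Fin 4 → R m → Matrix (Fin 4) (Fin 4) ℝ) (k : Fin m) (w : R m) :
    Matrix (Fin 4 ⊕ Fin 2) (Fin 4 ⊕ Fin 2) ℝ :=
  Matrix.fromBlocks (horForm τ ϖ K k w) (mixForm τ θ K k w) (-(mixForm τ θ K k w)ᵀ)
    (vertForm ϖ k w)

/-- The part of the covariant derivative of the curvature defined by the connection form of the
vertical bundle. -/
def vertCov (ϖ : Fin m → R m → Matrix (Fin 4) (Fin 4) ℝ)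
    (K : Fin 4 → Fin 4 → R m → Matrix (Fin 4) (Fin 4) ℝ) (a : Fin 2) (k : Fin m) (w : R m) :
    Matrix (Fin 4) (Fin 4) ℝ :=
  mpd (sdCurv K a.succ) k w + (ϖ k w * sdCurv K a.succ w - sdCurv K a.succ w * ϖ k w)
    + (vertForm ϖ k w a 0 • sdCurv K 1 w + vertForm ϖ k w a 1 • sdCurv K 2 w)

namespace MovingFrame

variable (hF : MovingFrame V θ ϖ K) (τ : ℝ)
include hF

lemma smooth_vertCoframe : MSmooth V (vertCoframe τ ϖ) := fun a k =>
  contDiffOn_const.mul (hF.smooth_sdForm a.succ k)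

lemma smooth_twCoframe : MSmooth V (twCoframe τ θ ϖ) := by
  rintro (i | a) k
  · exact hF.smooth_coframe i k
  · exact hF.smooth_vertCoframe τ a k

lemma smooth_vertForm (k : Fin m) : MSmooth V (vertForm ϖ k) :=
  MSmooth.smul (hF.smooth_sdForm 0 k) (MSmooth.const _)

lemma smooth_mixForm (k : Fin m) : MSmooth V (mixForm τ θ K k) := fun i a =>
  contDiffOn_const.mul (((hF.smooth_sdCurv a.succ).mul hF.smooth_coframe) i k)

lemma smooth_horForm (k : Fin m) : MSmooth V (horForm τ ϖ K k) :=
  (hF.smooth_form k).add (MSmooth.smul contDiffOn_const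
    ((MSmooth.smul (hF.smooth_vertCoframe τ 0 k) (hF.smooth_sdCurv 1)).add
      (MSmooth.smul (hF.smooth_vertCoframe τ 1 k) (hF.smooth_sdCurv 2))))

lemma smooth_twForm (k : Fin m) : MSmooth V (twForm τ θ ϖ K k) :=
  (hF.smooth_horForm τ k).fromBlocks (hF.smooth_mixForm τ k)
    (hF.smooth_mixForm τ k).transpose.neg (hF.smooth_vertForm k)

lemma twForm_skew (hskew : ∀ w ∈ V, ∀ b, (sdCurv K b w)ᵀ = - sdCurv K b w) (hu : u ∈ V)
    (k : Fin m) : (twForm τ θ ϖ K k u)ᵀ = - twForm τ θ ϖ K k u := by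
  have hv : (vertForm ϖ k u)ᵀ = - vertForm ϖ k u := by
    ext a b; fin_cases a <;> fin_cases b <;> simp [vertForm]
  simp only [twForm, Matrix.fromBlocks_transpose, Matrix.fromBlocks_neg, Matrix.transpose_neg,
    Matrix.transpose_transpose, hv, neg_neg]
  congr 1
  simp only [horForm, Matrix.transpose_add, Matrix.transpose_smul, hF.skew u hu, hskew u hu]
  module

/-- In the structure equations, components 1 and 2 of the self-dual connection are coupled through
component 0. That coupling is the rotation `vertForm`, so only the curvature is left over. -/
lemma vertCoframe_torsion (hu : u ∈ V) (k l : Fin m) (a : Fin 2) :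
    (mpd (vertCoframe τ ϖ) k u + vertForm ϖ k u * vertCoframe τ ϖ u) a l
      - (mpd (vertCoframe τ ϖ) l u + vertForm ϖ l u * vertCoframe τ ϖ u) a k
      = τ * ((θ u)ᵀ * sdCurv K a.succ u * θ u) k l := by
  have e : ∀ k l, mpd (vertCoframe τ ϖ) k u a l = τ * mpd (sdForm ϖ) k u a.succ l := fun k l =>
    pd_const_mul τ (hF.smooth_sdForm.differentiableAt hF.isOpen hu _ _) k
  have h := hF.sdForm_structure hu k l a.succ
  rw [← h, Matrix.add_apply, Matrix.add_apply, e, e, Matrix.mul_apply, Matrix.mul_apply]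
  fin_cases a <;> simp [vertForm, vertCoframe] <;> ring

/-- The defect of the vertical rows is `τ F_a` on horizontal vectors, and `mixForm` cancels it, half
for each order of `k` and `l`. Skewness forces the transposed block, and the correction in `horForm`
compensates what that block contributes to the horizontal rows. -/
lemma twForm_torsion (hskew : ∀ w ∈ V, ∀ b, (sdCurv K b w)ᵀ = - sdCurv K b w) (hu : u ∈ V)
    (k l : Fin m) (C : Fin 4 ⊕ Fin 2) :
    (mpd (twCoframe τ θ ϖ) k u + twForm τ θ ϖ K k u * twCoframe τ θ ϖ u) C l
      = (mpd (twCoframe τ θ ϖ) l u + twForm τ θ ϖ K l u * twCoframe τ θ ϖ u) C k := by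
  rw [twForm, twForm, twCoframe, Matrix.fromBlocks_mul_fromRows, Matrix.fromBlocks_mul_fromRows]
  rcases C with i | a
  · have h := hF.torsion u hu k l i
    have e : ∀ k l, (mpd (twCoframe τ θ ϖ) k u) (Sum.inl i) l = mpd θ k u i l := fun _ _ => rfl
    have e2 : ∀ k l, (mixForm τ θ K k u * vertCoframe τ ϖ u) i l = -(τ / 2) *
        ((sdCurv K 1 u * θ u) i k * vertCoframe τ ϖ u 0 l
          + (sdCurv K 2 u * θ u) i k * vertCoframe τ ϖ u 1 l) := by
      intro k l
      rw [Matrix.mul_apply, Fin.sum_univ_two]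
      simp only [mixForm, Matrix.of_apply, Fin.succ_zero_eq_one, Fin.succ_one_eq_two]
      ring
    simp only [Matrix.add_apply, Matrix.fromRows_apply_inl, e, e2, horForm, Matrix.add_mul,
      Matrix.smul_mul, Matrix.smul_apply, smul_eq_mul] at h ⊢
    linear_combination h
  · have h := hF.vertCoframe_torsion τ hu k l a
    have e : ∀ k l, (mpd (twCoframe τ θ ϖ) k u) (Sum.inr a) l
      = mpd (vertCoframe τ ϖ) k u a l := fun _ _ => rfl
    have e2 : ∀ k l, ((mixForm τ θ K k u)ᵀ * θ u) a l
        = (τ / 2) * ((θ u)ᵀ * sdCurv K a.succ u * θ u) k l := by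
      intro k l
      have e3 : (mixForm τ θ K k u)ᵀ a
          = fun i => (τ / 2) * ((θ u)ᵀ * sdCurv K a.succ u) k i := by
        ext i
        have := congrFun (congrFun (Matrix.transpose_mul (sdCurv K a.succ u) (θ u)) k) i
        rw [Matrix.transpose_apply, hskew u hu, Matrix.mul_neg, Matrix.neg_apply] at this
        simp only [Matrix.transpose_apply, mixForm, Matrix.of_apply, this]
        ring
      rw [Matrix.mul_apply, e3, Matrix.mul_apply, Finset.mul_sum]
      exact Finset.sum_congr rfl fun i _ => by ring
    have e4 := hF.sdCurv_skew_pull hu a.succ k l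
    simp only [Matrix.add_apply, Matrix.fromRows_apply_inr, e, Matrix.neg_mul, Matrix.neg_apply,
      e2] at h ⊢
    linear_combination h + τ / 2 * e4

/-- The exterior derivative of the vertical coframe is replaced using `vertCoframe_torsion`. Its
part with the vertical connection form joins the derivative of `F` to make `vertCov`; the product of
two corrections gives the commutator of `F₁` and `F₂`. -/
lemma curv_horForm (hu : u ∈ V) (k l : Fin m) :
    Twistor.curv (horForm τ ϖ K) k l u = Twistor.curv ϖ k l u
      + (-(τ / 2)) • ∑ a : Fin 2, ((τ * ((θ u)ᵀ * sdCurv K a.succ u * θ u) k l) • sdCurv K a.succ u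
        + vertCoframe τ ϖ u a l • vertCov ϖ K a k u - vertCoframe τ ϖ u a k • vertCov ϖ K a l u)
      + (τ / 2) ^ 2 • ((vertCoframe τ ϖ u 0 k * vertCoframe τ ϖ u 1 l
          - vertCoframe τ ϖ u 1 k * vertCoframe τ ϖ u 0 l) •
        (sdCurv K 1 u * sdCurv K 2 u - sdCurv K 2 u * sdCurv K 1 u)) := by
  have e : ∀ k l, mpd (horForm τ ϖ K l) k u = mpd (ϖ l) k u
      + (-(τ / 2)) • ((mpd (vertCoframe τ ϖ) k u 0 l • sdCurv K 1 u
          + vertCoframe τ ϖ u 0 l • mpd (sdCurv K 1) k u)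
        + (mpd (vertCoframe τ ϖ) k u 1 l • sdCurv K 2 u
          + vertCoframe τ ϖ u 1 l • mpd (sdCurv K 2) k u)) := by
    intro k l
    have s1 := MSmooth.smul (hF.smooth_vertCoframe τ 0 l) (hF.smooth_sdCurv 1)
    have s2 := MSmooth.smul (hF.smooth_vertCoframe τ 1 l) (hF.smooth_sdCurv 2)
    unfold horForm
    rw [mpd_add hF.isOpen hu (hF.smooth_form l) (MSmooth.smul contDiffOn_const (s1.add s2)),
      mpd_smul hF.isOpen hu contDiffOn_const (s1.add s2), mpd_add hF.isOpen hu s1 s2,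
      mpd_smul hF.isOpen hu (hF.smooth_vertCoframe τ 0 l) (hF.smooth_sdCurv 1),
      mpd_smul hF.isOpen hu (hF.smooth_vertCoframe τ 1 l) (hF.smooth_sdCurv 2), pd_const, zero_smul,
      zero_add]
    rfl
  have t0 := hF.vertCoframe_torsion τ hu k l 0
  have t1 := hF.vertCoframe_torsion τ hu k l 1
  simp only [Matrix.add_apply, Matrix.mul_apply (M := vertForm _ _ _), Fin.sum_univ_two] at t0 t1
  simp only [Fin.succ_zero_eq_one, Fin.succ_one_eq_two] at t0 t1
  rw [Twistor.curv, e, e, Fin.sum_univ_two]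
  simp only [Fin.succ_zero_eq_one, Fin.succ_one_eq_two, ← t0, ← t1, vertCov, horForm, Twistor.curv,
    Matrix.add_mul, Matrix.mul_add, smul_mul_assoc, mul_smul_comm, smul_add]
  have v : ∀ k, vertForm ϖ k u 0 0 = 0 ∧ vertForm ϖ k u 1 1 = 0
      ∧ vertForm ϖ k u 1 0 = - vertForm ϖ k u 0 1 := fun k => by simp [vertForm]
  simp only [(v _).1, (v _).2.1, (v _).2.2]
  module

/-- The derivative of `θ` is eliminated because the base frame has no torsion; the derivative of `F`
and the two connection forms acting on it combine to `vertCov`. -/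
lemma curv_mixForm (hu : u ∈ V)
    (k l : Fin m) (i : Fin 4) (a : Fin 2) :
    (mpd (mixForm τ θ K l) k u - mpd (mixForm τ θ K k) l u
          + (horForm τ ϖ K k u * mixForm τ θ K l u + mixForm τ θ K k u * vertForm ϖ l u
          - (horForm τ ϖ K l u * mixForm τ θ K k u + mixForm τ θ K l u * vertForm ϖ k u))) i a
      = -(τ / 2) * ((vertCov ϖ K a k u * θ u) i l - (vertCov ϖ K a l u * θ u) i k)
        + (τ / 2) ^ 2 * ∑ b, (vertCoframe τ ϖ u b k * (sdCurv K b.succ u * sdCurv K a.succ u * θ u) i l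
          - vertCoframe τ ϖ u b l * (sdCurv K b.succ u * sdCurv K a.succ u * θ u) i k) := by
  have e : ∀ k l, mpd (mixForm τ θ K l) k u i a = -(τ / 2) *
      ((mpd (sdCurv K a.succ) k u * θ u) i l + (sdCurv K a.succ u * mpd θ k u) i l) := by
    intro k l
    have s := (hF.smooth_sdCurv a.succ).mul hF.smooth_coframe
    have h1 := mpd_mul hF.isOpen hu (hF.smooth_sdCurv a.succ) hF.smooth_coframe k
    rw [← Matrix.add_apply, ← h1]
    exact pd_const_mul _ (s.differentiableAt hF.isOpen hu i l) k
  have e2 : ∀ (M : Matrix (Fin 4) (Fin 4) ℝ) l, (M * mixForm τ θ K l u) i a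
      = -(τ / 2) * (M * sdCurv K a.succ u * θ u) i l := by
    intro M l
    rw [Matrix.mul_assoc, Matrix.mul_apply, Matrix.mul_apply, Finset.mul_sum]
    exact Finset.sum_congr rfl fun p _ => by simp only [mixForm, Matrix.of_apply]; ring
  have e3 : ∀ k l, (mixForm τ θ K k u * vertForm ϖ l u) i a
      = -(τ / 2) * ((sdCurv K 1 u * θ u) i k * vertForm ϖ l u 0 a
        + (sdCurv K 2 u * θ u) i k * vertForm ϖ l u 1 a) := by
    intro k l
    rw [Matrix.mul_apply, Fin.sum_univ_two]
    simp only [mixForm, Matrix.of_apply, Fin.succ_zero_eq_one, Fin.succ_one_eq_two]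
    ring
  have t : (sdCurv K a.succ u * (mpd θ k u + ϖ k u * θ u)) i l
      = (sdCurv K a.succ u * (mpd θ l u + ϖ l u * θ u)) i k := by
    simp only [Matrix.mul_apply (M := sdCurv K a.succ u)]
    exact Finset.sum_congr rfl fun p _ => by rw [hF.torsion u hu k l p]
  have v : ∀ k (b c : Fin 2), vertForm ϖ k u b c = - vertForm ϖ k u c b := fun k b c => by
    fin_cases b <;> fin_cases c <;> simp [vertForm]
  simp only [Matrix.add_apply, Matrix.sub_apply, e, e2, e3, horForm, vertCov, Matrix.add_mul,
    Matrix.sub_mul, Matrix.mul_add, Matrix.smul_mul, Matrix.smul_apply, smul_eq_mul, Fin.sum_univ_two,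
    Fin.succ_zero_eq_one, Fin.succ_one_eq_two, Matrix.mul_assoc] at t ⊢
  rw [v l 0 a, v l 1 a, v k 0 a, v k 1 a]
  linear_combination (-(τ / 2)) * t

/-- Rotations of the plane commute, so only the exterior derivative of component 0 of `sdForm`
remains, and the structure equation supplies it. -/
lemma curv_vertForm (hu : u ∈ V) (k l : Fin m) :
    Twistor.curv (vertForm ϖ) k l u = (((θ u)ᵀ * sdCurv K 0 u * θ u) k l
      - 2 * (sdForm ϖ u 1 k * sdForm ϖ u 2 l - sdForm ϖ u 2 k * sdForm ϖ u 1 l)) •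
        !![0, -2; 2, 0] := by
  have e : ∀ k l, mpd (vertForm ϖ l) k u = mpd (sdForm ϖ) k u 0 l • !![0, -2; 2, 0] := by
    intro k l
    unfold vertForm
    rw [mpd_smul hF.isOpen hu (hF.smooth_sdForm 0 l) (MSmooth.const _), mpd_const, smul_zero,
      add_zero]
    rfl
  have h := hF.sdForm_structure hu k l 0
  simp only [zero_add] at h
  rw [Twistor.curv, e, e, ← h]
  simp only [vertForm, smul_mul_assoc, mul_smul_comm]
  module

end MovingFrame

end TwistorCurvature


/-! ### Curvature components and Ricci tensor of the twistor space in the adapted coframe -/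

section TwistorRicci

variable {m : ℕ}

/-- The area form of the plane. -/
def areaForm : Matrix (Fin 2) (Fin 2) ℝ := !![0, 1; -1, 0]

/-- The horizontal block of the curvature of the twistor space. -/
def twHH (τ : ℝ) (K : Fin 4 → Fin 4 → Matrix (Fin 4) (Fin 4) ℝ)
    (F : Fin 3 → Matrix (Fin 4) (Fin 4) ℝ) (D : Fin 3 → Fin 4 → Matrix (Fin 4) (Fin 4) ℝ) :
    Fin 4 ⊕ Fin 2 → Fin 4 ⊕ Fin 2 → Matrix (Fin 4) (Fin 4) ℝ
  | .inl i, .inl j => K i j + (-(τ / 2)) • ∑ a : Fin 2, (τ * F a.succ i j) • F a.succ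
      - (τ / 2) ^ 2 • ∑ a : Fin 2, Matrix.of fun p q =>
        F a.succ p i * F a.succ q j - F a.succ p j * F a.succ q i
  | .inl i, .inr b => (-(τ / 2)) • D b.succ i
  | .inr a, .inl j => (τ / 2) • D a.succ j
  | .inr a, .inr b => areaForm a b • ((-2 : ℝ) • F 0 + (τ / 2) ^ 2 • (F 1 * F 2 - F 2 * F 1))

/-- The mixed block of the curvature of the twistor space. -/
def twHV (τ : ℝ) (F : Fin 3 → Matrix (Fin 4) (Fin 4) ℝ)
    (D : Fin 3 → Fin 4 → Matrix (Fin 4) (Fin 4) ℝ) :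
    Fin 4 ⊕ Fin 2 → Fin 4 ⊕ Fin 2 → Matrix (Fin 4) (Fin 2) ℝ
  | .inl i, .inl j => Matrix.of fun p a => -(τ / 2) * (D a.succ i p j - D a.succ j p i)
  | .inl i, .inr b => Matrix.of fun p a =>
      -(areaForm a b * F 0 p i + (τ / 2) ^ 2 * (F b.succ * F a.succ) p i)
  | .inr b, .inl j => Matrix.of fun p a =>
      areaForm a b * F 0 p j + (τ / 2) ^ 2 * (F b.succ * F a.succ) p j
  | .inr _, .inr _ => 0

/-- The vertical block of the curvature of the twistor space. -/
def twVV (τ : ℝ) (F : Fin 3 → Matrix (Fin 4) (Fin 4) ℝ) :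
    Fin 4 ⊕ Fin 2 → Fin 4 ⊕ Fin 2 → Matrix (Fin 2) (Fin 2) ℝ
  | .inl i, .inl j => F 0 i j • !![0, -2; 2, 0] - (τ / 2) ^ 2 • Matrix.of fun c d : Fin 2 =>
      ∑ p, (F c.succ p i * F d.succ p j - F c.succ p j * F d.succ p i)
  | .inr a, .inr b => (-2 / τ ^ 2 * areaForm a b) • !![0, -2; 2, 0]
  | .inl _, .inr _ => 0
  | .inr _, .inl _ => 0

lemma twSum {N : Type*} [AddCommGroup N] [Module ℝ N] (t : Matrix (Fin 4) (Fin m) ℝ)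
    (s : Matrix (Fin 2) (Fin m) ℝ) (f : Fin 4 ⊕ Fin 2 → Fin 4 ⊕ Fin 2 → N) (k l : Fin m) :
    ∑ A, ∑ B, (Matrix.fromRows t s A k * Matrix.fromRows t s B l) • f A B =
      ∑ i, ∑ j, (t i k * t j l) • f (.inl i) (.inl j)
      + ∑ b, s b l • ∑ i, t i k • f (.inl i) (.inr b)
      + ∑ b, s b k • ∑ i, t i l • f (.inr b) (.inl i)
      + ∑ a, ∑ b, (s a k * s b l) • f (.inr a) (.inr b) := by
  simp only [Fintype.sum_sum_type, Matrix.fromRows_apply_inl, Matrix.fromRows_apply_inr,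
    Finset.sum_add_distrib, Finset.smul_sum, smul_smul]
  rw [Finset.sum_comm (f := fun b i => (s b l * t i k) • f (.inl i) (.inr b))]
  simp only [mul_comm (s _ l) (t _ k)]
  abel

lemma sum_lin_eq {α : Type*} (t : Matrix (Fin 4) (Fin m) ℝ) (F : Matrix α (Fin 4) ℝ) (p : α)
    (k : Fin m) : ∑ i, t i k * F p i = (F * t) p k := by
  rw [Matrix.mul_apply]
  exact Finset.sum_congr rfl fun i _ => mul_comm _ _

lemma sum_bilin_eq (t : Matrix (Fin 4) (Fin m) ℝ) (F : Matrix (Fin 4) (Fin 4) ℝ) (k l : Fin m) :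
    ∑ i, ∑ j, t i k * t j l * F i j = (tᵀ * F * t) k l := by
  simp only [Matrix.mul_apply, Matrix.transpose_apply, Finset.sum_mul]
  rw [Finset.sum_comm]
  exact Finset.sum_congr rfl fun i _ => Finset.sum_congr rfl fun j _ => by ring

lemma sum_prod_eq {α β : Type*} (t : Matrix (Fin 4) (Fin m) ℝ) (F : Matrix α (Fin 4) ℝ)
    (F' : Matrix β (Fin 4) ℝ) (p : α) (q : β) (k l : Fin m) :
    ∑ i, ∑ j, t i k * t j l * (F p i * F' q j) = (F * t) p k * (F' * t) q l := by
  simp only [Matrix.mul_apply, Finset.sum_mul_sum]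
  exact Finset.sum_congr rfl fun i _ => Finset.sum_congr rfl fun j _ => by ring

lemma sum_prod_eq' {α β : Type*} (t : Matrix (Fin 4) (Fin m) ℝ) (F : Matrix α (Fin 4) ℝ)
    (F' : Matrix β (Fin 4) ℝ) (p : α) (q : β) (k l : Fin m) :
    ∑ i, ∑ j, t i k * t j l * (F p j * F' q i) = (F * t) p l * (F' * t) q k := by
  simp only [Matrix.mul_apply, Finset.sum_mul_sum]
  rw [Finset.sum_comm]
  exact Finset.sum_congr rfl fun i _ => Finset.sum_congr rfl fun j _ => by ring

variable {V : Set (R m)} {u : R m} {θ : R m → Matrix (Fin 4) (Fin m) ℝ}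
  {ϖ : Fin m → R m → Matrix (Fin 4) (Fin 4) ℝ} {K : Fin 4 → Fin 4 → R m → Matrix (Fin 4) (Fin 4) ℝ}

/-- `vertCov` rotates the index of `F` only between 1 and 2, whereas `covCurv` also rotates it into
0. The difference is a multiple of `F₀` by a self-dual connection component, which is `1/τ` times an
entry of the vertical coframe. -/
lemma vertCov_zero (τ : ℝ) (hτ : τ ≠ 0) (k : Fin m) :
    vertCov ϖ K 0 k u = covCurv ϖ K 1 k u - (2 / τ * vertCoframe τ ϖ u 1 k) • sdCurv K 0 u := by
  have e : 2 / τ * (τ * sdForm ϖ u 2 k) = 2 * sdForm ϖ u 2 k := by field_simp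
  simp [vertCov, covCurv, vertForm, vertCoframe, e]
  module

lemma vertCov_one (τ : ℝ) (hτ : τ ≠ 0) (k : Fin m) :
    vertCov ϖ K 1 k u = covCurv ϖ K 2 k u + (2 / τ * vertCoframe τ ϖ u 0 k) • sdCurv K 0 u := by
  have e : 2 / τ * (τ * sdForm ϖ u 1 k) = 2 * sdForm ϖ u 1 k := by field_simp
  simp [vertCov, covCurv, vertForm, vertCoframe, e]
  module

namespace MovingFrame

variable (hF : MovingFrame V θ ϖ K) (τ : ℝ)
include hF

lemma covCurv_skew (hskew : ∀ w ∈ V, ∀ b, (sdCurv K b w)ᵀ = - sdCurv K b w) (hu : u ∈ V)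
    (b : Fin 3) (k : Fin m) : (covCurv ϖ K b k u)ᵀ = - covCurv ϖ K b k u := by
  have e : (mpd (sdCurv K b) k u)ᵀ = - mpd (sdCurv K b) k u := by
    rw [← mpd_transpose, ← mpd_neg]
    exact mpd_congr hF.isOpen (fun w hw => hskew w hw b) hu k
  simp only [covCurv, Matrix.transpose_add, Matrix.transpose_sub, Matrix.transpose_mul,
    Matrix.transpose_smul, e, hskew u hu, hF.skew u hu, Matrix.neg_mul, Matrix.mul_neg, neg_neg]
  module

/-- By `covCurv_eq` the covariant derivative of `F` is horizontal, so the block curvatures depend on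
the coordinate directions only through the entries of `twCoframe`. Comparing coefficients of
products of these entries gives `twHH`, `twHV` and `twVV`. -/
lemma twForm_curv (hτ : τ ≠ 0) (hskew : ∀ w ∈ V, ∀ b, (sdCurv K b w)ᵀ = - sdCurv K b w)
    (hu : u ∈ V) {X : Matrix (Fin m) (Fin 4) ℝ} (hX : θ u * X = 1) (k l : Fin m) :
    Twistor.curv (twForm τ θ ϖ K) k l u
      = ∑ A, ∑ B, (twCoframe τ θ ϖ u A k * twCoframe τ θ ϖ u B l) •
        Matrix.fromBlocks
          (twHH τ (fun i j => K i j u) (fun b => sdCurv K b u) (fun b p => covDir ϖ K X b p u) A B)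
          (twHV τ (fun b => sdCurv K b u) (fun b p => covDir ϖ K X b p u) A B)
          (-(twHV τ (fun b => sdCurv K b u) (fun b p => covDir ϖ K X b p u) A B)ᵀ)
          (twVV τ (fun b => sdCurv K b u) A B) := by
  have hcov : ∀ b k p q, covCurv ϖ K b k u p q = ∑ i, θ u i k * covDir ϖ K X b i u p q := by
    intro b k p q
    rw [hF.covCurv_eq (hskew u hu) hu hX b k, Matrix.sum_apply]; rfl
  have hcov2 : ∀ b k l p, (covCurv ϖ K b k u * θ u) p l
      = ∑ i, ∑ j, θ u i k * θ u j l * covDir ϖ K X b i u p j := by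
    intro b k l p
    rw [Matrix.mul_apply]
    simp only [hcov, Finset.sum_mul]
    rw [Finset.sum_comm]
    exact Finset.sum_congr rfl fun i _ => Finset.sum_congr rfl fun j _ => by ring
  have hcov2' : ∀ b k l p, (covCurv ϖ K b l u * θ u) p k
      = ∑ i, ∑ j, θ u i k * θ u j l * covDir ϖ K X b j u p i := by
    intro b k l p
    rw [hcov2, Finset.sum_comm]
    exact Finset.sum_congr rfl fun i _ => Finset.sum_congr rfl fun j _ => by ring
  have hHH : Twistor.curv (horForm τ ϖ K) k l u + (mixForm τ θ K k u * (-(mixForm τ θ K l u)ᵀ)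
      - mixForm τ θ K l u * (-(mixForm τ θ K k u)ᵀ))
      = ∑ A, ∑ B, (twCoframe τ θ ϖ u A k * twCoframe τ θ ϖ u B l) •
        twHH τ (fun i j => K i j u) (fun b => sdCurv K b u) (fun b p => covDir ϖ K X b p u) A B := by
    have hN : ∀ k l, mixForm τ θ K k u * (-(mixForm τ θ K l u)ᵀ) = -((τ / 2) ^ 2) •
        ∑ a : Fin 2, Matrix.of fun p q => (sdCurv K a.succ u * θ u) p k
          * (sdCurv K a.succ u * θ u) q l := by
      intro k l
      ext p q
      rw [Matrix.mul_neg, Matrix.neg_apply, Matrix.mul_apply]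
      simp only [Matrix.transpose_apply, Fin.sum_univ_two, Matrix.smul_apply, Matrix.add_apply,
        Matrix.of_apply, mixForm, smul_eq_mul]
      ring
    have hc : ∀ b k, covCurv ϖ K b k u = ∑ p, θ u p k • covDir ϖ K X b p u := fun b k =>
      hF.covCurv_eq (hskew u hu) hu hX b k
    rw [hF.curv_horForm τ hu, hF.curv u hu, twCoframe, twSum, hN, hN]
    have h1 : ∀ F : Matrix (Fin 4) (Fin 4) ℝ, ∑ i, ∑ j, (θ u i k * θ u j l) • ((τ * F i j) • F)
        = (τ * ((θ u)ᵀ * F * θ u) k l) • F := by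
      intro F
      simp only [smul_smul, ← Finset.sum_smul]
      rw [← sum_bilin_eq, Finset.mul_sum]
      congr 1
      refine Finset.sum_congr rfl fun i _ => ?_
      rw [Finset.mul_sum]
      exact Finset.sum_congr rfl fun j _ => by ring
    have h2 : ∀ F : Matrix (Fin 4) (Fin 4) ℝ, ∑ i, ∑ j, (θ u i k * θ u j l) •
        (Matrix.of fun p q => F p i * F q j - F p j * F q i : Matrix (Fin 4) (Fin 4) ℝ)
        = (Matrix.of fun p q => (F * θ u) p k * (F * θ u) q l)
          - Matrix.of fun p q => (F * θ u) p l * (F * θ u) q k := by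
      intro F
      ext p q
      simp only [Matrix.sum_apply, Matrix.smul_apply, Matrix.of_apply, smul_eq_mul, mul_sub,
        Finset.sum_sub_distrib, Matrix.sub_apply, sum_prod_eq, sum_prod_eq']
    have h3 : ∀ (c : ℝ) b k, ∑ i, θ u i k • (c • covDir ϖ K X b i u) = c • covCurv ϖ K b k u := by
      intro c b k
      rw [hc, Finset.smul_sum]
      exact Finset.sum_congr rfl fun i _ => smul_comm _ _ _
    simp only [twHH, Fin.sum_univ_two, smul_add, smul_sub, Finset.sum_add_distrib,
      Finset.sum_sub_distrib, h3, Fin.succ_zero_eq_one, Fin.succ_one_eq_two, vertCov_zero τ hτ,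
      vertCov_one τ hτ]
    have h4 : ∀ (c : ℝ) (M : Fin 4 → Fin 4 → Matrix (Fin 4) (Fin 4) ℝ),
        ∑ i, ∑ j, (θ u i k * θ u j l) • (c • M i j)
          = c • ∑ i, ∑ j, (θ u i k * θ u j l) • M i j := by
      intro c M
      simp only [Finset.smul_sum, smul_comm c]
    simp only [h4, h1, h2]
    have h5 : τ / 2 * (2 / τ) = 1 := by field_simp
    simp only [areaForm, Matrix.of_apply, Matrix.cons_val', Matrix.cons_val_zero,
      Matrix.cons_val_one, Matrix.cons_val_fin_one]
    simp only [show ∀ x, 2 / τ * x = 2 * (x / τ) from fun x => by ring]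
    match_scalars <;> field_simp <;> ring
  have hHV : mpd (mixForm τ θ K l) k u - mpd (mixForm τ θ K k) l u
          + (horForm τ ϖ K k u * mixForm τ θ K l u + mixForm τ θ K k u * vertForm ϖ l u
          - (horForm τ ϖ K l u * mixForm τ θ K k u + mixForm τ θ K l u * vertForm ϖ k u))
      = ∑ A, ∑ B, (twCoframe τ θ ϖ u A k * twCoframe τ θ ϖ u B l) •
        twHV τ (fun b => sdCurv K b u) (fun b p => covDir ϖ K X b p u) A B := by
    ext p a
    rw [hF.curv_mixForm τ hu]
    rw [twCoframe, twSum]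
    have h1 : ∑ i, ∑ j, θ u i k * θ u j l *
        (-(τ / 2) * (covDir ϖ K X a.succ i u p j - covDir ϖ K X a.succ j u p i))
        = -(τ / 2) * ((covCurv ϖ K a.succ k u * θ u) p l - (covCurv ϖ K a.succ l u * θ u) p k) := by
      rw [hcov2, hcov2', ← Finset.sum_sub_distrib, Finset.mul_sum]
      refine Finset.sum_congr rfl fun i _ => ?_
      rw [← Finset.sum_sub_distrib, Finset.mul_sum]
      exact Finset.sum_congr rfl fun j _ => by ring
    have h2 : ∀ (b : Fin 2) k, ∑ i, θ u i k * (areaForm a b * sdCurv K 0 u p i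
        + (τ / 2) ^ 2 * (sdCurv K b.succ u * sdCurv K a.succ u) p i)
        = areaForm a b * (sdCurv K 0 u * θ u) p k
          + (τ / 2) ^ 2 * (sdCurv K b.succ u * sdCurv K a.succ u * θ u) p k := by
      intro b k
      rw [← sum_lin_eq, ← sum_lin_eq, Finset.mul_sum, Finset.mul_sum, ← Finset.sum_add_distrib]
      exact Finset.sum_congr rfl fun i _ => by ring
    simp only [Matrix.add_apply, Matrix.sum_apply, Matrix.smul_apply, smul_eq_mul, twHV,
      Matrix.of_apply, h1, mul_neg, Finset.sum_neg_distrib, h2, Matrix.zero_apply, mul_zero,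
      Finset.sum_const_zero, add_zero]
    fin_cases a
    · simp [Fin.sum_univ_two, vertCov_zero τ hτ, areaForm, Matrix.sub_mul]
      field_simp
      ring
    · simp [Fin.sum_univ_two, vertCov_one τ hτ, areaForm, Matrix.add_mul]
      field_simp
      ring
  have hVV : Twistor.curv (vertForm ϖ) k l u + (-(mixForm τ θ K k u)ᵀ * mixForm τ θ K l u
      - -(mixForm τ θ K l u)ᵀ * mixForm τ θ K k u)
      = ∑ A, ∑ B, (twCoframe τ θ ϖ u A k * twCoframe τ θ ϖ u B l) •
        twVV τ (fun b => sdCurv K b u) A B := by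
    rw [hF.curv_vertForm hu, twCoframe, twSum]
    have hN : ∀ k l, (mixForm τ θ K k u)ᵀ * mixForm τ θ K l u = (τ / 2) ^ 2 •
        Matrix.of fun c d : Fin 2 => ∑ p, (sdCurv K c.succ u * θ u) p k
          * (sdCurv K d.succ u * θ u) p l := by
      intro k l
      ext c d
      rw [Matrix.mul_apply]
      simp only [Matrix.smul_apply, Matrix.of_apply,
        smul_eq_mul, Finset.mul_sum, Matrix.transpose_apply, mixForm]
      exact Finset.sum_congr rfl fun p _ => by ring
    have h1 : ∀ M : Matrix (Fin 2) (Fin 2) ℝ, ∑ i, ∑ j, (θ u i k * θ u j l) •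
        (sdCurv K 0 u i j • M) = ((θ u)ᵀ * sdCurv K 0 u * θ u) k l • M := by
      intro M
      simp only [smul_smul, ← Finset.sum_smul, sum_bilin_eq]
    have h2 : ∑ i, ∑ j, (θ u i k * θ u j l) • ((τ / 2) ^ 2 • (Matrix.of fun c d : Fin 2 =>
        ∑ p, (sdCurv K c.succ u p i * sdCurv K d.succ u p j
          - sdCurv K c.succ u p j * sdCurv K d.succ u p i)))
        = (mixForm τ θ K k u)ᵀ * mixForm τ θ K l u - (mixForm τ θ K l u)ᵀ * mixForm τ θ K k u := by
      rw [hN, hN, ← smul_sub]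
      ext c d
      simp only [Matrix.sum_apply, Matrix.smul_apply, Matrix.of_apply, smul_eq_mul,
        Matrix.sub_apply, ← Finset.sum_sub_distrib, ← sum_prod_eq _ _ _ _ _ k l,
        ← sum_prod_eq' _ _ _ _ _ k l, Finset.mul_sum]
      rw [Finset.sum_congr rfl fun i _ => Finset.sum_comm, Finset.sum_comm]
      exact Finset.sum_congr rfl fun p _ => Finset.sum_congr rfl fun i _ =>
        Finset.sum_congr rfl fun j _ => by ring
    have h3 : ∑ i, ∑ j, (θ u i k * θ u j l) • twVV τ (fun b => sdCurv K b u) (.inl i) (.inl j)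
        = ((θ u)ᵀ * sdCurv K 0 u * θ u) k l • !![0, -2; 2, 0]
          - ((mixForm τ θ K k u)ᵀ * mixForm τ θ K l u
            - (mixForm τ θ K l u)ᵀ * mixForm τ θ K k u) := by
      rw [← h2, ← h1, ← Finset.sum_sub_distrib]
      refine Finset.sum_congr rfl fun i _ => ?_
      rw [← Finset.sum_sub_distrib]
      exact Finset.sum_congr rfl fun j _ => smul_sub _ _ _
    rw [h3]
    simp only [twVV, Matrix.neg_mul, smul_zero, Finset.sum_const_zero, add_zero]
    simp only [Fin.sum_univ_two, areaForm, Matrix.of_apply, Matrix.cons_val', Matrix.cons_val_zero,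
      Matrix.cons_val_one, Matrix.cons_val_fin_one, vertCoframe, Fin.succ_zero_eq_one,
      Fin.succ_one_eq_two]
    match_scalars <;> field_simp
    ring
  have hsum : ∀ (c : Fin 4 ⊕ Fin 2 → Fin 4 ⊕ Fin 2 → ℝ)
      (M₁ : Fin 4 ⊕ Fin 2 → Fin 4 ⊕ Fin 2 → Matrix (Fin 4) (Fin 4) ℝ)
      (M₂ : Fin 4 ⊕ Fin 2 → Fin 4 ⊕ Fin 2 → Matrix (Fin 4) (Fin 2) ℝ)
      (M₃ : Fin 4 ⊕ Fin 2 → Fin 4 ⊕ Fin 2 → Matrix (Fin 2) (Fin 4) ℝ)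
      (M₄ : Fin 4 ⊕ Fin 2 → Fin 4 ⊕ Fin 2 → Matrix (Fin 2) (Fin 2) ℝ),
      ∑ A, ∑ B, c A B • Matrix.fromBlocks (M₁ A B) (M₂ A B) (M₃ A B) (M₄ A B)
        = Matrix.fromBlocks (∑ A, ∑ B, c A B • M₁ A B) (∑ A, ∑ B, c A B • M₂ A B)
          (∑ A, ∑ B, c A B • M₃ A B) (∑ A, ∑ B, c A B • M₄ A B) := by
    intro c M₁ M₂ M₃ M₄
    ext (i | i) (j | j) <;> simp [Matrix.sum_apply]
  have hVH : mpd (fun w => -(mixForm τ θ K l w)ᵀ) k u - mpd (fun w => -(mixForm τ θ K k w)ᵀ) l u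
      + (-(mixForm τ θ K k u)ᵀ * horForm τ ϖ K l u + vertForm ϖ k u * -(mixForm τ θ K l u)ᵀ
        - (-(mixForm τ θ K l u)ᵀ * horForm τ ϖ K k u + vertForm ϖ l u * -(mixForm τ θ K k u)ᵀ))
      = -(mpd (mixForm τ θ K l) k u - mpd (mixForm τ θ K k) l u
          + (horForm τ ϖ K k u * mixForm τ θ K l u + mixForm τ θ K k u * vertForm ϖ l u
          - (horForm τ ϖ K l u * mixForm τ θ K k u + mixForm τ θ K l u * vertForm ϖ k u)))ᵀ := by
    have hv : ∀ k, (vertForm ϖ k u)ᵀ = - vertForm ϖ k u := fun k => by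
      ext a b; fin_cases a <;> fin_cases b <;> simp [vertForm]
    have hh : ∀ k, (horForm τ ϖ K k u)ᵀ = - horForm τ ϖ K k u := fun k => by
      simp only [horForm, Matrix.transpose_add, Matrix.transpose_smul, hF.skew u hu, hskew u hu]
      module
    simp only [mpd_neg, mpd_transpose, Matrix.transpose_add, Matrix.transpose_sub,
      Matrix.transpose_mul, hv, hh, Matrix.neg_mul, Matrix.mul_neg]
    abel
  unfold twForm
  rw [curv_fromBlocks, hsum, hVH, hHH, hHV, hVV]
  congr 1
  simp only [Matrix.transpose_sum, Matrix.transpose_smul, smul_neg, Finset.sum_neg_distrib]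

/-- The Ricci tensor of the twistor space. -/
theorem twistor_ricci (hτ : τ ≠ 0) (hK : ∀ w ∈ V, ∀ i j, K i j w = - K j i w) (hu : u ∈ V)
    {X : R m → Matrix (Fin m) (Fin 4 ⊕ Fin 2) ℝ} (hXΘ : ∀ w ∈ V, X w * twCoframe τ θ ϖ w = 1)
    (hΘX : ∀ w ∈ V, twCoframe τ θ ϖ w * X w = 1) {h : R m → Matrix (Fin m) (Fin m) ℝ}
    (hh : ∀ w ∈ V, h w = (twCoframe τ θ ϖ w)ᵀ * twCoframe τ θ ϖ w) :
    ∃ Y : Matrix (Fin m) (Fin 4) ℝ, θ u * Y = 1 ∧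
    ricci h u = (twCoframe τ θ ϖ u)ᵀ * Matrix.fromBlocks
      ((Matrix.of fun j l => ∑ i, K i j u i l)
        + (τ ^ 2 / 2) • (sdCurv K 1 u * sdCurv K 1 u + sdCurv K 2 u * sdCurv K 2 u))
      (Matrix.of fun j a => -(τ / 2) * ∑ i, covDir ϖ K Y a.succ i u i j)
      (Matrix.of fun a j => -(τ / 2) * ∑ i, covDir ϖ K Y a.succ i u i j)
      (Matrix.of fun b a => (4 / τ ^ 2) * (1 : Matrix (Fin 2) (Fin 2) ℝ) b a
        - (τ / 2) ^ 2 * (sdCurv K b.succ u * sdCurv K a.succ u).trace)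
      * twCoframe τ θ ϖ u := by
  have hskew : ∀ w ∈ V, ∀ b, (sdCurv K b w)ᵀ = - sdCurv K b w := by
    intro w hw b
    ext i j
    simp only [Matrix.transpose_apply, Matrix.neg_apply, sdCurv, Matrix.of_apply]
    rw [hK w hw j i, show -K i j w = (-1 : ℝ) • K i j w by simp, sdPart_smul]
    simp
  -- These are the columns of `X` dual to the horizontal coframe; derivatives along them are the
  -- horizontal covariant derivatives in the mixed block.
  set Y : Matrix (Fin m) (Fin 4) ℝ := (X u).submatrix id Sum.inl with hY
  have hθY : θ u * Y = 1 := by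
    ext i j
    have := congrFun (congrFun (hΘX u hu) (.inl i)) (.inl j)
    rw [Matrix.mul_apply] at this ⊢
    rw [Matrix.one_apply] at this ⊢
    change ∑ p, θ u i p * X u p (Sum.inl j) = _
    simpa [twCoframe] using this
  refine ⟨Y, hθY, ?_⟩
  have hc := ricci_of_curv (u := u) (h := h) (hXΘ u hu) (hΘX u hu) _ fun k l => by
    rw [curv_of_coframe hF.isOpen (hF.smooth_twCoframe τ) (hF.smooth_twForm τ) hXΘ hΘX
      (fun w hw k => hF.twForm_skew τ hskew hw k)
      (fun w hw k l i => hF.twForm_torsion τ hskew hw k l i) hh hu k l,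
      hF.twForm_curv τ hτ hskew hu hθY]
  rw [hc]
  congr 2
  -- Skewness removes the diagonal terms from the trace, so that only a divergence of `F` remains in
  -- the mixed block.
  have hD : ∀ b p q, covDir ϖ K Y b p u q q = 0 := by
    intro b p q
    refine skew_diag ?_ q
    simp only [covDir, Matrix.transpose_sum, Matrix.transpose_smul,
      hF.covCurv_skew hskew hu, smul_neg, Finset.sum_neg_distrib]
  have hf : ∀ b i, sdCurv K b u i i = 0 := fun b i => skew_diag (hskew u hu b) i
  ext (j | b) (l | a)
  · simp only [Matrix.of_apply, Fintype.sum_sum_type, Matrix.fromBlocks_apply₁₁,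
      Matrix.fromBlocks_apply₂₁, twHH, twHV, Matrix.neg_apply, Matrix.transpose_apply,
      Matrix.add_apply, Matrix.smul_apply, Matrix.sub_apply, Fin.sum_univ_two,
      smul_eq_mul, Finset.sum_add_distrib, Finset.sum_sub_distrib]
    have e1 : ∀ b, ∑ i, sdCurv K b u i j * sdCurv K b u i l
        = -(sdCurv K b u * sdCurv K b u) j l := by
      intro b
      rw [Matrix.mul_apply, ← Finset.sum_neg_distrib]
      exact Finset.sum_congr rfl fun i _ => by rw [skew_apply (hskew u hu b) i j]; ring
    have e2 : ∀ b, ∑ i, sdCurv K b u l i * sdCurv K b u i j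
        = (sdCurv K b u * sdCurv K b u) j l := by
      intro b
      rw [Matrix.mul_apply]
      exact Finset.sum_congr rfl fun i _ => by
        rw [skew_apply (hskew u hu b) l i, skew_apply (hskew u hu b) i j]; ring
    have e3 : ∀ b, (sdCurv K b u * sdCurv K b u) l j = (sdCurv K b u * sdCurv K b u) j l := by
      intro b
      rw [← e2, Matrix.mul_apply]
    simp only [hf, zero_mul, areaForm, e3]
    simp only [← Finset.mul_sum, Finset.sum_add_distrib, Finset.sum_sub_distrib, mul_assoc, e1]
    simp only [mul_comm (sdCurv K _ u _ j) (sdCurv K _ u l _), e2, Matrix.of_apply,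
      Matrix.cons_val', Matrix.cons_val_zero, Matrix.cons_val_one, Matrix.cons_val_fin_one,
      Fin.succ_zero_eq_one, Fin.succ_one_eq_two, Finset.sum_const_zero]
    ring
  · simp only [Matrix.of_apply, Fintype.sum_sum_type, Matrix.fromBlocks_apply₁₂,
      Matrix.fromBlocks_apply₂₂, twHV, twVV, Matrix.zero_apply, Finset.sum_const_zero, add_zero,
      hD, sub_zero, Finset.mul_sum]
  · simp only [Matrix.of_apply, Fintype.sum_sum_type, Matrix.fromBlocks_apply₁₁,
      Matrix.fromBlocks_apply₂₁, twHH, twHV, Matrix.smul_apply, smul_eq_mul, Matrix.neg_apply,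
      Matrix.transpose_apply, Matrix.zero_apply, neg_zero, Finset.sum_const_zero, add_zero,
      Finset.mul_sum]
  · simp only [Matrix.of_apply, Fintype.sum_sum_type, Matrix.fromBlocks_apply₁₂,
      Matrix.fromBlocks_apply₂₂, twHV, twVV, hf, mul_zero, zero_add, Finset.sum_neg_distrib,
      ← Finset.mul_sum, Fin.sum_univ_two, Matrix.trace, Matrix.diag_apply, Matrix.smul_apply]
    fin_cases b <;> fin_cases a <;> simp [areaForm] <;> ring

end MovingFrame

end TwistorRicci


/-! ### Algebraic curvature tensors in dimension four -/

section AlgebraicCurvature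

/-- The symmetries of the Riemann tensor in an orthonormal frame. -/
structure IsCurv (K : Fin 4 → Fin 4 → Matrix (Fin 4) (Fin 4) ℝ) : Prop where
  swap : ∀ i j, K i j = - K j i
  skew : ∀ i j, (K i j)ᵀ = - K i j
  bianchi : ∀ i j k p, K i j p k + K j k p i + K k i p j = 0

/-- The `b`-th self-dual component of a curvature tensor, a two-form. -/
def sdTwo (K : Fin 4 → Fin 4 → Matrix (Fin 4) (Fin 4) ℝ) (b : Fin 3) : Matrix (Fin 4) (Fin 4) ℝ :=
  Matrix.of fun i j => sdPart (K i j) b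

/-- The `c`-th anti-self-dual component of a curvature tensor, a two-form. -/
def asdTwo (K : Fin 4 → Fin 4 → Matrix (Fin 4) (Fin 4) ℝ) (c : Fin 3) : Matrix (Fin 4) (Fin 4) ℝ :=
  Matrix.of fun i j => asdPart (K i j) c

/-- The block of the curvature operator that maps self-dual to self-dual two-vectors. -/
def blockA (K : Fin 4 → Fin 4 → Matrix (Fin 4) (Fin 4) ℝ) : Matrix (Fin 3) (Fin 3) ℝ :=
  Matrix.of fun a b => sdPart (sdTwo K b) a

/-- The block of the curvature operator that maps self-dual to anti-self-dual two-vectors. -/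
def blockB (K : Fin 4 → Fin 4 → Matrix (Fin 4) (Fin 4) ℝ) : Matrix (Fin 3) (Fin 3) ℝ :=
  Matrix.of fun c b => asdPart (sdTwo K b) c

/-- The Ricci tensor in an orthonormal frame. -/
def ricTensor (K : Fin 4 → Fin 4 → Matrix (Fin 4) (Fin 4) ℝ) : Matrix (Fin 4) (Fin 4) ℝ :=
  Matrix.of fun j l => ∑ i, K i j i l

lemma asdPart_neg (M : Matrix (Fin 4) (Fin 4) ℝ) : asdPart (-M) = - asdPart M := by
  ext b
  fin_cases b <;> simp [asdPart] <;> ring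

lemma sdPart_neg (M : Matrix (Fin 4) (Fin 4) ℝ) : sdPart (-M) = - sdPart M := by
  ext b
  fin_cases b <;> simp [sdPart] <;> ring

variable {K : Fin 4 → Fin 4 → Matrix (Fin 4) (Fin 4) ℝ}

namespace IsCurv

variable (hK : IsCurv K)
include hK

lemma sdTwo_skew (b : Fin 3) : (sdTwo K b)ᵀ = - sdTwo K b := by
  ext i j
  simp only [sdTwo, Matrix.transpose_apply, Matrix.of_apply, Matrix.neg_apply]
  rw [hK.swap j i, sdPart_neg]; rfl

lemma asdTwo_skew (b : Fin 3) : (asdTwo K b)ᵀ = - asdTwo K b := by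
  ext i j
  simp only [asdTwo, Matrix.transpose_apply, Matrix.of_apply, Matrix.neg_apply]
  rw [hK.swap j i, asdPart_neg]; rfl

lemma sdTwo_eq (b : Fin 3) : sdTwo K b = so (fun a => blockA K a b) (fun c => blockB K c b) :=
  eq_so (hK.sdTwo_skew b)

lemma entry (i j p q : Fin 4) : K i j p q
    = so (fun b => so (fun a => blockA K a b) (fun c => blockB K c b) i j)
      (fun c => so (sdPart (asdTwo K c)) (asdPart (asdTwo K c)) i j) p q := by
  simp only [← hK.sdTwo_eq, ← eq_so (hK.asdTwo_skew _)]
  exact congrFun (congrFun (eq_so (hK.skew i j)) p) q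

/-- The first Bianchi identity gives the pair symmetry of the curvature operator: the diagonal
blocks are symmetric and the off-diagonal ones transposes of each other. The remaining totally skew
component of the identity equates the two traces. -/
lemma relations : (∀ a b, blockA K a b = blockA K b a) ∧
    (∀ b c, sdPart (asdTwo K c) b = blockB K c b) ∧
    (∀ a b, asdPart (asdTwo K a) b = asdPart (asdTwo K b) a) ∧
    ∑ c, asdPart (asdTwo K c) c = ∑ a, blockA K a a := by
  have hb : ∀ p, ((K 0 1 p 2 + K 1 2 p 0 + K 2 0 p 1 = 0) ∧ (K 0 1 p 3 + K 1 3 p 0 + K 3 0 p 1 = 0)) ∧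
      (K 0 2 p 3 + K 2 3 p 0 + K 3 0 p 2 = 0) ∧ K 1 2 p 3 + K 2 3 p 1 + K 3 1 p 2 = 0 := fun p =>
    ⟨⟨hK.bianchi 0 1 2 p, hK.bianchi 0 1 3 p⟩, hK.bianchi 0 2 3 p, hK.bianchi 1 2 3 p⟩
  have h0 := hb 0
  have h1 := hb 1
  have h2 := hb 2
  have h3 := hb 3
  simp only [hK.entry] at h0 h1 h2 h3
  generalize blockA K = A at *
  generalize blockB K = B at *
  generalize hB' : (fun c => sdPart (asdTwo K c)) = B' at *
  generalize hC : (fun c => asdPart (asdTwo K c)) = C at *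
  have hB'' : ∀ c, sdPart (asdTwo K c) = B' c := fun c => congrFun hB' c
  have hC' : ∀ c, asdPart (asdTwo K c) = C c := fun c => congrFun hC c
  simp only [hB'', hC'] at *
  simp [so] at h0 h1 h2 h3
  obtain ⟨⟨a1, a2⟩, a3, a4⟩ := h0
  obtain ⟨⟨b1, b2⟩, b3, b4⟩ := h1
  obtain ⟨⟨c1, c2⟩, c3, c4⟩ := h2
  obtain ⟨⟨d1, d2⟩, d3, d4⟩ := h3
  refine ⟨fun a b => ?_, fun b c => ?_, fun a b => ?_, ?_⟩
  · fin_cases a <;> fin_cases b <;> simp <;> linarith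
  · fin_cases b <;> fin_cases c <;> simp <;> linarith
  · fin_cases a <;> fin_cases b <;> simp <;> linarith
  · simp only [Fin.sum_univ_three]; linarith

end IsCurv

end AlgebraicCurvature


/-! ### Ricci and Weyl tensors in terms of the curvature blocks -/

section AlgebraicCurvature

/-- The traceless symmetric matrix `∑ B c b I_b J_c` with components `B`. -/
def mix (B : Matrix (Fin 3) (Fin 3) ℝ) : Matrix (Fin 4) (Fin 4) ℝ :=
  !![-B 0 0 - B 1 1 - B 2 2, B 2 1 - B 1 2, -B 2 0 + B 0 2, B 1 0 - B 0 1;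
    B 2 1 - B 1 2, -B 0 0 + B 1 1 + B 2 2, -B 1 0 - B 0 1, -B 2 0 - B 0 2;
    -B 2 0 + B 0 2, -B 1 0 - B 0 1, B 0 0 - B 1 1 + B 2 2, -B 2 1 - B 1 2;
    B 1 0 - B 0 1, -B 2 0 - B 0 2, -B 2 1 - B 1 2, B 0 0 + B 1 1 - B 2 2]

lemma mix_trace (B : Matrix (Fin 3) (Fin 3) ℝ) : (mix B).trace = 0 := by
  simp [mix, Matrix.trace, Fin.sum_univ_four]; ring

lemma mix_zero : mix 0 = 0 := by
  ext i j
  fin_cases i <;> fin_cases j <;> simp [mix]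

lemma mix_add (B B' : Matrix (Fin 3) (Fin 3) ℝ) : mix (B + B') = mix B + mix B' := by
  ext i j
  fin_cases i <;> fin_cases j <;> simp [mix] <;> ring

lemma mix_smul (c : ℝ) (B : Matrix (Fin 3) (Fin 3) ℝ) : mix (c • B) = c • mix B := by
  ext i j
  fin_cases i <;> fin_cases j <;> simp [mix] <;> ring

/-- The nine products of a left and a right quaternion unit are independent and traceless, so `mix`
is injective and its range meets the scalar matrices only in zero. -/
lemma eq_zero_of_mix {B : Matrix (Fin 3) (Fin 3) ℝ} {x : ℝ} (h : mix B = x • 1) : B = 0 := by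
  have e : ∀ i j, mix B i j = (x • (1 : Matrix (Fin 4) (Fin 4) ℝ)) i j := fun i j => by rw [h]
  have h0 := e 0 0
  have h1 := e 1 1
  have h2 := e 2 2
  have h3 := e 3 3
  have h01 := e 0 1
  have h02 := e 0 2
  have h03 := e 0 3
  have h12 := e 1 2
  have h13 := e 1 3
  have h23 := e 2 3
  simp [mix] at h0 h1 h2 h3 h01 h02 h03 h12 h13 h23
  ext i j
  fin_cases i <;> fin_cases j <;> simp <;> linarith

/-- The left part `P` and the right part `Q` commute, so the square is `P² + Q² + 2PQ`; the first
two terms are scalar and the last is traceless symmetric. -/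
lemma so_mul_self (p q : Fin 3 → ℝ) : so p q * so p q
    = (-(∑ a, p a ^ 2 + ∑ c, q c ^ 2)) • 1 + (2 : ℝ) • mix (Matrix.of fun c b => q c * p b) := by
  ext i j
  fin_cases i <;> fin_cases j <;>
    simp [so, mix, Matrix.mul_apply, Fin.sum_univ_four, Fin.sum_univ_three] <;> ring

lemma trace_so_mul_so (p q p' q' : Fin 3 → ℝ) : (so p q * so p' q').trace
    = -4 * (∑ a, p a * p' a + ∑ c, q c * q' c) := by
  simp [so, Matrix.trace, Fin.sum_univ_four, Fin.sum_univ_three]; ring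

lemma sum_so_mul_so (p q p' q' : Fin 3 → ℝ) : ∑ i, ∑ j, so p q i j * so p' q' i j
    = 4 * (∑ a, p a * p' a + ∑ c, q c * q' c) := by
  simp [so, Fin.sum_univ_four, Fin.sum_univ_three]; ring

lemma asdPart_add (M N : Matrix (Fin 4) (Fin 4) ℝ) :
    asdPart (M + N) = asdPart M + asdPart N := by
  ext b; fin_cases b <;> simp [asdPart] <;> ring

lemma asdPart_smul (c : ℝ) (M : Matrix (Fin 4) (Fin 4) ℝ) :
    asdPart (c • M) = c • asdPart M := by
  ext b; fin_cases b <;> simp [asdPart] <;> ring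

lemma asdPart_sum {ι : Type*} (s : Finset ι) (M : ι → Matrix (Fin 4) (Fin 4) ℝ) :
    asdPart (∑ i ∈ s, M i) = ∑ i ∈ s, asdPart (M i) := by
  classical
  induction s using Finset.induction_on with
  | empty => ext b; fin_cases b <;> simp [asdPart]
  | insert a s ha ih => rw [Finset.sum_insert ha, Finset.sum_insert ha, asdPart_add, ih]

/-- Invariance of a symmetric matrix under `I₁`. -/
lemma mix_invariant_iff (x : ℝ) (W : Matrix (Fin 3) (Fin 3) ℝ) :
    (sdBasis 0)ᵀ * (x • 1 + mix W) * sdBasis 0 = x • 1 + mix W ↔ ∀ c, W c 1 = 0 ∧ W c 2 = 0 := by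
  have hI : sdBasis 0 = !![0, -1, 0, 0; 1, 0, 0, 0; 0, 0, 0, -1; 0, 0, 1, 0] := by
    ext i j; fin_cases i <;> fin_cases j <;> simp [sdBasis, so]
  -- `sdBasis 0` commutes with itself and with all right multiplications, and anticommutes with
  -- `sdBasis 1` and `sdBasis 2`. Conjugation by it changes the sign of the columns 1 and 2.
  have key : (sdBasis 0)ᵀ * (x • 1 + mix W) * sdBasis 0
      = x • 1 + mix (Matrix.of fun c b => if b = 0 then W c b else - W c b) := by
    rw [hI]
    ext i j
    fin_cases i <;> fin_cases j <;>
      simp [mix, Matrix.mul_apply, Fin.sum_univ_four, Matrix.transpose_apply] <;> ring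
  rw [key]
  constructor
  · intro h
    have h2 : mix ((Matrix.of fun c b => if b = 0 then W c b else - W c b) + (-1 : ℝ) • W)
        = (0 : ℝ) • 1 := by
      rw [mix_add, mix_smul, add_left_cancel h]; module
    have h3 := eq_zero_of_mix h2
    intro c
    have a := congrFun (congrFun h3 c) 1
    have b := congrFun (congrFun h3 c) 2
    simp at a b
    constructor <;> linarith
  · intro h
    congr 2
    ext c b
    fin_cases b
    · simp
    · simp [(h c).1]
    · simp [(h c).2]

variable {K : Fin 4 → Fin 4 → Matrix (Fin 4) (Fin 4) ℝ}

namespace IsCurv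

variable (hK : IsCurv K)
include hK

lemma blockA_symm (a b : Fin 3) : blockA K a b = blockA K b a := hK.relations.1 a b

lemma explicit : ∃ C : Matrix (Fin 3) (Fin 3) ℝ, (∀ a b, C a b = C b a) ∧
    ∑ c, C c c = ∑ a, blockA K a a ∧ ∀ i j p q, K i j p q
      = so (fun b => so (fun a => blockA K a b) (fun c => blockB K c b) i j)
        (fun c => so (fun b => blockB K c b) (fun d => C d c) i j) p q := by
  refine ⟨Matrix.of fun d c => asdPart (asdTwo K c) d, fun a b => hK.relations.2.2.1 b a,
    hK.relations.2.2.2, fun i j p q => ?_⟩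
  rw [hK.entry]
  have e : ∀ c, sdPart (asdTwo K c) = fun b => blockB K c b := fun c =>
    funext fun b => hK.relations.2.1 b c
  simp only [e]
  rfl

/-- The trace-free parts of the diagonal blocks are Weyl tensors and have no Ricci contraction. What
remains is the common trace and the mixed block, which is the traceless Ricci tensor. -/
lemma ricTensor_eq : ricTensor K
    = (2 * (blockA K).trace) • 1 + mix ((-2 : ℝ) • blockB K) := by
  obtain ⟨C, hC, ht, hE⟩ := hK.explicit
  have hA := hK.blockA_symm
  simp only [Fin.sum_univ_three] at ht
  have a1 := hA 1 0
  have a2 := hA 2 0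
  have a3 := hA 2 1
  have c1 := hC 1 0
  have c2 := hC 2 0
  have c3 := hC 2 1
  ext j l
  simp only [ricTensor, Matrix.of_apply, hE, Fin.sum_univ_four]
  generalize blockA K = A at *
  generalize blockB K = B at *
  fin_cases j <;> fin_cases l <;>
    simp [so, mix, Matrix.trace, Fin.sum_univ_three] <;> linarith

lemma trace_ricTensor : (ricTensor K).trace = 8 * (blockA K).trace := by
  rw [hK.ricTensor_eq, Matrix.trace_add, mix_trace, Matrix.trace_smul]
  simp; ring

lemma contract_sd (p : Fin 3 → ℝ) : ∑ i, ∑ j, so p 0 i j • K i j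
    = so (4 • (blockA K *ᵥ p)) (4 • (blockB K *ᵥ p)) := by
  have hs : (∑ i, ∑ j, so p 0 i j • K i j)ᵀ = -∑ i, ∑ j, so p 0 i j • K i j := by
    simp only [Matrix.transpose_sum, Matrix.transpose_smul, hK.skew, smul_neg,
      Finset.sum_neg_distrib]
  rw [eq_so hs]
  congr 1
  · ext b
    simp only [sdPart_sum, sdPart_smul, Finset.sum_apply, Pi.smul_apply, smul_eq_mul]
    have : ∀ i j, sdPart (K i j) b
        = so (fun a => blockA K a b) (fun c => blockB K c b) i j := fun i j => by
      rw [← hK.sdTwo_eq]; rfl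
    simp only [this, sum_so_mul_so]
    simp [Matrix.mulVec, dotProduct, hK.blockA_symm b, mul_comm]
  · ext c
    simp only [asdPart_sum, asdPart_smul, Finset.sum_apply, Pi.smul_apply, smul_eq_mul]
    have : ∀ i j, asdPart (K i j) c
        = so (sdPart (asdTwo K c)) (asdPart (asdTwo K c)) i j := fun i j => by
      rw [← eq_so (hK.asdTwo_skew _)]; rfl
    simp only [this, sum_so_mul_so, hK.relations.2.1]
    simp [Matrix.mulVec, dotProduct, mul_comm]

/-- The action of the Weyl tensor on self-dual two-vectors. -/
lemma weyl_sd (p : Fin 3 → ℝ) : ∑ i, ∑ j, so p 0 i j • K i j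
      - (so p 0 * ricTensor K + ricTensor K * so p 0) + ((ricTensor K).trace / 3) • so p 0
    = so (4 • (blockA K *ᵥ p) - (4 / 3 * (blockA K).trace) • p) 0 := by
  rw [hK.contract_sd, hK.trace_ricTensor, hK.ricTensor_eq]
  generalize blockA K *ᵥ p = y
  have hz : blockB K *ᵥ p = fun c => ∑ b, blockB K c b * p b := rfl
  rw [hz]
  generalize blockB K = B at *
  generalize (blockA K).trace = t at *
  ext k l
  simp only [Matrix.add_apply, Matrix.sub_apply, Matrix.mul_apply, Fin.sum_univ_four,
    Matrix.smul_apply]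
  fin_cases k <;> fin_cases l <;>
    simp [so, mix, Matrix.one_apply, Fin.sum_univ_three] <;> ring

end IsCurv

end AlgebraicCurvature


/-! ### Change of frame by self-dual rotations -/

section Rotation

/-- The components of a curvature tensor in the frame rotated by `O`. -/
def rotCurv (K : Fin 4 → Fin 4 → Matrix (Fin 4) (Fin 4) ℝ) (O : Matrix (Fin 4) (Fin 4) ℝ)
    (a b : Fin 4) : Matrix (Fin 4) (Fin 4) ℝ :=
  ∑ i, ∑ j, (O i a * O j b) • (Oᵀ * K i j * O)

/-- `O` is a rotation of `ℝ⁴` that induces the rotation `r` on self-dual forms and fixes the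
anti-self-dual forms. -/
structure SdRotation (O : Matrix (Fin 4) (Fin 4) ℝ) (r : Matrix (Fin 3) (Fin 3) ℝ) : Prop where
  orth : Oᵀ * O = 1
  det : O.det = 1
  orth_sd : r * rᵀ = 1
  sd : ∀ M b, sdPart (Oᵀ * M * O) b = ∑ c, r c b * sdPart M c
  asd : ∀ M, asdPart (Oᵀ * M * O) = asdPart M

namespace SdRotation

lemma one : SdRotation 1 1 where
  orth := by simp
  det := by simp
  orth_sd := by simp
  sd M b := by simp [Matrix.one_apply]
  asd M := by simp

lemma mul {O O' : Matrix (Fin 4) (Fin 4) ℝ} {r r' : Matrix (Fin 3) (Fin 3) ℝ}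
    (h : SdRotation O r) (h' : SdRotation O' r') : SdRotation (O * O') (r * r') where
  orth := by
    rw [Matrix.transpose_mul, Matrix.mul_assoc, ← Matrix.mul_assoc Oᵀ, h.orth, Matrix.one_mul,
      h'.orth]
  det := by rw [Matrix.det_mul, h.det, h'.det, one_mul]
  orth_sd := by
    rw [Matrix.transpose_mul, Matrix.mul_assoc, ← Matrix.mul_assoc r', h'.orth_sd, Matrix.one_mul,
      h.orth_sd]
  sd M b := by
    have : (O * O')ᵀ * M * (O * O') = O'ᵀ * (Oᵀ * M * O) * O' := by
      simp only [Matrix.transpose_mul, Matrix.mul_assoc]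
    rw [this, h'.sd]
    simp only [h.sd, Matrix.mul_apply, Fin.sum_univ_three]
    ring
  asd M := by
    have : (O * O')ᵀ * M * (O * O') = O'ᵀ * (Oᵀ * M * O) * O' := by
      simp only [Matrix.transpose_mul, Matrix.mul_assoc]
    rw [this, h'.asd, h.asd]

lemma det_four_rotation (a b c d e f g h i j k l m n o p : ℝ) :
    Matrix.det !![a, b, c, d; e, f, g, h; i, j, k, l; m, n, o, p]
      = a * (f * (k * p - l * o) - g * (j * p - l * n) + h * (j * o - k * n))
        - b * (e * (k * p - l * o) - g * (i * p - l * m) + h * (i * o - k * m))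
        + c * (e * (j * p - l * n) - f * (i * p - l * m) + h * (i * n - j * m))
        - d * (e * (j * o - k * n) - f * (i * o - k * m) + g * (i * n - j * m)) := by
  simp [Matrix.det_succ_row_zero, Fin.sum_univ_succ, Fin.succAbove]
  ring

/-- The cyclic permutation of the axes. -/
lemma cyc : SdRotation ((1 / 2 : ℝ) • !![1, -1, -1, -1; 1, 1, -1, 1; 1, 1, 1, -1; 1, -1, 1, 1])
    !![0, 0, 1; 1, 0, 0; 0, 1, 0] where
  -- The matrix is left multiplication by the unit quaternion `(1 + i + j + k)/2`, and conjugation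
  -- by this quaternion permutes i, j, k cyclically.
  orth := by
    ext i j
    fin_cases i <;> fin_cases j <;> simp [Matrix.mul_apply, Fin.sum_univ_four] <;> norm_num
  det := by
    rw [Matrix.det_smul, det_four_rotation]; simp; norm_num
  orth_sd := by
    ext i j
    fin_cases i <;> fin_cases j <;> simp [Matrix.mul_apply, Fin.sum_univ_three]
  sd M b := by
    simp only [Matrix.transpose_smul, Matrix.smul_mul, Matrix.mul_smul]
    fin_cases b <;>
      simp [sdPart, Matrix.mul_apply, Fin.sum_univ_four, Fin.sum_univ_three,
        Matrix.transpose_apply] <;> ring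
  asd M := by
    simp only [Matrix.transpose_smul, Matrix.smul_mul, Matrix.mul_smul]
    ext b
    fin_cases b <;>
      simp [asdPart, Matrix.mul_apply, Fin.sum_univ_four, Matrix.transpose_apply] <;> ring

/-- The rotation `x + y I₂`. -/
lemma plane {x y : ℝ} (h : x ^ 2 + y ^ 2 = 1) :
    SdRotation !![x, 0, 0, -y; 0, x, -y, 0; 0, y, x, 0; y, 0, 0, x]
      !![x ^ 2 - y ^ 2, -(2 * x * y), 0; 2 * x * y, x ^ 2 - y ^ 2, 0; 0, 0, 1] where
  -- Conjugation doubles the angle: the self-dual axes 0 and 1 turn by twice the angle of `(x, y)`,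
  -- and axis 2 is fixed.
  orth := by
    ext i j
    fin_cases i <;> fin_cases j <;> simp [Matrix.mul_apply, Fin.sum_univ_four] <;> linarith
  det := by
    rw [det_four_rotation]
    linear_combination (x ^ 2 + y ^ 2 + 1) * h
  orth_sd := by
    ext i j
    fin_cases i <;> fin_cases j <;> simp [Matrix.mul_apply, Fin.sum_univ_three] <;>
      first | linear_combination (x ^ 2 + y ^ 2 + 1) * h | ring
  sd M b := by
    fin_cases b <;>
      simp [sdPart, Matrix.mul_apply, Fin.sum_univ_four, Fin.sum_univ_three,
        Matrix.transpose_apply]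
    · ring
    · ring
    · linear_combination (M 3 0 - M 0 3 + M 2 1 - M 1 2) * h
  asd M := by
    ext b
    fin_cases b <;>
      simp [asdPart, Matrix.mul_apply, Fin.sum_univ_four, Matrix.transpose_apply]
    · linear_combination (M 1 0 - M 0 1 - M 3 2 + M 2 3) * h
    · linear_combination (M 2 0 - M 0 2 - M 1 3 + M 3 1) * h
    · linear_combination (M 3 0 - M 0 3 - M 2 1 + M 1 2) * h

variable {K : Fin 4 → Fin 4 → Matrix (Fin 4) (Fin 4) ℝ} {O : Matrix (Fin 4) (Fin 4) ℝ}
  {r : Matrix (Fin 3) (Fin 3) ℝ}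

lemma sdTwo_rotCurv (h : SdRotation O r) (b : Fin 3) :
    sdTwo (rotCurv K O) b = ∑ c, r c b • (Oᵀ * sdTwo K c * O) := by
  ext p q
  simp only [sdTwo, rotCurv, Matrix.of_apply, sdPart_sum, sdPart_smul, Finset.sum_apply,
    Pi.smul_apply, smul_eq_mul, h.sd, Matrix.sum_apply, Matrix.smul_apply, Matrix.mul_apply,
    Matrix.transpose_apply, Finset.mul_sum, Finset.sum_mul]
  rw [Finset.sum_comm' (t' := Finset.univ) (s' := fun _ => Finset.univ) (by simp)]
  rw [Finset.sum_congr rfl fun x _ => Finset.sum_comm]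
  rw [Finset.sum_comm]
  refine Finset.sum_congr rfl fun c _ => Finset.sum_congr rfl fun j _ =>
    Finset.sum_congr rfl fun i _ => by ring

/-- Both indices of this block are self-dual and turn with `r`. In `blockB` only the column index
does, since the rotation acts trivially on anti-self-dual forms. -/
lemma blockA_rotCurv (h : SdRotation O r) : blockA (rotCurv K O) = rᵀ * blockA K * r := by
  ext a b
  simp only [blockA, Matrix.of_apply, h.sdTwo_rotCurv, sdPart_sum, sdPart_smul, Finset.sum_apply,
    Pi.smul_apply, smul_eq_mul, h.sd]
  simp only [Matrix.mul_apply, Matrix.transpose_apply, Fin.sum_univ_three, Matrix.of_apply]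
  ring

lemma blockB_rotCurv (h : SdRotation O r) : blockB (rotCurv K O) = blockB K * r := by
  ext a b
  simp only [blockB, Matrix.of_apply, h.sdTwo_rotCurv, asdPart_sum, asdPart_smul, Finset.sum_apply,
    Pi.smul_apply, smul_eq_mul, h.asd]
  simp only [Matrix.mul_apply, Fin.sum_univ_three, Matrix.of_apply]
  ring

end SdRotation

/-- The conditions on the curvature blocks imposed at a point of the twistor space by the
horizontal and the vertical part of the Ricci tensor. -/
structure RicciCondition (t : ℝ) (A B : Matrix (Fin 3) (Fin 3) ℝ) : Prop where
  hor₁ : ∀ c, B c 1 = 2 * t * (A 1 1 * B c 1 + A 1 2 * B c 2)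
  hor₂ : ∀ c, B c 2 = 2 * t * (A 2 1 * B c 1 + A 2 2 * B c 2)
  vert : (A * A + Bᵀ * B) 1 1 = (A * A + Bᵀ * B) 2 2
  vert_off : (A * A + Bᵀ * B) 1 2 = 0

/-! ### Consequences of imposing the Ricci condition on a whole fibre -/

section

variable {t : ℝ} {A B : Matrix (Fin 3) (Fin 3) ℝ}
  (h : ∀ O r, SdRotation O r → RicciCondition t (rᵀ * A * r) (B * r))
include h

lemma ricciCondition_rotate {O : Matrix (Fin 4) (Fin 4) ℝ} {r : Matrix (Fin 3) (Fin 3) ℝ}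
    (hr : SdRotation O r) (O' : Matrix (Fin 4) (Fin 4) ℝ) (r' : Matrix (Fin 3) (Fin 3) ℝ)
    (hr' : SdRotation O' r') : RicciCondition t (r'ᵀ * (rᵀ * A * r) * r') (B * r * r') := by
  have := h _ _ (hr.mul hr')
  rwa [Matrix.transpose_mul, ← Matrix.mul_assoc B,
    show r'ᵀ * rᵀ * A * (r * r') = r'ᵀ * (rᵀ * A * r) * r' by simp only [Matrix.mul_assoc]] at this

/-- The symmetric matrix `M = A² + BᵀB` transforms as a quadratic form. The vertical condition reads
`M₁₁ = M₂₂` and `M₁₂ = 0`; its images under cyclic permutations of the axes equate all diagonal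
entries and annihilate all off-diagonal ones. -/
lemma ricciCondition_sq (hA : ∀ i j, A i j = A j i) : ∃ l : ℝ, A * A + Bᵀ * B = l • 1 := by
  have key : ∀ r : Matrix (Fin 3) (Fin 3) ℝ, r * rᵀ = 1 →
      rᵀ * A * r * (rᵀ * A * r) + (B * r)ᵀ * (B * r) = rᵀ * (A * A + Bᵀ * B) * r := fun r hr => by
    have : rᵀ * A * r * (rᵀ * A * r) = rᵀ * A * (r * rᵀ) * A * r := by
      simp only [Matrix.mul_assoc]
    rw [this, hr, Matrix.transpose_mul]
    simp only [Matrix.mul_one, Matrix.mul_add, Matrix.add_mul, Matrix.mul_assoc]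
  have hc := SdRotation.cyc
  have h0 := h _ _ SdRotation.one
  have h1 := h _ _ hc
  have h2 := h _ _ (hc.mul hc)
  have hs : ∀ i j, (A * A + Bᵀ * B) i j = (A * A + Bᵀ * B) j i := fun i j => by
    simp only [Matrix.add_apply, Matrix.mul_apply, Matrix.transpose_apply, Fin.sum_univ_three,
      hA j]
    rw [hA 0 i, hA 1 i, hA 2 i]; ring
  have e0 := h0.vert
  have f0 := h0.vert_off
  have e1 := h1.vert
  have f1 := h1.vert_off
  have f2 := h2.vert_off
  rw [key _ SdRotation.one.orth_sd] at e0 f0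
  rw [key _ hc.orth_sd] at e1 f1
  rw [key _ (hc.mul hc).orth_sd] at f2
  generalize A * A + Bᵀ * B = M at *
  simp [Matrix.mul_apply, Fin.sum_univ_three, Matrix.transpose_apply] at e0 f0 e1 f1 f2
  have s01 := hs 0 1
  have s02 := hs 0 2
  have s12 := hs 1 2
  refine ⟨M 0 0, ?_⟩
  ext i j
  fin_cases i <;> fin_cases j <;> simp <;> linarith

/-- For a row `b` of `B` and a unit vector `v` in the plane of the axes 0 and 1, the horizontal
condition is applied in the direction `w` of the plane orthogonal to `v`. After subtraction of the
conditions at `v = e₀` and `v = e₁`, what is left says that two linear forms `X`, `Y` in `b₀`, `b₁`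
vanish. Their determinant is the squared eigenvalue gap of the 2×2 block of `A`. -/
lemma ricciCondition_pair (hA : ∀ i j, A i j = A j i) (c : Fin 3) :
    ((A 1 1 - A 0 0) ^ 2 + 4 * A 0 1 ^ 2) * (t * B c 0) = 0 ∧
      ((A 1 1 - A 0 0) ^ 2 + 4 * A 0 1 ^ 2) * (t * B c 1) = 0 := by
  have h0 := (h _ _ SdRotation.one).hor₁ c
  have h1 := (h _ _ (SdRotation.cyc)).hor₂ c
  -- The doubled angles have cosine `-7/25` and `7/25` and the same sine `24/25`, so sum and
  -- difference of the two conditions separate `X` from `Y`.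
  have h2 := (h _ _ (SdRotation.plane (x := 3 / 5) (y := 4 / 5) (by norm_num))).hor₁ c
  have h3 := (h _ _ (SdRotation.plane (x := 4 / 5) (y := 3 / 5) (by norm_num))).hor₁ c
  simp [Matrix.mul_apply, Fin.sum_univ_three, Matrix.transpose_apply] at h0 h1 h2 h3
  rw [hA 1 0] at h2 h3
  have X : t * ((A 1 1 - A 0 0) * B c 0 + 2 * A 0 1 * B c 1) = 0 := by
    linear_combination (15625 / (14 * 336)) * ((h2 + 24 / 25 * h1 + 7 / 25 * h0)
      + (h3 + 24 / 25 * h1 - 7 / 25 * h0))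
  have Y : t * ((A 1 1 - A 0 0) * B c 1 - 2 * A 0 1 * B c 0) = 0 := by
    linear_combination (-15625 / (48 * 336)) * ((h2 + 24 / 25 * h1 + 7 / 25 * h0)
      - (h3 + 24 / 25 * h1 - 7 / 25 * h0))
  constructor
  · linear_combination (A 1 1 - A 0 0) * X - 2 * A 0 1 * Y
  · linear_combination (A 1 1 - A 0 0) * Y + 2 * A 0 1 * X

/-- Since `B c 0 ≠ 0`, the gap factors of the planes (0,1) and (2,0) vanish: the diagonal of `A` is
constant and `A₀₁ = A₀₂ = 0`. The horizontal condition for column 0 then gives `A₀₀ = 1/(2t)`. Only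
`A₁₂` needs a further argument. -/
lemma ricciCondition_column (ht : 0 < t) (hA : ∀ i j, A i j = A j i) {c : Fin 3}
    (hB : B c 0 ≠ 0) : A = (1 / (2 * t)) • 1 := by
  have hc := SdRotation.cyc
  have hsymm : ∀ r : Matrix (Fin 3) (Fin 3) ℝ, ∀ i j, (rᵀ * A * r) i j = (rᵀ * A * r) j i :=
    fun r i j => by
      have : (rᵀ * A * r)ᵀ = rᵀ * A * r := by
        rw [Matrix.transpose_mul, Matrix.transpose_mul, Matrix.transpose_transpose,
          show Aᵀ = A from Matrix.ext fun i j => hA j i, Matrix.mul_assoc]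
      exact (congrFun (congrFun this i) j).symm
  have p01 := (ricciCondition_pair h hA c).1
  have p12 := ricciCondition_pair (ricciCondition_rotate h hc) (hsymm _) c
  have p20 := (ricciCondition_pair (ricciCondition_rotate h (hc.mul hc)) (hsymm _) c).2
  have h1 := (h _ _ hc).hor₂ c
  obtain ⟨l, hl⟩ := ricciCondition_sq h hA
  have hl12 := congrFun (congrFun hl 1) 2
  simp [Matrix.mul_apply, Fin.sum_univ_three, Matrix.transpose_apply] at p12 p20 h1 hl12
  have sq : ∀ x y : ℝ, x ^ 2 + 4 * y ^ 2 = 0 → x = 0 ∧ y = 0 := fun x y hxy =>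
    ⟨by nlinarith [sq_nonneg x, sq_nonneg y], by nlinarith [sq_nonneg x, sq_nonneg y]⟩
  simp only [mul_eq_zero, ht.ne', hB, or_false, false_or] at p01 p12 p20
  obtain ⟨d01, a01⟩ := sq _ _ p01
  obtain ⟨d20, a20⟩ := sq _ _ p20
  have a02 : A 0 2 = 0 := by rw [hA, a20]
  have a00 : A 0 0 = 1 / (2 * t) := by
    rw [eq_div_iff (by positivity)]
    refine mul_right_cancel₀ hB ?_
    rw [a02] at h1
    linarith
  have a12 : A 1 2 = 0 := by
    by_cases h1 : B c 1 = 0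
    · by_contra hne
      -- If `A₁₂ ≠ 0`, the gap factor of the plane (1,2) is not zero, so columns 1 and 2 of `B`
      -- vanish. Then the (1,2) entry of `A² + BᵀB` is `2 A₀₀ A₁₂ = A₁₂ / t`, which contradicts
      -- `ricciCondition_sq`.
      have col : ∀ c', B c' 1 = 0 ∧ B c' 2 = 0 := fun c' => by
        have p := ricciCondition_pair (ricciCondition_rotate h hc) (hsymm _) c'
        simp [Matrix.mul_apply, Fin.sum_univ_three, Matrix.transpose_apply, ht.ne'] at p
        exact ⟨p.1.resolve_left fun h => hne (sq _ _ h).2, p.2.resolve_left fun h => hne (sq _ _ h).2⟩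
      simp only [(col _).1, (col _).2, a02, mul_zero, add_zero, zero_add] at hl12
      have e1 : A 1 1 = A 0 0 := by linarith
      have e2 : A 2 2 = A 0 0 := by linarith
      rw [e1, e2, a00] at hl12
      have : A 1 2 * (1 / t) = 0 := by linear_combination hl12
      exact hne ((mul_eq_zero.1 this).resolve_right (by positivity))
    · exact (sq _ _ (p12.1.resolve_right h1)).2
  have s01 := hA 1 0
  have s12 := hA 2 1
  generalize 1 / (2 * t) = m at a00 ⊢
  ext i j
  fin_cases i <;> fin_cases j <;> simp <;> linarith

/-- If the anti-self-dual part of the Ricci tensor does not vanish, then the self-dual block of the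
curvature is a definite multiple of the identity. -/
theorem ricciCondition_blockA (ht : 0 < t) (hA : ∀ i j, A i j = A j i) (hB : B ≠ 0) :
    A = (1 / (2 * t)) • 1 := by
  obtain ⟨c, d, hcd⟩ : ∃ c d, B c d ≠ 0 := by
    by_contra! hne
    exact hB (Matrix.ext hne)
  have hsymm : ∀ r : Matrix (Fin 3) (Fin 3) ℝ, ∀ i j, (rᵀ * A * r) i j = (rᵀ * A * r) j i :=
    fun r i j => by
      have : (rᵀ * A * r)ᵀ = rᵀ * A * r := by
        rw [Matrix.transpose_mul, Matrix.transpose_mul, Matrix.transpose_transpose,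
          show Aᵀ = A from Matrix.ext fun i j => hA j i, Matrix.mul_assoc]
      exact (congrFun (congrFun this i) j).symm
  have back : ∀ r : Matrix (Fin 3) (Fin 3) ℝ, r * rᵀ = 1 →
      rᵀ * A * r = (1 / (2 * t)) • 1 → A = (1 / (2 * t)) • 1 := fun r hr he => by
    calc A = (r * rᵀ) * A * (r * rᵀ) := by rw [hr, Matrix.one_mul, Matrix.mul_one]
      _ = r * (rᵀ * A * r) * rᵀ := by simp only [Matrix.mul_assoc]
      _ = _ := by rw [he, Matrix.mul_smul, Matrix.mul_one, Matrix.smul_mul, hr]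
  have hc := SdRotation.cyc
  -- A cyclic rotation carries the nonzero column to index 0, and the scalar conclusion is unchanged
  -- by rotating back.
  fin_cases d
  · exact ricciCondition_column h ht hA hcd
  · refine back _ hc.orth_sd (ricciCondition_column (ricciCondition_rotate h hc) ht (hsymm _)
      (c := c) ?_)
    simpa [Matrix.mul_apply, Fin.sum_univ_three] using hcd
  · refine back _ (hc.mul hc).orth_sd (ricciCondition_column (ricciCondition_rotate h (hc.mul hc))
      ht (hsymm _) (c := c) ?_)
    simpa [Matrix.mul_apply, Fin.sum_univ_three] using hcd

end

end Rotation


/-! ### Triple eigenvalues of the Ricci operator -/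

section TripleEigenvalue

/-- Rank–nullity in dimension four; ranks are easier to transport through a change of frame than
eigenspaces. -/
lemma three_le_finrank_eigenspace_iff (M : Matrix (Fin 4) (Fin 4) ℝ) (x : ℝ) :
    3 ≤ Module.finrank ℝ (Module.End.eigenspace (Matrix.toLin' M) x) ↔ (M - x • 1).rank ≤ 1 := by
  have h1 : Matrix.toLin' M - x • 1
      = (M - x • 1).mulVecLin := by
    ext i j
    simp
  have h2 := (M - x • 1).mulVecLin.finrank_range_add_finrank_ker
  rw [Module.finrank_fin_fun] at h2
  rw [Module.End.eigenspace_def, h1, Matrix.rank]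
  omega

lemma rank_conj_sub {e e' M N : Matrix (Fin 4) (Fin 4) ℝ} (he : e * e' = 1)
    (hN : N = e * M * e') (x : ℝ) : (N - x • 1).rank = (M - x • 1).rank := by
  have h1 : N - x • 1 = e * (M - x • 1) * e' := by
    rw [hN, Matrix.mul_sub, Matrix.sub_mul, Matrix.mul_smul, Matrix.smul_mul, Matrix.mul_one, he]
  have hd : e.det * e'.det = 1 := by rw [← Matrix.det_mul, he, Matrix.det_one]
  rw [h1, Matrix.rank_mul_eq_left_of_det_ne_zero _ _ (right_ne_zero_of_mul_eq_one hd),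
    Matrix.rank_mul_eq_right_of_det_ne_zero _ _ (left_ne_zero_of_mul_eq_one hd)]

/-- Products of `I_b J_c` and `I_b' J_c'` are scalar if both indices agree, cancel in pairs by
anticommutation if exactly one agrees, and give the third units otherwise. The last case assembles
the cofactors of `B`. -/
lemma mix_mul_self (B : Matrix (Fin 3) (Fin 3) ℝ) :
    mix B * mix B = (∑ i, ∑ j, B i j ^ 2) • 1 + (-2 : ℝ) • mix (B.adjugateᵀ) := by
  rw [Matrix.adjugate_fin_three]
  ext i j
  fin_cases i <;> fin_cases j <;>
    simp [mix, Matrix.mul_apply, Fin.sum_univ_four, Fin.sum_univ_three] <;> ring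

/-- `k⁻¹ N` is idempotent of trace one, and the rank of a projector is its trace. -/
lemma rank_le_one_of_sq {n : ℕ} {N : Matrix (Fin n) (Fin n) ℝ} {k : ℝ} (hk : k ≠ 0) (h : N * N = k • N)
    (ht : N.trace = k) : N.rank ≤ 1 := by
  have hP : IsIdempotentElem (Matrix.toLin' (k⁻¹ • N)) := by
    rw [IsIdempotentElem, Module.End.mul_eq_comp, ← Matrix.toLin'_mul]
    congr 1
    rw [Matrix.smul_mul, Matrix.mul_smul, h, smul_smul k⁻¹ k, inv_mul_cancel₀ hk, one_smul]
  have h1 := (LinearMap.IsIdempotentElem.isProj_range _ hP).trace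
  rw [Matrix.trace_toLin'_eq, Matrix.trace_smul, ht, smul_eq_mul, inv_mul_cancel₀ hk] at h1
  have h2 : (k⁻¹ • N).rank = 1 := by
    rw [Matrix.rank, ← Matrix.toLin'_apply']
    exact_mod_cast h1.symm
  have h3 : N = (k • (1 : Matrix (Fin n) (Fin n) ℝ)) * (k⁻¹ • N) := by
    rw [Matrix.smul_mul, Matrix.one_mul, smul_smul, mul_inv_cancel₀ hk, one_smul]
  rw [h3]
  exact (Matrix.rank_mul_le_right _ _).trans h2.le

/-- A matrix with `BᵀB` scalar is zero or a multiple of a rotation. In the second case its cofactor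
matrix is proportional to `B`, so `mix B` satisfies a quadratic equation. -/
lemma exists_rank_le_one {B : Matrix (Fin 3) (Fin 3) ℝ} {l : ℝ} (h : Bᵀ * B = l • 1) (x : ℝ) :
    ∃ m : ℝ, (x • 1 + mix ((-2 : ℝ) • B) - m • 1).rank ≤ 1 := by
  have hsq : ∑ i, ∑ j, B i j ^ 2 = 3 * l := by
    have := congrArg Matrix.trace h
    simp [Matrix.trace, Matrix.mul_apply, Fin.sum_univ_three] at this
    simp only [Fin.sum_univ_three]; linarith
  by_cases hl : l = 0
  · have hB : B = 0 := by
      ext i j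
      rw [hl] at hsq
      have h1 : B i j ^ 2 ≤ ∑ i, ∑ j, B i j ^ 2 :=
        (Finset.single_le_sum (f := fun j => B i j ^ 2) (fun _ _ => sq_nonneg _)
          (Finset.mem_univ j)).trans (Finset.single_le_sum (f := fun i => ∑ j, B i j ^ 2)
            (fun _ _ => Finset.sum_nonneg fun _ _ => sq_nonneg _) (Finset.mem_univ i))
      have : B i j ^ 2 = 0 := le_antisymm (by linarith) (sq_nonneg _)
      simpa using this
    exact ⟨x, by simp [hB, mix_zero]⟩
  · have h' : B * Bᵀ = l • 1 := by
      have h1 : (l⁻¹ • Bᵀ) * B = 1 := by rw [Matrix.smul_mul, h, smul_smul, inv_mul_cancel₀ hl, one_smul]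
      have h2 := mul_eq_one_comm.1 h1
      rw [Matrix.mul_smul] at h2
      rw [← h2, smul_smul, mul_inv_cancel₀ hl, one_smul]
    have hadj : B.adjugateᵀ = (B.det / l) • B := by
      have h1 : B.adjugate * (B * Bᵀ) = B.det • Bᵀ := by
        rw [← Matrix.mul_assoc, Matrix.adjugate_mul, Matrix.smul_mul, Matrix.one_mul]
      rw [h', Matrix.mul_smul, Matrix.mul_one] at h1
      rw [div_eq_inv_mul, mul_smul, ← Matrix.transpose_transpose (B.det • B),
        Matrix.transpose_smul, ← h1, Matrix.transpose_smul, smul_smul, inv_mul_cancel₀ hl, one_smul]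
    have hdet : B.det ^ 2 = l ^ 3 := by
      have := congrArg Matrix.det h
      rw [Matrix.det_mul, Matrix.det_transpose, Matrix.det_smul, Matrix.det_one] at this
      simp at this; linarith
    -- With this choice `k² = l` and `B / k` has determinant one, so the cofactor matrix of `B` is
    -- `k B`. The eigenvalues of `mix B` are then `k` three times and `-3k`, and `x - 2k` is the
    -- triple eigenvalue.
    set k := B.det / l with hk
    have hk2 : k ^ 2 = l := by rw [hk, div_pow, hdet]; field_simp
    have hk0 : k ≠ 0 := fun h0 => hl (by rw [← hk2, h0]; ring)
    refine ⟨x - 2 * k, ?_⟩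
    have hN : (mix B - k • 1) * (mix B - k • 1) = (-4 * k) • (mix B - k • 1) := by
      rw [Matrix.sub_mul, Matrix.mul_sub, Matrix.mul_sub, mix_mul_self, hadj, mix_smul, hsq, ← hk2]
      simp only [Matrix.smul_mul, Matrix.mul_smul, Matrix.one_mul, Matrix.mul_one]
      module
    have hr := rank_le_one_of_sq (mul_ne_zero (by norm_num) hk0) hN (by
      rw [Matrix.trace_sub, mix_trace, Matrix.trace_smul, Matrix.trace_one]; simp; ring)
    have e : x • 1 + mix ((-2 : ℝ) • B) - (x - 2 * k) • 1
        = ((-2 : ℝ) • (1 : Matrix (Fin 4) (Fin 4) ℝ)) * (mix B - k • 1) := by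
      rw [mix_smul, Matrix.smul_mul, Matrix.one_mul]; module
    rw [e]
    exact (Matrix.rank_mul_le_right _ _).trans hr

lemma exists_vecMulVec {n : ℕ} {S : Matrix (Fin n) (Fin n) ℝ} (hS : Sᵀ = S) (h : S.rank ≤ 1) :
    ∃ (k : ℝ) (v : Fin n → ℝ), ∀ i j, S i j = k * (v i * v j) := by
  obtain ⟨v, hv⟩ := finrank_le_one_iff.1 h
  have hw : ∀ j, ∃ c : ℝ, ∀ i, S i j = c * (v : Fin n → ℝ) i := fun j => by
    obtain ⟨c, hc⟩ := hv ⟨S.mulVecLin (Pi.single j 1), ⟨_, rfl⟩⟩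
    refine ⟨c, fun i => ?_⟩
    have := congrFun (congrArg Subtype.val hc) i
    simpa using this.symm
  choose w hw using hw
  have hs : ∀ i j, S i j = S j i := fun i j => congrFun (congrFun hS j) i
  by_cases h0 : ∀ j, w j = 0
  · exact ⟨0, 0, fun i j => by rw [hw, h0]; simp⟩
  · push Not at h0
    obtain ⟨j, hj⟩ := h0
    refine ⟨(v : Fin n → ℝ) j / w j, w, fun i l => ?_⟩
    have h1 : w j * (v : Fin n → ℝ) i = w i * (v : Fin n → ℝ) j := by rw [← hw, hs, hw]
    rw [hw l i]
    field_simp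
    linear_combination w l * h1

/-- A symmetric matrix of rank at most one is `k v vᵀ`. Reading `B` off its entries gives quadratic
expressions in `v` which, up to the factor `k/8`, are the Euler–Rodrigues formulas for a rotation
scaled by `|v|²`. -/
lemma transpose_mul_self_of_rank {B : Matrix (Fin 3) (Fin 3) ℝ} {x m : ℝ}
    (h : (x • 1 + mix ((-2 : ℝ) • B) - m • 1).rank ≤ 1) : ∃ l : ℝ, Bᵀ * B = l • 1 := by
  have hS : (x • 1 + mix ((-2 : ℝ) • B) - m • 1)ᵀ = x • 1 + mix ((-2 : ℝ) • B) - m • 1 := by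
    ext i j
    fin_cases i <;> fin_cases j <;> simp [mix]
  obtain ⟨k, v, hv⟩ := exists_vecMulVec hS h
  have h01 := hv 0 1
  have h02 := hv 0 2
  have h03 := hv 0 3
  have h12 := hv 1 2
  have h13 := hv 1 3
  have h23 := hv 2 3
  have h00 := hv 0 0
  have h11 := hv 1 1
  have h22 := hv 2 2
  have h33 := hv 3 3
  simp [mix] at h01 h02 h03 h12 h13 h23 h00 h11 h22 h33
  have b00 : B 0 0 = k / 8 * (v 0 ^ 2 + v 1 ^ 2 - v 2 ^ 2 - v 3 ^ 2) := by linarith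
  have b11 : B 1 1 = k / 8 * (v 0 ^ 2 - v 1 ^ 2 + v 2 ^ 2 - v 3 ^ 2) := by linarith
  have b22 : B 2 2 = k / 8 * (v 0 ^ 2 - v 1 ^ 2 - v 2 ^ 2 + v 3 ^ 2) := by linarith
  have b01 : B 0 1 = k / 4 * (v 0 * v 3 + v 1 * v 2) := by linarith
  have b10 : B 1 0 = k / 4 * (v 1 * v 2 - v 0 * v 3) := by linarith
  have b02 : B 0 2 = k / 4 * (v 1 * v 3 - v 0 * v 2) := by linarith
  have b20 : B 2 0 = k / 4 * (v 1 * v 3 + v 0 * v 2) := by linarith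
  have b12 : B 1 2 = k / 4 * (v 0 * v 1 + v 2 * v 3) := by linarith
  have b21 : B 2 1 = k / 4 * (v 2 * v 3 - v 0 * v 1) := by linarith
  refine ⟨(k / 8) ^ 2 * (v 0 ^ 2 + v 1 ^ 2 + v 2 ^ 2 + v 3 ^ 2) ^ 2, ?_⟩
  ext i j
  fin_cases i <;> fin_cases j <;>
    simp only [Matrix.mul_apply, Matrix.transpose_apply, Fin.sum_univ_three, Matrix.smul_apply,
      Matrix.one_apply, Fin.zero_eta, Fin.mk_one, Fin.reduceFinMk, b00, b01, b02, b10, b11, b12,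
      b20, b21, b22] <;>
    simp <;> ring

end TripleEigenvalue


/-! ### Curvature in an orthonormal frame -/

section FrameCurvature

variable {n : ℕ} {W : Set (R n)} {G : R n → Matrix (Fin n) (Fin n) ℝ} {y : R n}
  {e : Matrix (Fin n) (Fin n) ℝ}

lemma curv_neg_transpose (Γ : Fin n → R n → Matrix (Fin n) (Fin n) ℝ) (k l : Fin n) :
    curv (fun k w => -(Γ k w)ᵀ) k l y = -(curv Γ k l y)ᵀ := by
  have h1 : ∀ l k, mpd (fun w => -(Γ l w)ᵀ) k y = -(mpd (Γ l) k y)ᵀ := fun l k => by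
    rw [mpd_neg (fun w => (Γ l w)ᵀ), mpd_transpose]
  rw [curv, curv, h1, h1]
  simp only [Matrix.transpose_add, Matrix.transpose_sub, Matrix.transpose_mul, Matrix.neg_mul, Matrix.mul_neg,
    neg_neg]
  abel

/-- Metric compatibility says that `G` intertwines `Γ` with the dual connection `-Γᵀ`, whose
curvature is the negative transpose of that of `Γ`. -/
lemma IsMetricOn.curv_chr_skew (hG : IsMetricOn W G) (hy : y ∈ W) (k l : Fin n) :
    G y * curv (chr G) k l y = -((curv (chr G) k l y)ᵀ * G y) := by
  have h := curv_intertwine hG.isOpen hG.smooth (ϖ := chr G) (Γ := fun k w => -(chr G k w)ᵀ)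
    hG.smooth_chr (fun k => (hG.smooth_chr k).transpose.neg) (fun w hw k => by
      rw [chr_compat hG.isOpen hG.symm hw (hG.det_ne _ hw), Matrix.neg_mul]; abel) hy k l
  rw [h, curv_neg_transpose, Matrix.neg_mul]

/-- Column `j` of `Γᵢ` equals column `i` of `Γⱼ`; with this symmetry both the derivative terms and
the quadratic terms cancel in the cyclic sum. -/
lemma IsMetricOn.curv_chr_bianchi (hG : IsMetricOn W G) (hy : y ∈ W) (i j k p : Fin n) :
    curv (chr G) i j y p k + curv (chr G) j k y p i + curv (chr G) k i y p j = 0 := by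
  have hs : ∀ i j k, chr G i y k j = chr G j y k i := fun i j k =>
    chr_symm hG.isOpen hG.symm hy i j k
  have hd : ∀ i j k l, mpd (chr G i) l y k j = mpd (chr G j) l y k i := fun i j k l =>
    pd_congr hG.isOpen (fun w hw => chr_symm hG.isOpen hG.symm hw i j k) hy l
  simp only [curv, Matrix.add_apply, Matrix.sub_apply, Matrix.mul_apply]
  rw [hd j k, hd i k, hd i j]
  simp only [hs k i, hs j i, hs k j]
  ring

lemma frame_inv (he : eᵀ * G y * e = 1) : e * (eᵀ * G y) = 1 := mul_eq_one_comm.1 he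

lemma frameCurv_expand (he : eᵀ * G y * e = 1) (k l : Fin n) :
    eᵀ * G y * curv (chr G) k l y
      = (∑ a, ∑ b, ((eᵀ * G y) a k * (eᵀ * G y) b l) • frameCurv G y e a b) * (eᵀ * G y) := by
  have hj : ∀ i k, (if i = k then (1 : ℝ) else 0) = ∑ a, e i a * (eᵀ * G y) a k := fun i k => by
    rw [← Matrix.mul_apply, frame_inv he, Matrix.one_apply]
  simp only [frameCurv]
  rw [← sum_smul_bilin e (fun a => (eᵀ * G y) a k) (fun b => (eᵀ * G y) b l)]
  simp only [← hj]
  simp [Matrix.mul_assoc, frame_inv he]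

lemma sum_comm_four {ι N : Type*} [Fintype ι] [AddCommMonoid N] (f : ι → ι → ι → ι → N) :
    ∑ a, ∑ b, ∑ i, ∑ j, f a b i j = ∑ i, ∑ j, ∑ a, ∑ b, f a b i j := by
  calc _ = ∑ a, ∑ i, ∑ b, ∑ j, f a b i j := Finset.sum_congr rfl fun a _ => Finset.sum_comm
    _ = ∑ i, ∑ a, ∑ b, ∑ j, f a b i j := Finset.sum_comm
    _ = ∑ i, ∑ a, ∑ j, ∑ b, f a b i j :=
      Finset.sum_congr rfl fun i _ => Finset.sum_congr rfl fun a _ => Finset.sum_comm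
    _ = _ := Finset.sum_congr rfl fun i _ => Finset.sum_comm

/-- Links a change of frame at one point of `M` to the action of `SdRotation` on the blocks, that
is, to motion of `σ` in the fibre. -/
lemma frameCurv_mul (O : Matrix (Fin 4) (Fin 4) ℝ) (G : R 4 → Matrix (Fin 4) (Fin 4) ℝ) (y : R 4)
    (e : Matrix (Fin 4) (Fin 4) ℝ) : frameCurv G y (e * O) = rotCurv (frameCurv G y e) O := by
  ext1 a
  ext1 b
  simp only [frameCurv, rotCurv, Matrix.transpose_mul]
  have h := sum_smul_bilin e (fun c => O c a) (fun c => O c b)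
    (fun i j => Oᵀ * eᵀ * G y * curv (chr G) i j y * (e * O))
  simp only [← Matrix.mul_apply] at h
  rw [h]
  simp only [Matrix.mul_sum, Matrix.sum_mul, mul_smul_comm, smul_mul_assoc, Matrix.mul_assoc]

lemma ricci_eq_frame {G : R 4 → Matrix (Fin 4) (Fin 4) ℝ} {y : R 4} {e : Matrix (Fin 4) (Fin 4) ℝ}
    (he : eᵀ * G y * e = 1) :
    ricci G y = (eᵀ * G y)ᵀ * ricTensor (frameCurv G y e) * (eᵀ * G y) :=
  ricci_of_curv (frame_inv he) he _ (frameCurv_expand he)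

variable {W : Set (R 4)} {G : R 4 → Matrix (Fin 4) (Fin 4) ℝ} {y : R 4}
  {e : Matrix (Fin 4) (Fin 4) ℝ}

lemma frame_inv_metric (he : eᵀ * G y * e = 1) : (G y)⁻¹ = e * eᵀ := by
  refine Matrix.inv_eq_left_inv ?_
  rw [Matrix.mul_assoc, frame_inv he]

lemma frame_coframe_transpose (hG : IsMetricOn W G) (hy : y ∈ W) : (eᵀ * G y)ᵀ = G y * e := by
  rw [Matrix.transpose_mul, Matrix.transpose_transpose, hG.symm y hy]

lemma isCurv_frameCurv (hG : IsMetricOn W G) (hy : y ∈ W)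
    (e : Matrix (Fin 4) (Fin 4) ℝ) : IsCurv (frameCurv G y e) where
  swap a b := by
    simp only [frameCurv]
    rw [Finset.sum_comm, ← Finset.sum_neg_distrib]
    refine Finset.sum_congr rfl fun i _ => ?_
    rw [← Finset.sum_neg_distrib]
    refine Finset.sum_congr rfl fun j _ => ?_
    rw [curv_swap, mul_comm (e j a)]
    simp
  skew a b := by
    simp only [frameCurv, Matrix.transpose_sum, Matrix.transpose_smul]
    rw [← Finset.sum_neg_distrib]
    refine Finset.sum_congr rfl fun i _ => ?_
    rw [← Finset.sum_neg_distrib]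
    refine Finset.sum_congr rfl fun j _ => ?_
    rw [← smul_neg]
    congr 1
    simp only [Matrix.transpose_mul, Matrix.transpose_transpose, hG.symm y hy]
    rw [Matrix.mul_assoc eᵀ (G y), hG.curv_chr_skew hy i j]
    simp [Matrix.mul_assoc]
  bianchi a b c d := by
    have hL : ∀ i j k, (eᵀ * G y * curv (chr G) i j y) d k + (eᵀ * G y * curv (chr G) j k y) d i
        + (eᵀ * G y * curv (chr G) k i y) d j = 0 := fun i j k => by
      simp only [Matrix.mul_apply (M := eᵀ * G y), ← Finset.sum_add_distrib, ← mul_add,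
        hG.curv_chr_bianchi hy, mul_zero, Finset.sum_const_zero]
    have hK : ∀ a b c, frameCurv G y e a b d c
        = ∑ i, ∑ j, ∑ k, e i a * e j b * e k c * (eᵀ * G y * curv (chr G) i j y) d k :=
      fun a b c => by
        simp only [frameCurv, Matrix.sum_apply, Matrix.smul_apply, smul_eq_mul,
          Matrix.mul_apply (N := e), Finset.mul_sum]
        refine Finset.sum_congr rfl fun i _ => Finset.sum_congr rfl fun j _ =>
          Finset.sum_congr rfl fun k _ => by ring
    have hc : ∀ f : Fin 4 → Fin 4 → Fin 4 → ℝ,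
        ∑ j, ∑ k, ∑ i, f j k i = ∑ i, ∑ j, ∑ k, f j k i := fun f =>
      (Finset.sum_congr rfl fun j _ => Finset.sum_comm).trans Finset.sum_comm
    rw [hK a b c, hK b c a, hK c a b]
    rw [hc fun j k i => e j b * e k c * e i a * (eᵀ * G y * curv (chr G) j k y) d i,
      ← hc fun i j k => e k c * e i a * e j b * (eᵀ * G y * curv (chr G) k i y) d j]
    simp only [← Finset.sum_add_distrib]
    refine Finset.sum_eq_zero fun i _ => Finset.sum_eq_zero fun j _ =>
      Finset.sum_eq_zero fun k _ => ?_
    linear_combination e i a * e j b * e k c * hL i j k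

variable (hG : IsMetricOn W G) (hy : y ∈ W)
  (he : eᵀ * G y * e = 1)
include hG hy he

lemma frame_coframe_mul : (eᵀ * G y)ᵀ * (eᵀ * G y) = G y := by
  rw [Matrix.transpose_mul, Matrix.transpose_transpose, hG.symm y hy, Matrix.mul_assoc,
    frame_inv he, Matrix.mul_one]

lemma scalar_eq_frame : scalar G y = 8 * (blockA (frameCurv G y e)).trace := by
  rw [← (isCurv_frameCurv hG hy e).trace_ricTensor, scalar, ricciOperator, ricci_eq_frame he,
    frame_inv_metric he, Matrix.trace_mul_comm, frame_coframe_transpose hG hy]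
  have h1 : G y * e * ricTensor (frameCurv G y e) * (eᵀ * G y) * (e * eᵀ)
      = (G y * e) * (ricTensor (frameCurv G y e) * eᵀ) := by
    have : eᵀ * G y * (e * eᵀ) = eᵀ := by rw [← Matrix.mul_assoc, he, Matrix.one_mul]
    rw [Matrix.mul_assoc _ _ (e * eᵀ), this, Matrix.mul_assoc]
  rw [h1, Matrix.trace_mul_comm, Matrix.mul_assoc, ← Matrix.mul_assoc eᵀ, he, Matrix.mul_one]

lemma ricciOperator_eq_frame :
    ricciOperator G y = e * ricTensor (frameCurv G y e) * (eᵀ * G y) := by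
  rw [ricciOperator, ricci_eq_frame he, frame_inv_metric he,
    frame_coframe_transpose hG hy]
  simp only [← Matrix.mul_assoc]
  rw [Matrix.mul_assoc e, Matrix.mul_assoc e, he, Matrix.mul_one]

/-- In the frame the Ricci tensor is a scalar matrix plus `mix (-2 B)`, and `mix` is injective with
traceless values. -/
lemma einstein_iff_blockB : ricci G y = (scalar G y / 4) • G y ↔ blockB (frameCurv G y e) = 0 := by
  have hK := isCurv_frameCurv hG hy e
  have hinv := frame_inv he
  rw [scalar_eq_frame hG hy he, ricci_eq_frame he, hK.ricTensor_eq]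
  constructor
  · intro h
    have h2 : (eᵀ * G y) * e = 1 := he
    have h3 : eᵀ * (eᵀ * G y)ᵀ = 1 := by rw [← Matrix.transpose_mul, h2, Matrix.transpose_one]
    have h4 := congrArg (fun M => eᵀ * M * e) h
    simp only [Matrix.mul_smul, Matrix.smul_mul, he] at h4
    have h6 : ∀ N, eᵀ * ((eᵀ * G y)ᵀ * N * (eᵀ * G y)) * e = N := fun N => by
      calc _ = (eᵀ * (eᵀ * G y)ᵀ) * N * (eᵀ * G y * e) := by simp only [Matrix.mul_assoc]
        _ = N := by rw [h2, h3, Matrix.one_mul, Matrix.mul_one]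
    rw [h6] at h4
    have h5 : mix ((-2 : ℝ) • blockB (frameCurv G y e)) = (0 : ℝ) • 1 := by
      refine add_left_cancel (a := (2 * (blockA (frameCurv G y e)).trace)
        • (1 : Matrix (Fin 4) (Fin 4) ℝ)) ?_
      rw [h4]; module
    have := eq_zero_of_mix h5
    simpa using this
  · intro h
    rw [h, smul_zero, mix_zero, add_zero, Matrix.mul_smul, Matrix.smul_mul, Matrix.mul_one,
      frame_coframe_mul hG hy he]
    congr 1; ring

/-- The Ricci operator is conjugate to `x + mix (-2 B)`, so the claim is about the rank of this
matrix minus a scalar one. -/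
lemma tripleEigenvalue_iff : (∃ μ : ℝ, 3 ≤ Module.finrank ℝ
      (Module.End.eigenspace (Matrix.toLin' (ricciOperator G y)) μ)) ↔
    ∃ l : ℝ, (blockB (frameCurv G y e))ᵀ * blockB (frameCurv G y e) = l • 1 := by
  have hK := isCurv_frameCurv hG hy e
  simp only [three_le_finrank_eigenspace_iff,
    rank_conj_sub (frame_inv he) (ricciOperator_eq_frame hG hy he), hK.ricTensor_eq]
  exact ⟨fun ⟨_, h⟩ => transpose_mul_self_of_rank h, fun ⟨_, h⟩ => exists_rank_le_one h _⟩

/-- Against a skew matrix the four Ricci terms of the Weyl tensor combine to an anticommutator and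
the two scalar terms to one. This is the form evaluated on self-dual matrices by `IsCurv.weyl_sd`.
-/
lemma sum_weyl (a : Matrix (Fin 4) (Fin 4) ℝ) (ha : aᵀ = -a) :
    (Matrix.of fun k l => ∑ i, ∑ j, weyl G k l i j y * (e * a * eᵀ) i j)
      = (eᵀ * G y)ᵀ * (∑ i, ∑ j, a i j • frameCurv G y e i j
        - (a * ricTensor (frameCurv G y e) + ricTensor (frameCurv G y e) * a)
        + ((ricTensor (frameCurv G y e)).trace / 3) • a) * (eᵀ * G y) := by
  have hK := isCurv_frameCurv hG hy e
  have hs : (e * a * eᵀ)ᵀ = -(e * a * eᵀ) := by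
    simp only [Matrix.transpose_mul, Matrix.transpose_transpose, ha, Matrix.mul_assoc,
      Matrix.neg_mul, Matrix.mul_neg]
  have hρ : (ricci G y)ᵀ = ricci G y := by
    have : (ricTensor (frameCurv G y e))ᵀ = ricTensor (frameCurv G y e) := by
      rw [hK.ricTensor_eq]
      ext i j
      fin_cases i <;> fin_cases j <;> simp [mix]
    rw [ricci_eq_frame he]
    simp only [Matrix.transpose_mul, Matrix.transpose_transpose, this, Matrix.mul_assoc]
  have h1 : ∑ i, ∑ j, (e * a * eᵀ) i j • (G y * curv (chr G) i j y)
      = (eᵀ * G y)ᵀ * (∑ i, ∑ j, a i j • frameCurv G y e i j) * (eᵀ * G y) := by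
    have h5 : ∀ M : Matrix (Fin 4) (Fin 4) ℝ, (eᵀ * G y)ᵀ * (eᵀ * M * e) * (eᵀ * G y) = M :=
      fun M => by
        calc _ = (e * (eᵀ * G y))ᵀ * M * (e * (eᵀ * G y)) := by
              simp only [Matrix.transpose_mul, Matrix.mul_assoc]
          _ = M := by rw [frame_inv he, Matrix.transpose_one, Matrix.one_mul, Matrix.mul_one]
    have h6 : ∑ i, ∑ j, a i j • frameCurv G y e i j
        = ∑ i, ∑ j, (e * a * eᵀ) i j • (eᵀ * (G y * curv (chr G) i j y) * e) := by
      simp only [frameCurv, Matrix.mul_apply (N := eᵀ), Matrix.mul_apply (N := a), Finset.sum_mul,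
        Finset.sum_smul, Finset.smul_sum, smul_smul, Matrix.transpose_apply]
      rw [sum_comm_four]
      refine Finset.sum_congr rfl fun i _ => Finset.sum_congr rfl fun j _ => ?_
      rw [Finset.sum_comm]
      refine Finset.sum_congr rfl fun p _ => Finset.sum_congr rfl fun q _ => ?_
      rw [← Matrix.mul_assoc eᵀ]
      congr 1; ring
    rw [h6]
    simp only [Matrix.mul_sum, Matrix.sum_mul, mul_smul_comm, smul_mul_assoc, h5]
  have h2 : (eᵀ * G y)ᵀ * a * (eᵀ * G y) = G y * (e * a * eᵀ) * G y := by
    rw [frame_coframe_transpose hG hy]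
    simp only [Matrix.mul_assoc]
  have h3 : (eᵀ * G y)ᵀ * (a * ricTensor (frameCurv G y e)) * (eᵀ * G y)
      = G y * (e * a * eᵀ) * ricci G y := by
    have : eᵀ * (eᵀ * G y)ᵀ = 1 := by rw [← Matrix.transpose_mul, he, Matrix.transpose_one]
    rw [ricci_eq_frame he, frame_coframe_transpose hG hy]
    rw [frame_coframe_transpose hG hy] at this
    calc _ = G y * e * a * 1 * ricTensor (frameCurv G y e) * (eᵀ * G y) := by
          simp only [Matrix.mul_assoc, Matrix.mul_one]
      _ = _ := by rw [← this]; simp only [Matrix.mul_assoc]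
  have h4 : (eᵀ * G y)ᵀ * (ricTensor (frameCurv G y e) * a) * (eᵀ * G y)
      = ricci G y * (e * a * eᵀ) * G y := by
    rw [ricci_eq_frame he]
    calc _ = (eᵀ * G y)ᵀ * (ricTensor (frameCurv G y e) * 1 * a) * (eᵀ * G y) := by
          rw [Matrix.mul_one]
      _ = _ := by rw [← he]; simp only [Matrix.mul_assoc]
  have hsc : scalar G y = (ricTensor (frameCurv G y e)).trace := by
    rw [scalar_eq_frame hG hy he, hK.trace_ricTensor]
  rw [Matrix.mul_add, Matrix.add_mul, Matrix.mul_sub, Matrix.sub_mul, Matrix.mul_add,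
    Matrix.add_mul, Matrix.mul_smul, Matrix.smul_mul, h2, h3, h4, ← h1, ← hsc]
  generalize e * a * eᵀ = b at *
  have hb : ∀ i j, b i j = - b j i := skew_apply hs
  have hρ' : ∀ i j, ricci G y i j = ricci G y j i := fun i j => (congrFun (congrFun hρ j) i)
  have hg : ∀ i j, G y i j = G y j i := fun i j => (congrFun (congrFun (hG.symm y hy) j) i)
  ext k l
  have e1 : ∀ i j, weyl G k l i j y = (G y * curv (chr G) i j y) k l
      - (1 / 2 : ℝ) * (G y k i * ricci G y l j - G y k j * ricci G y l i
      + G y l j * ricci G y k i - G y l i * ricci G y k j)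
      + scalar G y / 6 * (G y k i * G y l j - G y k j * G y l i) := fun i j => by
    simp only [weyl, riemann_eq_curv, Matrix.mul_apply]
  have b0 : ∀ i, b i i = 0 := skew_diag hs
  have b10 := hb 1 0
  have b20 := hb 2 0
  have b30 := hb 3 0
  have b21 := hb 2 1
  have b31 := hb 3 1
  have b32 := hb 3 2
  simp only [Matrix.of_apply, Matrix.add_apply, Matrix.sub_apply, Matrix.sum_apply,
    Matrix.smul_apply, smul_eq_mul, Matrix.mul_apply (N := G y), Matrix.mul_apply (N := ricci G y),
    Matrix.mul_apply (N := b), e1]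
  generalize scalar G y = s at *
  generalize hR : (fun i j => (G y * curv (chr G) i j y) k l) = T at *
  have hR' : ∀ i j, (G y * curv (chr G) i j y) k l = T i j := fun i j => by rw [← hR]
  simp only [hR', Fin.sum_univ_four]
  rw [hρ' 0 l, hρ' 1 l, hρ' 2 l, hρ' 3 l, hg 0 l, hg 1 l, hg 2 l, hg 3 l, b10, b20, b30, b21, b31,
    b32, b0, b0, b0, b0]
  ring

end FrameCurvature

/-! ### The Hodge star in negatively oriented frames -/

section HodgeStar

/-- The Hodge star of the Euclidean metric. -/
def starMat (b : Matrix (Fin 4) (Fin 4) ℝ) : Matrix (Fin 4) (Fin 4) ℝ :=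
  !![0, b 2 3, -b 1 3, b 1 2; -b 2 3, 0, b 0 3, -b 0 2; b 1 3, -b 0 3, 0, b 0 1;
    -b 1 2, b 0 2, -b 0 1, 0]

lemma starMat_so (p q : Fin 3 → ℝ) : starMat (so p q) = so p (-q) := by
  ext i j
  fin_cases i <;> fin_cases j <;> simp [starMat, so] <;> ring

lemma epsilon_eq (i j k l : Fin 4) : epsilon i j k l
    = Matrix.det (Matrix.of ![Pi.single i 1, Pi.single j 1, Pi.single k 1, Pi.single l 1]) := by
  unfold epsilon
  congr 1
  ext r s
  fin_cases r <;> simp [Pi.single_apply, eq_comm]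

lemma det_rows_four (v w x y : Fin 4 → ℝ) : Matrix.det (Matrix.of ![v, w, x, y])
    = v 0 * (w 1 * (x 2 * y 3 - x 3 * y 2) - w 2 * (x 1 * y 3 - x 3 * y 1)
        + w 3 * (x 1 * y 2 - x 2 * y 1))
      - v 1 * (w 0 * (x 2 * y 3 - x 3 * y 2) - w 2 * (x 0 * y 3 - x 3 * y 0)
        + w 3 * (x 0 * y 2 - x 2 * y 0))
      + v 2 * (w 0 * (x 1 * y 3 - x 3 * y 1) - w 1 * (x 0 * y 3 - x 3 * y 0)
        + w 3 * (x 0 * y 1 - x 1 * y 0))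
      - v 3 * (w 0 * (x 1 * y 2 - x 2 * y 1) - w 1 * (x 0 * y 2 - x 2 * y 0)
        + w 2 * (x 0 * y 1 - x 1 * y 0)) := by
  simp [Matrix.det_succ_row_zero, Fin.sum_univ_succ, Fin.succAbove]
  ring

lemma sum_epsilon (b : Matrix (Fin 4) (Fin 4) ℝ) (h : bᵀ = -b) (i j : Fin 4) :
    ∑ k, ∑ l, epsilon i j k l * b k l = 2 * starMat b i j := by
  have h10 := skew_apply h 1 0
  have h20 := skew_apply h 2 0
  have h30 := skew_apply h 3 0
  have h21 := skew_apply h 2 1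
  have h31 := skew_apply h 3 1
  have h32 := skew_apply h 3 2
  have h0 := skew_diag h
  simp only [epsilon_eq, det_rows_four, Fin.sum_univ_four, h0, h10, h20, h30, h21, h31, h32]
  generalize hv : (Pi.single i 1 : Fin 4 → ℝ) = v
  generalize hw : (Pi.single j 1 : Fin 4 → ℝ) = w
  simp
  subst hv hw
  fin_cases i <;> fin_cases j <;> simp [starMat] <;> ring

lemma hodgeStar_eq (G a : Matrix (Fin 4) (Fin 4) ℝ) (h : (G * a * G)ᵀ = -(G * a * G)) :
    hodgeStar G a = (Real.sqrt G.det)⁻¹ • starMat (G * a * G) := by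
  ext i j
  simp only [hodgeStar, Matrix.of_apply, Matrix.smul_apply, smul_eq_mul, sum_epsilon _ h]
  ring

/-- The star is contraction with the volume form, which `T` multiplies by its determinant. -/
lemma starMat_conj (T a : Matrix (Fin 4) (Fin 4) ℝ) (ha : aᵀ = -a) :
    T * starMat (Tᵀ * a * T) * Tᵀ = T.det • starMat a := by
  have h0 := skew_diag ha
  have h10 := skew_apply ha 1 0
  have h20 := skew_apply ha 2 0
  have h30 := skew_apply ha 3 0
  have h21 := skew_apply ha 2 1
  have h31 := skew_apply ha 3 1
  have h32 := skew_apply ha 3 2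
  have hT : ∀ i j, (Tᵀ * a * T) i j = a 0 1 * (T 0 i * T 1 j - T 1 i * T 0 j)
      + a 0 2 * (T 0 i * T 2 j - T 2 i * T 0 j) + a 0 3 * (T 0 i * T 3 j - T 3 i * T 0 j)
      + a 1 2 * (T 1 i * T 2 j - T 2 i * T 1 j) + a 1 3 * (T 1 i * T 3 j - T 3 i * T 1 j)
      + a 2 3 * (T 2 i * T 3 j - T 3 i * T 2 j) := fun i j => by
    simp only [Matrix.mul_apply, Matrix.transpose_apply, Fin.sum_univ_four, h0, h10, h20, h30, h21,
      h31, h32]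
    ring
  have hS : ∀ b : Matrix (Fin 4) (Fin 4) ℝ, ∀ i j, (T * starMat b * Tᵀ) i j
      = b 2 3 * (T i 0 * T j 1 - T i 1 * T j 0) - b 1 3 * (T i 0 * T j 2 - T i 2 * T j 0)
      + b 1 2 * (T i 0 * T j 3 - T i 3 * T j 0) + b 0 3 * (T i 1 * T j 2 - T i 2 * T j 1)
      - b 0 2 * (T i 1 * T j 3 - T i 3 * T j 1) + b 0 1 * (T i 2 * T j 3 - T i 3 * T j 2) :=
    fun b i j => by
      simp only [Matrix.mul_apply, Matrix.transpose_apply, Fin.sum_univ_four]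
      simp [starMat]
      ring
  have hd : T.det = Matrix.det (Matrix.of ![T 0, T 1, T 2, T 3]) := by
    congr 1
    ext i j
    fin_cases i <;> rfl
  ext i j
  rw [hS, Matrix.smul_apply, hd, det_rows_four]
  simp only [hT, smul_eq_mul]
  fin_cases i <;> fin_cases j <;> simp [starMat] <;> ring

/-- Orthonormality gives `det G = (det e)⁻²`, and the sign is the negative orientation of `e`. This
sign is the reason why `∗a = -a` on `M` becomes the self-dual condition in the frame. -/
lemma sqrt_det_inv {G e : Matrix (Fin 4) (Fin 4) ℝ} (he : eᵀ * G * e = 1) (hd : e.det < 0) :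
    (Real.sqrt G.det)⁻¹ = - e.det := by
  have h := congrArg Matrix.det he
  rw [Matrix.det_mul, Matrix.det_mul, Matrix.det_transpose, Matrix.det_one] at h
  have h1 : G.det = (-e.det)⁻¹ ^ 2 := by
    rw [inv_pow, neg_sq]
    refine eq_inv_of_mul_eq_one_left ?_
    linarith
  rw [h1, Real.sqrt_sq (by simpa using hd.le), inv_inv]

/-- Two-vectors with `∗a = -a` in a negatively oriented orthonormal frame. -/
lemma hodgeStar_eq_neg_iff {W : Set (R 4)} {G : R 4 → Matrix (Fin 4) (Fin 4) ℝ} {y : R 4}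
    {e : Matrix (Fin 4) (Fin 4) ℝ} (hG : IsMetricOn W G) (hy : y ∈ W) (he : eᵀ * G y * e = 1)
    (hd : e.det < 0) (p q : Fin 3 → ℝ) :
    hodgeStar (G y) (e * so p q * eᵀ) = -(e * so p q * eᵀ) ↔ q = 0 := by
  have hs := so_transpose p q
  have h1 : G y * (e * so p q * eᵀ) * G y = (eᵀ * G y)ᵀ * so p q * (eᵀ * G y) := by
    rw [frame_coframe_transpose hG hy]; simp only [Matrix.mul_assoc]
  have h2 : (G y * (e * so p q * eᵀ) * G y)ᵀ = -(G y * (e * so p q * eᵀ) * G y) := by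
    rw [h1]
    simp only [Matrix.transpose_mul, Matrix.transpose_transpose, hs, Matrix.mul_assoc,
      Matrix.neg_mul, Matrix.mul_neg]
  have h3 : e.det * (eᵀ * G y).det = 1 := by rw [← Matrix.det_mul, frame_inv he, Matrix.det_one]
  have h4 : e * (((eᵀ * G y).det) • starMat (so p q)) * eᵀ
      = starMat ((eᵀ * G y)ᵀ * so p q * (eᵀ * G y)) := by
    rw [← starMat_conj _ _ hs]
    have h5 : ∀ M : Matrix (Fin 4) (Fin 4) ℝ, e * ((eᵀ * G y) * M * (eᵀ * G y)ᵀ) * eᵀ = M :=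
      fun M => by
        calc _ = (e * (eᵀ * G y)) * M * (e * (eᵀ * G y))ᵀ := by
              simp only [Matrix.transpose_mul, Matrix.mul_assoc]
          _ = M := by rw [frame_inv he, Matrix.transpose_one, Matrix.one_mul, Matrix.mul_one]
    exact h5 _
  rw [hodgeStar_eq _ _ h2, h1, ← h4, sqrt_det_inv he hd, starMat_so, Matrix.mul_smul,
    Matrix.smul_mul, smul_smul, neg_mul, h3, neg_one_smul, neg_inj]
  constructor
  · intro h
    have h6 : so p (-q) = so p q := by
      have h7 := congrArg (fun M => (eᵀ * G y) * M * (eᵀ * G y)ᵀ) h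
      have h5 : ∀ M : Matrix (Fin 4) (Fin 4) ℝ, (eᵀ * G y) * (e * M * eᵀ) * (eᵀ * G y)ᵀ = M :=
        fun M => by
          calc _ = (eᵀ * G y * e) * M * (eᵀ * G y * e)ᵀ := by
                simp only [Matrix.transpose_mul, Matrix.mul_assoc]
            _ = M := by rw [he, Matrix.transpose_one, Matrix.one_mul, Matrix.mul_one]
      simpa only [h5] using h7
    have h8 := congrArg asdPart h6
    rw [asdPart_so, asdPart_so] at h8
    ext c
    have := congrFun h8 c
    simp at this
    simp; linarith
  · rintro rfl
    rw [neg_zero]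

/-- `𝒲₋ = 0` in terms of the self-dual block of the curvature in a negatively oriented frame. -/
theorem weylMinusZeroAt_iff {W : Set (R 4)} {G : R 4 → Matrix (Fin 4) (Fin 4) ℝ} {y : R 4}
    {e : Matrix (Fin 4) (Fin 4) ℝ} (hG : IsMetricOn W G) (hy : y ∈ W) (he : eᵀ * G y * e = 1)
    (hd : e.det < 0) : WeylMinusZeroAt G y ↔
      blockA (frameCurv G y e) = ((blockA (frameCurv G y e)).trace / 3) • 1 := by
  have hK := isCurv_frameCurv hG hy e
  have key : ∀ p, (∀ k l, ∑ i, ∑ j, weyl G k l i j y * (e * so p 0 * eᵀ) i j = 0) ↔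
      blockA (frameCurv G y e) *ᵥ p = ((blockA (frameCurv G y e)).trace / 3) • p := fun p => by
    have h1 := sum_weyl hG hy he (so p 0) (so_transpose p 0)
    rw [hK.weyl_sd] at h1
    have h2 : (∀ k l, ∑ i, ∑ j, weyl G k l i j y * (e * so p 0 * eᵀ) i j = 0) ↔
        (eᵀ * G y)ᵀ * so (4 • (blockA (frameCurv G y e) *ᵥ p)
          - (4 / 3 * (blockA (frameCurv G y e)).trace) • p) 0 * (eᵀ * G y) = 0 := by
      rw [← h1]
      exact ⟨fun h => Matrix.ext h, fun h k l => congrFun (congrFun h k) l⟩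
    rw [h2]
    constructor
    · intro h
      have h5 : ∀ M : Matrix (Fin 4) (Fin 4) ℝ, eᵀ * ((eᵀ * G y)ᵀ * M * (eᵀ * G y)) * e = M :=
        fun M => by
          calc _ = (eᵀ * G y * e)ᵀ * M * (eᵀ * G y * e) := by
                simp only [Matrix.transpose_mul, Matrix.mul_assoc]
            _ = M := by rw [he, Matrix.transpose_one, Matrix.one_mul, Matrix.mul_one]
      have h6 := congrArg (fun M => sdPart (eᵀ * M * e)) h
      simp only [h5, sdPart_so, Matrix.mul_zero, Matrix.zero_mul] at h6
      ext a
      have h7 := congrFun h6 a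
      simp [sdPart] at h7
      have : ∀ a : Fin 3, ![(0 : ℝ), 0, 0] a = 0 := fun a => by fin_cases a <;> rfl
      simp [this] at h7
      simp; linarith
    · intro h
      have : 4 • (blockA (frameCurv G y e) *ᵥ p)
          - (4 / 3 * (blockA (frameCurv G y e)).trace) • p = 0 := by
        rw [h]; module
      rw [this, show so (0 : Fin 3 → ℝ) 0 = 0 by
        ext i j; fin_cases i <;> fin_cases j <;> simp [so]]
      simp
  constructor
  · intro h
    have h1 : ∀ p, blockA (frameCurv G y e) *ᵥ p
        = ((blockA (frameCurv G y e)).trace / 3) • p := fun p => by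
      refine (key p).1 (h _ ?_ ((hodgeStar_eq_neg_iff hG hy he hd p 0).2 rfl))
      simp only [Matrix.transpose_mul, Matrix.transpose_transpose, so_transpose, Matrix.mul_assoc,
        Matrix.neg_mul, Matrix.mul_neg]
    ext i j
    have := congrFun (h1 (Pi.single j 1)) i
    simpa [Matrix.one_apply, Pi.single_apply, eq_comm] using this
  · intro h a ha hs
    obtain ⟨p, q, rfl⟩ : ∃ p q, a = e * so p q * eᵀ := by
      have hb : ((eᵀ * G y) * a * (eᵀ * G y)ᵀ)ᵀ = -((eᵀ * G y) * a * (eᵀ * G y)ᵀ) := by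
        simp only [Matrix.transpose_mul, Matrix.transpose_transpose, ha, Matrix.mul_assoc,
          Matrix.neg_mul, Matrix.mul_neg]
      refine ⟨sdPart ((eᵀ * G y) * a * (eᵀ * G y)ᵀ), asdPart ((eᵀ * G y) * a * (eᵀ * G y)ᵀ), ?_⟩
      rw [← eq_so hb]
      calc a = (e * (eᵀ * G y)) * a * (e * (eᵀ * G y))ᵀ := by
            rw [frame_inv he, Matrix.transpose_one, Matrix.one_mul, Matrix.mul_one]
        _ = _ := by simp only [Matrix.transpose_mul, Matrix.mul_assoc]
    have hq := (hodgeStar_eq_neg_iff hG hy he hd p q).1 hs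
    subst hq
    refine (key p).2 ?_
    conv_lhs => rw [h]
    rw [Matrix.smul_mulVec, Matrix.one_mulVec]

end HodgeStar


/-! ### Consequences of the second Bianchi identity -/

section Divergence

/-- A self-dual two-form is its own star, so the cyclic sum of derivatives and the divergence have
the same four components up to sign. The anti-self-dual version differs only in sign. -/
lemma div_of_cyclic_sd {q : Fin 4 → Fin 3 → ℝ}
    (h : ∀ p a b, so (q p) 0 a b + so (q a) 0 b p + so (q b) 0 p a = 0) (j : Fin 4) :
    ∑ p, so (q p) 0 p j = 0 := by
  have h1 := h 0 1 2
  have h2 := h 0 1 3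
  have h3 := h 0 2 3
  have h4 := h 1 2 3
  simp [so] at h1 h2 h3 h4
  fin_cases j <;> simp [so, Fin.sum_univ_four] <;> linarith

lemma div_of_cyclic_asd {q : Fin 4 → Fin 3 → ℝ}
    (h : ∀ p a b, so 0 (q p) a b + so 0 (q a) b p + so 0 (q b) p a = 0) (j : Fin 4) :
    ∑ p, so 0 (q p) p j = 0 := by
  have h1 := h 0 1 2
  have h2 := h 0 1 3
  have h3 := h 0 2 3
  have h4 := h 1 2 3
  simp [so] at h1 h2 h3 h4
  fin_cases j <;> simp [so, Fin.sum_univ_four] <;> linarith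

lemma asdPart_sub (M N : Matrix (Fin 4) (Fin 4) ℝ) :
    asdPart (M - N) = asdPart M - asdPart N := by
  rw [sub_eq_add_neg, asdPart_add, asdPart_neg, sub_eq_add_neg]

lemma asdPart_bracket_of_asd_zero {M N : Matrix (Fin 4) (Fin 4) ℝ} (hM : Mᵀ = -M) (hN : Nᵀ = -N)
    (h : asdPart N = 0) : asdPart (M * N - N * M) = 0 := by
  rw [eq_so hM, eq_so hN, so_bracket, asdPart_so, h]
  ext b
  simp

end Divergence

/-! ### Rigidity of symmetric endomorphisms of the three-dimensional bundle -/

section SymmetricThree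

/-- The cross product with `2 w`. -/
def crossMat (w : Fin 3 → ℝ) : Matrix (Fin 3) (Fin 3) ℝ :=
  !![0, -(2 * w 2), 2 * w 1; 2 * w 2, 0, -(2 * w 0); -(2 * w 1), 2 * w 0, 0]

lemma crossMat_add (v w : Fin 3 → ℝ) : crossMat (v + w) = crossMat v + crossMat w := by
  ext i j
  fin_cases i <;> fin_cases j <;> simp [crossMat] <;> ring

lemma crossMat_sub (v w : Fin 3 → ℝ) : crossMat (v - w) = crossMat v - crossMat w := by
  ext i j
  fin_cases i <;> fin_cases j <;> simp [crossMat] <;> ring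

lemma crossMat_smul (c : ℝ) (w : Fin 3 → ℝ) : crossMat (c • w) = c • crossMat w := by
  ext i j
  fin_cases i <;> fin_cases j <;> simp [crossMat] <;> ring

lemma crossMat_sum {ι : Type*} (s : Finset ι) (w : ι → Fin 3 → ℝ) :
    crossMat (∑ i ∈ s, w i) = ∑ i ∈ s, crossMat (w i) := by
  classical
  induction s using Finset.induction_on with
  | empty => ext i j; fin_cases i <;> fin_cases j <;> simp [crossMat]
  | insert a s ha ih => rw [Finset.sum_insert ha, Finset.sum_insert ha, crossMat_add, ih]

lemma crossMat_transpose (w : Fin 3 → ℝ) : (crossMat w)ᵀ = - crossMat w := by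
  ext i j
  fin_cases i <;> fin_cases j <;> simp [crossMat]

lemma crossMat_bracket (v w : Fin 3 → ℝ) : crossMat v * crossMat w - crossMat w * crossMat v
    = crossMat (fun b => 2 * (v (b + 1) * w (b + 2) - v (b + 2) * w (b + 1))) := by
  ext i j
  fin_cases i <;> fin_cases j <;> simp [crossMat] <;> ring

/-- Multiply the `b`-th divergence by `I_b` and sum over `b`: as `v p` is symmetric, the products of
different units cancel, and `I_b² = -1` leaves minus the trace. -/
lemma trace_eq_zero_of_div {v : Fin 4 → Matrix (Fin 3) (Fin 3) ℝ} (hv : ∀ p, (v p)ᵀ = v p)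
    (hdiv : ∀ b j, ∑ p, so (fun c => v p c b) 0 p j = 0) (p : Fin 4) : (v p).trace = 0 := by
  have hs : ∀ p i j, v p i j = v p j i := fun p i j => congrFun (congrFun (hv p) j) i
  have a := hdiv 0
  have b := hdiv 1
  have c := hdiv 2
  have e1 := fun p => hs p 1 0
  have e2 := fun p => hs p 2 0
  have e3 := fun p => hs p 2 1
  have a0 := a 0
  have a1 := a 1
  have a2 := a 2
  have a3 := a 3
  have b0 := b 0
  have b1 := b 1
  have b2 := b 2
  have b3 := b 3
  have c0 := c 0
  have c1 := c 1
  have c2 := c 2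
  have c3 := c 3
  simp [so, Fin.sum_univ_four, e1, e2, e3] at a0 a1 a2 a3 b0 b1 b2 b3 c0 c1 c2 c3
  rw [Matrix.trace, Fin.sum_univ_three]
  fin_cases p <;> simp <;> linarith

/-- The cross products generate the irreducible representation of `so(3)` on `ℝ³`; the first two
axes already suffice. -/
lemma isScalar_of_comm_cross {A : Matrix (Fin 3) (Fin 3) ℝ}
    (h : ∀ x, A * crossMat x = crossMat x * A) : A = A 0 0 • 1 := by
  have h0 := h ![1, 0, 0]
  have h1 := h ![0, 1, 0]
  have e0 := fun i j => congrFun (congrFun h0 i) j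
  have e1 := fun i j => congrFun (congrFun h1 i) j
  have a1 := e0 0 1
  have a2 := e0 0 2
  have a3 := e0 1 0
  have a4 := e0 2 0
  have a5 := e0 1 2
  have b1 := e1 0 1
  have b2 := e1 2 1
  have b3 := e1 1 0
  have b4 := e1 1 2
  have b5 := e1 0 2
  have b6 := e1 2 0
  simp [crossMat, Matrix.mul_apply, Fin.sum_univ_three] at a1 a2 a3 a4 a5 b1 b2 b3 b4 b5 b6
  ext i j
  fin_cases i <;> fin_cases j <;> simp <;> linarith

lemma cayley_three (A : Matrix (Fin 3) (Fin 3) ℝ) : A * A * A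
    = A.trace • (A * A) - ((A.trace ^ 2 - (A * A).trace) / 2) • A + A.det • 1 := by
  ext i j
  fin_cases i <;> fin_cases j <;>
    simp [Matrix.mul_apply, Matrix.trace, Matrix.det_fin_three, Fin.sum_univ_three] <;> ring

/-- Substituting `A² = l` in the Cayley–Hamilton identity leaves a linear relation for `A`. Since
`A` is not scalar its leading coefficient `(tr² A - l)/2` must vanish. In the diagonalisable case
the eigenvalues are `a, a, -a`. -/
lemma sq_eq_trace_sq {A : Matrix (Fin 3) (Fin 3) ℝ} {l : ℝ} (h : A * A = l • 1)
    (hA : A ≠ A 0 0 • 1) : l = A.trace ^ 2 := by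
  by_contra hl
  have h1 := cayley_three A
  have ht : (l • (1 : Matrix (Fin 3) (Fin 3) ℝ)).trace = 3 * l := by
    rw [Matrix.trace_smul, Matrix.trace_one]; simp; ring
  rw [h, ht, Matrix.smul_mul, Matrix.one_mul] at h1
  have h2 : ((A.trace ^ 2 - l) / 2) • A = (A.trace * l + A.det) • 1 := by
    have : ((A.trace ^ 2 - l) / 2) • A = l • A + ((A.trace ^ 2 - 3 * l) / 2) • A := by module
    rw [this, h1]; module
  have hne : (A.trace ^ 2 - l) / 2 ≠ 0 := by
    intro h0; exact hl (by linarith)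
  have h3 : A = (((A.trace ^ 2 - l) / 2)⁻¹ * (A.trace * l + A.det)) • 1 := by
    rw [mul_smul, ← h2, smul_smul, inv_mul_cancel₀ hne, one_smul]
  have h4 : A 0 0 = ((A.trace ^ 2 - l) / 2)⁻¹ * (A.trace * l + A.det) := by
    conv_lhs => rw [h3]
    simp
  exact hA (by rw [h4]; exact h3)

/-- The algebraic part of the rigidity of a rank one projector with vanishing divergence. -/
lemma eq_zero_of_div {A : Matrix (Fin 3) (Fin 3) ℝ} {a : ℝ} (hA : Aᵀ = A) (ha : a ≠ 0)
    (hsq : A * A = a ^ 2 • 1) (htr : A.trace = a) {v : Fin 4 → Matrix (Fin 3) (Fin 3) ℝ}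
    (hv : ∀ p, (v p)ᵀ = v p) (hAv : ∀ p, A * v p + v p * A = 0)
    (hdiv : ∀ b j, ∑ p, so (fun c => v p c b) 0 p j = 0) (p : Fin 4) : v p = 0 := by
  -- `P` projects to the eigenspace of `-a`. Its trace is one, so `P` has rank one, and
  -- anticommutation of `v p` with `A` becomes `P v + v P = v`.
  set P : Matrix (Fin 3) (Fin 3) ℝ := (1 / 2 : ℝ) • (1 - a⁻¹ • A) with hP
  have hPt : Pᵀ = P := by rw [hP, Matrix.transpose_smul, Matrix.transpose_sub,
    Matrix.transpose_smul, hA, Matrix.transpose_one]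
  have hPP : P * P = P := by
    have : (1 - a⁻¹ • A) * (1 - a⁻¹ • A) = (2 : ℝ) • (1 - a⁻¹ • A) := by
      rw [Matrix.sub_mul, Matrix.mul_sub, Matrix.mul_sub]
      simp only [Matrix.mul_smul, Matrix.smul_mul, hsq, Matrix.one_mul, Matrix.mul_one, smul_smul]
      have : a⁻¹ * (a⁻¹ * a ^ 2) = 1 := by field_simp
      rw [this]; module
    rw [hP, Matrix.mul_smul, Matrix.smul_mul, this, smul_smul, smul_smul]; norm_num
  have hPtr : P.trace = 1 := by
    rw [hP, Matrix.trace_smul, Matrix.trace_sub, Matrix.trace_smul, htr, Matrix.trace_one]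
    simp [inv_mul_cancel₀ ha]; norm_num
  have hPv : ∀ p, P * v p + v p * P = v p := fun p => by
    have : P * v p + v p * P = v p - ((1 / 2 : ℝ) * a⁻¹) • (A * v p + v p * A) := by
      rw [hP]
      simp only [Matrix.smul_mul, Matrix.mul_smul, Matrix.sub_mul, Matrix.mul_sub, Matrix.one_mul,
        Matrix.mul_one]
      module
    rw [this, hAv, smul_zero, sub_zero]
  obtain ⟨k, n, hn⟩ := exists_vecMulVec hPt
    (rank_le_one_of_sq one_ne_zero (by rw [hPP, one_smul]) hPtr)
  -- All rows of `P` are multiples of one vector `n`, so these matrices are multiples of a single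
  -- imaginary quaternion, whose square is scalar; `P² = P` determines the scalar.
  have hN : ∀ g e, so (fun f => P f g) 0 * so (fun f => P f e) 0 = (-P g e) • 1 := fun g e => by
    have h1 : P g e = ∑ f, P f g * P f e := by
      conv_lhs => rw [← hPP, Matrix.mul_apply]
      exact Finset.sum_congr rfl fun f _ => by rw [show P g f = P f g by rw [hn, hn]; ring]
    rw [h1]
    simp only [hn, Fin.sum_univ_three]
    ext i j
    fin_cases i <;> fin_cases j <;> simp [so, Matrix.mul_apply, Fin.sum_univ_four] <;> ring
  -- Since `P v = v (1 - P)`, the divergence of `P v` is a combination of the divergences of the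
  -- columns of `v`, hence zero.
  have h1 : ∀ d j, ∑ e, ∑ p, v p e d * so (fun f => P f e) 0 p j = 0 := fun d j => by
    obtain ⟨r, hr⟩ : ∃ r : Fin 3 → ℝ, ∀ b, r b = (if b = d then 1 else 0) - P b d := ⟨_, fun _ => rfl⟩
    have h2 : ∀ p c, ∑ e, P c e * v p e d = ∑ b, r b * v p c b := fun p c => by
      have := congrFun (congrFun (hPv p) c) d
      simp only [Matrix.add_apply, Matrix.mul_apply] at this
      simp only [hr, sub_mul, ite_mul, one_mul, zero_mul, Finset.sum_sub_distrib,
        Finset.sum_ite_eq', Finset.mem_univ, if_true, mul_comm (P _ d)]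
      linarith
    have h3 : ∑ b, r b * ∑ p, so (fun c => v p c b) 0 p j = 0 := by
      simp [hdiv]
    have h4 : ∀ p, ∑ e, v p e d * so (fun f => P f e) 0 p j
        = so (fun c => ∑ e, P c e * v p e d) 0 p j := fun p => by
      fin_cases p <;> fin_cases j <;> simp [so, Fin.sum_univ_three] <;> ring
    have h5 : ∀ p, so (fun c => ∑ e, P c e * v p e d) 0 p j
        = ∑ b, r b * so (fun c => v p c b) 0 p j := fun p => by
      simp only [h2]
      fin_cases p <;> fin_cases j <;> simp [so, Fin.sum_univ_three]
    rw [Finset.sum_comm, ← h3]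
    simp only [h4, h5, Finset.mul_sum]
    rw [Finset.sum_comm]
  -- Multiplying the vanishing divergence by the quaternion of row `g` inverts the single quaternion
  -- occurring in it, up to scalars. Then `P v = 0`, and its transpose gives `v P = 0`.
  have h6 : ∀ p, P * v p = 0 := fun p => by
    ext g d
    have h7 : ∑ j, (∑ e, ∑ p, v p e d * so (fun f => P f e) 0 p j) * so (fun f => P f g) 0 j p = 0 := by
      simp [h1]
    have h8 : ∀ e q, ∑ j, so (fun f => P f e) 0 q j * so (fun f => P f g) 0 j p
        = (-P e g) * (if q = p then 1 else 0) := fun e q => by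
      rw [← Matrix.mul_apply, hN, Matrix.smul_apply, Matrix.one_apply, smul_eq_mul]
    have h9 : ∑ j, (∑ e, ∑ p, v p e d * so (fun f => P f e) 0 p j) * so (fun f => P f g) 0 j p
        = ∑ e, ∑ q, v q e d * ∑ j, so (fun f => P f e) 0 q j * so (fun f => P f g) 0 j p := by
      simp only [Finset.sum_mul, Finset.mul_sum]
      rw [Finset.sum_comm]
      refine Finset.sum_congr rfl fun e _ => ?_
      rw [Finset.sum_comm]
      refine Finset.sum_congr rfl fun q _ => Finset.sum_congr rfl fun j _ => by ring
    rw [h9] at h7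
    simp only [h8] at h7
    simp at h7
    rw [Matrix.mul_apply, Matrix.zero_apply, ← h7]
    refine Finset.sum_congr rfl fun e _ => ?_
    rw [show P g e = P e g by rw [hn, hn]; ring, mul_comm]
  have h10 : v p * P = 0 := by
    have := congrArg Matrix.transpose (h6 p)
    rwa [Matrix.transpose_mul, hPt, hv, Matrix.transpose_zero] at this
  rw [← hPv p, h6, h10, add_zero]

end SymmetricThree

/-! ### The covariant derivative of the self-dual curvature block -/

section SelfDualBlock

variable {m : ℕ} {V : Set (R m)} {u : R m} {θ : R m → Matrix (Fin 4) (Fin m) ℝ}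
  {ϖ : Fin m → R m → Matrix (Fin 4) (Fin 4) ℝ}
  {K : Fin 4 → Fin 4 → R m → Matrix (Fin 4) (Fin 4) ℝ}

lemma blockA_apply (c b : Fin 3) (w : R m) :
    blockA (fun i j => K i j w) c b = sdPart (sdCurv K b w) c := rfl

namespace MovingFrame

variable (hF : MovingFrame V θ ϖ K)
include hF

lemma smooth_blockA : MSmooth V (fun w => blockA (fun i j => K i j w)) := fun c b =>
  (hF.smooth_sdCurv b).sdPart c

/-- The bracket with `ϖ` rotates the form index `c` and the remaining terms of `covCurv` rotate the
index `b`, both by `crossMat`. Together they are the covariant derivative of an endomorphism. -/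
lemma sdPart_covCurv (hskew : ∀ b, (sdCurv K b u)ᵀ = - sdCurv K b u) (hu : u ∈ V) (b c : Fin 3)
    (k : Fin m) : sdPart (covCurv ϖ K b k u) c
      = (mpd (fun w => blockA (fun i j => K i j w)) k u
        + crossMat (fun b => sdForm ϖ u b k) * blockA (fun i j => K i j u)
        - blockA (fun i j => K i j u) * crossMat (fun b => sdForm ϖ u b k)) c b := by
  have h1 : mpd (fun w => blockA (fun i j => K i j w)) k u c b
      = sdPart (mpd (sdCurv K b) k u) c :=
    pd_sdPart hF.isOpen hu (hF.smooth_sdCurv b) c k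
  have h2 := sdPart_bracket (hF.skew u hu k) (hskew b) c
  simp only [covCurv, sdPart_add, sdPart_sub, sdPart_smul, Pi.add_apply, Pi.sub_apply,
    Pi.smul_apply, smul_eq_mul, Matrix.add_apply, Matrix.sub_apply, h1, Matrix.mul_apply,
    blockA_apply, Fin.sum_univ_three]
  rw [sdPart_sub] at h2
  simp only [Pi.sub_apply] at h2
  rw [h2]
  have hw : ∀ c, sdPart (ϖ k u) c = sdForm ϖ u c k := fun _ => rfl
  simp only [hw, crossMat]
  fin_cases b <;> fin_cases c <;> simp <;> ring

/-- As `B` vanishes on the whole open set, each `F_b` stays self-dual there, and so does its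
derivative; brackets with the connection preserve the splitting. -/
lemma asdPart_covCurv (hskew : ∀ w ∈ V, ∀ b, (sdCurv K b w)ᵀ = - sdCurv K b w) (hu : u ∈ V)
    (hB : ∀ w ∈ V, blockB (fun i j => K i j w) = 0) (b : Fin 3) (k : Fin m) :
    asdPart (covCurv ϖ K b k u) = 0 := by
  have hz : ∀ w ∈ V, ∀ b, asdPart (sdCurv K b w) = 0 := fun w hw b => by
    ext c
    exact congrFun (congrFun (hB w hw) c) b
  have h1 : asdPart (mpd (sdCurv K b) k u) = 0 := by
    have h2 : mpd (sdCurv K b) k u = mpd (fun w => so (sdPart (sdCurv K b w)) 0) k u :=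
      mpd_congr hF.isOpen (fun w hw => by rw [← hz w hw b]; exact eq_so (hskew w hw b)) hu k
    have hd : ∀ c, DifferentiableAt ℝ (fun w => sdPart (sdCurv K b w) c) u := fun c =>
      differentiableAt_of_smooth hF.isOpen ((hF.smooth_sdCurv b).sdPart c) hu
    rw [h2]
    have e : ∀ i j, mpd (fun w => so (sdPart (sdCurv K b w)) 0) k u i j
        = so (fun c => pd (fun w => sdPart (sdCurv K b w) c) k u) 0 i j := fun i j => by
      rw [mpd_apply]
      fin_cases i <;> fin_cases j <;> simp [so, pd_const, pd_neg]
    rw [Matrix.ext e, asdPart_so]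
  simp only [covCurv, asdPart_add, asdPart_smul, h1,
    asdPart_bracket_of_asd_zero (hF.skew u hu k) (hskew u hu b) (hz u hu b)]
  simp [asdPart_sub, asdPart_smul, hz u hu]

lemma covDir_eq_so (hskew : ∀ w ∈ V, ∀ b, (sdCurv K b w)ᵀ = - sdCurv K b w) (hu : u ∈ V)
    (X : Matrix (Fin m) (Fin 4) ℝ) (b : Fin 3) (p : Fin 4) :
    covDir ϖ K X b p u = so (sdPart (covDir ϖ K X b p u)) (asdPart (covDir ϖ K X b p u)) := by
  refine eq_so ?_
  simp only [covDir, Matrix.transpose_sum, Matrix.transpose_smul, hF.covCurv_skew hskew hu,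
    smul_neg, Finset.sum_neg_distrib]

/-- If the self-dual block is a multiple of the identity, then the derivative of the curvature is
given by the derivative of the factor. -/
lemma sdPart_covDir_of_scalar {α : R m → ℝ} (hskew : ∀ w ∈ V, ∀ b, (sdCurv K b w)ᵀ = - sdCurv K b w)
    (hu : u ∈ V) (hA : ∀ w ∈ V, blockA (fun i j => K i j w) = α w • 1)
    (X : Matrix (Fin m) (Fin 4) ℝ) (b : Fin 3) (p : Fin 4) :
    sdPart (covDir ϖ K X b p u) = (∑ j, X j p * pd α j u) • Pi.single b 1 := by
  have hd : ∀ k, mpd (fun w => blockA (fun i j => K i j w)) k u = pd α k u • 1 := fun k => by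
    rw [mpd_congr hF.isOpen hA hu]
    ext i j
    rw [mpd_apply]
    by_cases h : i = j
    · subst h; simp
    · simp [Matrix.one_apply_ne h, pd_const]
  have h1 : ∀ k, sdPart (covCurv ϖ K b k u) = pd α k u • Pi.single b 1 := fun k => by
    ext c
    rw [hF.sdPart_covCurv (hskew u hu) hu, hd, hA u hu]
    simp [Matrix.one_apply, Pi.single_apply]
  simp only [covDir, sdPart_sum, sdPart_smul, h1, Finset.sum_smul, smul_smul]

/-- Schur's lemma. -/
theorem schur {α : R m → ℝ} (hskew : ∀ w ∈ V, ∀ b, (sdCurv K b w)ᵀ = - sdCurv K b w)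
    (hu : u ∈ V) (hA : ∀ w ∈ V, blockA (fun i j => K i j w) = α w • 1)
    (hB : ∀ w ∈ V, blockB (fun i j => K i j w) = 0) {X : Matrix (Fin m) (Fin 4) ℝ}
    (hX : θ u * X = 1) (hX' : X * θ u = 1) (k : Fin m) : pd α k u = 0 := by
  have h1 : ∀ p, covDir ϖ K X 0 p u = so ((∑ j, X j p * pd α j u) • Pi.single 0 1) 0 := fun p => by
    rw [hF.covDir_eq_so hskew hu, hF.sdPart_covDir_of_scalar hskew hu hA]
    congr 1
    have : ∀ k, asdPart (covCurv ϖ K 0 k u) = 0 := hF.asdPart_covCurv hskew hu hB 0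
    simp [covDir, asdPart_sum, asdPart_smul, this]
  have h2 := hF.covDir_bianchi (hskew u hu) hu hX 0
  simp only [h1] at h2
  generalize hv : (fun p => ∑ j, X j p * pd α j u) = v at h2
  have hv' : ∀ p, ∑ j, X j p * pd α j u = v p := fun p => by rw [← hv]
  simp only [hv'] at h2
  -- The derivative of `F₀` in direction `p` is `v p` times `sdBasis 0`, so each of these four index
  -- triples leaves a single component of `v`.
  have a1 := h2 2 1 0
  have a2 := h2 3 1 0
  have a3 := h2 0 3 2
  have a4 := h2 1 3 2
  simp [so] at a1 a2 a3 a4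
  have hz : v = 0 := by ext p; fin_cases p <;> assumption
  have h3 : (fun k => pd α k u) ᵥ* X = 0 := by
    rw [← hz, ← hv]; ext p; simp [Matrix.vecMul, dotProduct, mul_comm]
  have h4 : (fun k => pd α k u) ᵥ* X ᵥ* θ u = 0 := by rw [h3, Matrix.zero_vecMul]
  rw [Matrix.vecMul_vecMul, hX', Matrix.vecMul_one] at h4
  exact congrFun h4 k

lemma mono {V' : Set (R m)} (hV' : IsOpen V') (h : V' ⊆ V) : MovingFrame V' θ ϖ K where
  isOpen := hV'
  smooth_coframe := hF.smooth_coframe.mono h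
  smooth_form k := (hF.smooth_form k).mono h
  smooth_curv i j := (hF.smooth_curv i j).mono h
  skew w hw k := hF.skew w (h hw) k
  torsion w hw := hF.torsion w (h hw)
  curv w hw := hF.curv w (h hw)

/-- `crossMat` carries the bracket of self-dual parts to the commutator, so the connection it
induces on the rank three bundle has the self-dual part of the curvature as its curvature. -/
lemma curv_crossMat (hu : u ∈ V) (k l : Fin m) :
    Twistor.curv (fun k w => crossMat (fun b => sdForm ϖ w b k)) k l u
      = crossMat (fun b => ((θ u)ᵀ * sdCurv K b u * θ u) k l) := by
  have hd : ∀ b k, DifferentiableAt ℝ (fun w => sdForm ϖ w b k) u := fun b k =>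
    hF.smooth_sdForm.differentiableAt hF.isOpen hu b k
  have h1 : ∀ k l, mpd (fun w => crossMat (fun b => sdForm ϖ w b l)) k u
      = crossMat (fun b => mpd (sdForm ϖ) k u b l) := fun k l => by
    ext i j
    rw [mpd_apply]
    fin_cases i <;> fin_cases j <;>
      simp [crossMat, pd_const, pd_neg, pd_const_mul, hd, mpd_apply]
  rw [Twistor.curv, h1, h1, crossMat_bracket, ← crossMat_sub, ← crossMat_add]
  congr 1
  ext b
  rw [← hF.sdForm_structure hu]
  rfl

/-- If `A` is not scalar at a point, then `A² = (tr A)² ≠ 0` nearby and `A` has eigenvalues `a, a,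
-a`. The Bianchi identity makes the derivative of `A` divergence free, so `tr A` is constant and `A`
is parallel by `eq_zero_of_div`. A parallel `A` commutes with the curvature of the bundle, which for
`B = 0` is given by the rows of the invertible matrix `A` itself. Hence `A` commutes with every
cross product and is scalar after all. -/
theorem blockA_isScalar (hskew : ∀ w ∈ V, ∀ b, (sdCurv K b w)ᵀ = - sdCurv K b w)
    (hsymm : ∀ w ∈ V, (blockA (fun i j => K i j w))ᵀ = blockA (fun i j => K i j w))
    (hB : ∀ w ∈ V, blockB (fun i j => K i j w) = 0)
    (hsq : ∀ w ∈ V, ∃ l : ℝ, blockA (fun i j => K i j w) * blockA (fun i j => K i j w) = l • 1)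
    {X : R m → Matrix (Fin m) (Fin 4) ℝ} (hX : ∀ w ∈ V, θ w * X w = 1)
    (hX' : ∀ w ∈ V, X w * θ w = 1) (hu : u ∈ V) :
    blockA (fun i j => K i j u) = blockA (fun i j => K i j u) 0 0 • 1 := by
  by_contra hne
  obtain ⟨i, j, hij⟩ : ∃ i j, blockA (fun i j => K i j u) i j
      ≠ (blockA (fun i j => K i j u) 0 0 • (1 : Matrix (Fin 3) (Fin 3) ℝ)) i j := by
    by_contra! h
    exact hne (Matrix.ext h)
  set A : R m → Matrix (Fin 3) (Fin 3) ℝ := fun w => blockA (fun i j => K i j w) with hAdef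
  have hAsm : MSmooth V A := hF.smooth_blockA
  have hcont : ContinuousOn (fun w => A w i j - (A w 0 0 • (1 : Matrix (Fin 3) (Fin 3) ℝ)) i j) V := by
    simp only [Matrix.smul_apply, smul_eq_mul]
    exact (hAsm i j).continuousOn.sub ((hAsm 0 0).continuousOn.mul continuousOn_const)
  -- One entry that witnesses non-scalarity at `u` keeps doing so on an open set, where derivatives
  -- may be taken.
  set V' := V ∩ (fun w => A w i j - (A w 0 0 • (1 : Matrix (Fin 3) (Fin 3) ℝ)) i j) ⁻¹' {0}ᶜ with hV'
  have hV'o : IsOpen V' := hcont.isOpen_inter_preimage hF.isOpen isOpen_compl_singleton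
  have hsub : V' ⊆ V := Set.inter_subset_left
  have huV' : u ∈ V' := ⟨hu, sub_ne_zero.2 hij⟩
  have hns : ∀ w ∈ V', A w ≠ A w 0 0 • 1 := fun w hw h => hw.2 (sub_eq_zero.2
    (congrFun (congrFun h i) j))
  have hF' := hF.mono hV'o hsub
  have htr2 : ∀ w ∈ V', A w * A w = (A w).trace ^ 2 • 1 := fun w hw => by
    obtain ⟨l, hl⟩ := hsq w (hsub hw)
    rw [← sq_eq_trace_sq hl (hns w hw)]
    exact hl
  have htr0 : ∀ w ∈ V', (A w).trace ≠ 0 := fun w hw h0 => by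
    have h1 := htr2 w hw
    rw [h0] at h1
    have h2 : (A w)ᴴ * A w = 0 := by
      rw [Matrix.conjTranspose_eq_transpose_of_trivial, hsymm w (hsub hw)]
      simpa using h1
    rw [Matrix.conjTranspose_mul_self_eq_zero] at h2
    exact hns w hw (by rw [h2]; simp)
  set D : Fin m → R m → Matrix (Fin 3) (Fin 3) ℝ := fun k w => mpd A k w
    + crossMat (fun b => sdForm ϖ w b k) * A w - A w * crossMat (fun b => sdForm ϖ w b k) with hD
  -- Vanishing of the trace part comes first; it makes `A²` constant and hence the derivative of `A`
  -- anticommute with `A`, as `eq_zero_of_div` needs.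
  have hD0 : ∀ w ∈ V', ∀ k, D k w = 0 := by
    intro w hw
    have hmsymm : ∀ k, (mpd A k w)ᵀ = mpd A k w := fun k => by
      rw [← mpd_transpose]
      exact mpd_congr hV'o (fun w hw => hsymm w (hsub hw)) hw k
    have hDsymm : ∀ k, (D k w)ᵀ = D k w := fun k => by
      simp only [hD, Matrix.transpose_sub, Matrix.transpose_add, Matrix.transpose_mul,
        crossMat_transpose, hmsymm, show (A w)ᵀ = A w from hsymm w (hsub hw), Matrix.mul_neg,
        Matrix.neg_mul]
      abel
    set v : Fin 4 → Matrix (Fin 3) (Fin 3) ℝ := fun p => ∑ j, X w j p • D j w with hv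
    have hvs : ∀ p, (v p)ᵀ = v p := fun p => by
      simp only [hv, Matrix.transpose_sum, Matrix.transpose_smul, hDsymm]
    have hcov : ∀ b p, covDir ϖ K (X w) b p w = so (fun c => v p c b) 0 := fun b p => by
      rw [hF'.covDir_eq_so (fun w hw => hskew w (hsub hw)) hw]
      congr 1
      · ext c
        simp only [covDir, sdPart_sum, sdPart_smul, Finset.sum_apply, Pi.smul_apply, smul_eq_mul,
          hF.sdPart_covCurv (hskew w (hsub hw)) (hsub hw), hv, Matrix.sum_apply, Matrix.smul_apply]
        rfl
      · have : ∀ k, asdPart (covCurv ϖ K b k w) = 0 := hF.asdPart_covCurv hskew (hsub hw) hB b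
        simp [covDir, asdPart_sum, asdPart_smul, this]
    have hdiv : ∀ b j, ∑ p, so (fun c => v p c b) 0 p j = 0 := fun b j => by
      refine div_of_cyclic_sd (q := fun p c => v p c b) (fun p q r => ?_) j
      have := hF.covDir_bianchi (hskew w (hsub hw)) (hsub hw) (hX w (hsub hw)) b p q r
      simpa only [hcov] using this
    have hDtr : ∀ k, (D k w).trace = pd (fun w => (A w).trace) k w := fun k => by
      simp only [hD, Matrix.trace_sub, Matrix.trace_add]
      rw [Matrix.trace_mul_comm, add_sub_cancel_right]
      simp only [Matrix.trace, Matrix.diag]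
      rw [pd_sum _ fun i _ => hAsm.differentiableAt hF.isOpen (hsub hw) i i]
      rfl
    have hback : ∀ {N : Type} [AddCommGroup N] [Module ℝ N] (f : Fin m → N),
        (∀ p, ∑ j, X w j p • f j = 0) → ∀ k, f k = 0 := by
      intro N _ _ f hf k
      have h1 : ∑ p, θ w p k • ∑ j, X w j p • f j = f k := by
        have h2 := sum_smul_lin (fun j p => X w j p) (fun p => θ w p k) f
        rw [← h2]
        simp only [← Matrix.mul_apply, hX' w (hsub hw), Matrix.one_apply]
        simp
      rw [← h1]
      simp [hf]
    have hpd : ∀ k, pd (fun w => (A w).trace) k w = 0 := by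
      refine hback _ fun p => ?_
      have := trace_eq_zero_of_div hvs hdiv p
      simpa [hv, Matrix.trace_sum, hDtr] using this
    have hAD : ∀ k, A w * D k w + D k w * A w = 0 := fun k => by
      have h1 : mpd (fun w => A w * A w) k w = 0 := by
        rw [mpd_congr hV'o htr2 hw]
        have hdt : DifferentiableAt ℝ (fun w => (A w).trace) w := by
          simp only [Matrix.trace, Matrix.diag]
          exact DifferentiableAt.fun_sum fun i _ => hAsm.differentiableAt hF.isOpen (hsub hw) i i
        ext a b
        rw [mpd_apply]
        simp only [Matrix.smul_apply, smul_eq_mul, pow_two]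
        rw [pd_mul (hdt.fun_mul hdt) (differentiableAt_const _), pd_mul hdt hdt, hpd, pd_const]
        simp
      rw [mpd_mul hF.isOpen (hsub hw) hAsm hAsm] at h1
      have h2 : A w * D k w + D k w * A w = (mpd A k w * A w + A w * mpd A k w)
          + (crossMat (fun b => sdForm ϖ w b k) * (A w * A w)
            - (A w * A w) * crossMat (fun b => sdForm ϖ w b k)) := by
        simp only [hD, Matrix.mul_sub, Matrix.mul_add, Matrix.sub_mul, Matrix.add_mul,
          Matrix.mul_assoc]
        abel
      rw [h2, h1, htr2 w hw]
      simp
    have hAv : ∀ p, A w * v p + v p * A w = 0 := fun p => by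
      simp only [hv, Matrix.mul_sum, Matrix.sum_mul, mul_smul_comm, smul_mul_assoc,
        ← Finset.sum_add_distrib, ← smul_add, hAD, smul_zero, Finset.sum_const_zero]
    exact hback _ (eq_zero_of_div (hsymm w (hsub hw)) (htr0 w hw) (htr2 w hw) rfl hvs hAv hdiv)
  -- That `A` is parallel means that it intertwines the induced connection with itself, so it
  -- commutes with the curvature.
  have hcurv : ∀ k l, A u * crossMat (fun b => ((θ u)ᵀ * sdCurv K b u * θ u) k l)
      = crossMat (fun b => ((θ u)ᵀ * sdCurv K b u * θ u) k l) * A u := fun k l => by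
    have hcs : ∀ k, MSmooth V' (fun w => crossMat (fun b => sdForm ϖ w b k)) := fun k => by
      have hs : ∀ b, ContDiffOn ℝ ∞ (fun w => sdForm ϖ w b k) V' := fun b => hF'.smooth_sdForm b k
      intro i j
      fin_cases i <;> fin_cases j <;> simp [crossMat] <;>
        first
          | exact contDiffOn_const
          | exact (contDiffOn_const.mul (hs _)).neg
          | exact contDiffOn_const.mul (hs _)
    rw [← hF'.curv_crossMat huV']
    refine curv_intertwine hV'o (hAsm.mono hsub) hcs hcs (fun w hw k => ?_) huV' k l
    exact (sub_eq_zero.1 (hD0 w hw k)).symm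
  have hcF : ∀ p q, A u * crossMat (fun b => sdCurv K b u p q)
      = crossMat (fun b => sdCurv K b u p q) * A u := fun p q => by
    have h1 : (fun b => sdCurv K b u p q)
        = ∑ k, ∑ l, (X u k p * X u l q) • fun b => ((θ u)ᵀ * sdCurv K b u * θ u) k l := by
      ext b
      have h2 : sdCurv K b u = (X u)ᵀ * ((θ u)ᵀ * sdCurv K b u * θ u) * X u := by
        calc sdCurv K b u = (θ u * X u)ᵀ * sdCurv K b u * (θ u * X u) := by
              rw [hX u hu, Matrix.transpose_one, Matrix.one_mul, Matrix.mul_one]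
          _ = _ := by simp only [Matrix.transpose_mul, Matrix.mul_assoc]
      conv_lhs => rw [h2]
      simp only [Matrix.mul_apply (N := X u), Matrix.mul_apply (M := (X u)ᵀ),
        Matrix.transpose_apply (M := X u), Finset.sum_apply, Pi.smul_apply, smul_eq_mul,
        Finset.sum_mul]
      rw [Finset.sum_comm]
      exact Finset.sum_congr rfl fun k _ => Finset.sum_congr rfl fun l _ => by ring
    rw [h1]
    simp only [crossMat_sum, crossMat_smul, Matrix.mul_sum, Matrix.sum_mul, mul_smul_comm,
      smul_mul_assoc, hcurv]
  have hF0 : ∀ b, sdCurv K b u = so (fun c => A u c b) 0 := fun b => by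
    have h1 : asdPart (sdCurv K b u) = 0 := by
      ext c; exact congrFun (congrFun (hB u hu) c) b
    rw [← h1]
    exact eq_so (hskew u hu b)
  have hcA : ∀ c, A u * crossMat (fun b => A u c b) = crossMat (fun b => A u c b) * A u := fun c => by
    have h1 := hcF c.succ 0
    have h2 : (fun b => sdCurv K b u c.succ 0) = fun b => A u c b := by
      ext b
      rw [hF0]
      fin_cases c <;> simp [so]
    rwa [h2] at h1
  refine hns u huV' (isScalar_of_comm_cross fun x => ?_)
  -- From `A² = (tr A)²` every vector is a combination of the rows of `A`.
  have hx : x = ∑ c, (((A u).trace ^ 2)⁻¹ * (x ᵥ* A u) c) • fun b => A u c b := by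
    have h1 : x ᵥ* (A u * A u) = (A u).trace ^ 2 • x := by
      rw [htr2 u huV', Matrix.vecMul_smul, Matrix.vecMul_one]
    rw [← Matrix.vecMul_vecMul] at h1
    have h2 : x = ((A u).trace ^ 2)⁻¹ • (x ᵥ* A u ᵥ* A u) := by
      rw [h1, smul_smul, inv_mul_cancel₀ (pow_ne_zero 2 (htr0 u huV')), one_smul]
    have h3 : ∀ y : Fin 3 → ℝ, y ᵥ* A u = ∑ c, y c • fun b => A u c b := fun y => by
      ext b
      simp [Matrix.vecMul, dotProduct]
    conv_lhs => rw [h2, h3, Finset.smul_sum]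
    simp only [smul_smul]
  rw [hx]
  simp only [crossMat_sum, crossMat_smul, Matrix.mul_sum, Matrix.sum_mul, mul_smul_comm,
    smul_mul_assoc, hcA]

end MovingFrame

end SelfDualBlock


/-! ### Orthonormal frames -/

section Frames

variable {m n : ℕ} {V : Set (R m)} {u : R m}

lemma one_by_one_eq {M N : Matrix Unit Unit ℝ} (h : M () () = N () ()) : M = N := by
  ext i j; exact h

/-- One step of the Gram-Schmidt process with parameters. -/
lemma exists_orthonormal_extension {κ : Type*} [Fintype κ] [DecidableEq κ]
    {G : R m → Matrix (Fin n) (Fin n) ℝ}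
    (hV : IsOpen V) (hG : MSmooth V G) {F : R m → Matrix (Fin n) κ ℝ} (hF : MSmooth V F)
    (hon : ∀ w ∈ V, (F w)ᵀ * G w * F w = 1) (hu : u ∈ V) {a : Matrix (Fin n) Unit ℝ}
    (ha : (F u)ᵀ * G u * a = 0) (haa : aᵀ * G u * a = 1) :
    ∃ V' ⊆ V, IsOpen V' ∧ u ∈ V' ∧ ∃ f : R m → Matrix (Fin n) Unit ℝ, MSmooth V' f ∧ f u = a ∧
      ∀ w ∈ V', (F w)ᵀ * G w * f w = 0 ∧ (f w)ᵀ * G w * f w = 1 := by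
  set f₀ : R m → Matrix (Fin n) Unit ℝ := fun w => a - F w * ((F w)ᵀ * G w * a) with hf₀
  have hf₀s : MSmooth V f₀ :=
    (MSmooth.const a).sub (hF.mul ((hF.transpose.mul hG).mul (MSmooth.const a)))
  set q : R m → ℝ := fun w => ((f₀ w)ᵀ * G w * f₀ w) () () with hq
  have hqs : ContDiffOn ℝ ∞ q V := ((hf₀s.transpose.mul hG).mul hf₀s) () ()
  have h0 : f₀ u = a := by simp [hf₀, ha]
  have hqu : q u = 1 := by simp [hq, h0, haa]
  have hV' : IsOpen (V ∩ q ⁻¹' Set.Ioi 0) := hqs.continuousOn.isOpen_inter_preimage hV isOpen_Ioi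
  refine ⟨V ∩ q ⁻¹' Set.Ioi 0, Set.inter_subset_left, hV', ⟨hu, by simp [hqu]⟩,
    fun w => (Real.sqrt (q w))⁻¹ • f₀ w, ?_, by simp [hqu, h0], fun w hw => ⟨?_, ?_⟩⟩
  · refine MSmooth.smul ?_ (hf₀s.mono Set.inter_subset_left)
    refine ContDiffOn.inv ((hqs.mono Set.inter_subset_left).sqrt fun w hw => ?_) fun w hw => ?_
    · exact ne_of_gt hw.2
    · exact (Real.sqrt_pos.2 hw.2).ne'
  · rw [Matrix.mul_smul, hf₀, Matrix.mul_sub, ← Matrix.mul_assoc, hon w hw.1, Matrix.one_mul,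
      sub_self, smul_zero]
  · rw [Matrix.transpose_smul, Matrix.smul_mul, Matrix.smul_mul, Matrix.mul_smul, smul_smul]
    refine one_by_one_eq ?_
    rw [Matrix.smul_apply, smul_eq_mul, Matrix.one_apply_eq, ← mul_inv, Real.mul_self_sqrt hw.2.le]
    exact inv_mul_cancel₀ hw.2.ne'

lemma exists_partial_frame {G : R m → Matrix (Fin n) (Fin n) ℝ} (hV : IsOpen V)
    (hG : MSmooth V G) (hGs : ∀ w ∈ V, (G w)ᵀ = G w) (hu : u ∈ V) {e : Matrix (Fin n) (Fin n) ℝ} (he : eᵀ * G u * e = 1) (k : ℕ)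
    (hk : k ≤ n) : ∃ V' ⊆ V, IsOpen V' ∧ u ∈ V' ∧ ∃ F : R m → Matrix (Fin n) (Fin k) ℝ,
      MSmooth V' F ∧ (∀ i j, F u i j = e i (Fin.castLE hk j)) ∧
      ∀ w ∈ V', (F w)ᵀ * G w * F w = 1 := by
  have hen : ∀ a b, ∑ j, (∑ i, e i a * G u i j) * e j b = (1 : Matrix (Fin n) (Fin n) ℝ) a b :=
    fun a b => by rw [← he]; simp [Matrix.mul_apply]
  induction k with
  | zero => exact ⟨V, subset_rfl, hV, hu, fun _ => 0, fun i j => j.elim0, fun i j => j.elim0,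
      fun w hw => by ext i; exact i.elim0⟩
  | succ k ih =>
    obtain ⟨V₁, hV₁, hV₁o, hu₁, F, hF, hFu, hon⟩ := ih (by omega)
    set last : Fin n := ⟨k, by omega⟩ with hlast
    obtain ⟨V₂, hV₂, hV₂o, hu₂, f, hf, hfu, hff⟩ := exists_orthonormal_extension hV₁o
      (hG.mono hV₁) hF hon hu₁ (a := Matrix.of fun i _ => e i last) (by
        ext a b
        simp only [Matrix.mul_apply, Matrix.transpose_apply, hFu, Matrix.of_apply, hen]
        exact Matrix.one_apply_ne (by simp [hlast, Fin.ext_iff]; omega)) (by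
        ext a b
        simp only [Matrix.mul_apply, Matrix.transpose_apply, Matrix.of_apply, hen]
        simp)
    refine ⟨V₂, hV₂.trans hV₁, hV₂o, hu₂, fun w => Matrix.of fun i => Fin.snoc (F w i) (f w i ()),
      fun i j => ?_, fun i j => ?_, fun w hw => ?_⟩
    · refine Fin.lastCases ?_ (fun j => ?_) j
      · simpa using hf i ()
      · simpa using (hF.mono hV₂) i j
    · refine Fin.lastCases ?_ (fun j => ?_) j
      · simp [hfu]; rfl
      · simp [hFu]
    · obtain ⟨h1, h2⟩ := hff w hw
      have h3 := hon w (hV₂ hw)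
      have h1' : (f w)ᵀ * G w * F w = 0 := by
        rw [← Matrix.transpose_eq_zero, ← h1]
        simp only [Matrix.transpose_mul, Matrix.transpose_transpose,
          hGs w (hV₁ (hV₂ hw)), Matrix.mul_assoc]
      ext i j
      have e3 := fun i j => congrFun (congrFun h3 i) j
      have e1 := fun i => congrFun (congrFun h1 i) ()
      have e1' := fun i => congrFun (congrFun h1' ()) i
      have e2 := congrFun (congrFun h2 ()) ()
      simp only [Matrix.mul_apply, Matrix.transpose_apply, Matrix.zero_apply] at e1 e1' e2 e3 ⊢
      refine Fin.lastCases ?_ (fun i => ?_) i <;> refine Fin.lastCases ?_ (fun j => ?_) j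
      · simpa using e2
      · simpa [Matrix.one_apply_ne (Fin.castSucc_lt_last j).ne'] using e1' j
      · simpa [Matrix.one_apply_ne (Fin.castSucc_lt_last i).ne] using e1 i
      · simpa [Matrix.one_apply] using e3 i j

/-- Smooth local orthonormal frames with prescribed value at a point. -/
theorem exists_frame {G : R m → Matrix (Fin n) (Fin n) ℝ} (hV : IsOpen V)
    (hG : MSmooth V G) (hGs : ∀ w ∈ V, (G w)ᵀ = G w) (hu : u ∈ V)
    {e : Matrix (Fin n) (Fin n) ℝ} (he : eᵀ * G u * e = 1) :
    ∃ V' ⊆ V, IsOpen V' ∧ u ∈ V' ∧ ∃ E : R m → Matrix (Fin n) (Fin n) ℝ,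
      MSmooth V' E ∧ E u = e ∧ ∀ w ∈ V', (E w)ᵀ * G w * E w = 1 := by
  obtain ⟨V', h1, h2, h3, E, h4, h5, h6⟩ := exists_partial_frame hV hG hGs hu he n le_rfl
  exact ⟨V', h1, h2, h3, E, h4, Matrix.ext fun i j => by simpa using h5 i j, h6⟩

/-- `S` is a complex structure that is compatible with the inner product with matrix `G` and the
opposite of the standard orientation. -/
structure IsNegCS (G S : Matrix (Fin 4) (Fin 4) ℝ) : Prop where
  sq : S * S = -1
  isom : Sᵀ * G * S = G
  neg : ∀ v w : Fin 4 → ℝ, Matrix.det (Matrix.of ![v, S *ᵥ v, w, S *ᵥ w]) ≤ 0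

lemma sdBasis_zero : sdBasis 0 = !![0, -1, 0, 0; 1, 0, 0, 0; 0, 0, 0, -1; 0, 0, 1, 0] := by
  ext i j; fin_cases i <;> fin_cases j <;> simp [sdBasis, so]

/-- The matrix with columns `f`, `S f`, `h`, `S h`. -/
def csFrame (S : Matrix (Fin 4) (Fin 4) ℝ) (f h : Matrix (Fin 4) Unit ℝ) :
    Matrix (Fin 4) (Fin 4) ℝ :=
  Matrix.of fun i => ![f i (), (S * f) i (), h i (), (S * h) i ()]

lemma csFrame_transpose (S : Matrix (Fin 4) (Fin 4) ℝ) (f h : Matrix (Fin 4) Unit ℝ) :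
    (csFrame S f h)ᵀ = Matrix.of ![fun i => f i (), S *ᵥ fun i => f i (), fun i => h i (),
      S *ᵥ fun i => h i ()] := by
  ext i j
  fin_cases i <;> rfl

/-- An isometry with `S² = -1` is skew, so `S f` is orthogonal to `f`, and orthogonality of `h` to
`f` and `S f` passes to `S h`. -/
lemma csFrame_orthonormal {G S : Matrix (Fin 4) (Fin 4) ℝ} (hG : Gᵀ = G) (hS : S * S = -1)
    (hiso : Sᵀ * G * S = G) {f h : Matrix (Fin 4) Unit ℝ} (hf : fᵀ * G * f = 1)
    (hh : hᵀ * G * h = 1) (hfh : fᵀ * G * h = 0) (hSfh : (S * f)ᵀ * G * h = 0) :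
    (csFrame S f h)ᵀ * G * csFrame S f h = 1 ∧
      S * csFrame S f h = csFrame S f h * sdBasis 0 := by
  have hsk : Sᵀ * G = -(G * S) := by
    have h1 : Sᵀ * G * S * S = G * S := by rw [hiso]
    rw [Matrix.mul_assoc, hS, Matrix.mul_neg, Matrix.mul_one] at h1
    rw [← h1, neg_neg]
  set b : Matrix (Fin 4) Unit ℝ → Matrix (Fin 4) Unit ℝ → ℝ := fun x y => (xᵀ * G * y) () () with hb
  have symm : ∀ x y, b x y = b y x := fun x y => by
    have : (xᵀ * G * y)ᵀ = yᵀ * G * x := by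
      simp only [Matrix.transpose_mul, Matrix.transpose_transpose, hG, Matrix.mul_assoc]
    simp only [hb, ← this]; rfl
  have iso : ∀ x y, b (S * x) (S * y) = b x y := fun x y => by
    have : (S * x)ᵀ * G * (S * y) = xᵀ * (Sᵀ * G * S) * y := by
      simp only [Matrix.transpose_mul, Matrix.mul_assoc]
    simp only [hb, this, hiso]
  have skew : ∀ x y, b (S * x) y = - b x (S * y) := fun x y => by
    have : (S * x)ᵀ * G * y = -(xᵀ * G * (S * y)) := by
      rw [Matrix.transpose_mul, Matrix.mul_assoc xᵀ, hsk]
      simp only [Matrix.mul_neg, Matrix.neg_mul, Matrix.mul_assoc]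
    simp only [hb, this]; rfl
  have diag : ∀ x, b x (S * x) = 0 := fun x => by
    have h1 := skew x x
    rw [symm] at h1; linarith
  have b1 : b f f = 1 := by simp [hb, hf]
  have b2 : b h h = 1 := by simp [hb, hh]
  have b3 : b f h = 0 := by simp [hb, hfh]
  have b4 : b (S * f) h = 0 := by simp only [hb, hSfh]; rfl
  have b5 : b f (S * h) = 0 := by rw [← neg_eq_zero, ← skew, b4]
  constructor
  · have key : ∀ i j : Fin 4, ((csFrame S f h)ᵀ * G * csFrame S f h) i j
        = b (![f, S * f, h, S * h] i) (![f, S * f, h, S * h] j) := fun i j => by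
      have : ∀ j, ∀ i, csFrame S f h i j = (![f, S * f, h, S * h] j) i () := fun j i => by
        fin_cases j <;> rfl
      simp only [hb, Matrix.mul_apply, Matrix.transpose_apply, this]
    ext i j
    rw [key]
    fin_cases i <;> fin_cases j <;>
      simp [b1, b2, b3, b4, b5, iso, diag, symm _ f, symm h (S * f), symm (S * h) h]
  · have hSS : ∀ x : Matrix (Fin 4) Unit ℝ, S * (S * x) = -x := fun x => by
      rw [← Matrix.mul_assoc, hS, Matrix.neg_mul, Matrix.one_mul]
    have e : ∀ (x : Matrix (Fin 4) Unit ℝ) i, ∑ k, S i k * x k () = (S * x) i () := fun x i => by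
      rw [Matrix.mul_apply]
    ext i j
    rw [sdBasis_zero]
    fin_cases j
    · simp [Matrix.mul_apply, Fin.sum_univ_four, csFrame]
    · have := e (S * f) i
      rw [hSS] at this
      simpa [Matrix.mul_apply, Fin.sum_univ_four, csFrame] using this
    · simp [Matrix.mul_apply, Fin.sum_univ_four, csFrame]
    · have := e (S * h) i
      rw [hSS] at this
      simpa [Matrix.mul_apply, Fin.sum_univ_four, csFrame] using this

lemma det_ne_zero_of_orthonormal {G e : Matrix (Fin n) (Fin n) ℝ} (he : eᵀ * G * e = 1) :
    e.det ≠ 0 := by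
  have h := congrArg Matrix.det he
  rw [Matrix.det_mul, Matrix.det_one] at h
  exact right_ne_zero_of_mul_eq_one h

lemma exists_unit {G : Matrix (Fin 4) (Fin 4) ℝ} (hG : G.PosDef) {v : Fin 4 → ℝ} (hv : v ≠ 0) :
    ∃ c : ℝ, (Matrix.of fun i (_ : Unit) => c * v i)ᵀ * G * (Matrix.of fun i (_ : Unit) => c * v i)
      = 1 := by
  have h := hG.dotProduct_mulVec_pos hv
  rw [star_trivial] at h
  refine ⟨(Real.sqrt (v ⬝ᵥ G *ᵥ v))⁻¹, one_by_one_eq ?_⟩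
  have e : ∀ c : ℝ, ((Matrix.of fun i (_ : Unit) => c * v i)ᵀ * G
      * (Matrix.of fun i (_ : Unit) => c * v i)) () () = c ^ 2 * (v ⬝ᵥ G *ᵥ v) := fun c => by
    simp only [Matrix.mul_apply, Matrix.transpose_apply, Matrix.of_apply, dotProduct, Matrix.mulVec,
      Fin.sum_univ_four]
    ring
  rw [e, inv_pow, Real.sq_sqrt h.le, inv_mul_cancel₀ h.ne', Matrix.one_apply_eq]

/-- Adapted frames at a point. -/
theorem IsNegCS.exists_adapted {G S : Matrix (Fin 4) (Fin 4) ℝ} (hG : G.PosDef)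
    (hS : IsNegCS G S) : ∃ e : Matrix (Fin 4) (Fin 4) ℝ, eᵀ * G * e = 1 ∧ S * e = e * sdBasis 0 ∧
      e.det < 0 := by
  have hGs : Gᵀ = G := by simpa using hG.isHermitian.eq
  obtain ⟨c, hc⟩ := exists_unit hG (v := Pi.single 0 1) (by simp)
  set f : Matrix (Fin 4) Unit ℝ := Matrix.of fun i _ => c * (Pi.single 0 1 : Fin 4 → ℝ) i
  -- The zero rows make the matrix singular; a kernel vector is a nonzero vector orthogonal to `f`
  -- and `S f`.
  obtain ⟨w, hw, hM⟩ := Matrix.exists_mulVec_eq_zero_iff.2 (show Matrix.det (Matrix.of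
      ![fun j => (fᵀ * G) () j, fun j => ((S * f)ᵀ * G) () j, 0, 0]) = 0 from
    Matrix.det_eq_zero_of_row_eq_zero 3 (by simp))
  obtain ⟨d, hd⟩ := exists_unit hG hw
  have h0 := congrFun hM 0
  have h1 := congrFun hM 1
  simp only [Matrix.mulVec, dotProduct, Matrix.of_apply, Matrix.cons_val_zero, Matrix.cons_val_one,
    Pi.zero_apply] at h0 h1
  have key := csFrame_orthonormal hGs hS.sq hS.isom hc hd
    (one_by_one_eq (by
      rw [Matrix.mul_apply]
      simp only [Matrix.of_apply, mul_left_comm _ d, ← Finset.mul_sum, h0, mul_zero]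
      rfl))
    (one_by_one_eq (by
      rw [Matrix.mul_apply]
      simp only [Matrix.of_apply, mul_left_comm _ d, ← Finset.mul_sum, h1, mul_zero]
      rfl))
  refine ⟨_, key.1, key.2, lt_of_le_of_ne ?_ (det_ne_zero_of_orthonormal key.1)⟩
  rw [← Matrix.det_transpose, csFrame_transpose]
  exact hS.neg _ _

/-- Smooth local adapted frames. -/
theorem exists_adapted_frame {G S : R m → Matrix (Fin 4) (Fin 4) ℝ} (hV : IsOpen V)
    (hG : MSmooth V G) (hGs : ∀ w ∈ V, (G w)ᵀ = G w) (hS : MSmooth V S)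
    (hcs : ∀ w ∈ V, IsNegCS (G w) (S w)) (hu : u ∈ V) {e : Matrix (Fin 4) (Fin 4) ℝ}
    (he : eᵀ * G u * e = 1) (hSe : S u * e = e * sdBasis 0) :
    ∃ V' ⊆ V, IsOpen V' ∧ u ∈ V' ∧ ∃ E : R m → Matrix (Fin 4) (Fin 4) ℝ,
      MSmooth V' E ∧ E u = e ∧ ∀ w ∈ V', (E w)ᵀ * G w * E w = 1 ∧ S w * E w = E w * sdBasis 0 := by
  have hcol : ∀ a b, ∑ j, (∑ i, e i a * G u i j) * e j b = (1 : Matrix (Fin 4) (Fin 4) ℝ) a b :=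
    fun a b => by rw [← he]; simp [Matrix.mul_apply]
  have hSe0 : ∀ i, ∑ j, S u i j * e j 0 = e i 1 := fun i => by
    have := congrFun (congrFun hSe i) 0
    rw [sdBasis_zero, Matrix.mul_apply] at this
    rw [this]
    simp [Matrix.mul_apply, Fin.sum_univ_four]
  have hSe2 : ∀ i, ∑ j, S u i j * e j 2 = e i 3 := fun i => by
    have := congrFun (congrFun hSe i) 2
    rw [sdBasis_zero, Matrix.mul_apply] at this
    rw [this]
    simp [Matrix.mul_apply, Fin.sum_univ_four]
  -- With an empty frame the Gram–Schmidt step only normalises. The second use of it extends the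
  -- orthonormal pair `f`, `S f`.
  obtain ⟨V₁, hV₁, hV₁o, hu₁, f, hf, hfu, hff⟩ := exists_orthonormal_extension hV hG
    (F := fun _ => (0 : Matrix (Fin 4) (Fin 0) ℝ)) (fun i j => j.elim0)
    (fun w _ => by ext i; exact i.elim0) hu (a := Matrix.of fun i _ => e i 0)
    (by ext i; exact i.elim0) (by
      ext a b
      simp only [Matrix.mul_apply, Matrix.transpose_apply, Matrix.of_apply, hcol]
      simp)
  have hSf : MSmooth V₁ (fun w => S w * f w) := (hS.mono hV₁).mul hf
  have hskew : ∀ w ∈ V, ∀ x : Matrix (Fin 4) Unit ℝ, xᵀ * G w * (S w * x) = 0 := fun w hw x => by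
    have hsk : (S w)ᵀ * G w = -(G w * S w) := by
      have h1 : (S w)ᵀ * G w * S w * S w = G w * S w := by rw [(hcs w hw).isom]
      rw [Matrix.mul_assoc, (hcs w hw).sq, Matrix.mul_neg, Matrix.mul_one] at h1
      rw [← h1, neg_neg]
    have h2 : (xᵀ * G w * (S w * x))ᵀ = -(xᵀ * G w * (S w * x)) := by
      simp only [Matrix.transpose_mul, Matrix.transpose_transpose, hGs w hw]
      rw [Matrix.mul_assoc, ← Matrix.mul_assoc _ (G w), hsk]
      simp only [Matrix.neg_mul, Matrix.mul_neg, Matrix.mul_assoc]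
    exact one_by_one_eq (by simpa using skew_diag h2 ())
  obtain ⟨V₂, hV₂, hV₂o, hu₂, h, hh, hhu, hhh⟩ := exists_orthonormal_extension hV₁o (hG.mono hV₁)
    (F := fun w => Matrix.fromCols (f w) (S w * f w)) (fun i j => by
      rcases j with j | j
      · simpa using hf i j
      · simpa using hSf i j) (fun w hw => by
      rw [Matrix.transpose_fromCols, Matrix.fromRows_mul, Matrix.fromRows_mul_fromCols,
        (hff w hw).2, hskew w (hV₁ hw)]
      have h1 : (S w * f w)ᵀ * G w * f w = 0 := by
        rw [← Matrix.transpose_eq_zero, ← hskew w (hV₁ hw) (f w)]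
        simp only [Matrix.transpose_mul, Matrix.transpose_transpose, hGs w (hV₁ hw),
          Matrix.mul_assoc]
      have h2 : (S w * f w)ᵀ * G w * (S w * f w) = 1 := by
        rw [← (hff w hw).2, show (S w * f w)ᵀ * G w * (S w * f w)
          = (f w)ᵀ * ((S w)ᵀ * G w * S w) * f w by
            simp only [Matrix.transpose_mul, Matrix.mul_assoc], (hcs w (hV₁ hw)).isom]
      rw [h1, h2, Matrix.fromBlocks_one])  hu₁ (a := Matrix.of fun i _ => e i 2)
    (by
      ext a b
      rcases a with a | a
      · simp only [Matrix.mul_apply, Matrix.transpose_apply, Matrix.of_apply, hfu,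
          Matrix.fromCols_apply_inl, hcol]
        simp
      · simp only [Matrix.mul_apply, Matrix.transpose_apply, Matrix.of_apply, hfu,
          Matrix.fromCols_apply_inr, hSe0, hcol]
        simp)
    (by
      ext a b
      simp only [Matrix.mul_apply, Matrix.transpose_apply, Matrix.of_apply, hcol]
      simp)
  have hkey : ∀ w ∈ V₂, _ := fun w hw => csFrame_orthonormal (hGs w (hV₁ (hV₂ hw)))
    (hcs w (hV₁ (hV₂ hw))).sq (hcs w (hV₁ (hV₂ hw))).isom (hff w (hV₂ hw)).2 (hhh w hw).2
    (by
      have := (hhh w hw).1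
      rw [Matrix.transpose_fromCols, Matrix.fromRows_mul, Matrix.fromRows_mul] at this
      ext i j
      exact congrFun (congrFun this (.inl i)) j)
    (by
      have := (hhh w hw).1
      rw [Matrix.transpose_fromCols, Matrix.fromRows_mul, Matrix.fromRows_mul] at this
      ext i j
      exact congrFun (congrFun this (.inr i)) j)
  refine ⟨V₂, hV₂.trans hV₁, hV₂o, hu₂, fun w => csFrame (S w) (f w) (h w), fun i j => ?_, ?_,
    hkey⟩
  · have hSh : MSmooth V₂ (fun w => S w * h w) := (hS.mono (hV₂.trans hV₁)).mul hh
    fin_cases j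
    · exact (hf.mono hV₂) i ()
    · exact (hSf.mono hV₂) i ()
    · exact hh i ()
    · exact hSh i ()
  · ext i j
    fin_cases j
    · simp [csFrame, hfu]
    · simp [csFrame, hfu, Matrix.mul_apply, hSe0]
    · simp [csFrame, hhu]
    · simp [csFrame, hhu, Matrix.mul_apply, hSe2]

open scoped MatrixOrder in
/-- Negatively oriented orthonormal bases. -/
lemma exists_neg_orthonormal {G : Matrix (Fin 4) (Fin 4) ℝ} (hG : G.PosDef) :
    ∃ e : Matrix (Fin 4) (Fin 4) ℝ, eᵀ * G * e = 1 ∧ e.det < 0 := by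
  obtain ⟨B, hB⟩ := CStarAlgebra.nonneg_iff_eq_star_mul_self.1 hG.posSemidef.nonneg
  rw [Matrix.star_eq_conjTranspose, Matrix.conjTranspose_eq_transpose_of_trivial] at hB
  have hdet : IsUnit B.det := by
    have h := hG.det_pos
    rw [hB, Matrix.det_mul] at h
    exact isUnit_iff_ne_zero.2 (right_ne_zero_of_mul h.ne')
  have h1 : (B⁻¹)ᵀ * G * B⁻¹ = 1 := by
    rw [hB, ← Matrix.mul_assoc, ← Matrix.transpose_mul, Matrix.mul_nonsing_inv _ hdet,
      Matrix.transpose_one, Matrix.one_mul, Matrix.mul_nonsing_inv _ hdet]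
  rcases (det_ne_zero_of_orthonormal h1).lt_or_gt with h | h
  · exact ⟨_, h1, h⟩
  · refine ⟨B⁻¹ * Matrix.diagonal ![-1, 1, 1, 1], ?_, ?_⟩
    · rw [Matrix.transpose_mul, Matrix.diagonal_transpose, Matrix.mul_assoc, Matrix.mul_assoc,
        ← Matrix.mul_assoc G, ← Matrix.mul_assoc (B⁻¹)ᵀ, ← Matrix.mul_assoc (B⁻¹)ᵀ, h1,
        Matrix.one_mul, Matrix.diagonal_mul_diagonal, ← Matrix.diagonal_one]
      congr 1
      ext i
      fin_cases i <;> simp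
    · rw [Matrix.det_mul, Matrix.det_diagonal]
      simpa [Fin.prod_univ_four] using h

/-- The determinant is the squared length of the cross product of `p` with the vector `z` of inner
products of `I_c a` with `b`. Left quaternion multiplications thus induce the standard orientation.
-/
lemma det_quaternion_rows (p : Fin 3 → ℝ) (a b : Fin 4 → ℝ) :
    0 ≤ Matrix.det (Matrix.of ![a, so p 0 *ᵥ a, b, so p 0 *ᵥ b]) := by
  set z : Fin 3 → ℝ := fun c => (sdBasis c *ᵥ a) ⬝ᵥ b with hz
  have : Matrix.det (Matrix.of ![a, so p 0 *ᵥ a, b, so p 0 *ᵥ b])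
      = (p 1 * z 2 - p 2 * z 1) ^ 2 + (p 2 * z 0 - p 0 * z 2) ^ 2
        + (p 0 * z 1 - p 1 * z 0) ^ 2 := by
    rw [det_rows_four]
    simp only [hz, sdBasis, so, Matrix.mulVec, dotProduct, Fin.sum_univ_four, Matrix.of_apply,
      Matrix.cons_val', Matrix.cons_val_zero, Matrix.cons_val_one, Matrix.cons_val]
    simp
    ring
  rw [this]
  positivity

/-- The orthogonal matrices that are complex structures compatible with the standard orientation. -/
def orthogonalCS : Set (Matrix (Fin 4) (Fin 4) ℝ) :=
  {A | Aᵀ * A = 1 ∧ A * A = -1 ∧ ∀ v w : Fin 4 → ℝ, 0 ≤ Matrix.det (Matrix.of ![v, A *ᵥ v, w, A *ᵥ w])}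

/-- Compatible complex structures in a negatively oriented orthonormal frame. -/
lemma isNegCS_frame_iff {G e A : Matrix (Fin 4) (Fin 4) ℝ} (hG : Gᵀ = G) (he : eᵀ * G * e = 1)
    (hd : e.det < 0) : IsNegCS G (e * A * (eᵀ * G)) ↔ A ∈ orthogonalCS := by
  have hinv : e * (eᵀ * G) = 1 := mul_eq_one_comm.1 he
  have h1 : e * A * (eᵀ * G) * (e * A * (eᵀ * G)) = e * (A * A) * (eᵀ * G) := by
    calc _ = e * A * (eᵀ * G * e) * A * (eᵀ * G) := by simp only [Matrix.mul_assoc]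
      _ = _ := by rw [he, Matrix.mul_one]; simp only [Matrix.mul_assoc]
  have h2 : (e * A * (eᵀ * G))ᵀ * G * (e * A * (eᵀ * G)) = (G * e) * (Aᵀ * A) * (eᵀ * G) := by
    calc _ = G * e * Aᵀ * (eᵀ * G * e) * A * (eᵀ * G) := by
          simp only [Matrix.transpose_mul, Matrix.transpose_transpose, hG, Matrix.mul_assoc]
      _ = _ := by rw [he, Matrix.mul_one]; simp only [Matrix.mul_assoc]
  have hcancel : ∀ B : Matrix (Fin 4) (Fin 4) ℝ, eᵀ * G * (e * B * (eᵀ * G)) * e = B := fun B => by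
    calc _ = (eᵀ * G * e) * B * (eᵀ * G * e) := by simp only [Matrix.mul_assoc]
      _ = _ := by rw [he, Matrix.mul_one, Matrix.one_mul]
  have hcancel' : ∀ B : Matrix (Fin 4) (Fin 4) ℝ, eᵀ * (G * e * B * (eᵀ * G)) * e = B := fun B => by
    calc _ = (eᵀ * G * e) * B * (eᵀ * G * e) := by simp only [Matrix.mul_assoc]
      _ = _ := by rw [he, Matrix.mul_one, Matrix.one_mul]
  have key : ∀ a b : Fin 4 → ℝ, Matrix.det (Matrix.of ![e *ᵥ a, (e * A * (eᵀ * G)) *ᵥ (e *ᵥ a),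
      e *ᵥ b, (e * A * (eᵀ * G)) *ᵥ (e *ᵥ b)])
      = Matrix.det (Matrix.of ![a, A *ᵥ a, b, A *ᵥ b]) * e.det := fun a b => by
    have h' : ∀ a, (e * A * (eᵀ * G)) *ᵥ (e *ᵥ a) = e *ᵥ (A *ᵥ a) := fun a => by
      rw [Matrix.mulVec_mulVec, Matrix.mulVec_mulVec, Matrix.mul_assoc, he, Matrix.mul_one]
    rw [h', h', ← Matrix.det_transpose e, ← Matrix.det_mul]
    congr 1
    have hm : ∀ (y : Fin 4 → ℝ) j, (e *ᵥ y) j = ∑ k, y k * eᵀ k j := fun y j => by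
      simp only [Matrix.mulVec, dotProduct, Matrix.transpose_apply, mul_comm]
    ext i j
    rw [Matrix.mul_apply]
    fin_cases i <;> exact hm _ j
  have hsurj : ∀ v : Fin 4 → ℝ, v = e *ᵥ ((eᵀ * G) *ᵥ v) := fun v => by
    rw [Matrix.mulVec_mulVec, hinv, Matrix.one_mulVec]
  constructor
  · rintro ⟨hsq, hiso, hneg⟩
    refine ⟨?_, ?_, fun a b => ?_⟩
    · rw [← hcancel' (Aᵀ * A), ← h2, hiso, he]
    · rw [← hcancel (A * A), ← h1, hsq, Matrix.mul_neg, Matrix.mul_one, Matrix.neg_mul, he]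
    · exact nonneg_of_mul_nonpos_left ((key a b).symm.trans_le (hneg _ _)) hd
  · rintro ⟨hort, hsq, hpos⟩
    refine ⟨?_, ?_, fun v w => ?_⟩
    · rw [h1, hsq, Matrix.mul_neg, Matrix.mul_one, Matrix.neg_mul, hinv]
    · rw [h2, hort, Matrix.mul_one, Matrix.mul_assoc, hinv, Matrix.mul_one]
    · rw [hsurj v, hsurj w, key]
      exact mul_nonpos_of_nonneg_of_nonpos (hpos _ _) hd.le

/-- The complex structures given by left multiplication with an imaginary unit quaternion. -/
lemma isNegCS_of_frame {G e : Matrix (Fin 4) (Fin 4) ℝ} (hG : Gᵀ = G) (he : eᵀ * G * e = 1)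
    (hd : e.det < 0) {p : Fin 3 → ℝ} (hp : p 0 ^ 2 + p 1 ^ 2 + p 2 ^ 2 = 1) :
    IsNegCS G (e * so p 0 * (eᵀ * G)) := by
  have hsq : so p 0 * so p 0 = -1 := by
    rw [so_left_mul_self, hp, neg_one_smul]
  refine (isNegCS_frame_iff hG he hd).2 ⟨?_, hsq, det_quaternion_rows p⟩
  rw [so_transpose, Matrix.neg_mul, hsq, neg_neg]

end Frames


/-! ### Local parametrizations of the twistor space -/

section TwistorLocal

/-! #### Tangent vectors in an adapted frame -/

section TangentVector

variable {G : R 4 → Matrix (Fin 4) (Fin 4) ℝ} {y : R 4} {S e : Matrix (Fin 4) (Fin 4) ℝ} {τ : ℝ}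
  {E F : TVec}

/-- `E` is a tangent vector of the twistor space; `e` is an adapted frame. -/
def IsTwTangent (G : R 4 → Matrix (Fin 4) (Fin 4) ℝ) (y : R 4) (S e : Matrix (Fin 4) (Fin 4) ℝ)
    (E : TVec) (a b : ℝ) : Prop :=
  vertical G y S E * e = e * so ![0, a, b] 0

/-- The components of a tangent vector of the twistor space in the frame defined by an adapted
frame `e`. -/
def twCoord (τ : ℝ) (G : R 4 → Matrix (Fin 4) (Fin 4) ℝ) (y : R 4)
    (e : Matrix (Fin 4) (Fin 4) ℝ) (X : Fin 4 → ℝ) (a b : ℝ) : Fin 4 ⊕ Fin 2 → ℝ :=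
  Sum.elim ((eᵀ * G y) *ᵥ X) ![-(τ / 2) * b, (τ / 2) * a]

/-- The rotation of the plane by a right angle. -/
def vertJ : Matrix (Fin 2) (Fin 2) ℝ := !![0, -1; 1, 0]

/-- The matrix of `𝒥_n` in the frame defined by an adapted frame. -/
def twJ (n : ℕ) : Matrix (Fin 4 ⊕ Fin 2) (Fin 4 ⊕ Fin 2) ℝ :=
  Matrix.fromBlocks (sdBasis 0) 0 0 ((-1 : ℝ) ^ (n + 1) • vertJ)

lemma vertical_acs (n : ℕ) : vertical G y S (acs n G y S E)
    = (-1 : ℝ) ^ (n + 1) • (S * vertical G y S E) := by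
  simp only [vertical, acs]; abel

/-- On the vertical part `-¼ Trace` is the Euclidean product of `(a, b)`, and `t = (τ/2)²` is
absorbed by the factors `τ/2` in `twCoord`. -/
lemma hMetric_eq (hGs : (G y)ᵀ = G y) (he : eᵀ * G y * e = 1) {t : ℝ} (hτ : τ ^ 2 = 4 * t)
    {a b a' b' : ℝ} (hE : IsTwTangent G y S e E a b) (hF : IsTwTangent G y S e F a' b') :
    hMetric t G y S E F = twCoord τ G y e E.1 a b ⬝ᵥ twCoord τ G y e F.1 a' b' := by
  have hv : ∀ {E : TVec} {a b : ℝ}, IsTwTangent G y S e E a b →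
      vertical G y S E = e * so ![0, a, b] 0 * (eᵀ * G y) := fun {E a b} h => by
    rw [← h, Matrix.mul_assoc, frame_inv he, Matrix.mul_one]
  have hG : G y = (eᵀ * G y)ᵀ * (eᵀ * G y) := by
    rw [Matrix.transpose_mul, Matrix.transpose_transpose, hGs, Matrix.mul_assoc, frame_inv he,
      Matrix.mul_one]
  have h1 : ∑ i, ∑ j, G y i j * E.1 i * F.1 j
      = ((eᵀ * G y) *ᵥ E.1) ⬝ᵥ ((eᵀ * G y) *ᵥ F.1) := by
    rw [← Matrix.vecMul_transpose, ← Matrix.dotProduct_mulVec, Matrix.mulVec_mulVec, ← hG]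
    simp only [dotProduct, Matrix.mulVec, Finset.mul_sum]
    exact Finset.sum_congr rfl fun i _ => Finset.sum_congr rfl fun j _ => by ring
  have h2 : (vertical G y S E * vertical G y S F).trace = -4 * (a * a' + b * b') := by
    rw [hv hE, hv hF, show e * so ![0, a, b] 0 * (eᵀ * G y) * (e * so ![0, a', b'] 0 * (eᵀ * G y))
      = e * so ![0, a, b] 0 * (eᵀ * G y * e) * so ![0, a', b'] 0 * (eᵀ * G y) by
        simp only [Matrix.mul_assoc], he, Matrix.mul_one, Matrix.trace_mul_comm, ← Matrix.mul_assoc,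
      ← Matrix.mul_assoc, he, Matrix.one_mul, trace_so_mul_so]
    simp [Fin.sum_univ_three]
  rw [hMetric, h1, h2, twCoord, twCoord, sumElim_dotProduct_sumElim]
  simp only [Matrix.vec2_dotProduct, Matrix.cons_val_zero, Matrix.cons_val_one]
  linear_combination (-(1 / 4) * (a * a' + b * b')) * hτ

lemma isTwTangent_acs (hS : S * e = e * sdBasis 0) (n : ℕ) {a b : ℝ}
    (hE : IsTwTangent G y S e E a b) : IsTwTangent G y S e (acs n G y S E)
      (-((-1 : ℝ) ^ (n + 1) * b)) ((-1 : ℝ) ^ (n + 1) * a) := by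
  have h1 : sdBasis 0 * so ![0, a, b] 0 = so ![0, -b, a] 0 := by
    rw [sdBasis_zero]
    ext i j
    fin_cases i <;> fin_cases j <;> simp [so, Matrix.mul_apply, Fin.sum_univ_four]
  rw [IsTwTangent, vertical_acs, Matrix.smul_mul, Matrix.mul_assoc, hE, ← Matrix.mul_assoc, hS,
    Matrix.mul_assoc, h1, ← Matrix.mul_smul, ← so_smul, smul_zero]
  congr 2
  ext i; fin_cases i <;> simp

lemma twCoord_acs (hS : S * e = e * sdBasis 0) (he : eᵀ * G y * e = 1) (n : ℕ) (a b : ℝ) :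
    twCoord τ G y e (acs n G y S E).1 (-((-1 : ℝ) ^ (n + 1) * b)) ((-1 : ℝ) ^ (n + 1) * a)
      = twJ n *ᵥ twCoord τ G y e E.1 a b := by
  have h1 : eᵀ * G y * S = sdBasis 0 * (eᵀ * G y) := by
    calc eᵀ * G y * S = eᵀ * G y * (S * e) * (eᵀ * G y) := by
          rw [Matrix.mul_assoc _ (S * e), Matrix.mul_assoc S, frame_inv he, Matrix.mul_one]
      _ = _ := by rw [hS, ← Matrix.mul_assoc _ e, he, Matrix.one_mul]
  rw [twJ, Matrix.fromBlocks_mulVec, twCoord, twCoord]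
  congr 1
  · simp only [acs, Matrix.mulVec_mulVec, h1, Sum.elim_comp_inl, Sum.elim_comp_inr,
      Matrix.zero_mulVec, add_zero]
  · simp only [Sum.elim_comp_inl, Sum.elim_comp_inr, Matrix.zero_mulVec, zero_add]
    ext i
    fin_cases i <;> simp [vertJ, Matrix.mulVec, dotProduct] <;> ring

lemma IsTwTangent.unique (he : eᵀ * G y * e = 1) {a b a' b' : ℝ}
    (hE : IsTwTangent G y S e E a b) (hE' : IsTwTangent G y S e E a' b') : a = a' ∧ b = b' := by
  have h1 : e * so ![0, a, b] 0 = e * so ![0, a', b'] 0 := hE.symm.trans hE'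
  have h2 := congrArg (fun M => sdPart (eᵀ * G y * M)) h1
  simp only [← Matrix.mul_assoc, he, Matrix.one_mul, sdPart_so] at h2
  exact ⟨by simpa using congrFun h2 1, by simpa using congrFun h2 2⟩

lemma eq_of_twCoord_eq (he : eᵀ * G y * e = 1) (hτ : τ ≠ 0) {a b a' b' : ℝ}
    (hE : IsTwTangent G y S e E a b) (hF : IsTwTangent G y S e F a' b')
    (h : twCoord τ G y e E.1 a b = twCoord τ G y e F.1 a' b') : E = F := by
  have h1 : E.1 = F.1 := by
    have h2 : (eᵀ * G y) *ᵥ E.1 = (eᵀ * G y) *ᵥ F.1 := funext fun i => congrFun h (.inl i)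
    have h3 := congrArg (e *ᵥ ·) h2
    simpa only [Matrix.mulVec_mulVec, frame_inv he, Matrix.one_mulVec] using h3
  have hb : b = b' := by
    have := congrFun h (.inr 0)
    simpa [twCoord, hτ] using this
  have ha : a = a' := by
    have := congrFun h (.inr 1)
    simpa [twCoord, hτ] using this
  have h2 : vertical G y S E = vertical G y S F := by
    have h3 : vertical G y S E * e = vertical G y S F * e := by rw [hE, hF, ha, hb]
    have h4 := congrArg (· * (eᵀ * G y)) h3
    simpa only [Matrix.mul_assoc, frame_inv he, Matrix.mul_one] using h4
  refine Prod.ext h1 ?_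
  simpa [vertical, h1] using h2

end TangentVector

/-! #### Parametrizations -/

variable {m : ℕ} {W : Set (R 4)} {G : R 4 → Matrix (Fin 4) (Fin 4) ℝ} {V : Set (R m)} {u : R m}
  {x : R m → R 4} {S E : R m → Matrix (Fin 4) (Fin 4) ℝ} {τ : ℝ}

/-- The differential of the parametrization `(x, S)`. -/
def pushLoc (x : R m → R 4) (S : R m → Matrix (Fin 4) (Fin 4) ℝ) (u : R m) (ξ : Fin m → ℝ) :
    TVec :=
  (fun i => ∑ k, ξ k * pd (fun w => x w i) k u,
    Matrix.of fun i j => ∑ k, ξ k * pd (fun w => S w i j) k u)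

/-- The coefficients of the metric `h_t` in the parametrization `(x, S)`. -/
def hLoc (t : ℝ) (G : R 4 → Matrix (Fin 4) (Fin 4) ℝ) (x : R m → R 4)
    (S : R m → Matrix (Fin 4) (Fin 4) ℝ) (u : R m) : Matrix (Fin m) (Fin m) ℝ :=
  Matrix.of fun k l => hMetric t G (x u) (S u) (pushLoc x S u (Pi.single k 1))
    (pushLoc x S u (Pi.single l 1))

/-- A smooth immersion `(x, S)` into the twistor space of the metric `G` on `W`. -/
structure TwParam (W : Set (R 4)) (G : R 4 → Matrix (Fin 4) (Fin 4) ℝ) (V : Set (R m))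
    (x : R m → R 4) (S : R m → Matrix (Fin 4) (Fin 4) ℝ) : Prop where
  isOpen : IsOpen V
  smooth_base : ContDiffOn ℝ ∞ x V
  smooth_end : MSmooth V S
  mem : ∀ w ∈ V, x w ∈ W
  isNegCS : ∀ w ∈ V, IsNegCS (G (x w)) (S w)
  immersion : ∀ w ∈ V, ∀ ξ, pushLoc x S w ξ = 0 → ξ = 0

/-- A smooth orthonormal frame `E` along `x` that is adapted to `S`. -/
structure AdaptedFrame (G : R 4 → Matrix (Fin 4) (Fin 4) ℝ) (V : Set (R m)) (x : R m → R 4)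
    (S E : R m → Matrix (Fin 4) (Fin 4) ℝ) : Prop where
  smooth : MSmooth V E
  orth : ∀ w ∈ V, (E w)ᵀ * G (x w) * E w = 1
  adapted : ∀ w ∈ V, S w * E w = E w * sdBasis 0

lemma TwParam.mono (h : TwParam W G V x S) {V' : Set (R m)} (hV' : V' ⊆ V) (ho : IsOpen V') :
    TwParam W G V' x S :=
  ⟨ho, h.smooth_base.mono hV', h.smooth_end.mono hV', fun w hw => h.mem w (hV' hw),
    fun w hw => h.isNegCS w (hV' hw), fun w hw => h.immersion w (hV' hw)⟩

lemma TwParam.exists_adaptedFrame (h : TwParam W G V x S) (hG : IsMetricOn W G) (hu : u ∈ V)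
    {e : Matrix (Fin 4) (Fin 4) ℝ} (he : eᵀ * G (x u) * e = 1) (hSe : S u * e = e * sdBasis 0) :
    ∃ V' ⊆ V, IsOpen V' ∧ u ∈ V' ∧ ∃ E, AdaptedFrame G V' x S E ∧ E u = e := by
  obtain ⟨V', hV', ho, hu', E, hE, hEu, hE'⟩ := exists_adapted_frame h.isOpen
    (hG.smooth.comp h.smooth_base h.mem) (fun w hw => hG.symm _ (h.mem w hw)) h.smooth_end
    h.isNegCS hu he hSe
  exact ⟨V', hV', ho, hu', E, ⟨hE, fun w hw => (hE' w hw).1, fun w hw => (hE' w hw).2⟩, hEu⟩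

lemma pushLoc_fst (ξ : Fin m → ℝ) : (pushLoc x S u ξ).1 = jac x u *ᵥ ξ := by
  ext i
  simp only [pushLoc, jac, Matrix.mulVec, dotProduct, Matrix.of_apply, mul_comm]

lemma pushLoc_snd (ξ : Fin m → ℝ) : (pushLoc x S u ξ).2 = ∑ k, ξ k • mpd S k u := by
  ext i j
  simp [pushLoc, Matrix.sum_apply, mpd_apply]

lemma connMatrix_eq (G : R 4 → Matrix (Fin 4) (Fin 4) ℝ) (y : R 4) (X : Fin 4 → ℝ) :
    connMatrix G y X = ∑ i, X i • chr G i y := by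
  ext k j
  simp [connMatrix, chr, Matrix.sum_apply, mul_comm]

lemma connMatrix_jac (ξ : Fin m → ℝ) :
    connMatrix G (x u) (jac x u *ᵥ ξ) = ∑ k, ξ k • pullForm x (chr G) k u := by
  simp only [connMatrix_eq, pullForm, Matrix.mulVec, dotProduct, Finset.sum_smul, Finset.smul_sum,
    smul_smul]
  rw [Finset.sum_comm]
  simp only [mul_comm]

/-- Differentiating `S E = E I₀` gives `∇S = E [ϖ, I₀] E⁻¹`. The commutator with `I₀` keeps only the
self-dual components 1 and 2 of `ϖ`, exchanged, doubled and one with a sign; the vertical entries of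
`twCoord` undo this. -/
lemma isTwTangent_pushLoc (h : TwParam W G V x S) (hE : AdaptedFrame G V x S E) (hG : IsMetricOn W G)
    (hu : u ∈ V) (ξ : Fin m → ℝ) : IsTwTangent G (x u) (S u) (E u) (pushLoc x S u ξ)
      (2 * (sdForm (frameForm G x E) u *ᵥ ξ) 2) (-(2 * (sdForm (frameForm G x E) u *ᵥ ξ) 1)) := by
  have hF := movingFrame_of_frame hG h.isOpen h.smooth_base h.mem hE.smooth hE.orth
  have h1 : ∀ k, (mpd S k u + (pullForm x (chr G) k u * S u - S u * pullForm x (chr G) k u)) * E u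
      = E u * (frameForm G x E k u * sdBasis 0 - sdBasis 0 * frameForm G x E k u) := fun k => by
    have h2 : mpd (fun w => S w * E w) k u = mpd (fun w => E w * sdBasis 0) k u :=
      mpd_congr h.isOpen hE.adapted hu k
    rw [mpd_mul h.isOpen hu h.smooth_end hE.smooth, mpd_mul h.isOpen hu hE.smooth (MSmooth.const _),
      mpd_const, Matrix.mul_zero, add_zero] at h2
    have h3 : E u * frameForm G x E k u = mpd E k u + pullForm x (chr G) k u * E u := by
      rw [frameForm, ← Matrix.mul_assoc, mul_eq_one_comm.1 (hE.orth u hu), Matrix.one_mul]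
    rw [Matrix.mul_sub, ← Matrix.mul_assoc, h3, ← Matrix.mul_assoc, ← hE.adapted u hu,
      Matrix.mul_assoc (S u), h3, Matrix.add_mul, eq_sub_of_add_eq h2]
    simp only [Matrix.add_mul, Matrix.sub_mul, Matrix.mul_add, Matrix.mul_assoc, hE.adapted u hu]
    abel
  have h4 : ∀ k, frameForm G x E k u * sdBasis 0 - sdBasis 0 * frameForm G x E k u
      = so ![0, 2 * sdForm (frameForm G x E) u 2 k, -(2 * sdForm (frameForm G x E) u 1 k)] 0 :=
    fun k => by
      conv_lhs => rw [eq_so (hF.skew u hu k), sdBasis, so_bracket]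
      congr 1
      · ext i; fin_cases i <;> simp [sdForm]
      · ext i; simp
  have h5 : vertical G (x u) (S u) (pushLoc x S u ξ) = ∑ k, ξ k •
      (mpd S k u + (pullForm x (chr G) k u * S u - S u * pullForm x (chr G) k u)) := by
    rw [vertical, pushLoc_snd, pushLoc_fst, connMatrix_jac]
    simp only [smul_add, smul_sub, Finset.sum_add_distrib, Finset.sum_sub_distrib, Matrix.sum_mul,
      Matrix.mul_sum, smul_mul_assoc, mul_smul_comm]
  have h6 : ∀ p : Fin m → Fin 3 → ℝ, ∑ k, ξ k • so (p k) 0 = so (∑ k, ξ k • p k) 0 := fun p => by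
    simp only [so_eq_sum, Finset.sum_apply, Pi.smul_apply, Finset.smul_sum, Finset.sum_smul,
      smul_smul, smul_eq_mul]
    exact Finset.sum_comm
  rw [IsTwTangent, h5, Matrix.sum_mul]
  simp only [smul_mul_assoc, h1, h4]
  simp only [← mul_smul_comm, ← Matrix.mul_sum, h6]
  congr 2
  ext i
  fin_cases i <;> simp [Matrix.mulVec, dotProduct, Finset.mul_sum] <;>
    exact Finset.sum_congr rfl fun k _ => by ring

lemma twCoord_pushLoc (τ : ℝ) (ξ : Fin m → ℝ) : twCoord τ G (x u) (E u) (pushLoc x S u ξ).1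
      (2 * (sdForm (frameForm G x E) u *ᵥ ξ) 2) (-(2 * (sdForm (frameForm G x E) u *ᵥ ξ) 1))
    = twCoframe τ (frameCoframe G x E) (frameForm G x E) u *ᵥ ξ := by
  rw [twCoord, twCoframe, Matrix.fromRows_mulVec, pushLoc_fst, Matrix.mulVec_mulVec, frameCoframe]
  congr 1
  ext a
  fin_cases a <;> simp [vertCoframe, Matrix.mulVec, dotProduct, Finset.mul_sum] <;>
    exact Finset.sum_congr rfl fun k _ => by ring

section

variable (h : TwParam W G V x S) (hE : AdaptedFrame G V x S E) (hG : IsMetricOn W G)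
include h hE hG

lemma hLoc_eq {t : ℝ} (hτ : τ ^ 2 = 4 * t) (hu : u ∈ V) : hLoc t G x S u
    = (twCoframe τ (frameCoframe G x E) (frameForm G x E) u)ᵀ
      * twCoframe τ (frameCoframe G x E) (frameForm G x E) u := by
  ext k l
  rw [hLoc, Matrix.of_apply, hMetric_eq (hG.symm _ (h.mem u hu)) (hE.orth u hu) hτ
    (isTwTangent_pushLoc h hE hG hu _) (isTwTangent_pushLoc h hE hG hu _), twCoord_pushLoc,
    twCoord_pushLoc, Matrix.mul_apply]
  simp [dotProduct, Matrix.col_apply]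

/-- A tangent vector is determined by its components in the adapted frame, and in these components
`𝒥_n` acts by the constant matrix `twJ n`. -/
lemma pushLoc_eq_acs_iff (hτ : τ ≠ 0) (hu : u ∈ V) (n : ℕ) (J : Matrix (Fin m) (Fin m) ℝ) :
    (∀ ξ, pushLoc x S u (J *ᵥ ξ) = acs n G (x u) (S u) (pushLoc x S u ξ)) ↔
      twCoframe τ (frameCoframe G x E) (frameForm G x E) u * J
        = twJ n * twCoframe τ (frameCoframe G x E) (frameForm G x E) u := by
  have h1 : ∀ ξ, pushLoc x S u (J *ᵥ ξ) = acs n G (x u) (S u) (pushLoc x S u ξ) ↔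
      twCoframe τ (frameCoframe G x E) (frameForm G x E) u *ᵥ (J *ᵥ ξ)
        = twJ n *ᵥ (twCoframe τ (frameCoframe G x E) (frameForm G x E) u *ᵥ ξ) := fun ξ => by
    have hT := isTwTangent_pushLoc h hE hG hu
    rw [← twCoord_pushLoc (S := S) τ (J *ᵥ ξ), ← twCoord_pushLoc (S := S) τ ξ,
      ← twCoord_acs (hE.adapted u hu) (hE.orth u hu) n]
    constructor
    · intro h2
      obtain ⟨h3, h4⟩ := (hT (J *ᵥ ξ)).unique (hE.orth u hu)
        (h2 ▸ isTwTangent_acs (hE.adapted u hu) n (hT ξ))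
      rw [h2, h3, h4]
    · exact eq_of_twCoord_eq (hE.orth u hu) hτ (hT _) (isTwTangent_acs (hE.adapted u hu) n (hT ξ))
  simp only [h1, Matrix.mulVec_mulVec]
  exact ⟨fun h2 => Matrix.ext_of_mulVec_single fun i => h2 _, fun h2 ξ => by rw [h2]⟩

end

section Six

variable {V : Set (R 6)} {u : R 6} {x : R 6 → R 4} {S E : R 6 → Matrix (Fin 4) (Fin 4) ℝ}
variable (h : TwParam W G V x S) (hE : AdaptedFrame G V x S E) (hG : IsMetricOn W G)
include h hE hG

/-- The frame dual to the coframe of the twistor space. -/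
lemma exists_dual_frame (hτ : τ ≠ 0) : ∃ X : R 6 → Matrix (Fin 6) (Fin 4 ⊕ Fin 2) ℝ,
    MSmooth V X ∧
    (∀ w ∈ V, X w * twCoframe τ (frameCoframe G x E) (frameForm G x E) w = 1) ∧
    ∀ w ∈ V, twCoframe τ (frameCoframe G x E) (frameForm G x E) w * X w = 1 := by
  have hF := movingFrame_of_frame hG h.isOpen h.smooth_base h.mem hE.smooth hE.orth
  set Θ := twCoframe τ (frameCoframe G x E) (frameForm G x E) with hΘ
  set r : Fin 4 ⊕ Fin 2 ≃ Fin 6 := finSumFinEquiv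
  -- A vector killed by the coframe has vanishing frame components, hence vanishing image under the
  -- differential; the parametrization is an immersion.
  have hinj : ∀ w ∈ V, ∀ ξ, Θ w *ᵥ ξ = 0 → ξ = 0 := fun w hw ξ hξ => by
    refine h.immersion w hw ξ ?_
    have hT := isTwTangent_pushLoc h hE hG hw
    have h0 : pushLoc x S w 0 = 0 := Prod.ext (by simp [pushLoc_fst]) (by simp [pushLoc_snd])
    rw [← h0]
    refine eq_of_twCoord_eq (hE.orth w hw) hτ (hT _) (hT 0) ?_
    rw [twCoord_pushLoc, twCoord_pushLoc, ← hΘ, hξ, Matrix.mulVec_zero]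
  have hdet : ∀ w ∈ V, ((Θ w).submatrix r.symm id).det ≠ 0 := fun w hw hd => by
    obtain ⟨ξ, hξ, hξ'⟩ := Matrix.exists_mulVec_eq_zero_iff.2 hd
    refine hξ (hinj w hw ξ ?_)
    ext i
    have := congrFun hξ' (r i)
    simpa [Matrix.mulVec, dotProduct] using this
  have hsm : MSmooth V fun w => (Θ w).submatrix r.symm id := fun i j =>
    hF.smooth_twCoframe τ (r.symm i) j
  have h1 : ∀ w ∈ V, ((Θ w).submatrix r.symm id)⁻¹.submatrix id r * Θ w = 1 := fun w hw => by
    have h2 := Matrix.nonsing_inv_mul _ (isUnit_iff_ne_zero.2 (hdet w hw))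
    ext i j
    rw [← h2, Matrix.mul_apply, Matrix.mul_apply]
    simp only [Matrix.submatrix_apply, id]
    exact (Equiv.sum_comp r (fun a => ((Θ w).submatrix r.symm id)⁻¹ i a * Θ w (r.symm a) j)).symm.trans
      (by simp) |>.symm
  refine ⟨fun w => ((Θ w).submatrix r.symm id)⁻¹.submatrix id r, fun i j =>
    hsm.inv hdet i (r j), h1, fun w hw => ?_⟩
  have h2 := Matrix.mul_nonsing_inv _ (isUnit_iff_ne_zero.2 (hdet w hw))
  ext i j
  have h3 := congrFun (congrFun h2 (r i)) (r j)
  simpa [Matrix.mul_apply, Matrix.one_apply] using h3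

end Six

end TwistorLocal


/-! ### The Ricci tensor of the twistor space in local parametrizations -/

section LocalRicci

/-- The Ricci tensor is Hermitian in all local parametrizations of the twistor space of the metric
`G` on `W`. -/
def LocHermitian (W : Set (R 4)) (G : R 4 → Matrix (Fin 4) (Fin 4) ℝ) (t : ℝ) (n : ℕ) : Prop :=
  ∀ (V : Set (R 6)) (x : R 6 → R 4) (S : R 6 → Matrix (Fin 4) (Fin 4) ℝ)
    (J : R 6 → Matrix (Fin 6) (Fin 6) ℝ), TwParam W G V x S →
    (∀ u ∈ V, ∀ ξ, pushLoc x S u (J u *ᵥ ξ) = acs n G (x u) (S u) (pushLoc x S u ξ)) →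
    ∀ u ∈ V, ∀ ξ η : Fin 6 → ℝ,
      (J u *ᵥ ξ) ⬝ᵥ (ricci (hLoc t G x S) u *ᵥ (J u *ᵥ η)) = ξ ⬝ᵥ (ricci (hLoc t G x S) u *ᵥ η)

lemma sign_sq (n : ℕ) : (-1 : ℝ) ^ (n + 1) * (-1 : ℝ) ^ (n + 1) = 1 := by
  rw [← mul_pow]; simp

lemma twJ_invariant_iff (n : ℕ) (P : Matrix (Fin 4) (Fin 4) ℝ) (Q : Matrix (Fin 4) (Fin 2) ℝ)
    (N : Matrix (Fin 2) (Fin 4) ℝ) (T : Matrix (Fin 2) (Fin 2) ℝ) :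
    (twJ n)ᵀ * Matrix.fromBlocks P Q N T * twJ n = Matrix.fromBlocks P Q N T ↔
      (sdBasis 0)ᵀ * P * sdBasis 0 = P ∧
      (-1 : ℝ) ^ (n + 1) • ((sdBasis 0)ᵀ * Q * vertJ) = Q ∧
      (-1 : ℝ) ^ (n + 1) • (vertJᵀ * N * sdBasis 0) = N ∧
      vertJᵀ * T * vertJ = T := by
  rw [twJ, Matrix.fromBlocks_transpose, Matrix.fromBlocks_multiply, Matrix.fromBlocks_multiply,
    Matrix.fromBlocks_inj]
  simp only [Matrix.transpose_zero, Matrix.zero_mul, Matrix.mul_zero, add_zero, zero_add,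
    Matrix.transpose_smul, Matrix.smul_mul, Matrix.mul_smul, smul_smul, sign_sq, one_smul]

variable {m : ℕ} {K : Fin 4 → Fin 4 → R m → Matrix (Fin 4) (Fin 4) ℝ} {u : R m} {t : ℝ}

lemma sdCurv_skew_of_isCurv (hK : IsCurv fun i j => K i j u) (b : Fin 3) :
    (sdCurv K b u)ᵀ = - sdCurv K b u := hK.sdTwo_skew b

lemma sdCurv_eq_so (hK : IsCurv fun i j => K i j u) (b : Fin 3) :
    sdCurv K b u = so (fun c => blockA (fun i j => K i j u) c b)
      (fun c => blockB (fun i j => K i j u) c b) := hK.sdTwo_eq b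

/-- By `so_mul_self` the squares `F_b²` contribute a scalar and products of columns of `A` and `B`
to the `mix` part. Invariance under `I₀` means that columns 1 and 2 of the total `mix` part vanish.
-/
lemma horizontal_invariant_iff (hK : IsCurv fun i j => K i j u) :
    (sdBasis 0)ᵀ * (ricTensor (fun i j => K i j u)
        + (2 * t) • (sdCurv K 1 u * sdCurv K 1 u + sdCurv K 2 u * sdCurv K 2 u)) * sdBasis 0
      = ricTensor (fun i j => K i j u)
        + (2 * t) • (sdCurv K 1 u * sdCurv K 1 u + sdCurv K 2 u * sdCurv K 2 u) ↔
    ∀ c, blockB (fun i j => K i j u) c 1 = 2 * t * (blockA (fun i j => K i j u) 1 1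
          * blockB (fun i j => K i j u) c 1
          + blockA (fun i j => K i j u) 1 2 * blockB (fun i j => K i j u) c 2) ∧
      blockB (fun i j => K i j u) c 2 = 2 * t * (blockA (fun i j => K i j u) 2 1
          * blockB (fun i j => K i j u) c 1
          + blockA (fun i j => K i j u) 2 2 * blockB (fun i j => K i j u) c 2) := by
  rw [hK.ricTensor_eq, sdCurv_eq_so hK, sdCurv_eq_so hK, so_mul_self, so_mul_self]
  generalize blockA (fun i j => K i j u) = A
  generalize blockB (fun i j => K i j u) = B
  have hm : ∀ (x y z s : ℝ) (P Q N : Matrix (Fin 3) (Fin 3) ℝ),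
      x • (1 : Matrix (Fin 4) (Fin 4) ℝ) + mix P
        + s • ((y • 1 + (2 : ℝ) • mix Q) + (z • 1 + (2 : ℝ) • mix N))
      = (x + s * (y + z)) • 1 + mix (P + (2 * s) • (Q + N)) := fun x y z s P Q N => by
    ext i j
    fin_cases i <;> fin_cases j <;> simp [mix] <;> ring
  rw [hm, mix_invariant_iff]
  refine forall_congr' fun c => and_congr ?_ ?_ <;>
    simp only [Matrix.add_apply, Matrix.smul_apply, Matrix.of_apply, smul_eq_mul] <;>
    constructor <;> intro h <;> linarith

/-- A symmetric 2×2 matrix invariant under a right-angle rotation is scalar, and the traces of `F_b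
F_a` are `-4` times the entries of `A² + BᵀB`. -/
lemma vertical_invariant_iff (hK : IsCurv fun i j => K i j u) (ht : 0 < t) {τ : ℝ}
    (hτ : τ ^ 2 = 4 * t) :
    vertJᵀ * (Matrix.of fun b a : Fin 2 =>
        (4 / τ ^ 2) * (1 : Matrix (Fin 2) (Fin 2) ℝ) b a
          - (τ / 2) ^ 2 * (sdCurv K b.succ u * sdCurv K a.succ u).trace) * vertJ
      = (Matrix.of fun b a : Fin 2 => (4 / τ ^ 2) * (1 : Matrix (Fin 2) (Fin 2) ℝ) b a
          - (τ / 2) ^ 2 * (sdCurv K b.succ u * sdCurv K a.succ u).trace) ↔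
    (blockA (fun i j => K i j u) * blockA (fun i j => K i j u)
      + (blockB fun i j => K i j u)ᵀ * blockB fun i j => K i j u) 1 1
      = (blockA (fun i j => K i j u) * blockA (fun i j => K i j u)
        + (blockB fun i j => K i j u)ᵀ * blockB fun i j => K i j u) 2 2 ∧
    (blockA (fun i j => K i j u) * blockA (fun i j => K i j u)
      + (blockB fun i j => K i j u)ᵀ * blockB fun i j => K i j u) 1 2 = 0 := by
  have hs := hK.blockA_symm
  have htr : ∀ b a, (sdCurv K b u * sdCurv K a u).trace
      = -4 * (blockA (fun i j => K i j u) * blockA (fun i j => K i j u)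
      + (blockB fun i j => K i j u)ᵀ * blockB fun i j => K i j u) b a := fun b a => by
    rw [sdCurv_eq_so hK, sdCurv_eq_so hK, trace_so_mul_so, Matrix.add_apply, Matrix.mul_apply,
      Matrix.mul_apply]
    simp only [Matrix.transpose_apply, hs _ b]
  have hsy : (blockA (fun i j => K i j u) * blockA (fun i j => K i j u)
      + (blockB fun i j => K i j u)ᵀ * blockB fun i j => K i j u) 2 1
      = (blockA (fun i j => K i j u) * blockA (fun i j => K i j u)
      + (blockB fun i j => K i j u)ᵀ * blockB fun i j => K i j u) 1 2 := by
    rw [Matrix.add_apply, Matrix.add_apply, Matrix.mul_apply, Matrix.mul_apply, Matrix.mul_apply,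
      Matrix.mul_apply]
    congr 1
    · exact Finset.sum_congr rfl fun i _ => by rw [hs 2 i, hs i 1, mul_comm]
    · exact Finset.sum_congr rfl fun i _ => by simp only [Matrix.transpose_apply, mul_comm]
  simp only [htr]
  generalize hM : (blockA (fun i j => K i j u) * blockA (fun i j => K i j u)
      + (blockB fun i j => K i j u)ᵀ * blockB fun i j => K i j u) = M at hsy ⊢
  rw [← Matrix.ext_iff]
  simp only [Fin.forall_fin_two, Matrix.mul_apply, Fin.sum_univ_two, Matrix.transpose_apply,
    Matrix.of_apply, Fin.succ_zero_eq_one, Fin.succ_one_eq_two]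
  have hτ0 : τ ≠ 0 := by rintro rfl; linarith [zero_pow (M₀ := ℝ) two_ne_zero]
  simp [vertJ, hτ0]
  have e : (τ / 2) ^ 2 = t := by rw [div_pow, hτ]; ring
  rw [e, hsy]
  constructor
  · rintro ⟨⟨h1, h2⟩, -⟩
    exact ⟨h1.symm, mul_left_cancel₀ ht.ne' (by linarith)⟩
  · rintro ⟨h1, h2⟩
    rw [h1, h2]; simp

/-- The invariance of the blocks of the Ricci tensor of the twistor space. -/
lemma ricciCondition_iff (hK : IsCurv fun i j => K i j u) (ht : 0 < t) {τ : ℝ}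
    (hτ : τ ^ 2 = 4 * t) (n : ℕ) (Q : Matrix (Fin 4) (Fin 2) ℝ) (N : Matrix (Fin 2) (Fin 4) ℝ) :
    (twJ n)ᵀ * Matrix.fromBlocks ((Matrix.of fun j l => ∑ i, K i j u i l)
        + (τ ^ 2 / 2) • (sdCurv K 1 u * sdCurv K 1 u + sdCurv K 2 u * sdCurv K 2 u)) Q N
        (Matrix.of fun b a : Fin 2 => (4 / τ ^ 2) * (1 : Matrix (Fin 2) (Fin 2) ℝ) b a
          - (τ / 2) ^ 2 * (sdCurv K b.succ u * sdCurv K a.succ u).trace) * twJ n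
      = Matrix.fromBlocks ((Matrix.of fun j l => ∑ i, K i j u i l)
        + (τ ^ 2 / 2) • (sdCurv K 1 u * sdCurv K 1 u + sdCurv K 2 u * sdCurv K 2 u)) Q N
        (Matrix.of fun b a : Fin 2 => (4 / τ ^ 2) * (1 : Matrix (Fin 2) (Fin 2) ℝ) b a
          - (τ / 2) ^ 2 * (sdCurv K b.succ u * sdCurv K a.succ u).trace) ↔
    RicciCondition t (blockA fun i j => K i j u) (blockB fun i j => K i j u) ∧
      (-1 : ℝ) ^ (n + 1) • ((sdBasis 0)ᵀ * Q * vertJ) = Q ∧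
      (-1 : ℝ) ^ (n + 1) • (vertJᵀ * N * sdBasis 0) = N := by
  rw [twJ_invariant_iff, vertical_invariant_iff hK ht hτ, show τ ^ 2 / 2 = 2 * t by rw [hτ]; ring]
  have := horizontal_invariant_iff (t := t) hK
  unfold ricTensor at this
  rw [this]
  constructor
  · rintro ⟨h1, h2, h3, h4, h5⟩
    exact ⟨⟨fun c => (h1 c).1, fun c => (h1 c).2, h4, h5⟩, h2, h3⟩
  · rintro ⟨⟨h1, h1', h4, h5⟩, h2, h3⟩
    exact ⟨fun c => ⟨h1 c, h1' c⟩, h2, h3, h4, h5⟩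

section

variable {W : Set (R 4)} {G : R 4 → Matrix (Fin 4) (Fin 4) ℝ} {V : Set (R 6)} {u : R 6}
  {x : R 6 → R 4} {S E : R 6 → Matrix (Fin 4) (Fin 4) ℝ} {τ : ℝ}
  (h : TwParam W G V x S) (hE : AdaptedFrame G V x S E) (hG : IsMetricOn W G)
include h hE hG

/-- The condition on the curvature for the Ricci tensor of the twistor space to be Hermitian. -/
theorem hermitian_iff (ht : 0 < t) (hτ : τ ^ 2 = 4 * t) (hu : u ∈ V) (n : ℕ) :
    ∃ Y : Matrix (Fin 6) (Fin 4) ℝ, frameCoframe G x E u * Y = 1 ∧ ∀ J : Matrix (Fin 6) (Fin 6) ℝ,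
    (∀ ξ, pushLoc x S u (J *ᵥ ξ) = acs n G (x u) (S u) (pushLoc x S u ξ)) →
    ∀ D : Matrix (Fin 4) (Fin 2) ℝ, D = (Matrix.of fun j a => -(τ / 2) *
      ∑ i, covDir (frameForm G x E) (fun a b w => frameCurv G (x w) (E w) a b) Y
        a.succ i u i j) →
    ((∀ ξ η : Fin 6 → ℝ, (J *ᵥ ξ) ⬝ᵥ (ricci (hLoc t G x S) u *ᵥ (J *ᵥ η))
        = ξ ⬝ᵥ (ricci (hLoc t G x S) u *ᵥ η)) ↔
      RicciCondition t (blockA (frameCurv G (x u) (E u))) (blockB (frameCurv G (x u) (E u))) ∧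
      (-1 : ℝ) ^ (n + 1) • ((sdBasis 0)ᵀ * D * vertJ) = D ∧
      (-1 : ℝ) ^ (n + 1) • (vertJᵀ * Dᵀ * sdBasis 0) = Dᵀ) := by
  have hτ0 : τ ≠ 0 := by rintro rfl; linarith [zero_pow (M₀ := ℝ) two_ne_zero]
  have hF := movingFrame_of_frame hG h.isOpen h.smooth_base h.mem hE.smooth hE.orth
  have hK : ∀ w ∈ V, IsCurv (frameCurv G (x w) (E w)) := fun w hw =>
    isCurv_frameCurv hG (h.mem w hw) (E w)
  obtain ⟨X, -, hXΘ, hΘX⟩ := exists_dual_frame h hE hG hτ0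
  obtain ⟨Y, hY, hR⟩ := hF.twistor_ricci τ hτ0 (fun w hw i j => (hK w hw).swap i j) hu hXΘ hΘX
    (fun w hw => hLoc_eq h hE hG hτ hw)
  refine ⟨Y, hY, fun J hJ D hD => ?_⟩
  rw [← ricciCondition_iff (K := fun a b w => frameCurv G (x w) (E w) a b) (u := u) (hK u hu) ht hτ]
  rw [pushLoc_eq_acs_iff h hE hG hτ0 hu] at hJ
  have hDt : Dᵀ = (Matrix.of fun a j => -(τ / 2) *
      ∑ i, covDir (frameForm G x E) (fun a b w => frameCurv G (x w) (E w) a b) Y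
        a.succ i u i j) := by rw [hD]; rfl
  rw [hR, hDt, hD]
  generalize Matrix.fromBlocks _ _ _ _ = P at *
  generalize hΘ : twCoframe τ (frameCoframe G x E) (frameForm G x E) u = Θ at *
  have hΘX' : Θ * X u = 1 := hΘ ▸ hΘX u hu
  have hJ' : ∀ η, Θ *ᵥ (J *ᵥ η) = twJ n *ᵥ (Θ *ᵥ η) := fun η => by
    rw [Matrix.mulVec_mulVec, hJ, ← Matrix.mulVec_mulVec]
  have key : ∀ ξ η, (J *ᵥ ξ) ⬝ᵥ ((Θᵀ * P * Θ) *ᵥ (J *ᵥ η))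
      = (Θ *ᵥ ξ) ⬝ᵥ (((twJ n)ᵀ * P * twJ n) *ᵥ (Θ *ᵥ η)) := fun ξ η => by
    rw [← Matrix.mulVec_mulVec, ← Matrix.mulVec_mulVec, Matrix.dotProduct_mulVec,
      Matrix.vecMul_transpose, hJ', hJ', ← Matrix.mulVec_mulVec, ← Matrix.mulVec_mulVec,
      Matrix.dotProduct_mulVec _ (twJ n)ᵀ, Matrix.vecMul_transpose]
  have key' : ∀ ξ η, ξ ⬝ᵥ ((Θᵀ * P * Θ) *ᵥ η) = (Θ *ᵥ ξ) ⬝ᵥ (P *ᵥ (Θ *ᵥ η)) := fun ξ η => by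
    rw [← Matrix.mulVec_mulVec, ← Matrix.mulVec_mulVec, Matrix.dotProduct_mulVec,
      Matrix.vecMul_transpose]
  simp only [key, key']
  constructor
  · intro h1
    have h2 : ∀ a b, a ⬝ᵥ (((twJ n)ᵀ * P * twJ n) *ᵥ b) = a ⬝ᵥ (P *ᵥ b) := fun a b => by
      have := h1 (X u *ᵥ a) (X u *ᵥ b)
      simpa only [Matrix.mulVec_mulVec _ Θ, hΘX', Matrix.one_mulVec] using this
    exact Matrix.ext_of_mulVec_single fun i => dotProduct_eq _ _ fun a => by
      rw [dotProduct_comm, h2, dotProduct_comm]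
  · intro h1 ξ η
    rw [h1]

end

/-- Adapted frames are negatively oriented. -/
lemma IsNegCS.det_neg {G S e : Matrix (Fin 4) (Fin 4) ℝ} (hS : IsNegCS G S) (he : eᵀ * G * e = 1)
    (hSe : S * e = e * sdBasis 0) : e.det < 0 := by
  refine lt_of_le_of_ne ?_ (det_ne_zero_of_orthonormal he)
  have h1 : eᵀ = Matrix.of ![fun i => e i 0, S *ᵥ fun i => e i 0, fun i => e i 2,
      S *ᵥ fun i => e i 2] := by
    have h2 : ∀ i j, ∑ k, S i k * e k j = (e * sdBasis 0) i j := fun i j => by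
      rw [← hSe, Matrix.mul_apply]
    ext j i
    fin_cases j
    · rfl
    · change e i 1 = ∑ k, S i k * e k 0
      rw [h2, sdBasis_zero]; simp [Matrix.mul_apply, Fin.sum_univ_four]
    · rfl
    · change e i 3 = ∑ k, S i k * e k 2
      rw [h2, sdBasis_zero]; simp [Matrix.mul_apply, Fin.sum_univ_four]
  rw [← Matrix.det_transpose, h1]
  exact hS.neg _ _

/-! ### Existence of parametrizations, and the local criterion in both directions -/

section

variable {W : Set (R 4)} {G : R 4 → Matrix (Fin 4) (Fin 4) ℝ} {y : R 4}
  {e : Matrix (Fin 4) (Fin 4) ℝ}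

lemma MSmooth.so {V : Set (R m)} {p : R m → Fin 3 → ℝ}
    (hp : ∀ b, ContDiffOn ℝ ∞ (fun w => p w b) V) : MSmooth V fun w => so (p w) 0 := by
  simp only [so_eq_sum]
  exact MSmooth.sum fun b => MSmooth.smul (hp b) (MSmooth.const _)

/-- There is a parametrization of the twistor space through every adapted frame. -/
theorem exists_twParam (hG : IsMetricOn W G) (hy : y ∈ W) (he : eᵀ * G y * e = 1)
    (hd : e.det < 0) : ∃ (V : Set (R 6)) (x : R 6 → R 4)
      (S : R 6 → Matrix (Fin 4) (Fin 4) ℝ) (u : R 6), TwParam W G V x S ∧ u ∈ V ∧ x u = y ∧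
      S u * e = e * sdBasis 0 := by
  obtain ⟨W', hW', hW'o, hyW', E, hE, hEy, hon⟩ := exists_frame hG.isOpen hG.smooth hG.symm hy he
  set x : R 6 → R 4 := fun u => WithLp.toLp 2 fun i => u (Fin.castAdd 2 i) with hx
  have hxs : ContDiff ℝ ∞ x := contDiff_euclidean.2 fun i => by
    simp only [hx]; fun_prop
  -- Graph chart of a hemisphere of the fibre sphere, centred at `(1, 0, 0)`, so that the centre
  -- corresponds to `sdBasis 0` and the adapted frame is `e`.
  set p : R 6 → Fin 3 → ℝ := fun u => ![Real.sqrt (1 - (u 4 ^ 2 + u 5 ^ 2)), u 4, u 5] with hp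
  have hV₀ : IsOpen (x ⁻¹' W') := hW'o.preimage hxs.continuous
  have hEx : MSmooth (x ⁻¹' W') fun u => E (x u) := fun i j =>
    ((hE i j).mono (subset_refl _)).comp hxs.contDiffOn fun w hw => hw
  have hV₁ : IsOpen (x ⁻¹' W' ∩ (fun u => (E (x u)).det) ⁻¹' Set.Iio 0) :=
    (contDiffOn_det hEx).continuousOn.isOpen_inter_preimage hV₀ isOpen_Iio
  have hV₂ : IsOpen {u : R 6 | u 4 ^ 2 + u 5 ^ 2 < 1} :=
    isOpen_lt (by fun_prop) continuous_const
  set V := x ⁻¹' W' ∩ (fun u => (E (x u)).det) ⁻¹' Set.Iio 0 ∩ {u : R 6 | u 4 ^ 2 + u 5 ^ 2 < 1}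
    with hV
  have hVo : IsOpen V := hV₁.inter hV₂
  have hVx : ∀ w ∈ V, x w ∈ W' := fun w hw => hw.1.1
  have hEV : MSmooth V fun u => E (x u) := hEx.mono hVx
  have hPV : MSmooth V fun u => (E (x u))ᵀ * G (x u) := hEV.transpose.mul
    (hG.smooth.comp hxs.contDiffOn fun w hw => hW' (hVx w hw))
  have hpV : ∀ b, ContDiffOn ℝ ∞ (fun w => p w b) V := fun b => by
    fin_cases b
    · refine ContDiffOn.sqrt (f := fun w : R 6 => 1 - (w 4 ^ 2 + w 5 ^ 2)) ?_ fun w hw => ?_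
      · fun_prop
      · have : w 4 ^ 2 + w 5 ^ 2 < 1 := hw.2
        exact (sub_pos.2 this).ne'
    · simp only [hp]; simp; fun_prop
    · simp only [hp]; simp; fun_prop
  have hso := MSmooth.so hpV
  have hinv : ∀ w ∈ V, (E (x w))ᵀ * G (x w) * E (x w) = 1 := fun w hw => hon _ (hVx w hw)
  set u₀ : R 6 := WithLp.toLp 2 (Fin.append y (0 : Fin 2 → ℝ)) with hu₀
  have hxu : x u₀ = y := by
    ext i; simp [hx, hu₀]
  have h4 : u₀ 4 = 0 := Fin.append_right (y : Fin 4 → ℝ) (0 : Fin 2 → ℝ) 0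
  have h5 : u₀ 5 = 0 := Fin.append_right (y : Fin 4 → ℝ) (0 : Fin 2 → ℝ) 1
  refine ⟨V, x, fun u => E (x u) * so (p u) 0 * ((E (x u))ᵀ * G (x u)), u₀,
    ⟨hVo, hxs.contDiffOn, (hEV.mul hso).mul hPV, fun w hw => hW' (hVx w hw), fun w hw => ?_,
      fun w hw ξ hξ => ?_⟩, ⟨⟨by simpa [hxu] using hyW', by simpa [hxu, hEy] using hd⟩,
      by simp [h4, h5]⟩, hxu, ?_⟩
  · refine isNegCS_of_frame (hG.symm _ (hW' (hVx w hw))) (hinv w hw) hw.1.2 ?_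
    have : w 4 ^ 2 + w 5 ^ 2 < 1 := hw.2
    simp only [hp, Matrix.cons_val_zero, Matrix.cons_val_one, Matrix.cons_val]
    rw [Real.sq_sqrt (by linarith)]
    ring
  · set S : R 6 → Matrix (Fin 4) (Fin 4) ℝ :=
      fun u => E (x u) * so (p u) 0 * ((E (x u))ᵀ * G (x u)) with hS
    have hSs : MSmooth V S := (hEV.mul hso).mul hPV
    have hj : jac x w *ᵥ ξ = 0 := by rw [← pushLoc_fst (S := S), hξ]; rfl
    have h1 : ∀ i : Fin 4, ξ (Fin.castAdd 2 i) = 0 := fun i => by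
      have := congrFun hj i
      simp only [jac, Matrix.mulVec, dotProduct, Matrix.of_apply] at this
      simpa [hx, pd_coord] using this
    have h2 : ∑ k, ξ k • mpd S k w = 0 := by rw [← pushLoc_snd (x := x), hξ]; rfl
    have h3 : ∀ k, mpd S k w * E (x w) + S w * mpd (fun w => E (x w)) k w
        = mpd (fun w => E (x w)) k w * so (p w) 0 + E (x w) * mpd (fun w => so (p w) 0) k w :=
      fun k => by
        rw [← mpd_mul hVo hw hSs hEV, ← mpd_mul hVo hw hEV hso]
        refine mpd_congr hVo (fun w hw => ?_) hw k
        simp only [hS]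
        rw [Matrix.mul_assoc, hinv w hw, Matrix.mul_one]
    have h4 : ∑ k, ξ k • mpd (fun w => E (x w)) k w = 0 := by
      have : ∀ k, mpd (fun w => E (x w)) k w = ∑ i, jac x w i k • mpd E i (x w) := fun k =>
        mpd_comp hVo hW'o (fun i j => (hE i j).mono (subset_refl _)) hxs.contDiffOn hVx hw k
      simp only [this, Finset.smul_sum, smul_smul]
      rw [Finset.sum_comm]
      simp only [← Finset.sum_smul]
      refine Finset.sum_eq_zero fun i _ => ?_
      have h5 := congrFun hj i
      simp only [Matrix.mulVec, dotProduct, mul_comm, Pi.zero_apply] at h5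
      rw [h5, zero_smul]
    have h5 : E (x w) * ∑ k, ξ k • mpd (fun w => so (p w) 0) k w = 0 := by
      have h6 : ∑ k, ξ k • (mpd S k w * E (x w) + S w * mpd (fun w => E (x w)) k w)
          = (∑ k, ξ k • mpd S k w) * E (x w)
            + S w * ∑ k, ξ k • mpd (fun w => E (x w)) k w := by
        simp only [smul_add, Finset.sum_add_distrib, Matrix.sum_mul, Matrix.mul_sum,
          smul_mul_assoc, mul_smul_comm]
      have h7 : ∑ k, ξ k • (mpd (fun w => E (x w)) k w * so (p w) 0
            + E (x w) * mpd (fun w => so (p w) 0) k w)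
          = (∑ k, ξ k • mpd (fun w => E (x w)) k w) * so (p w) 0
            + E (x w) * ∑ k, ξ k • mpd (fun w => so (p w) 0) k w := by
        simp only [smul_add, Finset.sum_add_distrib, Matrix.sum_mul, Matrix.mul_sum,
          smul_mul_assoc, mul_smul_comm]
      simp only [h3] at h6
      rw [h6, h2, h4, Matrix.mul_zero, Matrix.zero_mul, Matrix.zero_mul, zero_add, zero_add] at h7
      exact h7.symm
    have h6 : ∑ k, ξ k • mpd (fun w => so (p w) 0) k w = 0 := by
      have := congrArg (((E (x w))ᵀ * G (x w)) * ·) h5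
      simpa only [← Matrix.mul_assoc, hinv w hw, Matrix.one_mul, Matrix.mul_zero] using this
    -- The entries (2,0) and (3,0) of `so (p w) 0` are the fibre coordinates themselves, so their
    -- derivatives detect the last two components of `ξ`.
    have h8 : ξ 4 = 0 := by
      have := congrFun (congrFun h6 2) 0
      simp only [Matrix.sum_apply, Matrix.smul_apply, mpd_apply, so, hp] at this
      simpa [pd_coord] using this
    have h9 : ξ 5 = 0 := by
      have := congrFun (congrFun h6 3) 0
      simp only [Matrix.sum_apply, Matrix.smul_apply, mpd_apply, so, hp] at this
      simpa [pd_coord] using this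
    ext k
    refine Fin.addCases (m := 4) (n := 2) (motive := fun k => ξ k = 0) h1 (fun i => ?_) k
    fin_cases i
    · exact h8
    · exact h9
  · have h6 : p u₀ = Pi.single 0 1 := by
      ext b; fin_cases b <;> simp [hp, h4, h5]
    change E (x u₀) * so (p u₀) 0 * ((E (x u₀))ᵀ * G (x u₀)) * e = _
    rw [h6, hxu, hEy, Matrix.mul_assoc, he, Matrix.mul_one]
    rfl

/-- The restriction that a Hermitian Ricci tensor of the twistor space puts on the curvature. -/
theorem LocHermitian.ricciCondition {n : ℕ} (hH : LocHermitian W G t n) (hG : IsMetricOn W G)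
    (ht : 0 < t) (hy : y ∈ W) (he : eᵀ * G y * e = 1) (hd : e.det < 0) :
    RicciCondition t (blockA (frameCurv G y e)) (blockB (frameCurv G y e)) := by
  obtain ⟨V, x, S, u, hP, hu, hxu, hSe⟩ := exists_twParam hG hy he hd
  obtain ⟨V', hV', hV'o, hu', E, hE, hEu⟩ := hP.exists_adaptedFrame hG hu (hxu ▸ he) hSe
  have hP' := hP.mono hV' hV'o
  have hτ : (2 * Real.sqrt t) ^ 2 = 4 * t := by rw [mul_pow, Real.sq_sqrt ht.le]; ring
  have hτ0 : 2 * Real.sqrt t ≠ 0 := by positivity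
  obtain ⟨X, -, hXΘ, hΘX⟩ := exists_dual_frame hP' hE hG hτ0
  set Θ := twCoframe (2 * Real.sqrt t) (frameCoframe G x E) (frameForm G x E)
  -- Conjugating `twJ n` by the coframe gives the matrix of `𝒥_n` in coordinates, so the Hermitian
  -- hypothesis can be applied.
  have hJ : ∀ w ∈ V', ∀ ξ, pushLoc x S w ((X w * twJ n * Θ w) *ᵥ ξ)
      = acs n G (x w) (S w) (pushLoc x S w ξ) := fun w hw => by
    rw [pushLoc_eq_acs_iff hP' hE hG hτ0 hw, ← Matrix.mul_assoc, ← Matrix.mul_assoc, hΘX w hw,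
      Matrix.one_mul]
  obtain ⟨Y, -, hY⟩ := hermitian_iff hP' hE hG ht hτ hu' n
  have := ((hY _ (hJ u hu') _ rfl).1 (hH V' x S _ hP' hJ u hu')).1
  rwa [hxu, hEu] at this

/-- Sufficient conditions for the Ricci tensor of the twistor space to be Hermitian. -/
theorem locHermitian_of (hG : IsMetricOn W G) (ht : 0 < t)
    (h : (∀ y ∈ W, ∀ e : Matrix (Fin 4) (Fin 4) ℝ, eᵀ * G y * e = 1 → e.det < 0 →
        (∃ α : ℝ, blockA (frameCurv G y e) = α • 1) ∧ blockB (frameCurv G y e) = 0) ∨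
      (∀ y ∈ W, ∀ e : Matrix (Fin 4) (Fin 4) ℝ, eᵀ * G y * e = 1 → e.det < 0 →
        blockA (frameCurv G y e) = (1 / (2 * t)) • 1 ∧
        ∃ l : ℝ, (blockB (frameCurv G y e))ᵀ * blockB (frameCurv G y e) = l • 1)) (n : ℕ) :
    LocHermitian W G t n := by
  intro V x S J hP hJ u hu
  obtain ⟨e, he, hSe, -⟩ := (hP.isNegCS u hu).exists_adapted (hG.posDef _ (hP.mem u hu))
  obtain ⟨V', hV', hV'o, hu', E, hE, hEu⟩ := hP.exists_adaptedFrame hG hu he hSe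
  have hP' := hP.mono hV' hV'o
  have hd : ∀ w ∈ V', (E w).det < 0 := fun w hw =>
    (hP'.isNegCS w hw).det_neg (hE.orth w hw) (hE.adapted w hw)
  have hF := movingFrame_of_frame hG hP'.isOpen hP'.smooth_base hP'.mem hE.smooth hE.orth
  have hK : ∀ w ∈ V', IsCurv (frameCurv G (x w) (E w)) := fun w hw =>
    isCurv_frameCurv hG (hP'.mem w hw) (E w)
  have hskew : ∀ w ∈ V', ∀ b, (sdCurv (fun a b w => frameCurv G (x w) (E w) a b) b w)ᵀ
      = - sdCurv (fun a b w => frameCurv G (x w) (E w) a b) b w := fun w hw =>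
    sdCurv_skew_of_isCurv (K := fun a b w => frameCurv G (x w) (E w) a b) (hK w hw)
  have hτ : (2 * Real.sqrt t) ^ 2 = 4 * t := by rw [mul_pow, Real.sq_sqrt ht.le]; ring
  obtain ⟨Y, hθY, hY⟩ := hermitian_iff hP' hE hG ht hτ hu' n
  refine (hY _ (hJ u hu) _ rfl).2 ?_
  set D : Matrix (Fin 4) (Fin 2) ℝ := Matrix.of fun j a => -(2 * Real.sqrt t / 2) *
      ∑ i, covDir (frameForm G x E) (fun a b w => frameCurv G (x w) (E w) a b) Y
        a.succ i u i j with hD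
  have key : RicciCondition t (blockA (frameCurv G (x u) (E u))) (blockB (frameCurv G (x u) (E u)))
      ∧ D = 0 := by
    have hbi := fun b => hF.covDir_bianchi (hskew u hu') hu' hθY b
    rcases h with h | h
    · obtain ⟨⟨α, hα⟩, hB⟩ := h _ (hP'.mem u hu') _ (hE.orth u hu') (hd u hu')
      refine ⟨⟨?_, ?_, ?_, ?_⟩, ?_⟩
      · simp [hB]
      · simp [hB]
      · simp [hα, hB]
      · simp [hα, hB]
      -- Condition (i): `B = 0` near `u` makes the derivative of `F` self-dual, and the Bianchi
      -- identity then says that its divergence, the mixed Ricci block, is zero.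
      · have h1 : ∀ b k, asdPart (covCurv (frameForm G x E)
            (fun a b w => frameCurv G (x w) (E w) a b) b k u) = 0 := fun b k =>
          hF.asdPart_covCurv hskew hu' (fun w hw =>
            (h _ (hP'.mem w hw) _ (hE.orth w hw) (hd w hw)).2) b k
        have h2 : ∀ b p, covDir (frameForm G x E) (fun a b w => frameCurv G (x w) (E w) a b) Y b p u
            = so (sdPart (covDir (frameForm G x E)
              (fun a b w => frameCurv G (x w) (E w) a b) Y b p u)) 0 := fun b p => by
          conv_lhs => rw [hF.covDir_eq_so hskew hu']
          congr 1
          simp [covDir, asdPart_sum, asdPart_smul, h1]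
        have h3 : ∀ b j, ∑ p, covDir (frameForm G x E)
            (fun a b w => frameCurv G (x w) (E w) a b) Y b p u p j = 0 := fun b j => by
          have := div_of_cyclic_sd (q := fun p => sdPart (covDir (frameForm G x E)
              (fun a b w => frameCurv G (x w) (E w) a b) Y b p u)) (fun p q r => by
            have := hbi b p q r
            rw [h2 b p, h2 b q, h2 b r] at this
            exact this) j
          rw [← this]
          exact Finset.sum_congr rfl fun p _ => by rw [← h2]
        ext j a
        simp [hD, h3]
    · obtain ⟨hA, l, hl⟩ := h _ (hP'.mem u hu') _ (hE.orth u hu') (hd u hu')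
      refine ⟨⟨?_, ?_, ?_, ?_⟩, ?_⟩
      · intro c; simp [hA]; field_simp
      · intro c; simp [hA]; field_simp
      · simp [hA, hl]
      · simp [hA, hl]
      -- Condition (ii): `A` is constant, so the derivative of `F` has no self-dual part, and the
      -- same duality argument applies to the anti-self-dual part.
      · have h2 : ∀ b p, covDir (frameForm G x E) (fun a b w => frameCurv G (x w) (E w) a b) Y b p u
            = so 0 (asdPart (covDir (frameForm G x E)
              (fun a b w => frameCurv G (x w) (E w) a b) Y b p u)) := fun b p => by
          conv_lhs => rw [hF.covDir_eq_so hskew hu']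
          congr 1
          rw [hF.sdPart_covDir_of_scalar (α := fun _ => 1 / (2 * t)) hskew hu' fun w hw =>
            (h _ (hP'.mem w hw) _ (hE.orth w hw) (hd w hw)).1]
          simp [pd_const]
        have h3 : ∀ b j, ∑ p, covDir (frameForm G x E)
            (fun a b w => frameCurv G (x w) (E w) a b) Y b p u p j = 0 := fun b j => by
          have := div_of_cyclic_asd (q := fun p => asdPart (covDir (frameForm G x E)
              (fun a b w => frameCurv G (x w) (E w) a b) Y b p u)) (fun p q r => by
            have := hbi b p q r
            rw [h2 b p, h2 b q, h2 b r] at this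
            exact this) j
          rw [← this]
          exact Finset.sum_congr rfl fun p _ => by rw [← h2]
        ext j a
        simp [hD, h3]
  exact ⟨key.1, by simp [key.2], by simp [key.2]⟩

end

end LocalRicci


/-! ### Charts and local parametrizations -/

section Charts

variable {M : Type*} [TopologicalSpace M] [ChartedSpace (R 4) M] [IsManifold (𝓡 4) ∞ M]
  {c : OpenPartialHomeomorph M (R 4)} (g : Metric M)

/-- The differential of the inverse of a chart. -/
def chartInv (c : OpenPartialHomeomorph M (R 4)) (y : R 4) : R 4 →L[ℝ] R 4 :=
  mfderiv (𝓡 4) (𝓡 4) c.symm y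

/-- The differential of a chart. -/
def chartDer (c : OpenPartialHomeomorph M (R 4)) (p : M) : R 4 →L[ℝ] R 4 :=
  mfderiv (𝓡 4) (𝓡 4) c p

/-- The metric on a tangent space, as a bilinear form on `ℝ⁴`. -/
def innerAt (p : M) : R 4 →L[ℝ] R 4 →L[ℝ] ℝ := g.inner p

lemma chartDer_chartInv (hc : c ∈ atlas (R 4) M) {y : R 4} (hy : y ∈ c.target) (v : R 4) :
    chartDer c (c.symm y) (chartInv c y v) = v :=
  congrArg (fun L : R 4 →L[ℝ] R 4 => L v)
    ((mdifferentiable_of_mem_atlas (I := 𝓡 4) hc).comp_symm_deriv hy)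

lemma chartInv_chartDer (hc : c ∈ atlas (R 4) M) {p : M} (hp : p ∈ c.source) (v : R 4) :
    chartInv c (c p) (chartDer c p v) = v :=
  congrArg (fun L : R 4 →L[ℝ] R 4 => L v)
    ((mdifferentiable_of_mem_atlas (I := 𝓡 4) hc).symm_comp_deriv hp)

lemma coeff_apply (c : OpenPartialHomeomorph M (R 4)) (y : R 4) (i j : Fin 4) :
    coeff g c y i j = innerAt g (c.symm y) (chartInv c y (stdVec i)) (chartInv c y (stdVec j)) := rfl

lemma endCoord_apply (c : OpenPartialHomeomorph M (R 4)) (z : EndBundle M) (i j : Fin 4) :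
    endCoord c z i j
      = (chartDer c z.1 ((z.2 : R 4 →L[ℝ] R 4) (chartInv c (c z.1) (stdVec j)))) i := rfl

/-- The coordinate fields are smooth sections, as images of constant fields under the tangent map of
the inverse chart; the coefficients pair them with the smooth metric section. -/
lemma smooth_coeff (hc : c ∈ atlas (R 4) M) : MSmooth c.target (coeff g c) := by
  intro i j
  have hsymm : ContMDiffOn (𝓡 4) (𝓡 4) ∞ c.symm c.target :=
    contMDiffOn_symm_of_mem_maximalAtlas (IsManifold.subset_maximalAtlas hc)
  have hT := hsymm.contMDiffOn_tangentMapWithin (m := ∞) (by simp) c.open_target.uniqueMDiffOn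
  have hsec : ∀ j, ContMDiffOn (𝓡 4) (𝓡 4).tangent ∞
      (fun y => (TotalSpace.mk' (R 4) (c.symm y) (coordVec c y j) : TangentBundle (𝓡 4) M))
      c.target := by
    intro j
    have h1 : ContMDiffOn (𝓡 4) (𝓡 4).tangent ∞
        (fun y : R 4 => (⟨y, stdVec j⟩ : TangentBundle (𝓡 4) (R 4))) c.target :=
      (contMDiffOn_vectorSpace_iff_contDiffOn (V := fun _ => stdVec j)).2 contDiffOn_const
    refine (hT.comp h1 fun y hy => hy).congr fun y hy => ?_
    simp only [Function.comp, tangentMapWithin]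
    rw [mfderivWithin_of_isOpen c.open_target hy]
    rfl
  have hg : ContMDiffOn (𝓡 4) ((𝓡 4).prod 𝓘(ℝ, R 4 →L[ℝ] R 4 →L[ℝ] ℝ)) ∞
      (fun y => (⟨c.symm y, g.inner (c.symm y)⟩ : TotalSpace (R 4 →L[ℝ] R 4 →L[ℝ] ℝ)
        (fun p : M => TangentSpace (𝓡 4) p →L[ℝ] TangentSpace (𝓡 4) p →L[ℝ] ℝ))) c.target :=
    g.contMDiff.comp_contMDiffOn hsymm
  have key := ContMDiffOn.clm_bundle_apply₂ (F₃ := ℝ) (E₃ := Bundle.Trivial M ℝ) hg (hsec i) (hsec j)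
  rw [← contMDiffOn_iff_contDiffOn]
  intro y hy
  have := key y hy
  simp only [contMDiffWithinAt_totalSpace] at this
  exact this.2

lemma inner_chartInv (c : OpenPartialHomeomorph M (R 4)) (y : R 4) (a b : Fin 4 → ℝ) :
    innerAt g (c.symm y) (chartInv c y (WithLp.toLp 2 a)) (chartInv c y (WithLp.toLp 2 b))
      = a ⬝ᵥ (coeff g c y *ᵥ b) := by
  rw [sum_stdVec (WithLp.toLp 2 a), sum_stdVec (WithLp.toLp 2 b)]
  simp only [map_sum, map_smul, _root_.sum_apply, _root_.smul_apply,
    smul_eq_mul, dotProduct, Matrix.mulVec, coeff_apply, Finset.mul_sum]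
  rw [Finset.sum_comm]
  exact Finset.sum_congr rfl fun i _ => Finset.sum_congr rfl fun j _ => by ring

lemma isMetricOn_coeff (hc : c ∈ atlas (R 4) M) : IsMetricOn c.target (coeff g c) := by
  refine ⟨c.open_target, smooth_coeff g hc, fun y hy => ?_⟩
  refine Matrix.PosDef.of_dotProduct_mulVec_pos ?_ fun a ha => ?_
  · ext i j
    simp only [Matrix.conjTranspose_apply, star_trivial, coeff_apply]
    exact g.symm _ _ _
  · rw [star_trivial, ← inner_chartInv]
    refine g.pos _ _ fun h0 => ha ?_
    have h1 := chartDer_chartInv hc hy (WithLp.toLp 2 a)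
    rw [show chartInv c y (WithLp.toLp 2 a) = 0 from h0, map_zero] at h1
    exact (congrArg WithLp.ofLp h1).symm

/-- The endomorphism of a fibre, as an endomorphism of `ℝ⁴`. -/
def fibreEnd (z : EndBundle M) : R 4 →L[ℝ] R 4 := z.2

lemma endCoord_mulVec (c : OpenPartialHomeomorph M (R 4)) (z : EndBundle M) (a : Fin 4 → ℝ) :
    WithLp.toLp 2 (endCoord c z *ᵥ a)
      = chartDer c z.1 (fibreEnd z (chartInv c (c z.1) (WithLp.toLp 2 a))) := by
  rw [sum_stdVec (WithLp.toLp 2 a)]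
  simp only [map_sum, map_smul]
  ext i
  simp only [Matrix.mulVec, dotProduct, endCoord_apply]
  rw [WithLp.ofLp_sum, Finset.sum_apply]
  exact Finset.sum_congr rfl fun j _ => mul_comm _ _

lemma fibreEnd_chartInv (hc : c ∈ atlas (R 4) M) {z : EndBundle M} (hz : z.1 ∈ c.source)
    (a : Fin 4 → ℝ) : fibreEnd z (chartInv c (c z.1) (WithLp.toLp 2 a))
      = chartInv c (c z.1) (WithLp.toLp 2 (endCoord c z *ᵥ a)) := by
  rw [endCoord_mulVec, chartInv_chartDer hc hz]

/-- The tangent space at `p` is `ℝ⁴` through the preferred chart, so this differential is that of a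
transition map of the oriented atlas. -/
lemma det_chartInv (hM : IsOrientedAtlas M) (hc : c ∈ atlas (R 4) M) {p : M} (hp : p ∈ c.source) :
    0 < (chartInv c (c p)).det := by
  have h := hM c hc (chartAt (R 4) p) (chart_mem_atlas (R 4) p) (c p) (by
    simp [hp])
  convert h using 2
  have hy := c.map_source hp
  have hd : MDifferentiableAt (𝓡 4) (𝓡 4) c.symm (c p) :=
    (mdifferentiable_of_mem_atlas (I := 𝓡 4) hc).mdifferentiableAt_symm hy
  have h1 : chartInv c (c p) = fderivWithin ℝ (writtenInExtChartAt (𝓡 4) (𝓡 4) (c p) c.symm)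
      (Set.range (𝓡 4)) (extChartAt (𝓡 4) (c p) (c p)) := hd.mfderiv
  rw [h1]
  simp [writtenInExtChartAt, extChartAt, c.left_inv hp, fderivWithin_univ]
  rfl

lemma det_toBasis (v : Fin 4 → R 4) : (EuclideanSpace.basisFun (Fin 4) ℝ).toBasis.det v
    = Matrix.det (Matrix.of fun i => (v i : Fin 4 → ℝ)) := by
  rw [Module.Basis.det_apply, ← Matrix.det_transpose]
  rfl

/-- The negative twistor space in a chart. -/
theorem mem_twistorSpace_iff (hM : IsOrientedAtlas M) (hc : c ∈ atlas (R 4) M) {z : EndBundle M}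
    (hz : z.1 ∈ c.source) :
    z ∈ twistorSpace g ↔ IsNegCS (coeff g c (c z.1)) (endCoord c z) := by
  have hsurj : ∀ v : R 4, ∃ a : Fin 4 → ℝ, v = chartInv c (c z.1) (WithLp.toLp 2 a) := fun v =>
    ⟨chartDer c z.1 v, by rw [WithLp.toLp_ofLp, chartInv_chartDer hc hz]⟩
  have hinj : ∀ a b : Fin 4 → ℝ, chartInv c (c z.1) (WithLp.toLp 2 a)
      = chartInv c (c z.1) (WithLp.toLp 2 b) → a = b := fun a b h => by
    have h1 := congrArg (chartDer c (c.symm (c z.1))) h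
    rw [chartDer_chartInv hc (c.map_source hz), chartDer_chartInv hc (c.map_source hz)] at h1
    exact congrArg WithLp.ofLp h1
  have hin : ∀ a b : Fin 4 → ℝ, innerAt g z.1 (chartInv c (c z.1) (WithLp.toLp 2 a))
      (chartInv c (c z.1) (WithLp.toLp 2 b)) = a ⬝ᵥ (coeff g c (c z.1) *ᵥ b) := fun a b => by
    rw [← inner_chartInv, c.left_inv hz]
  have h1 : (∀ v, z.2 (z.2 v) = -v) ↔ endCoord c z * endCoord c z = -1 := by
    constructor
    · intro h
      refine Matrix.ext_of_mulVec_single fun i => hinj _ _ ?_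
      rw [← Matrix.mulVec_mulVec, ← fibreEnd_chartInv hc hz, ← fibreEnd_chartInv hc hz,
        Matrix.neg_mulVec, Matrix.one_mulVec, WithLp.toLp_neg, map_neg]
      exact h _
    · intro h v
      obtain ⟨a, rfl⟩ := hsurj v
      change fibreEnd z (fibreEnd z _) = _
      rw [fibreEnd_chartInv hc hz, fibreEnd_chartInv hc hz, Matrix.mulVec_mulVec, h,
        Matrix.neg_mulVec, Matrix.one_mulVec, WithLp.toLp_neg, map_neg]
      rfl
  have h2 : (∀ v w, g.inner z.1 (z.2 v) (z.2 w) = g.inner z.1 v w) ↔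
      (endCoord c z)ᵀ * coeff g c (c z.1) * endCoord c z = coeff g c (c z.1) := by
    have e : ∀ a b : Fin 4 → ℝ, (endCoord c z *ᵥ a) ⬝ᵥ (coeff g c (c z.1) *ᵥ (endCoord c z *ᵥ b))
        = a ⬝ᵥ (((endCoord c z)ᵀ * coeff g c (c z.1) * endCoord c z) *ᵥ b) := fun a b => by
      rw [← Matrix.mulVec_mulVec, ← Matrix.mulVec_mulVec, Matrix.dotProduct_mulVec _ (endCoord c z)ᵀ,
        Matrix.vecMul_transpose]
    constructor
    · intro h
      refine Matrix.ext_of_mulVec_single fun i => dotProduct_eq _ _ fun a => ?_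
      rw [dotProduct_comm, ← e, dotProduct_comm _ a, ← hin, ← hin, ← fibreEnd_chartInv hc hz,
        ← fibreEnd_chartInv hc hz]
      exact h _ _
    · intro h v w
      obtain ⟨a, rfl⟩ := hsurj v
      obtain ⟨b, rfl⟩ := hsurj w
      change innerAt g z.1 (fibreEnd z _) (fibreEnd z _) = innerAt g z.1 _ _
      rw [fibreEnd_chartInv hc hz, fibreEnd_chartInv hc hz, hin, hin, e, h]
  have h3 : (∀ v w : R 4, (EuclideanSpace.basisFun (Fin 4) ℝ).toBasis.det
        ![v, (z.2 v : R 4), w, (z.2 w : R 4)] ≤ 0) ↔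
      ∀ v w : Fin 4 → ℝ, Matrix.det (Matrix.of ![v, endCoord c z *ᵥ v, w, endCoord c z *ᵥ w]) ≤ 0 := by
    have e : ∀ a b : Fin 4 → ℝ, (EuclideanSpace.basisFun (Fin 4) ℝ).toBasis.det
        ![chartInv c (c z.1) (WithLp.toLp 2 a), fibreEnd z (chartInv c (c z.1) (WithLp.toLp 2 a)),
          chartInv c (c z.1) (WithLp.toLp 2 b), fibreEnd z (chartInv c (c z.1) (WithLp.toLp 2 b))]
        = (chartInv c (c z.1)).det *
          Matrix.det (Matrix.of ![a, endCoord c z *ᵥ a, b, endCoord c z *ᵥ b]) := fun a b => by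
      rw [fibreEnd_chartInv hc hz, fibreEnd_chartInv hc hz]
      have h4 : ![chartInv c (c z.1) (WithLp.toLp 2 a),
          chartInv c (c z.1) (WithLp.toLp 2 (endCoord c z *ᵥ a)),
          chartInv c (c z.1) (WithLp.toLp 2 b),
          chartInv c (c z.1) (WithLp.toLp 2 (endCoord c z *ᵥ b))]
          = (chartInv c (c z.1) : R 4 →ₗ[ℝ] R 4) ∘ ![WithLp.toLp 2 a,
            WithLp.toLp 2 (endCoord c z *ᵥ a), WithLp.toLp 2 b,
            WithLp.toLp 2 (endCoord c z *ᵥ b)] := by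
        ext i; fin_cases i <;> rfl
      rw [h4, Module.Basis.det_comp, det_toBasis]
      congr 2
      ext i j; fin_cases i <;> rfl
    have hpos := det_chartInv hM hc hz
    constructor
    · intro h a b
      have h5 := (e a b).symm.trans_le (h _ _)
      exact nonpos_of_mul_nonpos_right h5 hpos
    · intro h v w
      obtain ⟨a, rfl⟩ := hsurj v
      obtain ⟨b, rfl⟩ := hsurj w
      exact (e a b).trans_le (mul_nonpos_of_nonneg_of_nonpos hpos.le (h a b))
  constructor
  · rintro ⟨a, b, d⟩; exact ⟨h1.1 a, h2.1 b, h3.1 d⟩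
  · rintro ⟨a, b, d⟩; exact ⟨h1.2 a, h2.2 b, h3.2 d⟩

/-- The point of the endomorphism bundle with given coordinates. -/
def mkEnd (c : OpenPartialHomeomorph M (R 4)) (y : R 4) (S : Matrix (Fin 4) (Fin 4) ℝ) :
    EndBundle M :=
  ⟨c.symm y, show R 4 →L[ℝ] R 4 from
    (chartInv c y).comp ((Matrix.toEuclideanCLM (𝕜 := ℝ) S).comp (chartDer c (c.symm y)))⟩

lemma baseCoord_mkEnd {y : R 4} (hy : y ∈ c.target) (S : Matrix (Fin 4) (Fin 4) ℝ) :
    baseCoord c (mkEnd c y S) = y := c.right_inv hy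

lemma endCoord_mkEnd (hc : c ∈ atlas (R 4) M) {y : R 4} (hy : y ∈ c.target)
    (S : Matrix (Fin 4) (Fin 4) ℝ) : endCoord c (mkEnd c y S) = S := by
  have h1 : ∀ a : Fin 4 → ℝ, WithLp.toLp 2 (endCoord c (mkEnd c y S) *ᵥ a) = WithLp.toLp 2 (S *ᵥ a) :=
    fun a => by
      rw [endCoord_mulVec]
      change chartDer c (c.symm y) (chartInv c y ((Matrix.toEuclideanCLM (𝕜 := ℝ) S)
        (chartDer c (c.symm y) (chartInv c (c (c.symm y)) (WithLp.toLp 2 a))))) = _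
      rw [c.right_inv hy, chartDer_chartInv hc hy, chartDer_chartInv hc hy]
      rfl
  exact Matrix.ext_of_mulVec_single fun i => congrArg WithLp.ofLp (h1 _)

end Charts


/-! ### Consequences of the Hermitian condition -/

section Rigidity

variable {W : Set (R 4)} {G : R 4 → Matrix (Fin 4) (Fin 4) ℝ} {y : R 4} {t : ℝ} {n : ℕ}
  {e : Matrix (Fin 4) (Fin 4) ℝ}

lemma MSmooth.asdPart {m : ℕ} {V : Set (R m)} {A : R m → Matrix (Fin 4) (Fin 4) ℝ}
    (hA : MSmooth V A) (b : Fin 3) : ContDiffOn ℝ ∞ (fun w => asdPart (A w) b) V := by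
  fin_cases b
  · exact ((((hA 1 0).sub (hA 0 1)).sub (hA 3 2)).add (hA 2 3)).div_const 4
  · exact ((((hA 2 0).sub (hA 0 2)).sub (hA 1 3)).add (hA 3 1)).div_const 4
  · exact ((((hA 3 0).sub (hA 0 3)).sub (hA 2 1)).add (hA 1 2)).div_const 4

lemma jac_id (w : R 4) : jac (fun w => w) w = 1 := by
  ext i k
  rw [jac, Matrix.of_apply, pd_coord, Matrix.one_apply]

/-- Local frames, as moving frames. -/
lemma exists_movingFrame (hG : IsMetricOn W G) (hy : y ∈ W) (he : eᵀ * G y * e = 1)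
    (hd : e.det < 0) : ∃ V ⊆ W, y ∈ V ∧ ∃ (E : R 4 → Matrix (Fin 4) (Fin 4) ℝ)
      (θ : R 4 → Matrix (Fin 4) (Fin 4) ℝ) (ϖ : Fin 4 → R 4 → Matrix (Fin 4) (Fin 4) ℝ),
      MovingFrame V θ ϖ (fun a b w => frameCurv G w (E w) a b) ∧ E y = e ∧
      (∀ w ∈ V, (E w)ᵀ * G w * E w = 1) ∧ (∀ w ∈ V, (E w).det < 0) ∧
      (∀ w ∈ V, θ w * E w = 1) ∧ ∀ w ∈ V, E w * θ w = 1 := by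
  obtain ⟨V₀, hV₀, ho, hy₀, E, hE, hEy, hon⟩ := exists_frame hG.isOpen hG.smooth hG.symm hy he
  set V := V₀ ∩ (fun w => (E w).det) ⁻¹' Set.Iio 0
  have hVo : IsOpen V := (contDiffOn_det hE).continuousOn.isOpen_inter_preimage ho isOpen_Iio
  have hF := movingFrame_of_frame (x := fun w => w) hG hVo contDiffOn_id (fun w hw => hV₀ hw.1)
    (hE.mono Set.inter_subset_left) (fun w hw => hon w hw.1)
  have hθ : ∀ w ∈ V, frameCoframe G (fun w => w) E w * E w = 1 := fun w hw => by
    rw [frameCoframe, jac_id, Matrix.mul_one, hon w hw.1]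
  exact ⟨V, fun w hw => hV₀ hw.1, ⟨hy₀, by simpa [hEy] using hd⟩, E, _, _, hF, hEy,
    fun w hw => hon w hw.1, fun w hw => hw.2, hθ, fun w hw => mul_eq_one_comm.1 (hθ w hw)⟩

variable (hH : LocHermitian W G t n) (hG : IsMetricOn W G) (ht : 0 < t)
include hH hG ht

/-- Replacing `e` by `e O` moves the point in the twistor fibre, where the Hermitian condition holds
as well. -/
lemma LocHermitian.ricciCondition_rotate (hy : y ∈ W) (he : eᵀ * G y * e = 1) (hd : e.det < 0)
    (O : Matrix (Fin 4) (Fin 4) ℝ) (r : Matrix (Fin 3) (Fin 3) ℝ) (hO : SdRotation O r) :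
    RicciCondition t (rᵀ * blockA (frameCurv G y e) * r) (blockB (frameCurv G y e) * r) := by
  have h := hH.ricciCondition hG ht hy (e := e * O) (by
    calc (e * O)ᵀ * G y * (e * O) = Oᵀ * (eᵀ * G y * e) * O := by
          simp only [Matrix.transpose_mul, Matrix.mul_assoc]
      _ = 1 := by rw [he, Matrix.mul_one, hO.orth]) (by rwa [Matrix.det_mul, hO.det, mul_one])
  rwa [frameCurv_mul, hO.blockA_rotCurv, hO.blockB_rotCurv] at h

lemma LocHermitian.blockA_eq (hy : y ∈ W) (he : eᵀ * G y * e = 1) (hd : e.det < 0)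
    (hB : blockB (frameCurv G y e) ≠ 0) : blockA (frameCurv G y e) = (1 / (2 * t)) • 1 :=
  ricciCondition_blockA (hH.ricciCondition_rotate hG ht hy he hd) ht
    (fun i j => (isCurv_frameCurv hG hy e).blockA_symm i j) hB

lemma LocHermitian.sq (hy : y ∈ W) (he : eᵀ * G y * e = 1) (hd : e.det < 0) :
    ∃ l : ℝ, blockA (frameCurv G y e) * blockA (frameCurv G y e)
      + (blockB (frameCurv G y e))ᵀ * blockB (frameCurv G y e) = l • 1 :=
  ricciCondition_sq (hH.ricciCondition_rotate hG ht hy he hd)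
    (fun i j => (isCurv_frameCurv hG hy e).blockA_symm i j)

/-- If the Ricci tensor of the twistor space is Hermitian, then the metric is self-dual. -/
theorem LocHermitian.blockA_isScalar (hy : y ∈ W) (he : eᵀ * G y * e = 1) (hd : e.det < 0) :
    blockA (frameCurv G y e) = blockA (frameCurv G y e) 0 0 • 1 := by
  by_contra hne
  obtain ⟨V, hV, hyV, E, θ, ϖ, hF, hEy, hon, hdE, hθE, hEθ⟩ := exists_movingFrame hG hy he hd
  obtain ⟨i, j, hij⟩ : ∃ i j, blockA (frameCurv G y e) i j
      - blockA (frameCurv G y e) 0 0 * (1 : Matrix (Fin 3) (Fin 3) ℝ) i j ≠ 0 := by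
    by_contra! h
    exact hne (Matrix.ext fun i j => by simpa [sub_eq_zero] using h i j)
  -- On this open set `A` is not scalar, so `B` vanishes there by `LocHermitian.blockA_eq`.
  set V' := V ∩ (fun w => blockA (frameCurv G w (E w)) i j
    - blockA (frameCurv G w (E w)) 0 0 * (1 : Matrix (Fin 3) (Fin 3) ℝ) i j) ⁻¹' {0}ᶜ with hV'
  have hsm := hF.smooth_blockA
  have hV'o : IsOpen V' := ((hsm i j).sub ((hsm 0 0).mul contDiffOn_const)).continuousOn
    |>.isOpen_inter_preimage hF.isOpen isOpen_compl_singleton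
  have hsub : V' ⊆ V := Set.inter_subset_left
  have hB : ∀ w ∈ V', blockB (frameCurv G w (E w)) = 0 := fun w hw => by
    by_contra hB
    refine hw.2 ?_
    have := hH.blockA_eq hG ht (hV (hsub hw)) (hon w (hsub hw)) (hdE w (hsub hw)) hB
    simp [this]
  have hK : ∀ w ∈ V', IsCurv (frameCurv G w (E w)) := fun w hw =>
    isCurv_frameCurv hG (hV (hsub hw)) (E w)
  have hyV' : y ∈ V' := ⟨hyV, by simpa [hEy] using hij⟩
  have := (hF.mono hV'o hsub).blockA_isScalar
    (fun w hw => sdCurv_skew_of_isCurv (K := fun a b w => frameCurv G w (E w) a b) (hK w hw))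
    (fun w hw => Matrix.ext fun i j => (hK w hw).blockA_symm j i) hB
    (fun w hw => by
      obtain ⟨l, hl⟩ := hH.sq hG ht (hV (hsub hw)) (hon w (hsub hw)) (hdE w (hsub hw))
      rw [hB w hw, Matrix.transpose_zero, Matrix.zero_mul, add_zero] at hl
      exact ⟨l, hl⟩) (fun w hw => hθE w (hsub hw)) (fun w hw => hEθ w (hsub hw)) hyV'
  rw [hEy] at this
  exact hne this

/-- If the Ricci tensor of the twistor space is Hermitian, then the scalar curvature is locally
constant. -/
theorem LocHermitian.pd_scalar (hy : y ∈ W) :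
    DifferentiableAt ℝ (scalar G) y ∧ ∀ k : Fin 4, pd (scalar G) k y = 0 := by
  obtain ⟨e, he, hd⟩ := exists_neg_orthonormal (hG.posDef y hy)
  obtain ⟨V, hV, hyV, E, θ, ϖ, hF, hEy, hon, hdE, hθE, hEθ⟩ := exists_movingFrame hG hy he hd
  set α : R 4 → ℝ := fun w => blockA (frameCurv G w (E w)) 0 0 with hα
  have hαs : ContDiffOn ℝ ∞ α V := hF.smooth_blockA 0 0
  have hA : ∀ w ∈ V, blockA (frameCurv G w (E w)) = α w • 1 := fun w hw =>
    hH.blockA_isScalar hG ht (hV hw) (hon w hw) (hdE w hw)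
  have hs : ∀ w ∈ V, scalar G w = 24 * α w := fun w hw => by
    rw [scalar_eq_frame hG (hV hw) (hon w hw), hA w hw, Matrix.trace_smul, Matrix.trace_one]
    norm_num; ring
  refine ⟨((differentiableAt_of_smooth hF.isOpen hαs hyV).const_mul 24).congr_of_eventuallyEq
    (Filter.eventuallyEq_of_mem (hF.isOpen.mem_nhds hyV) hs), fun k => ?_⟩
  rw [pd_congr hF.isOpen hs hyV, pd_const_mul 24 (differentiableAt_of_smooth hF.isOpen hαs hyV),
    mul_eq_zero]
  right
  by_contra hne
  -- Where the derivative of `α` is not zero, `B` must vanish, because `B ≠ 0` persists on an open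
  -- set and fixes `α = 1/(2t)` there. With `B = 0` on the open set `V'`, Schur's lemma contradicts
  -- its definition.
  set V' := V ∩ (pd α k) ⁻¹' {0}ᶜ with hV'
  have hV'o : IsOpen V' := (contDiffOn_pd hF.isOpen hαs k).continuousOn.isOpen_inter_preimage
    hF.isOpen isOpen_compl_singleton
  have hsub : V' ⊆ V := Set.inter_subset_left
  have hB : ∀ w ∈ V', blockB (frameCurv G w (E w)) = 0 := fun w hw => by
    by_contra hB
    obtain ⟨i, j, hij⟩ : ∃ i j, blockB (frameCurv G w (E w)) i j ≠ 0 := by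
      by_contra! h
      exact hB (Matrix.ext h)
    have hBs : ContDiffOn ℝ ∞ (fun w => blockB (frameCurv G w (E w)) i j) V :=
      MSmooth.asdPart (hF.smooth_sdCurv j) i
    have hVB := hBs.continuousOn.isOpen_inter_preimage hF.isOpen
      (isOpen_compl_singleton (x := (0 : ℝ)))
    refine hw.2 ?_
    have h1 : ∀ v ∈ V ∩ (fun w => blockB (frameCurv G w (E w)) i j) ⁻¹' {0}ᶜ,
        α v = 1 / (2 * t) := fun v hv => by
      have := hH.blockA_eq hG ht (hV hv.1) (hon v hv.1) (hdE v hv.1) fun h0 => hv.2 (by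
        simp [h0])
      simp [hα, this]
    rw [Set.mem_singleton_iff, pd_congr hVB h1 ⟨hsub hw, hij⟩, pd_const]
  refine hne ((hF.mono hV'o hsub).schur (α := α)
    (fun w hw => sdCurv_skew_of_isCurv (K := fun a b w => frameCurv G w (E w) a b)
      (isCurv_frameCurv hG (hV (hsub hw)) (E w))) ⟨hyV, hne⟩ (fun w hw => hA w (hsub hw)) hB
    (hθE y hyV) (hEθ y hyV) k)

end Rigidity

/-- The scalar curvature is invariant under changes of coordinates. -/
theorem scalar_comp {W' O : Set (R 4)} {G G' : R 4 → Matrix (Fin 4) (Fin 4) ℝ} {f : R 4 → R 4}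
    {y : R 4} (hG' : IsMetricOn W' G') (hO : IsOpen O) (hf : ContDiffOn ℝ ∞ f O)
    (hfW : ∀ w ∈ O, f w ∈ W') (hinv : ∀ w ∈ O, (jac f w).det ≠ 0)
    (hGG : ∀ w ∈ O, G w = (jac f w)ᵀ * G' (f w) * jac f w) (hy : y ∈ O) :
    scalar G y = scalar G' (f y) := by
  obtain ⟨e, he, -⟩ := exists_neg_orthonormal (hG'.posDef _ (hfW y hy))
  -- An orthonormal frame for `G'` along `f` pulls back to an orthonormal coframe for `G` with the
  -- curvature components of `G'`, and the scalar curvature depends only on these components.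
  obtain ⟨V₀, hV₀, ho, hy₀, E, hE, hEy, hon⟩ := exists_frame (V := O) (G := fun w => G' (f w)) hO
    (hG'.smooth.comp hf hfW) (fun w hw => hG'.symm _ (hfW w hw)) hy he
  have hF := movingFrame_of_frame hG' ho (hf.mono hV₀) (fun w hw => hfW w (hV₀ hw)) hE hon
  set θ := frameCoframe G' f E with hθ
  have hθdet : ∀ w ∈ V₀, IsUnit (θ w).det := fun w hw => by
    have h1 : (θ w)ᵀ * θ w = (jac f w)ᵀ * G' (f w) * jac f w := by
      calc (θ w)ᵀ * θ w = (jac f w)ᵀ * (G' (f w))ᵀ * (E w * ((E w)ᵀ * G' (f w))) * jac f w := by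
            simp only [hθ, frameCoframe, Matrix.transpose_mul, Matrix.transpose_transpose,
              Matrix.mul_assoc]
        _ = _ := by
          rw [mul_eq_one_comm.1 (hon w hw), Matrix.mul_one, hG'.symm _ (hfW w (hV₀ hw))]
    have h2 := congrArg Matrix.det h1
    rw [Matrix.det_mul, Matrix.det_mul, Matrix.det_mul, Matrix.det_transpose,
      Matrix.det_transpose] at h2
    refine isUnit_iff_ne_zero.2 fun h0 => ?_
    rw [h0, mul_zero] at h2
    have := mul_ne_zero (mul_ne_zero (hinv w (hV₀ hw)) (hG'.det_ne _ (hfW w (hV₀ hw))))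
      (hinv w (hV₀ hw))
    exact this h2.symm
  have hXΘ : ∀ w ∈ V₀, (θ w)⁻¹ * θ w = 1 := fun w hw => Matrix.nonsing_inv_mul _ (hθdet w hw)
  have hΘX : ∀ w ∈ V₀, θ w * (θ w)⁻¹ = 1 := fun w hw => Matrix.mul_nonsing_inv _ (hθdet w hw)
  have hGθ : ∀ w ∈ V₀, G w = (θ w)ᵀ * θ w := fun w hw => by
    rw [hGG w (hV₀ hw)]
    symm
    calc (θ w)ᵀ * θ w = (jac f w)ᵀ * (G' (f w))ᵀ * (E w * ((E w)ᵀ * G' (f w))) * jac f w := by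
          simp only [hθ, frameCoframe, Matrix.transpose_mul, Matrix.transpose_transpose,
            Matrix.mul_assoc]
      _ = _ := by
        rw [mul_eq_one_comm.1 (hon w hw), Matrix.mul_one, hG'.symm _ (hfW w (hV₀ hw))]
  have hc := ricci_of_curv (h := G) (u := y) (hXΘ y hy₀) (hΘX y hy₀)
    (frameCurv G' (f y) (E y)) fun k l => by
      rw [curv_of_coframe ho hF.smooth_coframe hF.smooth_form hXΘ hΘX hF.skew hF.torsion hGθ hy₀,
        hF.curv y hy₀]
  have hGi : (G y)⁻¹ = (θ y)⁻¹ * ((θ y)⁻¹)ᵀ := by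
    refine Matrix.inv_eq_left_inv ?_
    rw [hGθ y hy₀, Matrix.mul_assoc, ← Matrix.mul_assoc _ (θ y)ᵀ, ← Matrix.transpose_mul,
      hΘX y hy₀, Matrix.transpose_one, Matrix.one_mul, hXΘ y hy₀]
  rw [scalar, ricciOperator, hc, hGi, scalar_eq_frame hG' (hfW y hy) (hon y hy₀),
    ← (isCurv_frameCurv hG' (hfW y hy) (E y)).trace_ricTensor]
  rw [Matrix.mul_assoc, Matrix.trace_mul_comm, Matrix.mul_assoc, Matrix.mul_assoc, Matrix.mul_assoc,
    hΘX y hy₀, Matrix.mul_one, ← Matrix.mul_assoc, ← Matrix.transpose_mul, hΘX y hy₀,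
    Matrix.transpose_one, Matrix.one_mul]
  rfl


/-! ### The twistor space of an oriented Riemannian four-manifold -/

section Global

lemma christoffel_congr {n : ℕ} {V : Set (R n)} {G G' : R n → Matrix (Fin n) (Fin n) ℝ}
    (hV : IsOpen V) (h : ∀ w ∈ V, G w = G' w) {u : R n} (hu : u ∈ V) (k i j : Fin n) :
    christoffel G k i j u = christoffel G' k i j u := by
  have h1 : ∀ a b c, pd (fun w => G w a b) c u = pd (fun w => G' w a b) c u := fun a b c =>
    pd_congr hV (fun w hw => by rw [h w hw]) hu c
  simp only [christoffel, h1, h u hu]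

lemma ricci_congr {n : ℕ} {V : Set (R n)} {G G' : R n → Matrix (Fin n) (Fin n) ℝ}
    (hV : IsOpen V) (h : ∀ w ∈ V, G w = G' w) {u : R n} (hu : u ∈ V) :
    ricci G u = ricci G' u := by
  have h1 : ∀ a b c d, pd (christoffel G a b c) d u = pd (christoffel G' a b c) d u :=
    fun a b c d => pd_congr hV (fun w hw => christoffel_congr hV h hw a b c) hu d
  ext j k
  simp only [ricci, riemann, Matrix.of_apply, h1, christoffel_congr hV h hu]

lemma pushLoc_congr {m : ℕ} {V : Set (R m)} {x x' : R m → R 4}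
    {S S' : R m → Matrix (Fin 4) (Fin 4) ℝ} (hV : IsOpen V) (hx : ∀ w ∈ V, x w = x' w)
    (hS : ∀ w ∈ V, S w = S' w) {u : R m} (hu : u ∈ V) (ξ : Fin m → ℝ) :
    pushLoc x S u ξ = pushLoc x' S' u ξ := by
  have h1 : ∀ i k, pd (fun w => x w i) k u = pd (fun w => x' w i) k u := fun i k =>
    pd_congr hV (fun w hw => by rw [hx w hw]) hu k
  have h2 : ∀ i j k, pd (fun w => S w i j) k u = pd (fun w => S' w i j) k u := fun i j k =>
    pd_congr hV (fun w hw => by rw [hS w hw]) hu k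
  simp only [pushLoc, h1, h2]

lemma hLoc_congr {m : ℕ} {V : Set (R m)} {G : R 4 → Matrix (Fin 4) (Fin 4) ℝ} {x x' : R m → R 4}
    {S S' : R m → Matrix (Fin 4) (Fin 4) ℝ} (hV : IsOpen V) (hx : ∀ w ∈ V, x w = x' w)
    (hS : ∀ w ∈ V, S w = S' w) {u : R m} (hu : u ∈ V) (t : ℝ) :
    hLoc t G x S u = hLoc t G x' S' u := by
  simp only [hLoc, pushLoc_congr hV hx hS hu, hx u hu, hS u hu]

variable {M : Type*} [TopologicalSpace M] [ChartedSpace (R 4) M] [IsManifold (𝓡 4) ∞ M]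
  {c : OpenPartialHomeomorph M (R 4)} {g : Metric M} {V : Set (R 6)} {t : ℝ} {n : ℕ}

lemma IsLocalParam.twParam (hM : IsOrientedAtlas M) (hc : c ∈ atlas (R 4) M)
    {φ : R 6 → EndBundle M} (h : IsLocalParam g c V φ) : TwParam c.target (coeff g c) V
      (fun w => baseCoord c (φ w)) (fun w => endCoord c (φ w)) where
  isOpen := h.isOpen
  smooth_base := contDiffOn_euclidean.2 h.smooth_base
  smooth_end := h.smooth_end
  mem w hw := c.map_source (h.mem_source w hw)
  isNegCS w hw := (mem_twistorSpace_iff g hM hc (h.mem_source w hw)).1 (h.mem w hw)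
  immersion w hw ξ hξ := h.immersion w hw ξ (fun i => congrFun (congrArg Prod.fst hξ) i)
    (fun i j => congrFun (congrFun (congrArg Prod.snd hξ) i) j)

lemma TwParam.isLocalParam (hM : IsOrientedAtlas M) (hc : c ∈ atlas (R 4) M) {x : R 6 → R 4}
    {S : R 6 → Matrix (Fin 4) (Fin 4) ℝ} (h : TwParam c.target (coeff g c) V x S) :
    IsLocalParam g c V (fun w => mkEnd c (x w) (S w)) := by
  have hx : ∀ w ∈ V, baseCoord c (mkEnd c (x w) (S w)) = x w := fun w hw =>
    baseCoord_mkEnd (h.mem w hw) _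
  have hS : ∀ w ∈ V, endCoord c (mkEnd c (x w) (S w)) = S w := fun w hw =>
    endCoord_mkEnd hc (h.mem w hw) _
  have hsrc : ∀ w ∈ V, (mkEnd c (x w) (S w)).1 ∈ c.source := fun w hw =>
    c.map_target (h.mem w hw)
  refine ⟨h.isOpen, fun w hw => ?_, hsrc, fun i => ?_, fun i j => ?_, fun w hw ξ h1 h2 => ?_⟩
  · rw [mem_twistorSpace_iff g hM hc (hsrc w hw), hS w hw]
    have := h.isNegCS w hw
    rwa [← hx w hw] at this
  · exact (contDiffOn_euclidean.1 h.smooth_base i).congr fun w hw => by simp only [hx w hw]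
  · exact (h.smooth_end i j).congr fun w hw => by simp only [hS w hw]
  · refine h.immersion w hw ξ ?_
    rw [← pushLoc_congr h.isOpen hx hS hw]
    exact Prod.ext (funext h1) (Matrix.ext h2)

/-- The Hermitian condition in terms of charts. -/
theorem ricciIsHermitian_iff (hM : IsOrientedAtlas M) : RicciIsHermitian g t n ↔
    ∀ c ∈ atlas (R 4) M, LocHermitian c.target (coeff g c) t n := by
  constructor
  · intro h c hc V x S J hP hJ u hu ξ η
    have hx : ∀ w ∈ V, baseCoord c (mkEnd c (x w) (S w)) = x w := fun w hw =>
      baseCoord_mkEnd (hP.mem w hw) _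
    have hS : ∀ w ∈ V, endCoord c (mkEnd c (x w) (S w)) = S w := fun w hw =>
      endCoord_mkEnd hc (hP.mem w hw) _
    have h1 := h c hc V _ J (hP.isLocalParam hM hc) (fun w hw ζ => by
      rw [hx w hw, hS w hw]
      exact (pushLoc_congr hP.isOpen hx hS hw _).trans ((hJ w hw ζ).trans (by
        rw [← pushLoc_congr hP.isOpen hx hS hw]; rfl))) u hu ξ η
    have h2 : ricci (hCoeff g t c fun w => mkEnd c (x w) (S w)) u
        = ricci (hLoc t (coeff g c) x S) u :=
      ricci_congr hP.isOpen (fun w hw => hLoc_congr hP.isOpen hx hS hw t) hu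
    rwa [h2] at h1
  · intro h c hc V φ J hφ hJ
    exact h c hc V _ _ J (hφ.twParam hM hc) hJ

/-- Sufficient conditions for the Ricci tensor of the twistor space to be Hermitian. -/
theorem ricciIsHermitian_of (hM : IsOrientedAtlas M) (ht : 0 < t)
    (h : (IsEinstein g ∧ IsSelfDual g) ∨ (IsSelfDual g ∧ HasConstantScalar g (12 / t) ∧
      HasTripleRicciEigenvalue g)) (n : ℕ) : RicciIsHermitian g t n := by
  rw [ricciIsHermitian_iff hM]
  intro c hc
  have hG := isMetricOn_coeff g hc
  refine locHermitian_of hG ht ?_ n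
  rcases h with ⟨hE, hS⟩ | ⟨hS, hs, hT⟩
  · refine .inl fun y hy e he hd => ⟨⟨_, (weylMinusZeroAt_iff hG hy he hd).1 (hS c hc y hy)⟩, ?_⟩
    exact (einstein_iff_blockB hG hy he).1 (hE c hc y hy)
  · refine .inr fun y hy e he hd => ⟨?_, (tripleEigenvalue_iff hG hy he).1 (hT c hc y hy)⟩
    have h1 := (weylMinusZeroAt_iff hG hy he hd).1 (hS c hc y hy)
    have h2 := hs c hc y hy
    rw [scalar_eq_frame hG hy he] at h2
    rw [h1]
    congr 1
    field_simp at h2 ⊢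
    linarith

/-- The scalar curvature, as a function on the manifold. -/
def scalarAt (g : Metric M) (p : M) : ℝ := scalar (coeff g (chartAt (R 4) p)) (chartAt (R 4) p p)

/-- The transition map is an isometry between the two coefficient metrics, so `scalar_comp` applies.
-/
lemma scalar_eq_of_charts {c c' : OpenPartialHomeomorph M (R 4)}
    (hc : c ∈ atlas (R 4) M) (hc' : c' ∈ atlas (R 4) M) {p : M} (hp : p ∈ c.source)
    (hp' : p ∈ c'.source) : scalar (coeff g c) (c p) = scalar (coeff g c') (c' p) := by
  set f : R 4 → R 4 := ⇑(c.symm.trans c') with hf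
  have hO : IsOpen (c.symm.trans c').source := (c.symm.trans c').open_source
  have hsm : ContDiffOn ℝ ∞ f (c.symm.trans c').source := by
    rw [← contMDiffOn_iff_contDiffOn]
    exact contMDiffOn_of_mem_contDiffGroupoid (HasGroupoid.compatible hc hc')
  have hmem : ∀ w ∈ (c.symm.trans c').source, w ∈ c.target ∧ c.symm w ∈ c'.source := fun w hw => by
    simpa using hw
  have hW : ∀ w ∈ (c.symm.trans c').source, f w ∈ c'.target := fun w hw =>
    c'.map_source (hmem w hw).2
  have hGG : ∀ w ∈ (c.symm.trans c').source,
      coeff g c w = (jac f w)ᵀ * coeff g c' (f w) * jac f w := fun w hw => by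
    obtain ⟨h1, h2⟩ := hmem w hw
    have hd : DifferentiableAt ℝ f w := (hsm.contDiffAt (hO.mem_nhds hw)).differentiableAt (by simp)
    have h3 : ∀ v, fderiv ℝ f w v = chartDer c' (c.symm w) (chartInv c w v) := fun v => by
      have h4 := mfderiv_comp w
        ((mdifferentiable_of_mem_atlas (I := 𝓡 4) hc').mdifferentiableAt h2)
        ((mdifferentiable_of_mem_atlas (I := 𝓡 4) hc).mdifferentiableAt_symm h1)
      rw [← mfderiv_eq_fderiv]
      exact congrArg (fun L : R 4 →L[ℝ] R 4 => L v) h4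
    have h5 : ∀ j, chartInv c w (stdVec j)
        = chartInv c' (f w) (WithLp.toLp 2 ((jac f w) *ᵥ Pi.single j 1)) := fun j => by
      rw [← chartInv_chartDer hc' h2 (chartInv c w (stdVec j)), ← h3]
      congr 1
      ext i
      rw [fderiv_coord hd]
      simp [jac, pd, Matrix.col_apply]
    ext i j
    rw [coeff_apply, h5, h5, show c.symm w = c'.symm (f w) from (c'.left_inv h2).symm,
      inner_chartInv, Matrix.dotProduct_mulVec, Matrix.dotProduct_mulVec, Matrix.vecMul_mulVec]
    simp
    rfl
  have key := scalar_comp (G := coeff g c) (f := f) (y := c p) (isMetricOn_coeff g hc') hO hsm hW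
    (fun w hw h0 => (isMetricOn_coeff g hc).det_ne w (hmem w hw).1 (by
      rw [hGG w hw, Matrix.det_mul, h0, mul_zero])) hGG (by simp [hp, hp'])
  rw [key]
  simp [hf, c.left_inv hp]

lemma scalar_eq_scalarAt (hc : c ∈ atlas (R 4) M) {y : R 4}
    (hy : y ∈ c.target) : scalar (coeff g c) y = scalarAt g (c.symm y) := by
  have := scalar_eq_of_charts (g := g) hc (chart_mem_atlas (R 4) (c.symm y)) (c.map_target hy)
    (mem_chart_source (R 4) _)
  rwa [c.right_inv hy] at this

/-- If the Ricci tensor of the twistor space is Hermitian, then the scalar curvature is constant. -/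
theorem RicciIsHermitian.scalar_const [PreconnectedSpace M] (hM : IsOrientedAtlas M) (ht : 0 < t)
    (h : RicciIsHermitian g t n) (p q : M) : scalarAt g p = scalarAt g q := by
  rw [ricciIsHermitian_iff hM] at h
  have hloc : IsLocallyConstant (scalarAt g) := by
    rw [IsLocallyConstant.iff_eventually_eq]
    intro p
    set c := chartAt (R 4) p with hc
    have hca : c ∈ atlas (R 4) M := chart_mem_atlas (R 4) p
    have hG := isMetricOn_coeff g hca
    obtain ⟨r, hr, hball⟩ := Metric.isOpen_iff.1 c.open_target (c p)
      (c.map_source (mem_chart_source (R 4) p))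
    have hconst : ∀ y ∈ Metric.ball (c p) r, scalar (coeff g c) y = scalar (coeff g c) (c p) :=
      fun y hy => by
        have hd := fun w hw => (h c hca).pd_scalar hG ht (y := w) (hball hw)
        refine (convex_ball (c p) r).is_const_of_fderivWithin_eq_zero (𝕜 := ℝ)
          (fun w hw => (hd w hw).1.differentiableWithinAt) (fun w hw => ?_) hy (Metric.mem_ball_self hr)
        rw [fderivWithin_of_isOpen Metric.isOpen_ball hw]
        ext v
        rw [fderiv_apply_eq_sum]
        exact Finset.sum_eq_zero fun k _ => by
          rw [(hd w hw).2, mul_zero]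
    have hev : ∀ᶠ q in nhds p, q ∈ c.source ∧ c q ∈ Metric.ball (c p) r :=
      (c.open_source.eventually_mem (mem_chart_source (R 4) p)).and
        ((c.continuousAt (mem_chart_source (R 4) p)).eventually (Metric.ball_mem_nhds _ hr))
    filter_upwards [hev] with q hq
    rw [scalarAt, ← scalar_eq_of_charts hca (chart_mem_atlas (R 4) q) hq.1
      (mem_chart_source (R 4) q), hconst _ hq.2]
    rfl
  exact hloc.apply_eq_of_isPreconnected isPreconnected_univ trivial trivial

/-- The geometry of the base if the Ricci tensor of the twistor space is Hermitian. -/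
theorem RicciIsHermitian.base [ConnectedSpace M] (hM : IsOrientedAtlas M) (ht : 0 < t)
    (h : RicciIsHermitian g t n) : (IsEinstein g ∧ IsSelfDual g) ∨
      (IsSelfDual g ∧ HasConstantScalar g (12 / t) ∧ HasTripleRicciEigenvalue g) := by
  have hconst := h.scalar_const hM ht
  rw [ricciIsHermitian_iff hM] at h
  obtain ⟨p₀⟩ := (inferInstance : Nonempty M)
  have hS : IsSelfDual g := fun c hc y hy => by
    have hG := isMetricOn_coeff g hc
    obtain ⟨e, he, hd⟩ := exists_neg_orthonormal (hG.posDef y hy)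
    rw [weylMinusZeroAt_iff hG hy he hd]
    have := (h c hc).blockA_isScalar hG ht hy he hd
    rw [this, Matrix.trace_smul, Matrix.trace_one]
    congr 1
    simp
  have hs : ∀ c ∈ atlas (R 4) M, ∀ y ∈ c.target, scalar (coeff g c) y = scalarAt g p₀ :=
    fun c hc y hy => by rw [scalar_eq_scalarAt hc hy, hconst]
  -- A single point with `B ≠ 0` has `A = 1/(2t)` and hence `s = 8 · 3/(2t) = 12/t`. For any other
  -- value of the constant `s`, the metric is Einstein everywhere.
  by_cases h0 : scalarAt g p₀ = 12 / t
  · refine .inr ⟨hS, fun c hc y hy => by rw [hs c hc y hy, h0], fun c hc y hy => ?_⟩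
    have hG := isMetricOn_coeff g hc
    obtain ⟨e, he, hd⟩ := exists_neg_orthonormal (hG.posDef y hy)
    rw [tripleEigenvalue_iff hG hy he]
    obtain ⟨l, hl⟩ := (h c hc).sq hG ht hy he hd
    rw [(h c hc).blockA_isScalar hG ht hy he hd] at hl
    refine ⟨l - blockA (frameCurv (coeff g c) y e) 0 0 * blockA (frameCurv (coeff g c) y e) 0 0, ?_⟩
    rw [sub_smul, ← hl, Matrix.smul_mul, Matrix.one_mul, smul_smul]
    abel
  · refine .inl ⟨fun c hc y hy => ?_, hS⟩
    have hG := isMetricOn_coeff g hc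
    obtain ⟨e, he, hd⟩ := exists_neg_orthonormal (hG.posDef y hy)
    rw [einstein_iff_blockB hG hy he]
    by_contra hB
    have h1 := (h c hc).blockA_eq hG ht hy he hd hB
    refine h0 ?_
    rw [← hs c hc y hy, scalar_eq_frame hG hy he, h1, Matrix.trace_smul, Matrix.trace_one]
    norm_num
    field_simp
    norm_num

end Global


/-! ### The Kähler form -/

section KahlerForm

variable {m : ℕ} {ι : Type*} [Fintype ι] {V : Set (R m)} {u : R m}

/-- In a torsion-free coframe the exterior derivative of a two-form with constant coefficients is the
alternation of its covariant derivative. -/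
lemma cyclic_pd_of_torsionFree {Θ : R m → Matrix ι (Fin m) ℝ} {A : Fin m → Matrix ι ι ℝ}
    {L : Matrix ι ι ℝ} (hL : Lᵀ = -L) (hV : IsOpen V) (hu : u ∈ V) (hΘ : MSmooth V Θ)
    (hA : ∀ k, (A k)ᵀ = - A k)
    (htor : ∀ k l C, (mpd Θ k u + A k * Θ u) C l = (mpd Θ l u + A l * Θ u) C k) (i j k : Fin m) :
    mpd (fun w => (Θ w)ᵀ * L * Θ w) i u j k + mpd (fun w => (Θ w)ᵀ * L * Θ w) j u k i
      + mpd (fun w => (Θ w)ᵀ * L * Θ w) k u i j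
    = ((Θ u)ᵀ * (A i * L - L * A i) * Θ u) j k + ((Θ u)ᵀ * (A j * L - L * A j) * Θ u) k i
      + ((Θ u)ᵀ * (A k * L - L * A k) * Θ u) i j := by
  obtain ⟨T, hT⟩ : ∃ T : Fin m → Matrix ι (Fin m) ℝ, ∀ k, T k = mpd Θ k u + A k * Θ u :=
    ⟨_, fun _ => rfl⟩
  simp only [← hT] at htor
  have hTs : ∀ i j k, ((T i)ᵀ * L * Θ u) j k = ((T j)ᵀ * L * Θ u) i k := fun i j k => by
    rw [Matrix.mul_assoc, Matrix.mul_assoc, Matrix.mul_apply, Matrix.mul_apply]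
    exact Finset.sum_congr rfl fun C _ => by
      rw [Matrix.transpose_apply, Matrix.transpose_apply, htor i j C]
  have hTt : ∀ i j k, ((Θ u)ᵀ * L * T i) j k = - ((T i)ᵀ * L * Θ u) k j := fun i j k => by
    rw [← Matrix.transpose_apply ((T i)ᵀ * L * Θ u), ← Matrix.neg_apply]
    simp only [Matrix.transpose_mul, hL, Matrix.transpose_transpose, Matrix.neg_mul,
      Matrix.mul_neg, neg_neg, Matrix.mul_assoc]
  have key : ∀ i, mpd (fun w => (Θ w)ᵀ * L * Θ w) i u
      = (T i)ᵀ * L * Θ u + (Θ u)ᵀ * L * T i + (Θ u)ᵀ * (A i * L - L * A i) * Θ u := fun i => by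
    rw [mpd_mul hV hu (hΘ.transpose.mul (MSmooth.const L)) hΘ,
      mpd_mul hV hu hΘ.transpose (MSmooth.const L), mpd_const, mpd_transpose]
    simp only [hT, Matrix.transpose_add, Matrix.transpose_mul, hA, Matrix.mul_zero, add_zero,
      Matrix.add_mul, Matrix.mul_add, Matrix.mul_sub, Matrix.sub_mul, Matrix.mul_neg,
      Matrix.neg_mul, Matrix.mul_assoc]
    abel
  simp only [key, Matrix.add_apply, hTt]
  linarith [hTs i j k, hTs j k i, hTs k i j]

lemma so_comm_sdBasis_zero (p q : Fin 3 → ℝ) : so p q * sdBasis 0 - sdBasis 0 * so p q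
    = (2 : ℝ) • (p 2 • sdBasis 1 - p 1 • sdBasis 2) := by
  ext i j
  fin_cases i <;> fin_cases j <;>
    simp [sdBasis, so] <;> ring

lemma sdBasis_one_mul_zero : sdBasis 0 * sdBasis 1 = sdBasis 2 := by
  ext i j
  fin_cases i <;> fin_cases j <;> simp [sdBasis, so, Matrix.mul_apply, Fin.sum_univ_four]

lemma sdBasis_two_mul_zero : sdBasis 0 * sdBasis 2 = - sdBasis 1 := by
  ext i j
  fin_cases i <;> fin_cases j <;> simp [sdBasis, so, Matrix.mul_apply, Fin.sum_univ_four]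

lemma sdBasis_transpose (b : Fin 3) : (sdBasis b)ᵀ = - sdBasis b := by
  ext i j
  fin_cases i <;> fin_cases j <;> simp [sdBasis, so]

lemma twJ_transpose (n : ℕ) : (twJ n)ᵀ = - twJ n := by
  rw [twJ, Matrix.fromBlocks_transpose, Matrix.fromBlocks_neg, sdBasis_transpose]
  congr 1 <;> simp [vertJ]
  ext i j; fin_cases i <;> fin_cases j <;> simp

variable {θ : R m → Matrix (Fin 4) (Fin m) ℝ} {ϖ : Fin m → R m → Matrix (Fin 4) (Fin 4) ℝ}
  {K : Fin 4 → Fin 4 → R m → Matrix (Fin 4) (Fin 4) ℝ}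

/-- The covariant derivative of `𝒥₂` if the self-dual part of the curvature is scalar. -/
lemma twForm_comm_twJ {τ α : ℝ} (hK : ∀ b, sdCurv K b u = α • sdBasis b) {k : Fin m}
    (hϖ : (ϖ k u)ᵀ = - ϖ k u) :
    twForm τ θ ϖ K k u * twJ 2 - twJ 2 * twForm τ θ ϖ K k u = Matrix.fromBlocks
      ((2 - α * τ ^ 2) • (sdForm ϖ u 2 k • sdBasis 1 - sdForm ϖ u 1 k • sdBasis 2))
      (Matrix.of fun i => ![τ * α * (sdBasis 2 * θ u) i k, -(τ * α * (sdBasis 1 * θ u) i k)])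
      (-(Matrix.of fun i => ![τ * α * (sdBasis 2 * θ u) i k, -(τ * α * (sdBasis 1 * θ u) i k)])ᵀ)
      0 := by
  have hM : mixForm τ θ K k u * ((-1 : ℝ) ^ (2 + 1) • vertJ) - sdBasis 0 * mixForm τ θ K k u
      = Matrix.of fun i => ![τ * α * (sdBasis 2 * θ u) i k, -(τ * α * (sdBasis 1 * θ u) i k)] := by
    have h1 : ∀ i a, (sdBasis 0 * mixForm τ θ K k u) i a
        = -(τ / 2) * (α * (sdBasis 0 * sdBasis a.succ * θ u) i k) := fun i a => by
      rw [Matrix.mul_assoc, Matrix.mul_apply, Matrix.mul_apply, Finset.mul_sum, Finset.mul_sum]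
      exact Finset.sum_congr rfl fun j _ => by
        simp only [mixForm, Matrix.of_apply, hK, Matrix.smul_mul, Matrix.smul_apply, smul_eq_mul]
        ring
    have h2 : ∀ (Q : Matrix (Fin 4) (Fin 2) ℝ) i a,
        (Q * ((-1 : ℝ) ^ (2 + 1) • vertJ)) i a = ![-Q i 1, Q i 0] a := fun Q i a => by
      rw [Matrix.mul_apply, Fin.sum_univ_two]
      fin_cases a <;> norm_num [vertJ]
    ext i a
    rw [Matrix.sub_apply, h1, h2]
    fin_cases a
    · simp [mixForm, hK, sdBasis_one_mul_zero]
      ring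
    · simp [mixForm, hK, sdBasis_two_mul_zero]
      ring
  have hH : horForm τ ϖ K k u * sdBasis 0 - sdBasis 0 * horForm τ ϖ K k u
      = (2 - α * τ ^ 2) • (sdForm ϖ u 2 k • sdBasis 1 - sdForm ϖ u 1 k • sdBasis 2) := by
    have h1 : ϖ k u * sdBasis 0 - sdBasis 0 * ϖ k u
        = (2 : ℝ) • (sdForm ϖ u 2 k • sdBasis 1 - sdForm ϖ u 1 k • sdBasis 2) := by
      conv_lhs => rw [eq_so hϖ]
      exact so_comm_sdBasis_zero _ _
    have h2 : sdBasis 1 * sdBasis 0 - sdBasis 0 * sdBasis 1 = (-2 : ℝ) • sdBasis 2 := by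
      rw [sdBasis, so_comm_sdBasis_zero]; simp
    have h3 : sdBasis 2 * sdBasis 0 - sdBasis 0 * sdBasis 2 = (2 : ℝ) • sdBasis 1 := by
      rw [sdBasis, so_comm_sdBasis_zero]; simp
    calc _ = (ϖ k u * sdBasis 0 - sdBasis 0 * ϖ k u)
          + (-(τ / 2) * (vertCoframe τ ϖ u 0 k * α)) • (sdBasis 1 * sdBasis 0 - sdBasis 0 * sdBasis 1)
          + (-(τ / 2) * (vertCoframe τ ϖ u 1 k * α)) • (sdBasis 2 * sdBasis 0 - sdBasis 0 * sdBasis 2) := by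
          simp only [horForm, hK, Matrix.add_mul, Matrix.mul_add, Matrix.smul_mul, Matrix.mul_smul,
            smul_add, smul_smul]
          module
      _ = _ := by
        rw [h1, h2, h3]
        simp only [vertCoframe, Matrix.of_apply, Fin.isValue, Fin.succ_zero_eq_one, Fin.succ_one_eq_two]
        module
  rw [twForm, twJ, Matrix.fromBlocks_multiply, Matrix.fromBlocks_multiply, sub_eq_add_neg,
    Matrix.fromBlocks_neg, Matrix.fromBlocks_add]
  simp only [Matrix.mul_zero, Matrix.zero_mul, add_zero, zero_add, ← sub_eq_add_neg]
  rw [hH, hM, ← hM]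
  congr 1
  · have hj : vertJᵀ = - vertJ := by
      ext i j; fin_cases i <;> fin_cases j <;> simp [vertJ]
    simp only [Matrix.transpose_sub, Matrix.transpose_mul, Matrix.transpose_smul, hj,
      sdBasis_transpose, Matrix.neg_mul, Matrix.mul_neg, smul_neg]
    abel
  · have hv : vertForm ϖ k u = (2 * sdForm ϖ u 0 k) • vertJ := by
      ext i j; fin_cases i <;> fin_cases j <;> simp [vertForm, vertJ, mul_comm]
    simp only [hv, Matrix.smul_mul, Matrix.mul_smul]
    module

/-- If the self-dual part of the curvature is `-(2 / τ²)`, the Kähler form of `𝒥₂` is closed. -/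
theorem MovingFrame.kahler_closed (hF : MovingFrame V θ ϖ K) {τ α : ℝ} (hα : α * τ ^ 2 = -2)
    (hK : ∀ w ∈ V, ∀ b, sdCurv K b w = α • sdBasis b) (hu : u ∈ V) (i j k : Fin m) :
    mpd (fun w => (twCoframe τ θ ϖ w)ᵀ * twJ 2 * twCoframe τ θ ϖ w) i u j k
      + mpd (fun w => (twCoframe τ θ ϖ w)ᵀ * twJ 2 * twCoframe τ θ ϖ w) j u k i
      + mpd (fun w => (twCoframe τ θ ϖ w)ᵀ * twJ 2 * twCoframe τ θ ϖ w) k u i j = 0 := by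
  have hskew : ∀ w ∈ V, ∀ b, (sdCurv K b w)ᵀ = - sdCurv K b w := fun w hw b => by
    rw [hK w hw, Matrix.transpose_smul, sdBasis_transpose, smul_neg]
  rw [cyclic_pd_of_torsionFree (twJ_transpose 2) hF.isOpen hu (hF.smooth_twCoframe τ)
    (fun k => hF.twForm_skew τ hskew hu k) (fun k l C => hF.twForm_torsion τ hskew hu k l C)]
  obtain ⟨B, hB⟩ : ∃ B : Fin 3 → Fin m → Fin m → ℝ,
      ∀ b j k, ((θ u)ᵀ * sdBasis b * θ u) j k = B b j k := ⟨_, fun _ _ _ => rfl⟩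
  have hBs : ∀ b j k, B b j k = - B b k j := fun b j k => by
    have h : ((θ u)ᵀ * sdBasis b * θ u)ᵀ = -((θ u)ᵀ * sdBasis b * θ u) := by
      simp [Matrix.transpose_mul, sdBasis_transpose, Matrix.mul_assoc]
    rw [← hB, ← hB, skew_apply h]
  -- With `α τ² = -2` the coefficient `2 - α τ²` is 4, and the mixed blocks contribute twice with
  -- coefficient 2. The cyclic sum of the three contributions cancels by skewness of `B 1` and `B
  -- 2`.
  have key : ∀ i j k, ((twCoframe τ θ ϖ u)ᵀ * (twForm τ θ ϖ K i u * twJ 2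
        - twJ 2 * twForm τ θ ϖ K i u) * twCoframe τ θ ϖ u) j k
      = 4 * (sdForm ϖ u 2 i * B 1 j k - sdForm ϖ u 1 i * B 2 j k)
        - 2 * (B 2 j i * sdForm ϖ u 1 k - B 1 j i * sdForm ϖ u 2 k)
        + 2 * (B 2 k i * sdForm ϖ u 1 j - B 1 k i * sdForm ϖ u 2 j) := fun i j k => by
    have hN : ∀ l k, ((θ u)ᵀ * (Matrix.of fun p => ![τ * α * (sdBasis 2 * θ u) p i,
        -(τ * α * (sdBasis 1 * θ u) p i)]) * vertCoframe τ ϖ u) l k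
        = -2 * (B 2 l i * sdForm ϖ u 1 k - B 1 l i * sdForm ϖ u 2 k) := fun l k => by
      have h1 : ∀ a, ((θ u)ᵀ * (Matrix.of fun p => ![τ * α * (sdBasis 2 * θ u) p i,
          -(τ * α * (sdBasis 1 * θ u) p i)])) l a
          = ![τ * α * B 2 l i, -(τ * α * B 1 l i)] a := fun a => by
        rw [← hB, ← hB, Matrix.mul_apply, Matrix.mul_assoc, Matrix.mul_assoc, Matrix.mul_apply,
          Matrix.mul_apply, Finset.mul_sum, Finset.mul_sum, ← Finset.sum_neg_distrib]
        fin_cases a <;> simp only [Matrix.of_apply, Matrix.cons_val_zero, Matrix.cons_val_one,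
          Fin.mk_one, Fin.zero_eta, Matrix.cons_val_fin_one] <;>
          exact Finset.sum_congr rfl fun p _ => by ring
      rw [Matrix.mul_apply, Fin.sum_univ_two, h1, h1]
      simp [vertCoframe]
      linear_combination (B 2 l i * sdForm ϖ u 1 k - B 1 l i * sdForm ϖ u 2 k) * hα
    rw [twForm_comm_twJ (hK u hu) (hF.skew u hu i), twCoframe, Matrix.transpose_fromRows,
      Matrix.fromCols_mul_fromBlocks, Matrix.fromCols_mul_fromRows, Matrix.mul_zero, add_zero,
      Matrix.add_mul, Matrix.add_apply, Matrix.add_apply, hN, Matrix.mul_neg, Matrix.neg_mul,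
      Matrix.neg_apply]
    have h2 : ∀ N : Matrix (Fin 4) (Fin 2) ℝ, ((vertCoframe τ ϖ u)ᵀ * Nᵀ * θ u) j k
        = ((θ u)ᵀ * N * vertCoframe τ ϖ u) k j := fun N => by
      rw [← Matrix.transpose_apply ((θ u)ᵀ * N * vertCoframe τ ϖ u)]
      simp only [Matrix.transpose_mul, Matrix.transpose_transpose, Matrix.mul_assoc]
    rw [h2, hN]
    have h3 : ((θ u)ᵀ * ((2 - α * τ ^ 2) • (sdForm ϖ u 2 i • sdBasis 1
        - sdForm ϖ u 1 i • sdBasis 2) : Matrix (Fin 4) (Fin 4) ℝ) * θ u) j k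
        = 4 * (sdForm ϖ u 2 i * B 1 j k - sdForm ϖ u 1 i * B 2 j k) := by
      simp only [hα, Matrix.mul_smul, Matrix.smul_mul, Matrix.mul_sub, Matrix.sub_mul,
        Matrix.smul_apply, Matrix.sub_apply, smul_eq_mul, hB]
      ring
    rw [h3]
    ring
  rw [key, key, key]
  linear_combination (-2 * sdForm ϖ u 1 k) * hBs 2 i j + (2 * sdForm ϖ u 2 k) * hBs 1 i j
    + (-2 * sdForm ϖ u 1 i) * hBs 2 j k + (2 * sdForm ϖ u 2 i) * hBs 1 j k
    + (-2 * sdForm ϖ u 1 j) * hBs 2 k i + (2 * sdForm ϖ u 2 j) * hBs 1 k i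

end KahlerForm


/-! ### The Nijenhuis tensor -/

section NijenhuisTensor

variable {m : ℕ} {V : Set (R m)} {u : R m} {θ : R m → Matrix (Fin 4) (Fin m) ℝ}
  {ϖ : Fin m → R m → Matrix (Fin 4) (Fin 4) ℝ} {K : Fin 4 → Fin 4 → R m → Matrix (Fin 4) (Fin 4) ℝ}

/-- The contraction of the Nijenhuis tensor with a one-form `v₀` such that `v₀ ∘ J = v₁` and
`v₁ ∘ J = -v₀`, in terms of the exterior derivatives of `v₀` and `v₁`. -/
lemma contract_nijenhuis {J : R m → Matrix (Fin m) (Fin m) ℝ} {v : R m → Matrix (Fin 2) (Fin m) ℝ}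
    (hV : IsOpen V) (hu : u ∈ V) (hv : MSmooth V v) (hJ : MSmooth V J)
    (h0 : ∀ w ∈ V, ∀ j, (v w * J w) 0 j = v w 1 j) (h1 : ∀ w ∈ V, ∀ j, (v w * J w) 1 j = - v w 0 j)
    {D : Fin 2 → Matrix (Fin m) (Fin m) ℝ}
    (hD : ∀ a k l, D a k l = mpd v k u a l - mpd v l u a k) (i j : Fin m) :
    ∑ k, v u 0 k * nijenhuis J k i j u
      = ((J u)ᵀ * D 1 + D 1 * J u - (J u)ᵀ * D 0 * J u + D 0) i j := by
  set P : Fin 2 → Matrix (Fin m) (Fin m) ℝ := fun a => Matrix.of fun k l => mpd v k u a l with hP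
  have hDP : ∀ a, D a = P a - (P a)ᵀ := fun a => by
    ext k l; rw [hD]; rfl
  have hmul : ∀ l a j, mpd (fun w => v w * J w) l u a j
      = (P a * J u) l j + (v u * mpd J l u) a j := fun l a j => by
    rw [mpd_mul hV hu hv hJ]; rfl
  -- Differentiating `v₀ J = v₁` and `v₁ J = -v₀` trades the derivatives of `J` for those of `v`.
  have hR0 : ∀ l j, (v u * mpd J l u) 0 j = (P 1 - P 0 * J u) l j := fun l j => by
    have : mpd (fun w => v w * J w) l u 0 j = P 1 l j := pd_congr hV (fun w hw => h0 w hw j) hu l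
    rw [Matrix.sub_apply, ← this, hmul]; ring
  have hR1 : ∀ l j, (v u * mpd J l u) 1 j = (-P 0 - P 1 * J u) l j := fun l j => by
    have : mpd (fun w => v w * J w) l u 1 j = - P 0 l j :=
      (pd_congr hV (fun w hw => h1 w hw j) hu l).trans (pd_neg _ _ _)
    rw [Matrix.sub_apply, Matrix.neg_apply, ← this, hmul]; ring
  have hN : ∑ k, v u 0 k * nijenhuis J k i j u
      = ∑ l, J u l i * (v u * mpd J l u) 0 j - ∑ l, J u l j * (v u * mpd J l u) 0 i
        - ((v u * mpd J i u) 1 j - (v u * mpd J j u) 1 i) := by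
    have e : ∀ i j, (v u * mpd J i u) 1 j = ∑ k, ∑ l, v u 0 k * (J u k l * mpd J i u l j) :=
      fun i j => by
        rw [Matrix.mul_apply, Finset.sum_comm]
        refine Finset.sum_congr rfl fun l _ => ?_
        rw [← h0 u hu, Matrix.mul_apply, Finset.sum_mul]
        exact Finset.sum_congr rfl fun k _ => by ring
    have e' : ∀ i j, ∑ l, J u l i * (v u * mpd J l u) 0 j
        = ∑ k, ∑ l, v u 0 k * (J u l i * mpd J l u k j) := fun i j => by
      rw [Finset.sum_comm]
      refine Finset.sum_congr rfl fun l _ => ?_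
      rw [Matrix.mul_apply, Finset.mul_sum]
      exact Finset.sum_congr rfl fun k _ => by ring
    rw [e, e, e', e', ← Finset.sum_sub_distrib, ← Finset.sum_sub_distrib, ← Finset.sum_sub_distrib]
    refine Finset.sum_congr rfl fun k _ => ?_
    rw [← Finset.sum_sub_distrib, ← Finset.sum_sub_distrib, ← Finset.sum_sub_distrib, nijenhuis,
      Finset.mul_sum]
    refine Finset.sum_congr rfl fun l _ => ?_
    simp only [mpd_apply]
    ring
  have hmat : ∀ i j, ∑ l, J u l i * (v u * mpd J l u) 0 j = ((J u)ᵀ * (P 1 - P 0 * J u)) i j :=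
    fun i j => by
      rw [Matrix.mul_apply]
      exact Finset.sum_congr rfl fun l _ => by rw [hR0, Matrix.transpose_apply]
  have hsum : (J u)ᵀ * (P 1 - P 0 * J u) - ((J u)ᵀ * (P 1 - P 0 * J u))ᵀ
        - ((-P 0 - P 1 * J u) - (-P 0 - P 1 * J u)ᵀ)
      = (J u)ᵀ * D 1 + D 1 * J u - (J u)ᵀ * D 0 * J u + D 0 := by
    simp only [hDP, Matrix.transpose_mul, Matrix.transpose_sub, Matrix.transpose_neg,
      Matrix.transpose_transpose, Matrix.mul_sub, Matrix.sub_mul, Matrix.mul_assoc]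
    abel
  rw [hN, hmat, hmat, hR1, hR1, ← hsum]
  rfl

/-- If the self-dual part of the curvature is scalar and not zero, then `𝒥₂` is not integrable. -/
theorem MovingFrame.nijenhuis_ne_zero (hF : MovingFrame V θ ϖ K) {τ α : ℝ} (hτ : τ ≠ 0)
    (hα : α ≠ 0) (hu : u ∈ V) (hK : ∀ b, sdCurv K b u = α • sdBasis b)
    {J : R m → Matrix (Fin m) (Fin m) ℝ} (hJ : MSmooth V J)
    (hΘJ : ∀ w ∈ V, twCoframe τ θ ϖ w * J w = twJ 2 * twCoframe τ θ ϖ w)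
    {X : Matrix (Fin m) (Fin 4 ⊕ Fin 2) ℝ} (hX : twCoframe τ θ ϖ u * X = 1) :
    ∃ k i j, nijenhuis J k i j u ≠ 0 := by
  by_contra! hN
  have hrows : ∀ w ∈ V, θ w * J w = sdBasis 0 * θ w ∧
      vertCoframe τ ϖ w * J w = ((-1 : ℝ) ^ (2 + 1) • vertJ) * vertCoframe τ ϖ w := fun w hw => by
    have := hΘJ w hw
    rw [twCoframe, twJ, Matrix.fromRows_mul, Matrix.fromBlocks_mul_fromRows, Matrix.zero_mul,
      Matrix.zero_mul, add_zero, zero_add] at this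
    exact Matrix.fromRows_inj this
  have h0 : ∀ w ∈ V, ∀ j, (vertCoframe τ ϖ w * J w) 0 j = vertCoframe τ ϖ w 1 j := fun w hw j => by
    rw [(hrows w hw).2, Matrix.mul_apply, Fin.sum_univ_two]
    norm_num [vertJ]
  have h1 : ∀ w ∈ V, ∀ j, (vertCoframe τ ϖ w * J w) 1 j = - vertCoframe τ ϖ w 0 j := fun w hw j => by
    rw [(hrows w hw).2, Matrix.mul_apply, Fin.sum_univ_two]
    norm_num [vertJ]
  obtain ⟨D, hD⟩ : ∃ D : Fin 2 → Matrix (Fin m) (Fin m) ℝ, ∀ a k l,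
      D a k l = mpd (vertCoframe τ ϖ) k u a l - mpd (vertCoframe τ ϖ) l u a k :=
    ⟨fun a => Matrix.of fun k l => _, fun _ _ _ => rfl⟩
  set A : Matrix (Fin 2) (Fin 2) ℝ := !![0, -2; 2, 0] with hA
  have hzero : (J u)ᵀ * D 1 + D 1 * J u - (J u)ᵀ * D 0 * J u + D 0 = 0 := by
    ext i j
    rw [← contract_nijenhuis hF.isOpen hu (hF.smooth_vertCoframe τ) hJ h0 h1 hD]
    simp [hN]
  -- The torsion formula expresses the exterior derivative of `vertCoframe` by `τ α I_a` and terms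
  -- containing `vertCoframe` as a factor; on horizontal vectors only the former survive.
  have hDeq : ∀ {Y Z : Matrix (Fin m) (Fin 4) ℝ}, vertCoframe τ ϖ u * Y = 0 →
      vertCoframe τ ϖ u * Z = 0 → ∀ a, Yᵀ * D a * Z
        = (τ * α) • ((θ u * Y)ᵀ * sdBasis a.succ * (θ u * Z)) := fun {Y Z} hY hZ a => by
    have h2 : D a = (τ * α) • ((θ u)ᵀ * sdBasis a.succ * θ u)
        - Matrix.vecMulVec (sdForm ϖ u 0) ((A * vertCoframe τ ϖ u) a)
        + Matrix.vecMulVec ((A * vertCoframe τ ϖ u) a) (sdForm ϖ u 0) := by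
      ext k l
      have := hF.vertCoframe_torsion τ hu k l a
      simp only [hK, vertForm, ← hA, Matrix.smul_mul, Matrix.mul_smul, Matrix.add_apply,
        Matrix.smul_apply, smul_eq_mul] at this
      simp only [hD, Matrix.add_apply, Matrix.sub_apply, Matrix.smul_apply,
        Matrix.vecMulVec_apply, smul_eq_mul]
      linear_combination this
    have h3 : ∀ {Z : Matrix (Fin m) (Fin 4) ℝ}, vertCoframe τ ϖ u * Z = 0 →
        ((A * vertCoframe τ ϖ u) a) ᵥ* Z = 0 := fun {Z} hZ => by
      have : (A * vertCoframe τ ϖ u) * Z = 0 := by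
        rw [Matrix.mul_assoc, hZ, Matrix.mul_zero]
      exact congrFun this a
    rw [h2, Matrix.mul_add, Matrix.mul_sub, Matrix.add_mul, Matrix.sub_mul, Matrix.mul_vecMulVec,
      Matrix.mul_vecMulVec, Matrix.vecMulVec_mul, Matrix.vecMulVec_mul, h3 hZ,
      Matrix.mulVec_transpose, Matrix.mulVec_transpose, h3 hY]
    simp [Matrix.mul_assoc, Matrix.transpose_mul]
  set Y : Matrix (Fin m) (Fin 4) ℝ := X.submatrix id Sum.inl with hY
  have hθY : θ u * Y = 1 := by
    ext i j
    exact (congrFun (congrFun hX (.inl i)) (.inl j)).trans (by simp [Matrix.one_apply])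
  have hvY : vertCoframe τ ϖ u * Y = 0 := by
    ext i j
    exact (congrFun (congrFun hX (.inr i)) (.inl j)).trans (by simp)
  have hvJY : vertCoframe τ ϖ u * (J u * Y) = 0 := by
    rw [← Matrix.mul_assoc, (hrows u hu).2, Matrix.mul_assoc, hvY, Matrix.mul_zero]
  have hθJY : θ u * (J u * Y) = sdBasis 0 := by
    rw [← Matrix.mul_assoc, (hrows u hu).1, Matrix.mul_assoc, hθY, Matrix.mul_one]
  have h4 : (J u * Y)ᵀ * D 1 * Y + Yᵀ * D 1 * (J u * Y) - (J u * Y)ᵀ * D 0 * (J u * Y) + Yᵀ * D 0 * Y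
      = 0 := by
    have := congrArg (fun N => Yᵀ * N * Y) hzero
    simp only [Matrix.mul_zero, Matrix.zero_mul] at this
    rw [← this]
    simp only [Matrix.transpose_mul, Matrix.mul_add, Matrix.add_mul, Matrix.mul_sub, Matrix.sub_mul,
      Matrix.mul_assoc]
  rw [hDeq hvJY hvY, hDeq hvY hvJY, hDeq hvJY hvJY, hDeq hvY hvY, hθY, hθJY] at h4
  -- By the quaternion relations each of the four terms equals `τ α` times `sdBasis 1`, whose (0,2)
  -- entry is `-1`.
  have h5 := congrFun (congrFun h4 0) 2
  simp [sdBasis, so, Matrix.mul_apply, Fin.sum_univ_four] at h5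
  have h6 : τ * α * 4 = 0 := by linarith
  simp [hτ, hα] at h6

end NijenhuisTensor


/-! ### Almost Kähler twistor spaces -/

section AlmostKahler

variable {W : Set (R 4)} {G : R 4 → Matrix (Fin 4) (Fin 4) ℝ} {V : Set (R 6)} {x : R 6 → R 4}
  {S E : R 6 → Matrix (Fin 4) (Fin 4) ℝ} {u : R 6} {t τ : ℝ}

/-- The self-dual part of the curvature of an Einstein metric with `𝒲₋ = 0`, in a negatively oriented
frame. -/
lemma sdCurv_of_einstein (hG : IsMetricOn W G) {y : R 4} (hy : y ∈ W)
    {e : Matrix (Fin 4) (Fin 4) ℝ} (he : eᵀ * G y * e = 1) (hd : e.det < 0)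
    (hE : ricci G y = (scalar G y / 4) • G y) (hS : WeylMinusZeroAt G y) (b : Fin 3) :
    sdCurv (fun i j (_ : R 6) => frameCurv G y e i j) b 0 = (scalar G y / 24) • sdBasis b := by
  have hA := (weylMinusZeroAt_iff hG hy he hd).1 hS
  rw [sdCurv_eq_so (isCurv_frameCurv hG hy e), (einstein_iff_blockB hG hy he).1 hE, hA,
    scalar_eq_frame hG hy he, sdBasis, ← so_smul, smul_zero]
  congr 1
  funext c
  fin_cases b <;> fin_cases c <;> simp <;> ring

/-- In the adapted coframe the Kähler form has constant coefficients; the sign comes from moving the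
skew matrix `twJ n` to the other argument. -/
lemma kahler_eq (h : TwParam W G V x S) (hE : AdaptedFrame G V x S E) (hG : IsMetricOn W G)
    (hτ : τ ^ 2 = 4 * t) (hu : u ∈ V) (n : ℕ) (k l : Fin 6) :
    hMetric t G (x u) (S u) (acs n G (x u) (S u) (pushLoc x S u (Pi.single k 1)))
      (pushLoc x S u (Pi.single l 1))
    = -((twCoframe τ (frameCoframe G x E) (frameForm G x E) u)ᵀ * twJ n
      * twCoframe τ (frameCoframe G x E) (frameForm G x E) u) k l := by
  have hT := isTwTangent_pushLoc h hE hG hu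
  have hdot : ∀ A B : Matrix (Fin 4 ⊕ Fin 2) (Fin 6) ℝ,
      (A *ᵥ Pi.single k 1) ⬝ᵥ (B *ᵥ Pi.single l 1) = (Aᵀ * B) k l := fun A B => by
    simp [Matrix.mul_apply, dotProduct, Matrix.col_apply]
  rw [hMetric_eq (hG.symm _ (h.mem u hu)) (hE.orth u hu) hτ
    (isTwTangent_acs (hE.adapted u hu) n (hT _)) (hT _),
    twCoord_acs (hE.adapted u hu) (hE.orth u hu), twCoord_pushLoc, twCoord_pushLoc,
    Matrix.mulVec_mulVec, hdot, Matrix.transpose_mul, twJ_transpose, Matrix.mul_neg, Matrix.neg_mul,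
    Matrix.neg_apply]

variable {M : Type*} [TopologicalSpace M] [ChartedSpace (R 4) M] [IsManifold (𝓡 4) ∞ M]
  {g : Metric M}

/-- The curvature along an adapted frame over an Einstein self-dual manifold. -/
lemma sdCurv_adapted (hG : IsMetricOn W G) (h : TwParam W G V x S) (hE : AdaptedFrame G V x S E)
    {s : ℝ} (hEin : ∀ y ∈ W, ricci G y = (scalar G y / 4) • G y)
    (hS : ∀ y ∈ W, WeylMinusZeroAt G y) (hs : ∀ y ∈ W, scalar G y = s) :
    ∀ w ∈ V, ∀ b, sdCurv (fun i j w => frameCurv G (x w) (E w) i j) b w = (s / 24) • sdBasis b :=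
  fun w hw b => by
    have hy := h.mem w hw
    rw [← hs _ hy]
    exact sdCurv_of_einstein hG hy (hE.orth w hw)
      ((h.isNegCS w hw).det_neg (hE.orth w hw) (hE.adapted w hw)) (hEin _ hy) (hS _ hy) b

/-- The twistor space of an Einstein self-dual manifold of scalar curvature `-12 / t` is almost
Kähler. -/
theorem isAlmostKahler_of (hM : IsOrientedAtlas M) (ht : 0 < t) (hEin : IsEinstein g)
    (hS : IsSelfDual g) (hs : HasConstantScalar g (-12 / t)) : IsAlmostKahler g t 2 := by
  intro c hc V φ hφ u hu i j k
  have hG := isMetricOn_coeff g hc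
  have hP := hφ.twParam hM hc
  obtain ⟨e, he, hSe, -⟩ := (hP.isNegCS u hu).exists_adapted (hG.posDef _ (hP.mem u hu))
  obtain ⟨V', hV', hV'o, hu', E, hE, -⟩ := hP.exists_adaptedFrame hG hu he hSe
  have hP' := hP.mono hV' hV'o
  have hτ : (2 * Real.sqrt t) ^ 2 = 4 * t := by rw [mul_pow, Real.sq_sqrt ht.le]; ring
  have hF := movingFrame_of_frame hG hP'.isOpen hP'.smooth_base hP'.mem hE.smooth hE.orth
  have hK := sdCurv_adapted hG hP' hE (hEin c hc) (hS c hc) (hs c hc)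
  -- The scalar curvature is 24 times `α` and `τ² = 4t`; this is the normalisation required by
  -- `MovingFrame.kahler_closed`.
  have hα : -12 / t / 24 * (2 * Real.sqrt t) ^ 2 = -2 := by rw [hτ]; field_simp; norm_num
  have hpd : ∀ i j k, pd (fun w => kahlerForm g t 2 c φ w j k) i u
      = - mpd (fun w => (twCoframe (2 * Real.sqrt t) (frameCoframe (coeff g c) _ E)
        (frameForm (coeff g c) _ E) w)ᵀ * twJ 2 * twCoframe (2 * Real.sqrt t)
        (frameCoframe (coeff g c) _ E) (frameForm (coeff g c) _ E) w) i u j k := fun i j k =>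
    (pd_congr hV'o (fun w hw => kahler_eq hP' hE hG hτ hw 2 j k) hu' i).trans (pd_neg _ _ _)
  rw [hpd, hpd, hpd]
  linarith [hF.kahler_closed hα hK hu' i j k]

/-- The almost complex structure `𝒥₂` is not integrable. -/
theorem not_isIntegrable_two [Nonempty M] (hM : IsOrientedAtlas M) {s : ℝ} (hs0 : s ≠ 0)
    (hEin : IsEinstein g) (hS : IsSelfDual g) (hs : HasConstantScalar g s) :
    ¬ IsIntegrable g 2 := by
  intro hint
  obtain ⟨p⟩ := (inferInstance : Nonempty M)
  have hc : chartAt (R 4) p ∈ atlas (R 4) M := chart_mem_atlas (R 4) p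
  set c := chartAt (R 4) p
  have hG := isMetricOn_coeff g hc
  have hy : c p ∈ c.target := c.map_source (mem_chart_source (R 4) p)
  obtain ⟨e, he, hd⟩ := exists_neg_orthonormal (hG.posDef _ hy)
  obtain ⟨V, x, S, u, hP, hu, hxu, hSe⟩ := exists_twParam hG hy he hd
  obtain ⟨V', hV', hV'o, hu', E, hE, -⟩ := hP.exists_adaptedFrame hG hu (hxu ▸ he) hSe
  have hP' := hP.mono hV' hV'o
  -- Integrability involves only `𝒥₂` and not the metric `h_t`, so the coframe may be taken with `τ
  -- = 1`.
  obtain ⟨X, hX, hXΘ, hΘX⟩ := exists_dual_frame hP' hE hG one_ne_zero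
  have hF := movingFrame_of_frame hG hP'.isOpen hP'.smooth_base hP'.mem hE.smooth hE.orth
  have hK := sdCurv_adapted hG hP' hE (hEin c hc) (hS c hc) (hs c hc)
  set Θ := twCoframe 1 (frameCoframe (coeff g c) x E) (frameForm (coeff g c) x E)
  have hΘJ : ∀ w ∈ V', Θ w * (X w * twJ 2 * Θ w) = twJ 2 * Θ w := fun w hw => by
    rw [← Matrix.mul_assoc, ← Matrix.mul_assoc, hΘX w hw, Matrix.one_mul]
  obtain ⟨k, i, j, hne⟩ := hF.nijenhuis_ne_zero one_ne_zero (by positivity) hu' (hK u hu')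
    ((hX.mul (MSmooth.const _)).mul (hF.smooth_twCoframe 1)) hΘJ (hΘX u hu')
  refine hne (hint c hc V' _ _ (hP'.isLocalParam hM hc) (fun w hw ξ => ?_) u hu' k i j)
  have hx : ∀ w ∈ V', baseCoord c (mkEnd c (x w) (S w)) = x w := fun w hw =>
    baseCoord_mkEnd (hP'.mem w hw) _
  have hS : ∀ w ∈ V', endCoord c (mkEnd c (x w) (S w)) = S w := fun w hw =>
    endCoord_mkEnd hc (hP'.mem w hw) _
  rw [hx w hw, hS w hw]
  refine (pushLoc_congr hV'o hx hS hw _).trans (((pushLoc_eq_acs_iff hP' hE hG one_ne_zero hw 2 _).2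
    (hΘJ w hw) ξ).trans ?_)
  rw [← pushLoc_congr hV'o hx hS hw]
  rfl

end AlmostKahler


/-! ### Compactness of the twistor space -/

section Compactness

lemma MSmooth.continuousOn {m : ℕ} {α β : Type*} {V : Set (R m)} {A : R m → Matrix α β ℝ}
    (hA : MSmooth V A) : ContinuousOn A V :=
  continuousOn_pi.2 fun i => continuousOn_pi.2 fun j => (hA i j).continuousOn

lemma isCompact_orthogonalCS : IsCompact orthogonalCS := by
  have hbdd : orthogonalCS ⊆ Set.pi Set.univ fun _ => Set.pi Set.univ fun _ => Set.Icc (-1 : ℝ) 1 := by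
    intro A hA i _ j _
    have h1 : A ∈ Matrix.unitaryGroup (Fin 4) ℝ :=
      Matrix.mem_unitaryGroup_iff'.2 (by simpa [Matrix.star_eq_conjTranspose] using hA.1)
    have h2 := entry_norm_bound_of_unitary h1 i j
    rw [Real.norm_eq_abs, abs_le] at h2
    exact h2
  refine IsCompact.of_isClosed_subset (isCompact_univ_pi fun _ => isCompact_univ_pi fun _ =>
    isCompact_Icc) ?_ hbdd
  have h3 : orthogonalCS = {A : Matrix (Fin 4) (Fin 4) ℝ | Aᵀ * A = 1} ∩
      ({A : Matrix (Fin 4) (Fin 4) ℝ | A * A = -1} ∩ ⋂ v : Fin 4 → ℝ, ⋂ w : Fin 4 → ℝ,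
        {A : Matrix (Fin 4) (Fin 4) ℝ | 0 ≤ Matrix.det (Matrix.of ![v, A *ᵥ v, w, A *ᵥ w])}) := by
    ext A; simp [orthogonalCS]
  rw [h3]
  refine (isClosed_eq (by fun_prop) (by fun_prop)).inter
    ((isClosed_eq (by fun_prop) (by fun_prop)).inter
      (isClosed_iInter fun v => isClosed_iInter fun w => isClosed_le (by fun_prop) ?_))
  refine Continuous.matrix_det (continuous_matrix fun i j => ?_)
  have h4 : ∀ v : Fin 4 → ℝ, Continuous fun A : Matrix (Fin 4) (Fin 4) ℝ => (A *ᵥ v) j := fun v => by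
    fun_prop
  fin_cases i
  · exact continuous_const
  · exact h4 v
  · exact continuous_const
  · exact h4 w

variable {M : Type*} [TopologicalSpace M] [ChartedSpace (R 4) M] [IsManifold (𝓡 4) ∞ M]
  {g : Metric M}

/-- Identifies `endCoord` with the fibre coordinate of the bundle trivialization, which ties the
matrix coordinates to the topology of the total space. -/
lemma trivializationAt_endBundle (p : M) {z : EndBundle M} (hz : z.1 ∈ (chartAt (R 4) p).source) :
    trivializationAt (R 4 →L[ℝ] R 4) (fun q : M => TangentSpace (𝓡 4) q →L[ℝ] TangentSpace (𝓡 4) q) p z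
      = (z.1, Matrix.toEuclideanCLM (𝕜 := ℝ) (endCoord (chartAt (R 4) p) z)) := by
  set c := chartAt (R 4) p with hc
  have hca : c ∈ atlas (R 4) M := chart_mem_atlas (R 4) p
  rw [hom_trivializationAt_apply]
  refine Prod.ext rfl ?_
  have h1 : ∀ v : R 4, (trivializationAt (R 4) (TangentSpace (𝓡 4)) p).continuousLinearMapAt ℝ z.1 v
      = chartDer c z.1 v := fun v => by
    rw [TangentBundle.continuousLinearMapAt_trivializationAt hz]
    rfl
  have h2 : ∀ v : R 4, (trivializationAt (R 4) (TangentSpace (𝓡 4)) p).symmL ℝ z.1 v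
      = chartInv c (c z.1) v := fun v => by
    rw [TangentBundle.symmL_trivializationAt hz, modelWithCornersSelf_coe, Set.range_id,
      mfderivWithin_univ]
    rfl
  ext v : 1
  rw [ContinuousLinearMap.inCoordinates]
  refine (h1 _).trans ?_
  exact (congrArg (fun w => chartDer c z.1 (fibreEnd z w)) (h2 v)).trans (endCoord_mulVec c z v).symm

lemma mkEnd_endCoord (p : M) {z : EndBundle M} (hz : z.1 ∈ (chartAt (R 4) p).source) :
    mkEnd (chartAt (R 4) p) (chartAt (R 4) p z.1) (endCoord (chartAt (R 4) p) z) = z := by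
  set c := chartAt (R 4) p with hc
  have hca : c ∈ atlas (R 4) M := chart_mem_atlas (R 4) p
  have h1 : (mkEnd c (c z.1) (endCoord c z)).1 = z.1 := c.left_inv hz
  have h2 : (mkEnd c (c z.1) (endCoord c z)).1 ∈ c.source := by rw [h1]; exact hz
  refine (trivializationAt (R 4 →L[ℝ] R 4) (fun q : M =>
    TangentSpace (𝓡 4) q →L[ℝ] TangentSpace (𝓡 4) q) p).injOn ?_ ?_ ?_
  · simpa using h2
  · simpa using hz
  · refine (trivializationAt_endBundle p h2).trans (Eq.trans ?_ (trivializationAt_endBundle p hz).symm)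
    rw [← hc, endCoord_mkEnd hca (c.map_source hz), h1]

lemma continuousOn_mkEnd (p : M) : ContinuousOn
    (fun a : R 4 × Matrix (Fin 4) (Fin 4) ℝ => mkEnd (chartAt (R 4) p) a.1 a.2)
    ((chartAt (R 4) p).target ×ˢ Set.univ) := by
  set c := chartAt (R 4) p with hc
  have hca : c ∈ atlas (R 4) M := chart_mem_atlas (R 4) p
  set e := trivializationAt (R 4 →L[ℝ] R 4) (fun q : M =>
    TangentSpace (𝓡 4) q →L[ℝ] TangentSpace (𝓡 4) q) p with he
  have hmaps : Set.MapsTo (fun a : R 4 × Matrix (Fin 4) (Fin 4) ℝ =>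
      (c.symm a.1, Matrix.toEuclideanCLM (𝕜 := ℝ) a.2)) (c.target ×ˢ Set.univ) e.target :=
    fun a ha => by
      have := c.map_target ha.1
      simpa [he, e.target_eq] using this
  have hlin : Continuous fun A : Matrix (Fin 4) (Fin 4) ℝ => Matrix.toEuclideanCLM (𝕜 := ℝ) A :=
    (Matrix.toEuclideanCLM (n := Fin 4) (𝕜 := ℝ)).toAlgEquiv.toLinearMap.continuous_of_finiteDimensional
  have hcont : ContinuousOn (fun a : R 4 × Matrix (Fin 4) (Fin 4) ℝ =>
      (c.symm a.1, Matrix.toEuclideanCLM (𝕜 := ℝ) a.2)) (c.target ×ˢ Set.univ) :=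
    (c.continuousOn_symm.comp continuousOn_fst fun a ha => ha.1).prodMk
      (hlin.comp continuous_snd).continuousOn
  refine (e.toOpenPartialHomeomorph.continuousOn_symm.comp hcont hmaps).congr fun a ha => ?_
  have h1 : (mkEnd c a.1 a.2).1 ∈ c.source := c.map_target ha.1
  have h2 : e (mkEnd c a.1 a.2) = (c.symm a.1, Matrix.toEuclideanCLM (𝕜 := ℝ) a.2) := by
    rw [trivializationAt_endBundle p h1, ← hc, endCoord_mkEnd hca ha.1]
    rfl
  rw [Function.comp, ← h2]
  exact (e.toOpenPartialHomeomorph.left_inv (by simpa [he] using h1)).symm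

/-- The twistor space of a compact manifold is compact. -/
theorem isCompact_twistorSpace [CompactSpace M] (hM : IsOrientedAtlas M) (g : Metric M) :
    IsCompact (twistorSpace g) := by
  have hloc : ∀ p : M, ∃ U ∈ nhds p, ∃ K ⊆ twistorSpace g, IsCompact K ∧
      ∀ z ∈ twistorSpace g, z.1 ∈ U → z ∈ K := fun p => by
    set c := chartAt (R 4) p with hc
    have hca : c ∈ atlas (R 4) M := chart_mem_atlas (R 4) p
    have hG := isMetricOn_coeff g hca
    have hp := mem_chart_source (R 4) p
    obtain ⟨e, he, hd⟩ := exists_neg_orthonormal (hG.posDef _ (c.map_source hp))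
    obtain ⟨V₀, hV₀, ho, hp₀, E, hE, hEp, hon⟩ :=
      exists_frame hG.isOpen hG.smooth hG.symm (c.map_source hp) he
    have hVo : IsOpen (V₀ ∩ (fun w => (E w).det) ⁻¹' Set.Iio 0) :=
      (contDiffOn_det hE).continuousOn.isOpen_inter_preimage ho isOpen_Iio
    obtain ⟨N, hN, hpN, hNV⟩ := exists_compact_subset hVo ⟨hp₀, by simpa [hEp] using hd⟩
    -- Over the compact neighbourhood `N`, a negatively oriented frame identifies the twistor space
    -- with the product of `N` and the compact set `orthogonalCS`.
    set F : R 4 × Matrix (Fin 4) (Fin 4) ℝ → EndBundle M := fun a =>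
      mkEnd c a.1 (E a.1 * a.2 * ((E a.1)ᵀ * coeff g c a.1))
    have hNt : ∀ y ∈ N, y ∈ c.target := fun y hy => hV₀ (hNV hy).1
    have hF : ContinuousOn F (N ×ˢ orthogonalCS) := by
      refine (continuousOn_mkEnd p).comp (f := fun a : R 4 × Matrix (Fin 4) (Fin 4) ℝ =>
        (a.1, E a.1 * a.2 * ((E a.1)ᵀ * coeff g c a.1))) ?_ fun a ha => ⟨hNt _ ha.1, trivial⟩
      have hfst : Set.MapsTo Prod.fst (N ×ˢ orthogonalCS) V₀ := fun a ha => (hNV ha.1).1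
      have hE1 := hE.continuousOn.comp continuousOn_fst hfst
      have hE2 := (hE.transpose.mul (hG.smooth.mono hV₀)).continuousOn.comp continuousOn_fst hfst
      exact continuousOn_fst.prodMk ((hE1.mul continuousOn_snd).mul hE2)
    refine ⟨c.source ∩ c ⁻¹' N, Filter.inter_mem (c.open_source.mem_nhds hp)
      ((c.continuousAt hp).preimage_mem_nhds (mem_interior_iff_mem_nhds.1 hpN)),
      F '' (N ×ˢ orthogonalCS), ?_, (hN.prod isCompact_orthogonalCS).image_of_continuousOn hF, ?_⟩
    · rintro _ ⟨⟨y, A⟩, ⟨hy, hA⟩, rfl⟩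
      have hyt := hNt y hy
      rw [mem_twistorSpace_iff g hM hca (c.map_target hyt), endCoord_mkEnd hca hyt]
      change IsNegCS (coeff g c (c (c.symm y))) _
      rw [c.right_inv hyt]
      exact (isNegCS_frame_iff (hG.symm y hyt) (hon y (hNV hy).1) (hNV hy).2).2 hA
    · rintro z hz ⟨hzs, hzN⟩
      have hyt := hNt _ hzN
      have hinv := frame_inv (hon _ (hNV hzN).1)
      have hS : E (c z.1) * ((E (c z.1))ᵀ * coeff g c (c z.1) * endCoord c z * E (c z.1))
          * ((E (c z.1))ᵀ * coeff g c (c z.1)) = endCoord c z := by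
        calc _ = E (c z.1) * ((E (c z.1))ᵀ * coeff g c (c z.1)) * endCoord c z
              * (E (c z.1) * ((E (c z.1))ᵀ * coeff g c (c z.1))) := by simp only [Matrix.mul_assoc]
          _ = _ := by rw [hinv, Matrix.one_mul, Matrix.mul_one]
      refine ⟨(c z.1, _), ⟨hzN, ?_⟩, (congrArg (mkEnd c (c z.1)) hS).trans (mkEnd_endCoord p hzs)⟩
      rw [← isNegCS_frame_iff (hG.symm _ hyt) (hon _ (hNV hzN).1) (hNV hzN).2, hS]
      exact (mem_twistorSpace_iff g hM hca hzs).1 hz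
  choose U hU K hK hKc hKU using hloc
  obtain ⟨t, ht⟩ := CompactSpace.elim_nhds_subcover U hU
  have : twistorSpace g = ⋃ p ∈ t, K p := by
    refine Set.Subset.antisymm (fun z hz => ?_) (Set.iUnion₂_subset fun p _ => hK p)
    have h1 : z.1 ∈ ⋃ p ∈ t, U p := ht ▸ Set.mem_univ _
    simp only [Set.mem_iUnion] at h1 ⊢
    obtain ⟨p, hp, hzp⟩ := h1
    exact ⟨p, hp, hKU p z hz hzp⟩
  rw [this]
  exact t.isCompact_biUnion fun p _ => hKc p

end Compactness

end Twistor

end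

theorem theorem4p1 {M : Type*} [TopologicalSpace M] [T2Space M] [SecondCountableTopology M]
    [ChartedSpace (Twistor.R 4) M] [IsManifold (𝓡 4) ∞ M]
    (hM : Twistor.IsOrientedAtlas M) (g : Twistor.Metric M) (t : ℝ) (ht : 0 < t) :
    (ConnectedSpace M → Twistor.IsRealAnalytic g →
      ∀ n : ℕ, (n = 1 ∨ n = 2) → Twistor.RicciIsHermitian g t n →
        (Twistor.IsEinstein g ∧ Twistor.IsSelfDual g) ∨
        (Twistor.IsSelfDual g ∧ Twistor.HasConstantScalar g (12 / t) ∧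
          Twistor.HasTripleRicciEigenvalue g)) ∧
    ((Twistor.IsEinstein g ∧ Twistor.IsSelfDual g) ∨
        (Twistor.IsSelfDual g ∧ Twistor.HasConstantScalar g (12 / t) ∧
          Twistor.HasTripleRicciEigenvalue g) →
      ∀ n : ℕ, (n = 1 ∨ n = 2) → Twistor.RicciIsHermitian g t n) ∧
    (CompactSpace M → Nonempty M → Twistor.IsEinstein g → Twistor.IsSelfDual g →
      Twistor.HasConstantScalar g (-12 / t) →
        IsCompact (Twistor.twistorSpace g) ∧ Twistor.IsAlmostKahler g t 2 ∧
          ¬ Twistor.IsKahler g t 2 ∧ Twistor.RicciIsHermitian g t 2) := by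
  refine ⟨fun _ _ n _ h => h.base hM ht, fun h n _ => Twistor.ricciIsHermitian_of hM ht h n,
    fun _ _ hE hS hs => ⟨Twistor.isCompact_twistorSpace hM g,
      Twistor.isAlmostKahler_of hM ht hE hS hs, fun h => ?_,
      Twistor.ricciIsHermitian_of hM ht (.inl ⟨hE, hS⟩) 2⟩⟩
  exact Twistor.not_isIntegrable_two hM (div_ne_zero (by norm_num) ht.ne') hE hS hs h.2
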